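/- Let $M^2$ be an oriented smooth $2$-manifold and let $(\mathcal E,\langle\,,\rangle,D,\psi)$ be a co-oriented coherent tangent bundle on it: $\mathcal E$ is an orientable smooth vector bundle of rank $2$ with a metric $\langle\,,\rangle$, a metric connection $D$ and a smooth bundle homomorphism $\psi\colon TM^2\to\mathcal E$ such that $D_X\psi(Y)-D_Y\psi(X)=\psi([X,Y])$ for all vector fields $X,Y$; the co-orientation is a smooth skew-symmetric bilinear form $\mu$ on $\mathcal E$ with $\mu(e_1,e_2)=\pm1$ on orthonormal frames. Let $\Sigma$ be the set of singular points, i.e. of points $q$ at which $\psi_q\colon T_qM^2\to\mathcal E_q$ is not bijective, and let $\lambda=\mu(\psi(\partial_u),\psi(\partial_v))$ in positively oriented local coordinates $(u,v)$; $M_+$ and $M_-$ are the sets where $\lambda>0$ and $\lambda<0$. An $A_2$-point is a singular point at which $d\lambda\neq0$ and the tangent of the singular curve $\{\lambda=0\}$ is transversal to the null direction $\ker\psi$. A peak is a singular point $p$ that is not an $A_2$-point, such that $\psi_p$ has rank $1$ and $p$ has a coordinate neighborhood $U_0$ in which all singular points other than $p$ are $A_2$-points and in which $\Sigma$ consists of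 $p$ and finitely many (possibly no) simple $C^1$-regular arcs that start at $p$ and meet only at $p$. Let $p$ be a peak and $U$ a sufficiently small coordinate disc about $p$. A singular sector at $p$ is a domain $\Omega\subset U$ without singular points whose boundary in $U$ consists of two singular curves running from $p$ to $\partial U$, or, if $\Sigma\cap U=\{p\}$, the domain $\Omega=U\setminus\{p\}$. It is called positive if $\Omega\subset M_+$ and negative if $\Omega\subset M_-$. For a $C^1$-regular curve $\gamma$ from $p$ which is a singular curve or has $\dot\gamma(0)\notin\ker\psi_p$, put $\Psi_\gamma=\lim_{t\to+0}\psi(\dot\gamma(t))/|\psi(\dot\gamma(t))|\in\mathcal E_p$. The interior angle of a singular sector $\Omega$ is $$\sum_{j=1}^{n}\arccos\langle\Psi_{\gamma_{j-1}},\Psi_{\gamma_j}\rangle ,$$ where $\gamma_0,\dots,\gamma_n$ $(n\ge1)$ are simple $C^1$-regular arcs of this kind from $p$ to $\partial U$ such that: (a) if $\Omega$ is bounded by two singular curves, these are $\gamma_0$ and $\gamma_n$, the curves $\gamma_1,\dots,\gamma_{n-1}$ run in $\Omega$, and $\gamma_0,\dots,\gamma_n$ do not meet in $U\setminus\{p\}$;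 if $\Omega=U\setminus\{p\}$, then $n=3$, $\gamma_3=\gamma_0$, and $\gamma_0,\gamma_1,\gamma_2$ do not meet in $U\setminus\{p\}$; (b) for each $j$ there is a domain $\omega_j\subset\Omega$ whose boundary in $U$ is $\gamma_{j-1}\cup\gamma_j$ and which meets no other $\gamma_k$; (c) if $n\ge2$, then $(\dot\gamma_{j-1}(0),\dot\gamma_j(0))$ is a positively oriented basis of $T_pM^2$ for $j=1,\dots,n$; (d) if $n=1$, then $\dot\gamma_0(0)$ is not a negative multiple of $\dot\gamma_1(0)$, and $\Omega$ contains neither the direction $-\dot\gamma_0(0)$ nor the direction $-\dot\gamma_1(0)$ (no $C^1$-regular curve that starts at $p$ with this velocity runs in $\Omega$). Then there are finitely many singular sectors, each has one and only one interior angle, and the sum $\alpha_+(p)$ (resp. $\alpha_-(p)$) of the interior angles of all positive (resp. negative) singular sectors at $p$ is independent of the choice of the coordinates and of the sufficiently small coordinate disc $U$ and satisfies $$\alpha_+(p)+\alpha_-(p)=2\pi,\qquad \alpha_+(p)-\alpha_-(p)\in\{2\pi,\,0,\,-2\pi\}.$$ -/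

import Mathlib

open Set Filter Topology Bundle Manifold
open scoped ContDiff

namespace CoherentTangent

noncomputable section

/-- The coordinate plane `ℝ²`. -/
abbrev Plane : Type := EuclideanSpace ℝ (Fin 2)

/-- `(v, w)` is a basis representing the orientation `o` of a real plane. -/
def IsPositivePair {W : Type*} [AddCommGroup W] [Module ℝ W]
    (o : Orientation ℝ W (Fin 2)) (v w : W) : Prop :=
  ∃ b : Module.Basis (Fin 2) ℝ W, b.orientation = o ∧ b 0 = v ∧ b 1 = w

section Surface

variable (M : Type*) [TopologicalSpace M] [ChartedSpace Plane M] [IsManifold (𝓡 2) ∞ M]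

/-- An orientation of a smooth surface: an orientation of every tangent plane, represented near
every point by a smooth frame. -/
structure SurfaceOrientation where
  /-- the orientation of each tangent plane -/
  at_point : ∀ x : M, Orientation ℝ (TangentSpace (𝓡 2) x) (Fin 2)
  exists_frame : ∀ x : M, ∃ U ∈ 𝓝 x, ∃ X Y : (Π y : M, TangentSpace (𝓡 2) y),
    ContMDiffOn (𝓡 2) ((𝓡 2).prod 𝓘(ℝ, Plane)) ∞
      (fun y ↦ (⟨y, X y⟩ : TotalSpace Plane (TangentSpace (𝓡 2) : M → Type _))) U ∧
    ContMDiffOn (𝓡 2) ((𝓡 2).prod 𝓘(ℝ, Plane)) ∞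
      (fun y ↦ (⟨y, Y y⟩ : TotalSpace Plane (TangentSpace (𝓡 2) : M → Type _))) U ∧
    ∀ y ∈ U, IsPositivePair (at_point y) (X y) (Y y)

variable {M}
variable (V : M → Type*) [TopologicalSpace (TotalSpace Plane V)]
  [∀ x, NormedAddCommGroup (V x)] [∀ x, InnerProductSpace ℝ (V x)]
  [FiberBundle Plane V] [VectorBundle ℝ Plane V] [ContMDiffVectorBundle ∞ Plane V (𝓡 2)]

/-- A coherent tangent bundle structure on a smooth rank two vector bundle `V` over a surface with
a fibrewise inner product: a smooth metric connection `D` and a smooth bundle homomorphism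
`ψ : TM → V` with `D_X ψ(Y) - D_Y ψ(X) = ψ([X, Y])`.  Here `D s x v` is `(D_v s)(x)`. -/
structure CoherentTangentBundle where
  /-- the connection -/
  D : CovariantDerivative (𝓡 2) Plane V
  smooth_D : CovariantDerivative.ContMDiffCovariantDerivative D ∞
  metric_D : ∀ s t : (Π x : M, V x),
    ContMDiff (𝓡 2) ((𝓡 2).prod 𝓘(ℝ, Plane)) ∞ (fun x ↦ (⟨x, s x⟩ : TotalSpace Plane V)) →
    ContMDiff (𝓡 2) ((𝓡 2).prod 𝓘(ℝ, Plane)) ∞ (fun x ↦ (⟨x, t x⟩ : TotalSpace Plane V)) →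
    ∀ (x : M) (v : TangentSpace (𝓡 2) x),
      mfderiv (𝓡 2) 𝓘(ℝ, ℝ) (fun y ↦ (inner ℝ (s y) (t y) : ℝ)) x v =
        (inner ℝ (D s x v) (t x) + inner ℝ (s x) (D t x v) : ℝ)
  /-- the bundle homomorphism -/
  ψ : ∀ x : M, TangentSpace (𝓡 2) x →L[ℝ] V x
  smooth_ψ : ContMDiff (𝓡 2) ((𝓡 2).prod 𝓘(ℝ, Plane →L[ℝ] Plane)) ∞
    (fun x ↦ TotalSpace.mk' (Plane →L[ℝ] Plane)
      (E := fun y ↦ TangentSpace (𝓡 2) y →L[ℝ] V y) x (ψ x))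
  coherent : ∀ X Y : (Π x : M, TangentSpace (𝓡 2) x),
    ContMDiff (𝓡 2) ((𝓡 2).prod 𝓘(ℝ, Plane)) ∞
      (fun y ↦ (⟨y, X y⟩ : TotalSpace Plane (TangentSpace (𝓡 2) : M → Type _))) →
    ContMDiff (𝓡 2) ((𝓡 2).prod 𝓘(ℝ, Plane)) ∞
      (fun y ↦ (⟨y, Y y⟩ : TotalSpace Plane (TangentSpace (𝓡 2) : M → Type _))) →
    ∀ x : M, D (fun y ↦ ψ y (Y y)) x (X x) - D (fun y ↦ ψ y (X y)) x (Y x) =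
      ψ x (VectorField.mlieBracket (𝓡 2) X Y x)

/-- A co-orientation: a smooth skew-symmetric bilinear form `μ` on the fibres with
`μ(e₁, e₂) = ±1` on orthonormal frames.  (It exists if and only if `V` is orientable.) -/
structure CoOrientation where
  /-- the area form on each fibre -/
  μ : ∀ x : M, V x →L[ℝ] V x →L[ℝ] ℝ
  smooth_μ : ContMDiff (𝓡 2) ((𝓡 2).prod 𝓘(ℝ, Plane →L[ℝ] Plane →L[ℝ] ℝ)) ∞
    (fun x ↦ TotalSpace.mk' (Plane →L[ℝ] Plane →L[ℝ] ℝ)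
      (E := fun y ↦ V y →L[ℝ] V y →L[ℝ] ℝ) x (μ x))
  skew : ∀ (x : M) (v w : V x), μ x v w = -μ x w v
  orthonormal : ∀ (x : M) (e₁ e₂ : V x), ‖e₁‖ = 1 → ‖e₂‖ = 1 → inner ℝ e₁ e₂ = (0 : ℝ) →
    μ x e₁ e₂ = 1 ∨ μ x e₁ e₂ = -1

end Surface

section Curves

variable {M : Type*} [TopologicalSpace M] [ChartedSpace Plane M]

/-- The velocity at time `t` of a curve defined on the interval `s` (one-sided at end points). -/
def velocity (γ : ℝ → M) (s : Set ℝ) (t : ℝ) : TangentSpace (𝓡 2) (γ t) :=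
  mfderivWithin 𝓘(ℝ, ℝ) (𝓡 2) γ s t (1 : ℝ)

/-- `γ` is a `C¹`-regular curve on the interval `s`. -/
def IsRegularCurve (γ : ℝ → M) (s : Set ℝ) : Prop :=
  ContMDiffOn 𝓘(ℝ, ℝ) (𝓡 2) 1 γ s ∧ ∀ t ∈ s, velocity γ s t ≠ 0

/-- The initial velocity, in `T_p M`, of a curve on `[0, 1]` that starts at `p`
(it is used only for curves with `γ 0 = p`). -/
def initialVelocity (p : M) (γ : ℝ → M) : TangentSpace (𝓡 2) p :=
  velocity γ (Icc 0 1) 0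

/-- `γ` is a `C¹`-regular simple arc in `U` which starts at `p` and ends on the boundary of `U`. -/
structure IsArc (p : M) (U : Set M) (γ : ℝ → M) : Prop where
  regular : IsRegularCurve γ (Icc 0 1)
  injOn : InjOn γ (Icc 0 1)
  start : γ 0 = p
  mem : ∀ t ∈ Ico (0 : ℝ) 1, γ t ∈ U
  finish : γ 1 ∈ frontier U

/-- The set `Ω` contains the direction `w ∈ T_p M`: some `C¹`-regular curve starting at `p` with
velocity `w` runs in `Ω`. -/
def ContainsDirection (p : M) (Ω : Set M) (w : TangentSpace (𝓡 2) p) : Prop :=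
  ∃ c : ℝ → M, IsRegularCurve c (Icc 0 1) ∧ c 0 = p ∧ initialVelocity p c = w ∧
    ∀ t ∈ Ioc (0 : ℝ) 1, c t ∈ Ω

/-- A sector `Ω` bounded by two curves with initial velocities `v`, `w` opens by less than `π`:
`v`, `w` are not opposite, and `Ω` contains neither the direction `-v` nor the direction `-w`.
(The directions `v`, `w` may coincide; then `Ω` is the thin sector between the curves.) -/
def OpensLessThanPi (p : M) (Ω : Set M) (v w : TangentSpace (𝓡 2) p) : Prop :=
  (¬ ∃ k : ℝ, 0 < k ∧ v = -(k • w)) ∧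
    ¬ ContainsDirection p Ω (-v) ∧ ¬ ContainsDirection p Ω (-w)

/-- The disc of radius `r` about `p` in the coordinates `φ`. -/
def coordinateDisc (φ : OpenPartialHomeomorph M Plane) (p : M) (r : ℝ) : Set M :=
  φ.source ∩ φ ⁻¹' Metric.ball (φ p) r

/-- The coordinate vector field `∂/∂xᵢ` of the chart `φ`. -/
def coordinateField (φ : OpenPartialHomeomorph M Plane) (i : Fin 2) (q : M) :
    TangentSpace (𝓡 2) q :=
  mfderiv 𝓘(ℝ, Plane) (𝓡 2) φ.symm (φ q) (EuclideanSpace.single i (1 : ℝ))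

/-- `φ` is a positively oriented local coordinate system. -/
def IsPositiveChart [IsManifold (𝓡 2) ∞ M] (o : SurfaceOrientation M)
    (φ : OpenPartialHomeomorph M Plane) : Prop :=
  φ ∈ IsManifold.maximalAtlas (𝓡 2) ∞ M ∧
    ∀ q ∈ φ.source, IsPositivePair (o.at_point q) (coordinateField φ 0 q) (coordinateField φ 1 q)

end Curves

section Singularities

variable {M : Type*} [TopologicalSpace M] [ChartedSpace Plane M] [IsManifold (𝓡 2) ∞ M]
  (o : SurfaceOrientation M)
  {V : M → Type*} [TopologicalSpace (TotalSpace Plane V)]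
  [∀ x, NormedAddCommGroup (V x)] [∀ x, InnerProductSpace ℝ (V x)]
  [FiberBundle Plane V] [VectorBundle ℝ Plane V] [ContMDiffVectorBundle ∞ Plane V (𝓡 2)]
  (C : CoherentTangentBundle V) (μ : CoOrientation V)

/-- The singular set `Σ`. -/
def singularSet : Set M := {q | ¬ Function.Bijective (C.ψ q)}

/-- The signed area form `ψ^* μ`. -/
def signedArea (q : M) (v w : TangentSpace (𝓡 2) q) : ℝ := μ.μ q (C.ψ q v) (C.ψ q w)

/-- The set `M₊` of regular points at which the signed area form agrees with the unsigned one. -/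
def positiveRegion : Set M :=
  {q | q ∉ singularSet C ∧ ∀ v w : TangentSpace (𝓡 2) q, IsPositivePair (o.at_point q) v w →
    signedArea C μ q v w = |signedArea C μ q v w|}

/-- The set `M₋` of regular points at which the signed area form is minus the unsigned one. -/
def negativeRegion : Set M :=
  {q | q ∉ singularSet C ∧ ∀ v w : TangentSpace (𝓡 2) q, IsPositivePair (o.at_point q) v w →
    signedArea C μ q v w = -|signedArea C μ q v w|}

/-- The signed area density function `λ = μ(ψ_u, ψ_v)` in the chart `φ`. -/
def areaDensity (φ : OpenPartialHomeomorph M Plane) (q : M) : ℝ :=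
  signedArea C μ q (coordinateField φ 0 q) (coordinateField φ 1 q)

/-- Non-degenerate singular points: `dλ ≠ 0`. -/
def IsNondegenerate (p : M) : Prop :=
  p ∈ singularSet C ∧ ∃ φ : OpenPartialHomeomorph M Plane, IsPositiveChart o φ ∧ p ∈ φ.source ∧
    mfderiv (𝓡 2) 𝓘(ℝ, ℝ) (areaDensity C μ φ) p ≠ 0

/-- `A₂`-points: non-degenerate singular points at which the velocity of the singular curve is
transversal to (that is, does not lie in) the null line `ker ψ_p`. -/
def IsA2Point (p : M) : Prop :=
  IsNondegenerate o C μ p ∧ ∃ γ : ℝ → M, IsRegularCurve γ (Ioo (-1) 1) ∧ γ 0 = p ∧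
    (∀ t ∈ Ioo (-1 : ℝ) 1, γ t ∈ singularSet C) ∧
    C.ψ (γ 0) (velocity γ (Ioo (-1) 1) 0) ≠ 0

/-- Peaks. The singular set in the coordinate neighbourhood is the (possibly empty) finite union
of simple `C¹`-regular arcs starting at `p` and meeting only at `p`, together with `p`. -/
def IsPeak (p : M) : Prop :=
  p ∈ singularSet C ∧ ¬ IsA2Point o C μ p ∧
  ∃ φ : OpenPartialHomeomorph M Plane, φ ∈ IsManifold.maximalAtlas (𝓡 2) ∞ M ∧ p ∈ φ.source ∧
    (∀ q ∈ φ.source \ {p}, q ∈ singularSet C → IsA2Point o C μ q) ∧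
    Module.finrank ℝ (LinearMap.range (C.ψ p).toLinearMap) = 1 ∧
    ∃ (k : ℕ) (c : Fin k → ℝ → M),
      (∀ i, IsRegularCurve (c i) (Icc 0 1) ∧ InjOn (c i) (Icc 0 1) ∧ c i 0 = p) ∧
      (∀ i j, i ≠ j → Disjoint (c i '' Ioc 0 1) (c j '' Ioc 0 1)) ∧
      singularSet C ∩ φ.source = ({p} ∪ ⋃ i, c i '' Icc 0 1) ∩ φ.source

/-- A singular curve in `U`, from `p` to the boundary of `U`. -/
def IsSingularArc (p : M) (U : Set M) (σ : ℝ → M) : Prop :=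
  IsArc p U σ ∧ ∀ t ∈ Ico (0 : ℝ) 1, σ t ∈ singularSet C

/-- `Ω` is a domain in `U` whose boundary in `U` consists of the curves `σ₁` and `σ₂`. -/
def IsBoundedBy (U Ω : Set M) (σ₁ σ₂ : ℝ → M) : Prop :=
  IsOpen Ω ∧ IsConnected Ω ∧ Ω ⊆ U ∧ frontier Ω ∩ U = σ₁ '' Ico 0 1 ∪ σ₂ '' Ico 0 1

/-- `Ω` is a singular sector, bounded by the two singular curves `σ₁` and `σ₂`. -/
def IsSectorBetween (p : M) (U Ω : Set M) (σ₁ σ₂ : ℝ → M) : Prop :=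
  IsSingularArc C p U σ₁ ∧ IsSingularArc C p U σ₂ ∧
    Disjoint (σ₁ '' Ioo 0 1) (σ₂ '' Ioo 0 1) ∧
    IsBoundedBy U Ω σ₁ σ₂ ∧ Disjoint Ω (singularSet C)

/-- `p` is the only singular point in `U`, and `Ω` is the punctured neighbourhood. -/
def IsPuncturedSector (p : M) (U Ω : Set M) : Prop :=
  singularSet C ∩ U = {p} ∧ Ω = U \ {p}

/-- Singular sectors at `p` in the neighbourhood `U`. -/
def IsSingularSector (p : M) (U Ω : Set M) : Prop :=
  (∃ σ₁ σ₂ : ℝ → M, IsSectorBetween C p U Ω σ₁ σ₂) ∨ IsPuncturedSector C p U Ω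

/-- `Ψ ∈ V_p` is the initial vector of `γ`: the limit as `t → +0`, in the total space of the
bundle, of `ψ(γ'(t)) / |ψ(γ'(t))|`. -/
def IsInitialVector (p : M) (γ : ℝ → M) (Ψ : V p) : Prop :=
  Tendsto
    (fun t ↦ (⟨γ t, ‖C.ψ (γ t) (velocity γ (Icc 0 1) t)‖⁻¹ •
      C.ψ (γ t) (velocity γ (Icc 0 1) t)⟩ : TotalSpace Plane V))
    (𝓝[>] 0) (𝓝 ⟨p, Ψ⟩)

/-- Conditions on a finite sequence of curves `γ 0, …, γ n` starting at `p` and subdividing a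
sector `Ω` in `U`: each one is a singular curve or starts in a non-null direction; consecutive ones
bound a subsector of `Ω` that is disjoint from the others; if `n ≥ 2` then the initial velocities
of consecutive ones form positively oriented bases. -/
structure IsSubdivision (p : M) (U Ω : Set M) (n : ℕ) (γ : ℕ → ℝ → M) : Prop where
  arc : ∀ j ≤ n, IsArc p U (γ j)
  initial : ∀ j ≤ n, C.ψ p (initialVelocity p (γ j)) ≠ 0 ∨ IsSingularArc C p U (γ j)
  subsector : ∀ j < n, ∃ T : Set M, T ⊆ Ω ∧ IsBoundedBy U T (γ j) (γ (j + 1)) ∧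
    ∀ k ≤ n, k ≠ j → k ≠ j + 1 → Disjoint T (γ k '' Ico 0 1)
  positive : 2 ≤ n → ∀ j < n,
    IsPositivePair (o.at_point p) (initialVelocity p (γ j)) (initialVelocity p (γ (j + 1)))

/-- A subdivision of a sector bounded by two singular curves `γ 0` and `γ n`. No interpolating
curve is needed (`n = 1`) only if the sector opens by less than `π`. -/
def SubdividesSector (p : M) (U Ω : Set M) (n : ℕ) (γ : ℕ → ℝ → M) : Prop :=
  1 ≤ n ∧ IsSectorBetween C p U Ω (γ 0) (γ n) ∧ IsSubdivision o C p U Ω n γ ∧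
  (∀ j, 0 < j → j < n → ∀ t ∈ Ioo (0 : ℝ) 1, γ j t ∈ Ω) ∧
  (∀ i j, i < j → j ≤ n → Disjoint (γ i '' Ioo 0 1) (γ j '' Ioo 0 1)) ∧
  (n = 1 → OpensLessThanPi p Ω (initialVelocity p (γ 0)) (initialVelocity p (γ 1)))

/-- A subdivision of a punctured neighbourhood by three curves `γ 0`, `γ 1`, `γ 2`, with
`γ 3 = γ 0`. -/
def SubdividesPunctured (p : M) (U Ω : Set M) (γ : ℕ → ℝ → M) : Prop :=
  IsPuncturedSector C p U Ω ∧ γ 3 = γ 0 ∧ IsSubdivision o C p U Ω 3 γ ∧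
  (∀ i j, i < j → j ≤ 2 → Disjoint (γ i '' Ioo 0 1) (γ j '' Ioo 0 1))

/-- `θ` is an interior angle of the singular sector `Ω`: the sum of the angles between the initial
vectors of consecutive curves of a subdivision. -/
def IsInteriorAngle (p : M) (U Ω : Set M) (θ : ℝ) : Prop :=
  ∃ (n : ℕ) (γ : ℕ → ℝ → M) (Ψ : ℕ → V p),
    (SubdividesSector o C p U Ω n γ ∨ (n = 3 ∧ SubdividesPunctured o C p U Ω γ)) ∧
    (∀ j ≤ n, IsInitialVector C p (γ j) (Ψ j)) ∧
    θ = ∑ j ∈ Finset.range n, Real.arccos (inner ℝ (Ψ j) (Ψ (j + 1)))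

open Classical in
/-- The interior angle of a singular sector (`0` if there were none). -/
def interiorAngle (p : M) (U Ω : Set M) : ℝ :=
  if h : ∃ θ, IsInteriorAngle o C p U Ω θ then h.choose else 0

/-- The sum of the interior angles of the positive singular sectors at `p` in `U`. -/
def positiveAngleSum (p : M) (U : Set M) : ℝ :=
  ∑ᶠ Ω ∈ {Ω : Set M | IsSingularSector C p U Ω ∧ Ω ⊆ positiveRegion o C μ},
    interiorAngle o C p U Ω

/-- The sum of the interior angles of the negative singular sectors at `p` in `U`. -/
def negativeAngleSum (p : M) (U : Set M) : ℝ :=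
  ∑ᶠ Ω ∈ {Ω : Set M | IsSingularSector C p U Ω ∧ Ω ⊆ negativeRegion o C μ},
    interiorAngle o C p U Ω

end Singularities

end

end CoherentTangent

/-!
# Interior angles of singular sectors at a peak

At a peak `p` the map `ψ_p` has rank one: its image is spanned by a unit vector `e`, and its kernel
is a line, the null direction.  The initial vector of a curve from `p` is therefore `e` or `-e`, so
each term `arccos ⟪Ψ_{j-1}, Ψ_j⟫` of an interior angle is `0` or `π`, and one has to count the
changes of sign.

*The null curve.*  Choose a vector `n` at `p` that is not null, and let `ℓ = ψ_p n`, extended as a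
constant vector in a trivialization of the bundle.  The one-form `β = ⟨ℓ, ψ ·⟩` does not vanish at
`p`, so its kernel has a `C¹` integral curve through `p`, the *null curve*, which is tangent to the
null direction; let `Γ₁`, `Γ₂` be its two halves.  Along a curve `γ` that starts in a non-null
direction, or that is a singular curve, `β(γ')` has a constant sign near `p`: for a singular curve
because `ψ` has rank one along it and `γ'` is not null at `A₂`-points.  This sign decides whether
the initial vector of `γ` is `e` or `-e`, and by an inequality of Gronwall type it also decides on
which side of the null curve `γ` runs (`exists_null_curve`, `exists_isNullCurve`).  So the initial
vector changes sign exactly when the null curve is crossed, even where the curves in question are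
tangent to it at `p`.

*Polar coordinates.*  A regular curve from `p` has an equation `θ = g ρ` in polar coordinates, with
`g` continuous up to `ρ = 0`.  The lifts of the angle functions of `Γ₁` and `Γ₂` form an increasing
sequence `H m`, `m ∈ ℤ`, with `H (m + 2) = H m + 2π`, and every curve as above lies between some
`H Q` and `H (Q + 1)`; the integer `Q` is its index and the parity of `Q` gives its initial vector
(`exists_isNullFan`).  The singular set is a union of graphs `θ = f i ρ`, and the singular sectors
are the strips between consecutive lifts of the `f i` (`exists_isSingularFan`,
`IsSingularFan.exists_strip_of_isSingularSector`).  Precisely one singular curve is impossible: its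
complement in a disc would be connected, although the area density takes both signs near an
`A₂`-point.

*One sector.*  The curves of a subdivision of a sector between `a` and `b` form a monotone chain of
angle functions, since no curve separates two consecutive ones.  Consecutive curves open by less
than `π`, by the orientation condition or by the condition on a sector without interpolating
curves, so their indices differ by at most one.  The sum of the angles thus telescopes to
`π (Q b - Q a)`, whatever the subdivision is (`IsNullFan.sum_arccos_of_chain`,
`IsSingularFan.sum_arccos_of_subdividesSector`).  This is `π` times the number of halves of the null
curve that start in the sector (`IsSingularFan.isInteriorAngle_iff`).  For a punctured disc the same
argument gives `2π`.

*The sums.*  Each of `Γ₁`, `Γ₂` starts in exactly one singular sector, hence in `M₊` or in `M₋`.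
So `α₊` is `π` times the number of those of `Γ₁`, `Γ₂` that start in `M₊`, and `α₋` is `π` times the
number of those that start in `M₋`.  The null curve does not depend on the coordinates or on the
disc.
-/

namespace CoherentTangent

/-! ### Angular sectors in polar coordinates about a point -/

/-- Two continuous functions that agree nowhere on a connected set are ordered the same way
everywhere on it. -/
theorem lt_on_of_ne {X : Type*} [TopologicalSpace X] {s : Set X} (hs : IsPreconnected s)
    {f g : X → ℝ} (hf : ContinuousOn f s) (hg : ContinuousOn g s) (hne : ∀ x ∈ s, f x ≠ g x)
    {x₀ : X} (hx₀ : x₀ ∈ s) (h : f x₀ < g x₀) : ∀ x ∈ s, f x < g x := by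
  intro x hx
  by_contra hlt
  have hgt : g x < f x := lt_of_le_of_ne (not_lt.mp hlt) (hne x hx).symm
  obtain ⟨y, hy, h0⟩ := hs.intermediate_value₂ hx₀ hx hf hg h.le hgt.le
  exact hne y hy h0

/-- A connected set that meets an open set `T` but not its frontier lies in `T`. -/
theorem subset_of_preconnected_of_disjoint_frontier {X : Type*} [TopologicalSpace X]
    {K T : Set X} (hK : IsPreconnected K) (hT : IsOpen T) (hne : (K ∩ T).Nonempty)
    (hfr : Disjoint K (frontier T)) : K ⊆ T := by
  have hcover : K ⊆ T ∪ (closure T)ᶜ := by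
    intro x hx
    by_cases hxT : x ∈ T
    · exact Or.inl hxT
    · refine Or.inr fun hcl ↦ hfr.le_bot ⟨hx, ?_⟩
      rw [hT.frontier_eq]
      exact ⟨hcl, hxT⟩
  refine hK.subset_left_of_subset_union hT isClosed_closure.isOpen_compl ?_ hcover hne
  exact disjoint_left.mpr fun x hx hx' ↦ hx' (subset_closure hx)

/-- Two domains of `U` that avoid `S`, whose frontiers in `U` lie in `S`, are equal as soon as they
meet: both are connected components of `U \ S`. -/
theorem eq_of_meet_of_frontier_subset {X : Type*} [TopologicalSpace X] {U S A B : Set X}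
    (hA : IsOpen A) (hA' : IsPreconnected A) (hAU : A ⊆ U) (hAS : Disjoint A S)
    (hAf : frontier A ∩ U ⊆ S)
    (hB : IsOpen B) (hB' : IsPreconnected B) (hBU : B ⊆ U) (hBS : Disjoint B S)
    (hBf : frontier B ∩ U ⊆ S) (h : (A ∩ B).Nonempty) : A = B := by
  apply Subset.antisymm
  · refine subset_of_preconnected_of_disjoint_frontier hA' hB h ?_
    exact disjoint_left.mpr fun x hx hx' ↦ hAS.le_bot ⟨hx, hBf ⟨hx', hAU hx⟩⟩
  · refine subset_of_preconnected_of_disjoint_frontier hB' hA (by rwa [inter_comm]) ?_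
    exact disjoint_left.mpr fun x hx hx' ↦ hBS.le_bot ⟨hx, hAf ⟨hx', hBU hx⟩⟩

section Polar

variable {M : Type*} [TopologicalSpace M]

/-- The point with polar coordinates `(ρ, θ)` in the complex coordinate `Φ`. -/
noncomputable def polarPoint (Φ : OpenPartialHomeomorph M ℂ) (ρ θ : ℝ) : M :=
  Φ.symm ((ρ : ℂ) * Complex.exp ((θ : ℂ) * Complex.I))

/-- The disc of radius `r` about the origin of the complex coordinate `Φ`. -/
def complexDisc (Φ : OpenPartialHomeomorph M ℂ) (r : ℝ) : Set M :=
  Φ.source ∩ Φ ⁻¹' Metric.ball 0 r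

/-- The open sector of radius `r` between the angle functions `a` and `b`. -/
def angularSector (Φ : OpenPartialHomeomorph M ℂ) (a b : ℝ → ℝ) (r : ℝ) : Set M :=
  {q | ∃ ρ ∈ Ioo 0 r, ∃ θ ∈ Ioo (a ρ) (b ρ), q = polarPoint Φ ρ θ}

/-- The curve of polar equation `θ = a ρ`, for `0 < ρ < r`. -/
def angularGraph (Φ : OpenPartialHomeomorph M ℂ) (a : ℝ → ℝ) (r : ℝ) : Set M :=
  {q | ∃ ρ ∈ Ioo 0 r, q = polarPoint Φ ρ (a ρ)}

/-- `Φ` is a complex coordinate centred at `p` whose range contains the closed disc of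
radius `R`. -/
structure IsPolarChart (Φ : OpenPartialHomeomorph M ℂ) (p : M) (R : ℝ) : Prop where
  pos : 0 < R
  mem_source : p ∈ Φ.source
  map_center : Φ p = 0
  closedBall_subset : Metric.closedBall 0 R ⊆ Φ.target

theorem norm_polar {ρ : ℝ} (hρ : 0 ≤ ρ) (θ : ℝ) :
    ‖(ρ : ℂ) * Complex.exp ((θ : ℂ) * Complex.I)‖ = ρ := by
  rw [norm_mul, Complex.norm_exp_ofReal_mul_I, mul_one, Complex.norm_real, Real.norm_of_nonneg hρ]

theorem exp_angle_eq_iff {θ θ' : ℝ} :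
    Complex.exp ((θ : ℂ) * Complex.I) = Complex.exp ((θ' : ℂ) * Complex.I) ↔
      ∃ m : ℤ, θ = θ' + m * (2 * Real.pi) := by
  rw [Complex.exp_eq_exp_iff_exists_int]
  refine exists_congr fun m ↦ ?_
  constructor
  · intro h
    have h2 : ((θ : ℂ)) * Complex.I = ((θ' + m * (2 * Real.pi) : ℝ) : ℂ) * Complex.I := by
      rw [h]; push_cast; ring
    exact_mod_cast mul_right_cancel₀ Complex.I_ne_zero h2
  · intro h
    rw [h]; push_cast; ring

/-- Every non-zero complex number has an argument in any given half-open interval of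
length `2π`. -/
theorem exists_polar_form (z : ℂ) (c : ℝ) :
    ∃ θ, c ≤ θ ∧ θ < c + 2 * Real.pi ∧
      z = ((‖z‖ : ℝ) : ℂ) * Complex.exp ((θ : ℂ) * Complex.I) := by
  refine ⟨toIcoMod Real.two_pi_pos c z.arg, left_le_toIcoMod _ _ _, toIcoMod_lt_right _ _ _, ?_⟩
  have : Complex.exp (((toIcoMod Real.two_pi_pos c z.arg : ℝ) : ℂ) * Complex.I) =
      Complex.exp ((z.arg : ℂ) * Complex.I) := by
    rw [exp_angle_eq_iff]
    refine ⟨-(toIcoDiv Real.two_pi_pos c z.arg), ?_⟩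
    have := toIcoMod_add_toIcoDiv_zsmul Real.two_pi_pos c z.arg
    rw [zsmul_eq_mul] at this
    push_cast
    linarith
  rw [this, Complex.norm_mul_exp_arg_mul_I]

theorem polarPoint_add_int (Φ : OpenPartialHomeomorph M ℂ) (ρ θ : ℝ) (m : ℤ) :
    polarPoint Φ ρ (θ + m * (2 * Real.pi)) = polarPoint Φ ρ θ := by
  unfold polarPoint
  rw [(exp_angle_eq_iff (θ := θ + m * (2 * Real.pi)) (θ' := θ)).mpr ⟨m, rfl⟩]

variable {Φ : OpenPartialHomeomorph M ℂ} {p : M} {R : ℝ}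

theorem angularGraph_add_int (a : ℝ → ℝ) (r : ℝ) (m : ℤ) :
    angularGraph Φ (fun ρ ↦ a ρ + m * (2 * Real.pi)) r = angularGraph Φ a r := by
  simp only [angularGraph, polarPoint_add_int]

theorem angularSector_add_int (a b : ℝ → ℝ) (r : ℝ) (m : ℤ) :
    angularSector Φ (fun ρ ↦ a ρ + m * (2 * Real.pi)) (fun ρ ↦ b ρ + m * (2 * Real.pi)) r =
      angularSector Φ a b r := by
  ext q
  constructor
  · rintro ⟨ρ, hρ, θ, hθ, rfl⟩
    refine ⟨ρ, hρ, θ + (-m : ℤ) * (2 * Real.pi), ?_, by rw [polarPoint_add_int]⟩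
    push_cast
    constructor <;> linarith [hθ.1, hθ.2]
  · rintro ⟨ρ, hρ, θ, hθ, rfl⟩
    refine ⟨ρ, hρ, θ + m * (2 * Real.pi), ?_, by rw [polarPoint_add_int]⟩
    constructor <;> linarith [hθ.1, hθ.2]

theorem angularGraph_mono_radius {a : ℝ → ℝ} {r r' : ℝ} (h : r ≤ r') :
    angularGraph Φ a r ⊆ angularGraph Φ a r' := by
  rintro q ⟨ρ, hρ, rfl⟩
  exact ⟨ρ, ⟨hρ.1, hρ.2.trans_le h⟩, rfl⟩

theorem complexDisc_mono {r r' : ℝ} (h : r ≤ r') : complexDisc Φ r ⊆ complexDisc Φ r' :=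
  inter_subset_inter_right _ (preimage_mono (Metric.ball_subset_ball h))

theorem isOpen_complexDisc (r : ℝ) : IsOpen (complexDisc Φ r) :=
  Φ.isOpen_inter_preimage Metric.isOpen_ball

namespace IsPolarChart

theorem mono (h : IsPolarChart Φ p R) {r : ℝ} (hr : 0 < r) (hrR : r ≤ R) : IsPolarChart Φ p r :=
  ⟨hr, h.mem_source, h.map_center, (Metric.closedBall_subset_closedBall hrR).trans
    h.closedBall_subset⟩

theorem polar_mem_target (h : IsPolarChart Φ p R) {ρ : ℝ} (hρ : ρ ∈ Icc 0 R) (θ : ℝ) :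
    (ρ : ℂ) * Complex.exp ((θ : ℂ) * Complex.I) ∈ Φ.target :=
  h.closedBall_subset (by rw [mem_closedBall_zero_iff, norm_polar hρ.1]; exact hρ.2)

theorem apply_polarPoint (h : IsPolarChart Φ p R) {ρ : ℝ} (hρ : ρ ∈ Icc 0 R) (θ : ℝ) :
    Φ (polarPoint Φ ρ θ) = (ρ : ℂ) * Complex.exp ((θ : ℂ) * Complex.I) :=
  Φ.right_inv (h.polar_mem_target hρ θ)

theorem norm_apply_polarPoint (h : IsPolarChart Φ p R) {ρ : ℝ} (hρ : ρ ∈ Icc 0 R) (θ : ℝ) :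
    ‖Φ (polarPoint Φ ρ θ)‖ = ρ := by
  rw [h.apply_polarPoint hρ, norm_polar hρ.1]

theorem polarPoint_mem_source (h : IsPolarChart Φ p R) {ρ : ℝ} (hρ : ρ ∈ Icc 0 R) (θ : ℝ) :
    polarPoint Φ ρ θ ∈ Φ.source :=
  Φ.map_target (h.polar_mem_target hρ θ)

theorem polarPoint_ne (h : IsPolarChart Φ p R) {ρ : ℝ} (hρ : ρ ∈ Ioc 0 R) (θ : ℝ) :
    polarPoint Φ ρ θ ≠ p := by
  intro he
  have := h.norm_apply_polarPoint (Ioc_subset_Icc_self hρ) θ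
  rw [he, h.map_center, norm_zero] at this
  exact hρ.1.ne this

theorem polarPoint_zero (h : IsPolarChart Φ p R) (θ : ℝ) : polarPoint Φ 0 θ = p := by
  have : Φ.symm 0 = p := by rw [← h.map_center, Φ.left_inv h.mem_source]
  simp [polarPoint, this]

theorem polarPoint_eq_iff (h : IsPolarChart Φ p R) {ρ ρ' θ θ' : ℝ} (hρ : ρ ∈ Ioc 0 R)
    (hρ' : ρ' ∈ Ioc 0 R) :
    polarPoint Φ ρ θ = polarPoint Φ ρ' θ' ↔ ρ = ρ' ∧ ∃ m : ℤ, θ = θ' + m * (2 * Real.pi) := by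
  constructor
  · intro he
    have h1 := congrArg (fun q ↦ Φ q) he
    simp only [h.apply_polarPoint (Ioc_subset_Icc_self hρ),
      h.apply_polarPoint (Ioc_subset_Icc_self hρ')] at h1
    have h2 : ρ = ρ' := by
      have := congrArg norm h1
      rwa [norm_polar hρ.1.le, norm_polar hρ'.1.le] at this
    subst h2
    refine ⟨rfl, exp_angle_eq_iff.mp (mul_left_cancel₀ ?_ h1)⟩
    exact_mod_cast hρ.1.ne'
  · rintro ⟨rfl, m, rfl⟩
    rw [polarPoint_add_int]

theorem polarPoint_mem_disc_iff (h : IsPolarChart Φ p R) {ρ θ r : ℝ} (hρ : ρ ∈ Icc 0 R) :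
    polarPoint Φ ρ θ ∈ complexDisc Φ r ↔ ρ < r := by
  simp only [complexDisc, mem_inter_iff, mem_preimage, mem_ball_zero_iff,
    h.norm_apply_polarPoint hρ, h.polarPoint_mem_source hρ, true_and]

theorem center_mem_disc (h : IsPolarChart Φ p R) {r : ℝ} (hr : 0 < r) : p ∈ complexDisc Φ r :=
  ⟨h.mem_source, by simpa [h.map_center] using hr⟩

/-- Polar coordinates of a point other than the centre, with angle in a prescribed interval. -/
theorem exists_polar (h : IsPolarChart Φ p R) {q : M} (hq : q ∈ Φ.source) (hqp : q ≠ p) (c : ℝ) :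
    ∃ θ, c ≤ θ ∧ θ < c + 2 * Real.pi ∧ 0 < ‖Φ q‖ ∧ q = polarPoint Φ ‖Φ q‖ θ := by
  have hz : Φ q ≠ 0 := by
    rw [← h.map_center]
    exact fun he ↦ hqp (Φ.injOn hq h.mem_source he)
  obtain ⟨θ, h1, h2, h3⟩ := exists_polar_form (Φ q) c
  refine ⟨θ, h1, h2, norm_pos_iff.mpr hz, ?_⟩
  rw [polarPoint, ← h3, Φ.left_inv hq]

theorem exists_polar_of_mem_disc (h : IsPolarChart Φ p R) {q : M} {r : ℝ}
    (hq : q ∈ complexDisc Φ r) (hqp : q ≠ p) (c : ℝ → ℝ) :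
    ∃ ρ ∈ Ioo 0 r, ∃ θ, c ρ ≤ θ ∧ θ < c ρ + 2 * Real.pi ∧ q = polarPoint Φ ρ θ := by
  obtain ⟨θ, h1, h2, h3, h4⟩ := h.exists_polar hq.1 hqp (c ‖Φ q‖)
  exact ⟨‖Φ q‖, ⟨h3, by simpa using hq.2⟩, θ, h1, h2, h4⟩

theorem continuousOn_polarPoint (h : IsPolarChart Φ p R) :
    ContinuousOn (fun x : ℝ × ℝ ↦ polarPoint Φ x.1 x.2) (Icc 0 R ×ˢ univ) := by
  refine Φ.continuousOn_symm.comp (f := fun x : ℝ × ℝ ↦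
    (x.1 : ℂ) * Complex.exp ((x.2 : ℂ) * Complex.I)) ?_ ?_
  · exact Continuous.continuousOn (by fun_prop)
  · rintro ⟨ρ, θ⟩ ⟨hρ, -⟩
    exact h.polar_mem_target hρ θ

/-- Polar coordinates are open: nearby points have nearby polar coordinates. -/
theorem isOpen_image_polarPoint (h : IsPolarChart Φ p R) {O : Set (ℝ × ℝ)} (hO : IsOpen O)
    (hOR : O ⊆ Ioo 0 R ×ˢ univ) : IsOpen ((fun x : ℝ × ℝ ↦ polarPoint Φ x.1 x.2) '' O) := by
  -- `ρ exp(iθ) = exp(log ρ + iθ)`, and the complex exponential is an open map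
  let O' : Set ℂ := {z | (Real.exp z.re, z.im) ∈ O}
  have hO' : IsOpen O' := hO.preimage
    (f := fun z : ℂ ↦ (Real.exp z.re, z.im)) (by fun_prop)
  have himg : (fun x : ℝ × ℝ ↦ polarPoint Φ x.1 x.2) '' O = Φ.symm '' (Complex.exp '' O') := by
    ext q
    constructor
    · rintro ⟨⟨ρ, θ⟩, hx, rfl⟩
      have hρ : 0 < ρ := (hOR hx).1.1
      refine ⟨_, ⟨⟨Real.log ρ, θ⟩, ?_, rfl⟩, ?_⟩
      · simpa [O', Real.exp_log hρ] using hx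
      · have : (⟨Real.log ρ, θ⟩ : ℂ) = ((Real.log ρ : ℝ) : ℂ) + (θ : ℂ) * Complex.I :=
          Complex.mk_eq_add_mul_I _ _
        rw [this, Complex.exp_add, ← Complex.ofReal_exp, Real.exp_log hρ]
        rfl
    · rintro ⟨_, ⟨z, hz, rfl⟩, rfl⟩
      refine ⟨(Real.exp z.re, z.im), hz, ?_⟩
      simp only [polarPoint]
      rw [Complex.ofReal_exp, ← Complex.exp_add, Complex.re_add_im]
  rw [himg]
  refine Φ.symm.isOpen_image_of_subset_source (Complex.isOpenMap_exp _ hO') ?_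
  rintro _ ⟨z, hz, rfl⟩
  refine h.closedBall_subset ?_
  rw [mem_closedBall_zero_iff, Complex.norm_exp]
  exact (hOR hz).1.2.le

theorem isOpen_angularSector (h : IsPolarChart Φ p R) {a b : ℝ → ℝ} {r : ℝ} (hr : r ≤ R)
    (ha : ContinuousOn a (Ioo 0 r)) (hb : ContinuousOn b (Ioo 0 r)) :
    IsOpen (angularSector Φ a b r) := by
  have : angularSector Φ a b r = (fun x : ℝ × ℝ ↦ polarPoint Φ x.1 x.2) ''
      {x | x.1 ∈ Ioo 0 r ∧ x.2 ∈ Ioo (a x.1) (b x.1)} := by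
    ext q
    constructor
    · rintro ⟨ρ, hρ, θ, hθ, rfl⟩
      exact ⟨(ρ, θ), ⟨hρ, hθ⟩, rfl⟩
    · rintro ⟨⟨ρ, θ⟩, ⟨hρ, hθ⟩, rfl⟩
      exact ⟨ρ, hρ, θ, hθ, rfl⟩
  rw [this]
  refine h.isOpen_image_polarPoint ?_ fun x hx ↦ ⟨⟨hx.1.1, hx.1.2.trans_le hr⟩, mem_univ _⟩
  have h1 : IsOpen (Ioo 0 r ×ˢ (univ : Set ℝ)) := isOpen_Ioo.prod isOpen_univ
  have ha' : ContinuousOn (fun x : ℝ × ℝ ↦ x.2 - a x.1) (Ioo 0 r ×ˢ univ) :=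
    continuousOn_snd.sub (ha.comp continuousOn_fst fun x hx ↦ hx.1)
  have hb' : ContinuousOn (fun x : ℝ × ℝ ↦ b x.1 - x.2) (Ioo 0 r ×ˢ univ) :=
    (hb.comp continuousOn_fst fun x hx ↦ hx.1).sub continuousOn_snd
  have h2 := (ha'.isOpen_inter_preimage h1 (isOpen_Ioi (a := (0 : ℝ)))).inter
    (hb'.isOpen_inter_preimage h1 (isOpen_Ioi (a := (0 : ℝ))))
  convert h2 using 1
  ext x
  simp only [mem_ofPred_eq, mem_inter_iff, mem_prod, mem_univ, and_true, mem_preimage, mem_Ioi,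
    sub_pos, mem_Ioo (a := a x.1)]
  tauto

theorem isPreconnected_angularSector (h : IsPolarChart Φ p R) {a b : ℝ → ℝ} {r : ℝ} (hr : r ≤ R)
    (ha : ContinuousOn a (Ioo 0 r)) (hb : ContinuousOn b (Ioo 0 r))
    (hab : ∀ ρ ∈ Ioo 0 r, a ρ < b ρ) : IsPreconnected (angularSector Φ a b r) := by
  have : angularSector Φ a b r = (fun x : ℝ × ℝ ↦
      polarPoint Φ x.1 (a x.1 + x.2 * (b x.1 - a x.1))) '' (Ioo 0 r ×ˢ Ioo 0 1) := by
    ext q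
    constructor
    · rintro ⟨ρ, hρ, θ, hθ, rfl⟩
      have hpos : 0 < b ρ - a ρ := sub_pos.mpr (hab ρ hρ)
      refine ⟨(ρ, (θ - a ρ) / (b ρ - a ρ)), ⟨hρ, ?_, ?_⟩, ?_⟩
      · exact div_pos (sub_pos.mpr hθ.1) hpos
      · rw [div_lt_one hpos]; linarith [hθ.2]
      · simp only
        rw [div_mul_cancel₀ _ hpos.ne', add_sub_cancel]
    · rintro ⟨⟨ρ, t⟩, ⟨hρ, ht⟩, rfl⟩
      have hpos : 0 < b ρ - a ρ := sub_pos.mpr (hab ρ hρ)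
      refine ⟨ρ, hρ, _, ⟨?_, ?_⟩, rfl⟩
      · linarith [mul_pos ht.1 hpos]
      · have := mul_lt_mul_of_pos_right ht.2 hpos
        linarith
  rw [this]
  refine (isPreconnected_Ioo.prod isPreconnected_Ioo).image _ ?_
  have hA : ContinuousOn (fun x : ℝ × ℝ ↦ a x.1) (Ioo 0 r ×ˢ Ioo (0 : ℝ) 1) :=
    ha.comp continuousOn_fst fun x hx ↦ hx.1
  have hB : ContinuousOn (fun x : ℝ × ℝ ↦ b x.1) (Ioo 0 r ×ˢ Ioo (0 : ℝ) 1) :=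
    hb.comp continuousOn_fst fun x hx ↦ hx.1
  refine h.continuousOn_polarPoint.comp (f := fun x : ℝ × ℝ ↦
    (x.1, a x.1 + x.2 * (b x.1 - a x.1))) ?_ fun x hx ↦ ⟨⟨hx.1.1.le, hx.1.2.le.trans hr⟩, mem_univ _⟩
  exact continuousOn_fst.prodMk (hA.add (continuousOn_snd.mul (hB.sub hA)))

theorem nonempty_angularSector {a b : ℝ → ℝ} {r : ℝ} (hr : 0 < r)
    (hab : ∀ ρ ∈ Ioo 0 r, a ρ < b ρ) : (angularSector Φ a b r).Nonempty := by
  have hρ : r / 2 ∈ Ioo 0 r := ⟨by linarith, by linarith⟩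
  obtain ⟨θ, hθ⟩ := exists_between (hab _ hρ)
  exact ⟨_, _, hρ, θ, hθ, rfl⟩

theorem isConnected_angularSector (h : IsPolarChart Φ p R) {a b : ℝ → ℝ} {r : ℝ} (h0 : 0 < r)
    (hr : r ≤ R) (ha : ContinuousOn a (Ioo 0 r)) (hb : ContinuousOn b (Ioo 0 r))
    (hab : ∀ ρ ∈ Ioo 0 r, a ρ < b ρ) : IsConnected (angularSector Φ a b r) :=
  ⟨nonempty_angularSector h0 hab, h.isPreconnected_angularSector hr ha hb hab⟩

theorem angularSector_subset_disc (h : IsPolarChart Φ p R) {a b : ℝ → ℝ} {r : ℝ} (hr : r ≤ R) :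
    angularSector Φ a b r ⊆ complexDisc Φ r \ {p} := by
  rintro q ⟨ρ, hρ, θ, hθ, rfl⟩
  have hρ' : ρ ∈ Ioc 0 R := ⟨hρ.1, hρ.2.le.trans hr⟩
  exact ⟨(h.polarPoint_mem_disc_iff (Ioc_subset_Icc_self hρ')).mpr hρ.2, h.polarPoint_ne hρ' θ⟩

theorem angularGraph_subset_disc (h : IsPolarChart Φ p R) {a : ℝ → ℝ} {r : ℝ} (hr : r ≤ R) :
    angularGraph Φ a r ⊆ complexDisc Φ r \ {p} := by
  rintro q ⟨ρ, hρ, rfl⟩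
  have hρ' : ρ ∈ Ioc 0 R := ⟨hρ.1, hρ.2.le.trans hr⟩
  exact ⟨(h.polarPoint_mem_disc_iff (Ioc_subset_Icc_self hρ')).mpr hρ.2, h.polarPoint_ne hρ' _⟩

theorem polarPoint_mem_sector_iff (h : IsPolarChart Φ p R) {a b : ℝ → ℝ} {r ρ θ : ℝ} (hr : r ≤ R)
    (hρ : ρ ∈ Ioo 0 r) : polarPoint Φ ρ θ ∈ angularSector Φ a b r ↔
      ∃ m : ℤ, θ + m * (2 * Real.pi) ∈ Ioo (a ρ) (b ρ) := by
  constructor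
  · rintro ⟨ρ', hρ', θ', hθ', he⟩
    obtain ⟨rfl, m, rfl⟩ := (h.polarPoint_eq_iff ⟨hρ.1, hρ.2.le.trans hr⟩
      ⟨hρ'.1, hρ'.2.le.trans hr⟩).mp he
    refine ⟨-m, ?_⟩
    push_cast
    convert hθ' using 1
    ring
  · rintro ⟨m, hm⟩
    exact ⟨ρ, hρ, _, hm, (polarPoint_add_int _ _ _ _).symm⟩

theorem polarPoint_mem_graph_iff (h : IsPolarChart Φ p R) {a : ℝ → ℝ} {r ρ θ : ℝ} (hr : r ≤ R)
    (hρ : ρ ∈ Ioo 0 r) : polarPoint Φ ρ θ ∈ angularGraph Φ a r ↔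
      ∃ m : ℤ, θ = a ρ + m * (2 * Real.pi) := by
  constructor
  · rintro ⟨ρ', hρ', he⟩
    obtain ⟨rfl, m, rfl⟩ := (h.polarPoint_eq_iff ⟨hρ.1, hρ.2.le.trans hr⟩
      ⟨hρ'.1, hρ'.2.le.trans hr⟩).mp he
    exact ⟨m, rfl⟩
  · rintro ⟨m, hm⟩
    exact ⟨ρ, hρ, by rw [hm, polarPoint_add_int]⟩

/-- An integer multiple of `2π` that lies strictly between `-2π` and `2π` is zero. -/
theorem _root_.CoherentTangent.int_eq_zero_of_abs_lt {m : ℤ} (h1 : -(2 * Real.pi) < m * (2 * Real.pi))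
    (h2 : m * (2 * Real.pi) < 2 * Real.pi) : m = 0 := by
  have hp := Real.two_pi_pos
  have h3 : (-1 : ℝ) < m := by nlinarith
  have h4 : (m : ℝ) < 1 := by nlinarith
  have h5 : -1 < m := by exact_mod_cast h3
  have h6 : m < 1 := by exact_mod_cast h4
  omega

/-- If `a < b ≤ a + 2π`, a direction of the closed range `[a, a + 2π)` lies in the open sector only
if it is strictly between `a` and `b`. -/
theorem polarPoint_mem_sector_iff_of_mem (h : IsPolarChart Φ p R) {a b : ℝ → ℝ} {r ρ θ : ℝ}
    (hr : r ≤ R) (hρ : ρ ∈ Ioo 0 r) (hb : b ρ ≤ a ρ + 2 * Real.pi)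
    (h1 : a ρ ≤ θ) (h2 : θ ≤ a ρ + 2 * Real.pi) :
    polarPoint Φ ρ θ ∈ angularSector Φ a b r ↔ θ ∈ Ioo (a ρ) (b ρ) := by
  rw [h.polarPoint_mem_sector_iff hr hρ]
  constructor
  · rintro ⟨m, hm⟩
    have : m = 0 := int_eq_zero_of_abs_lt (by linarith [hm.1]) (by linarith [hm.2])
    simpa [this] using hm
  · intro hθ
    exact ⟨0, by simpa using hθ⟩

theorem mem_disc_cases (h : IsPolarChart Φ p R) (a b : ℝ → ℝ) {r : ℝ} {q : M}
    (hq : q ∈ complexDisc Φ r) :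
    q = p ∨ q ∈ angularGraph Φ a r ∨ q ∈ angularSector Φ a b r ∨ q ∈ angularGraph Φ b r ∨
      q ∈ angularSector Φ b (fun ρ ↦ a ρ + 2 * Real.pi) r := by
  by_cases hqp : q = p
  · exact Or.inl hqp
  right
  obtain ⟨ρ, hρ, θ, h1, h2, rfl⟩ := h.exists_polar_of_mem_disc hq hqp a
  rcases h1.eq_or_lt with h1 | h1
  · exact Or.inl ⟨ρ, hρ, by rw [h1]⟩
  rcases lt_trichotomy θ (b ρ) with h3 | h3 | h3
  · exact Or.inr (Or.inl ⟨ρ, hρ, θ, ⟨h1, h3⟩, rfl⟩)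
  · exact Or.inr (Or.inr (Or.inl ⟨ρ, hρ, by rw [h3]⟩))
  · exact Or.inr (Or.inr (Or.inr ⟨ρ, hρ, θ, ⟨h3, h2⟩, rfl⟩))

theorem disjoint_sector_graph_left (h : IsPolarChart Φ p R) {a b : ℝ → ℝ} {r : ℝ} (hr : r ≤ R)
    (hb : ∀ ρ ∈ Ioo 0 r, b ρ ≤ a ρ + 2 * Real.pi) :
    Disjoint (angularSector Φ a b r) (angularGraph Φ a r) := by
  refine disjoint_left.mpr ?_
  rintro q hq ⟨ρ, hρ, rfl⟩
  have := (h.polarPoint_mem_sector_iff_of_mem hr hρ (hb ρ hρ) le_rfl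
    (by linarith [Real.two_pi_pos])).mp hq
  exact lt_irrefl _ this.1

theorem disjoint_sector_graph_right (h : IsPolarChart Φ p R) {a b : ℝ → ℝ} {r : ℝ} (hr : r ≤ R)
    (hab : ∀ ρ ∈ Ioo 0 r, a ρ < b ρ) (hb : ∀ ρ ∈ Ioo 0 r, b ρ ≤ a ρ + 2 * Real.pi) :
    Disjoint (angularSector Φ a b r) (angularGraph Φ b r) := by
  refine disjoint_left.mpr ?_
  rintro q hq ⟨ρ, hρ, rfl⟩
  have := (h.polarPoint_mem_sector_iff_of_mem hr hρ (hb ρ hρ) (hab ρ hρ).le (hb ρ hρ)).mp hq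
  exact lt_irrefl _ this.2

theorem disjoint_sector_sector (h : IsPolarChart Φ p R) {a b : ℝ → ℝ} {r : ℝ} (hr : r ≤ R)
    (hab : ∀ ρ ∈ Ioo 0 r, a ρ < b ρ) (hb : ∀ ρ ∈ Ioo 0 r, b ρ ≤ a ρ + 2 * Real.pi) :
    Disjoint (angularSector Φ a b r) (angularSector Φ b (fun ρ ↦ a ρ + 2 * Real.pi) r) := by
  refine disjoint_left.mpr ?_
  rintro q hq ⟨ρ, hρ, θ, hθ, rfl⟩
  have := (h.polarPoint_mem_sector_iff_of_mem hr hρ (hb ρ hρ)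
    ((hab ρ hρ).trans hθ.1).le hθ.2.le).mp hq
  exact lt_asymm this.2 hθ.1

/-- The centre lies in the closure of every angular curve. -/
theorem tendsto_polarPoint_center (h : IsPolarChart Φ p R) (a : ℝ → ℝ) :
    Tendsto (fun ρ ↦ polarPoint Φ ρ (a ρ)) (𝓝[>] 0) (𝓝 p) := by
  have h1 : Tendsto (fun ρ : ℝ ↦ (ρ : ℂ) * Complex.exp ((a ρ : ℂ) * Complex.I)) (𝓝[>] 0)
      (𝓝 0) := by
    rw [tendsto_zero_iff_norm_tendsto_zero]
    refine Tendsto.congr' (f₁ := fun ρ ↦ ρ) ?_ (tendsto_id.mono_left nhdsWithin_le_nhds)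
    filter_upwards [self_mem_nhdsWithin] with ρ hρ
    exact (norm_polar (le_of_lt hρ) _).symm
  have h2 : ContinuousAt Φ.symm 0 := Φ.symm.continuousAt (by
    rw [← h.map_center]; exact Φ.map_source h.mem_source)
  have h3 : Φ.symm 0 = p := by rw [← h.map_center, Φ.left_inv h.mem_source]
  have := h2.tendsto.comp h1
  rwa [h3] at this

theorem angularGraph_left_subset_closure (h : IsPolarChart Φ p R) {a b : ℝ → ℝ} {r : ℝ}
    (hr : r ≤ R) (hab : ∀ ρ ∈ Ioo 0 r, a ρ < b ρ) :
    angularGraph Φ a r ⊆ closure (angularSector Φ a b r) := by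
  rintro q ⟨ρ, hρ, rfl⟩
  have hρ' : ρ ∈ Icc 0 R := ⟨hρ.1.le, hρ.2.le.trans hr⟩
  have hc : ContinuousOn (fun θ : ℝ ↦ polarPoint Φ ρ θ) univ :=
    h.continuousOn_polarPoint.comp (f := fun θ : ℝ ↦ (ρ, θ)) (by fun_prop)
      fun θ _ ↦ ⟨hρ', mem_univ _⟩
  refine mem_closure_of_tendsto ((hc.continuousAt univ_mem).tendsto.mono_left
    (nhdsWithin_le_nhds (s := Ioi (a ρ)))) ?_
  filter_upwards [Ioo_mem_nhdsGT (hab ρ hρ)] with θ hθ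
  exact ⟨ρ, hρ, θ, hθ, rfl⟩

theorem angularGraph_right_subset_closure (h : IsPolarChart Φ p R) {a b : ℝ → ℝ} {r : ℝ}
    (hr : r ≤ R) (hab : ∀ ρ ∈ Ioo 0 r, a ρ < b ρ) :
    angularGraph Φ b r ⊆ closure (angularSector Φ a b r) := by
  rintro q ⟨ρ, hρ, rfl⟩
  have hρ' : ρ ∈ Icc 0 R := ⟨hρ.1.le, hρ.2.le.trans hr⟩
  have hc : ContinuousOn (fun θ : ℝ ↦ polarPoint Φ ρ θ) univ :=
    h.continuousOn_polarPoint.comp (f := fun θ : ℝ ↦ (ρ, θ)) (by fun_prop)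
      fun θ _ ↦ ⟨hρ', mem_univ _⟩
  refine mem_closure_of_tendsto ((hc.continuousAt univ_mem).tendsto.mono_left
    (nhdsWithin_le_nhds (s := Iio (b ρ)))) ?_
  filter_upwards [Ioo_mem_nhdsLT (hab ρ hρ)] with θ hθ
  exact ⟨ρ, hρ, θ, hθ, rfl⟩

theorem center_mem_closure_sector (h : IsPolarChart Φ p R) {a b : ℝ → ℝ} {r : ℝ} (h0 : 0 < r)
    (hab : ∀ ρ ∈ Ioo 0 r, a ρ < b ρ) : p ∈ closure (angularSector Φ a b r) := by
  refine mem_closure_of_tendsto (h.tendsto_polarPoint_center fun ρ ↦ (a ρ + b ρ) / 2) ?_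
  filter_upwards [Ioo_mem_nhdsGT h0] with ρ hρ
  exact ⟨ρ, hρ, _, ⟨by linarith [hab ρ hρ], by linarith [hab ρ hρ]⟩, rfl⟩

/-- The boundary, inside the disc, of the sector between two angle functions. -/
theorem frontier_angularSector (h : IsPolarChart Φ p R) {a b : ℝ → ℝ} {r : ℝ} (h0 : 0 < r)
    (hr : r ≤ R) (ha : ContinuousOn a (Ioo 0 r)) (hb : ContinuousOn b (Ioo 0 r))
    (hab : ∀ ρ ∈ Ioo 0 r, a ρ < b ρ) (hba : ∀ ρ ∈ Ioo 0 r, b ρ ≤ a ρ + 2 * Real.pi) :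
    frontier (angularSector Φ a b r) ∩ complexDisc Φ r =
      insert p (angularGraph Φ a r ∪ angularGraph Φ b r) := by
  have hopen := h.isOpen_angularSector hr ha hb
  rw [hopen.frontier_eq]
  ext q
  constructor
  · rintro ⟨⟨hcl, hnot⟩, hq⟩
    rcases h.mem_disc_cases a b hq with h1 | h1 | h1 | h1 | h1
    · exact Or.inl h1
    · exact Or.inr (Or.inl h1)
    · exact absurd h1 hnot
    · exact Or.inr (Or.inr h1)
    · exfalso
      have ho : IsOpen (angularSector Φ b (fun ρ ↦ a ρ + 2 * Real.pi) r) :=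
        h.isOpen_angularSector hr hb (ha.add continuousOn_const)
      have := (h.disjoint_sector_sector hr hab hba).closure_left ho
      exact this.le_bot ⟨hcl, h1⟩
  · rintro (rfl | h1 | h1)
    · exact ⟨⟨h.center_mem_closure_sector h0 hab,
        fun hm ↦ (h.angularSector_subset_disc hr hm).2 rfl⟩, h.center_mem_disc h0⟩
    · exact ⟨⟨h.angularGraph_left_subset_closure hr hab h1,
        fun hm ↦ (h.disjoint_sector_graph_left hr hba).le_bot ⟨hm, h1⟩⟩,
        (h.angularGraph_subset_disc hr h1).1⟩
    · exact ⟨⟨h.angularGraph_right_subset_closure hr hab h1,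
        fun hm ↦ (h.disjoint_sector_graph_right hr hab hba).le_bot ⟨hm, h1⟩⟩,
        (h.angularGraph_subset_disc hr h1).1⟩

/-- A domain whose boundary near the centre consists of the two curves `θ = a ρ` and `θ = b ρ`, and
which misses a point of the complementary sector, contains near the centre the sector from `a`
to `b`. -/
theorem sector_subset_of_frontier (h : IsPolarChart Φ p R) {a b : ℝ → ℝ} {r : ℝ} (h0 : 0 < r)
    (hr : r ≤ R) (ha : ContinuousOn a (Ioo 0 r)) (hb : ContinuousOn b (Ioo 0 r))
    (hab : ∀ ρ ∈ Ioo 0 r, a ρ < b ρ) (hba : ∀ ρ ∈ Ioo 0 r, b ρ < a ρ + 2 * Real.pi)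
    {T : Set M} (hT : IsOpen T)
    (hfr : frontier T ∩ complexDisc Φ r = insert p (angularGraph Φ a r ∪ angularGraph Φ b r))
    (hmiss : ¬ angularSector Φ b (fun ρ ↦ a ρ + 2 * Real.pi) r ⊆ T) :
    angularSector Φ a b r ⊆ T := by
  have ha' : ContinuousOn (fun ρ ↦ a ρ + 2 * Real.pi) (Ioo 0 r) := ha.add continuousOn_const
  have hgraph : angularGraph Φ (fun ρ ↦ a ρ + 2 * Real.pi) r = angularGraph Φ a r := by
    have := angularGraph_add_int (Φ := Φ) a r 1
    simpa using this
  have hba' : ∀ ρ ∈ Ioo 0 r, a ρ + 2 * Real.pi ≤ b ρ + 2 * Real.pi := fun ρ hρ ↦ by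
    linarith [hab ρ hρ]
  have hd : Disjoint (angularSector Φ a b r) (frontier T) := by
    refine disjoint_left.mpr fun q hq hqf ↦ ?_
    have hqd := h.angularSector_subset_disc hr hq
    have : q ∈ frontier T ∩ complexDisc Φ r := ⟨hqf, hqd.1⟩
    rw [hfr] at this
    rcases this with h1 | h1 | h1
    · exact hqd.2 h1
    · exact (h.disjoint_sector_graph_left hr fun ρ hρ ↦ (hba ρ hρ).le).le_bot ⟨hq, h1⟩
    · exact (h.disjoint_sector_graph_right hr hab fun ρ hρ ↦ (hba ρ hρ).le).le_bot ⟨hq, h1⟩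
  have hd' : Disjoint (angularSector Φ b (fun ρ ↦ a ρ + 2 * Real.pi) r) (frontier T) := by
    refine disjoint_left.mpr fun q hq hqf ↦ ?_
    have hqd := h.angularSector_subset_disc hr hq
    have : q ∈ frontier T ∩ complexDisc Φ r := ⟨hqf, hqd.1⟩
    rw [hfr] at this
    rcases this with h1 | h1 | h1
    · exact hqd.2 h1
    · rw [← hgraph] at h1
      exact (h.disjoint_sector_graph_right hr hba hba').le_bot ⟨hq, h1⟩
    · exact (h.disjoint_sector_graph_left hr hba').le_bot ⟨hq, h1⟩
  refine subset_of_preconnected_of_disjoint_frontier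
    (h.isPreconnected_angularSector hr ha hb hab) hT ?_ hd
  have hp : p ∈ frontier T := by
    have : p ∈ frontier T ∩ complexDisc Φ r := hfr ▸ mem_insert _ _
    exact this.1
  obtain ⟨q, hqd, hqT⟩ := mem_closure_iff.mp (frontier_subset_closure hp) _
    (isOpen_complexDisc r) (h.center_mem_disc h0)
  have hqf : q ∉ frontier T := fun hf ↦ by
    rw [hT.frontier_eq] at hf
    exact hf.2 hqT
  have hout : q ∉ insert p (angularGraph Φ a r ∪ angularGraph Φ b r) := fun hm ↦ by
    rw [← hfr] at hm
    exact hqf hm.1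
  rcases h.mem_disc_cases a b hqd with h1 | h1 | h1 | h1 | h1
  · exact absurd (Or.inl h1) hout
  · exact absurd (Or.inr (Or.inl h1)) hout
  · exact ⟨q, h1, hqT⟩
  · exact absurd (Or.inr (Or.inr h1)) hout
  · exact absurd (subset_of_preconnected_of_disjoint_frontier
      (h.isPreconnected_angularSector hr hb ha' hba) hT ⟨q, h1, hqT⟩ hd') hmiss

end IsPolarChart

end Polar

/-! ### Polar equations of regular arcs -/

/-- The inverse of a continuous injective function on a compact set is continuous. -/
theorem continuousOn_invFunOn_image {N : ℝ → ℝ} {K : Set ℝ} (hK : IsCompact K)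
    (hN : ContinuousOn N K) (hinj : InjOn N K) :
    ContinuousOn (Function.invFunOn N K) (N '' K) := by
  rw [continuousOn_iff_isClosed]
  intro t ht
  refine ⟨N '' (K ∩ t), ((hK.inter_right ht).image_of_continuousOn
    (hN.mono inter_subset_left)).isClosed, ?_⟩
  ext y
  constructor
  · rintro ⟨hy, x, hx, rfl⟩
    rw [mem_preimage, hinj.leftInvOn_invFunOn hx] at hy
    exact ⟨⟨x, ⟨hx, hy⟩, rfl⟩, x, hx, rfl⟩
  · rintro ⟨⟨x, ⟨hx, hxt⟩, rfl⟩, -⟩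
    refine ⟨?_, x, hx, rfl⟩
    rwa [mem_preimage, hinj.leftInvOn_invFunOn hx]

/-- A `C¹` plane curve that leaves the origin with velocity `v ≠ 0` has near the origin a polar
equation `θ = g(ρ)`, with `g` continuous up to `ρ = 0` and `g(0)` the argument of `v`. -/
theorem exists_polar_equation {z : ℝ → ℂ} {v : ℂ} {τ α : ℝ} (hτ : 0 < τ)
    (hz : ContDiffOn ℝ 1 z (Icc 0 τ)) (h0 : z 0 = 0) (hv : HasDerivWithinAt z v (Icc 0 τ) 0)
    (hv0 : v ≠ 0) (hα : v = ((‖v‖ : ℝ) : ℂ) * Complex.exp ((α : ℂ) * Complex.I)) :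
    ∃ τ₀ ∈ Ioc 0 τ, ∃ g : ℝ → ℝ, StrictMonoOn (fun t ↦ ‖z t‖) (Icc 0 τ₀) ∧
      ContinuousOn g (Icc 0 ‖z τ₀‖) ∧ g 0 = α ∧
      ∀ t ∈ Icc 0 τ₀, z t = ((‖z t‖ : ℝ) : ℂ) * Complex.exp ((g ‖z t‖ : ℂ) * Complex.I) := by
  have hud : UniqueDiffOn ℝ (Icc 0 τ) := uniqueDiffOn_Icc hτ
  have h0mem : (0 : ℝ) ∈ Icc 0 τ := left_mem_Icc.mpr hτ.le
  let z' := derivWithin z (Icc 0 τ)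
  have hz'c : ContinuousOn z' (Icc 0 τ) := hz.continuousOn_derivWithin hud le_rfl
  have hz'0 : z' 0 = v := hv.derivWithin (hud 0 h0mem)
  have hder : ∀ t ∈ Icc 0 τ, HasDerivWithinAt z (z' t) (Icc 0 τ) t := fun t ht ↦
    ((hz.differentiableOn one_ne_zero) t ht).hasDerivWithinAt
  -- the difference quotient `z(t)/t`, extended by `v` at `t = 0`
  let y : ℝ → ℂ := Function.update (fun t ↦ (t : ℂ)⁻¹ * z t) 0 v
  have hy0 : y 0 = v := Function.update_self _ _ _
  have hyt : ∀ t ≠ 0, z t = (t : ℂ) * y t := fun t ht ↦ by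
    have : (t : ℂ) ≠ 0 := by exact_mod_cast ht
    simp only [y, Function.update_of_ne ht]
    rw [mul_inv_cancel_left₀ this]
  have hyc : ContinuousOn y (Icc 0 τ) := by
    intro t ht
    rcases eq_or_ne t 0 with rfl | hne
    · rw [continuousWithinAt_update_same]
      have := hasDerivWithinAt_iff_tendsto_slope.mp hv
      refine this.congr fun t ↦ ?_
      rw [slope_def_module, h0, sub_zero, sub_zero, Complex.real_smul, Complex.ofReal_inv]
    · refine ContinuousWithinAt.congr_of_eventuallyEq (f := fun t : ℝ ↦ (t : ℂ)⁻¹ * z t) ?_ ?_ ?_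
      · refine ContinuousWithinAt.mul ?_ (hz.continuousOn t ht)
        refine ContinuousAt.continuousWithinAt ?_
        have : (t : ℂ) ≠ 0 := by exact_mod_cast hne
        exact Complex.continuous_ofReal.continuousAt.inv₀ this
      · filter_upwards [mem_nhdsWithin_of_mem_nhds (isOpen_ne.mem_nhds hne)] with s hs
        exact Function.update_of_ne hs _ _
      · exact Function.update_of_ne hne _ _
  let e : ℂ := Complex.exp (((-α : ℝ) : ℂ) * Complex.I)
  have hee : e * Complex.exp ((α : ℂ) * Complex.I) = 1 := by
    rw [← Complex.exp_add]; simp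
  have hve : v * e = ((‖v‖ : ℝ) : ℂ) := by
    rw [hα, mul_assoc, mul_comm (Complex.exp _) e, hee, mul_one, norm_polar (norm_nonneg _)]
  have hvpos : 0 < ‖v‖ := norm_pos_iff.mpr hv0
  have hE1 : ∀ᶠ t in 𝓝[Icc 0 τ] (0 : ℝ), 0 < (y t * e).re := by
    have hc : ContinuousWithinAt (fun t ↦ (y t * e).re) (Icc 0 τ) 0 :=
      Complex.continuous_re.continuousAt.comp_continuousWithinAt
        ((hyc 0 h0mem).mul continuousWithinAt_const)
    refine hc.eventually (lt_mem_nhds ?_)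
    change 0 < (y 0 * e).re
    rw [hy0, hve, Complex.ofReal_re]; exact hvpos
  have hE2 : ∀ᶠ t in 𝓝[Icc 0 τ] (0 : ℝ), 0 < inner ℝ (y t) (z' t) := by
    have hc : ContinuousWithinAt (fun t ↦ inner ℝ (y t) (z' t)) (Icc 0 τ) 0 :=
      ContinuousWithinAt.inner (hyc 0 h0mem) (hz'c 0 h0mem)
    refine hc.eventually (lt_mem_nhds ?_)
    change 0 < inner ℝ (y 0) (z' 0)
    rw [hy0, hz'0, real_inner_self_eq_norm_sq]; positivity
  obtain ⟨ε, hε, hE⟩ := Metric.mem_nhdsWithin_iff.mp (hE1.and hE2)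
  let τ₀ := min τ (ε / 2)
  have hτ₀ : 0 < τ₀ := lt_min hτ (half_pos hε)
  have hτ₀τ : τ₀ ≤ τ := min_le_left _ _
  have hsub : Icc 0 τ₀ ⊆ Icc 0 τ := Icc_subset_Icc_right hτ₀τ
  have hgood : ∀ t ∈ Icc 0 τ₀, 0 < (y t * e).re ∧ 0 < inner ℝ (y t) (z' t) := fun t ht ↦ by
    refine hE ⟨?_, hsub ht⟩
    rw [Metric.mem_ball, Real.dist_eq, sub_zero, abs_of_nonneg ht.1]
    linarith [ht.2.trans (min_le_right _ _)]
  let N : ℝ → ℝ := fun t ↦ ‖z t‖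
  have hNc : ContinuousOn N (Icc 0 τ₀) := (hz.continuousOn.mono hsub).norm
  have hN0 : N 0 = 0 := by simp [N, h0]
  have hmono : StrictMonoOn N (Icc 0 τ₀) := by
    have hsq : StrictMonoOn (fun t ↦ ‖z t‖ ^ 2) (Icc 0 τ₀) := by
      refine strictMonoOn_of_deriv_pos (convex_Icc _ _) (hNc.pow 2) fun t ht ↦ ?_
      rw [interior_Icc] at ht
      have htm : t ∈ Icc 0 τ₀ := Ioo_subset_Icc_self ht
      have hd : HasDerivAt z (z' t) t := (hder t (hsub htm)).hasDerivAt
        (Icc_mem_nhds ht.1 (ht.2.trans_le hτ₀τ))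
      rw [hd.norm_sq.deriv, hyt t ht.1.ne', ← Complex.real_smul, real_inner_smul_left]
      exact mul_pos two_pos (mul_pos ht.1 (hgood t htm).2)
    intro s hs t ht hst
    exact lt_of_pow_lt_pow_left₀ 2 (norm_nonneg _) (hsq hs ht hst)
  have himg : N '' Icc 0 τ₀ = Icc 0 (N τ₀) := by
    have := (hmono.monotoneOn).image_Icc_subset
    refine Subset.antisymm ?_ ?_
    · rwa [hN0] at this
    · have := intermediate_value_Icc hτ₀.le hNc
      rwa [hN0] at this
  let G : ℝ → ℝ := fun t ↦ α + (y t * e).arg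
  have hGc : ContinuousOn G (Icc 0 τ₀) := by
    refine continuousOn_const.add fun t ht ↦ ?_
    refine (Complex.continuousAt_arg (Or.inl (hgood t ht).1)).comp_continuousWithinAt
      (f := fun t ↦ y t * e) ?_
    exact ((hyc.mono hsub) t ht).mul continuousWithinAt_const
  have hG : ∀ t ∈ Icc 0 τ₀, z t = ((‖z t‖ : ℝ) : ℂ) * Complex.exp ((G t : ℂ) * Complex.I) := by
    intro t ht
    rcases ht.1.eq_or_lt with rfl | hpos
    · simp [h0]
    have h1 : y t * e = ((‖y t‖ : ℝ) : ℂ) * Complex.exp (((y t * e).arg : ℂ) * Complex.I) := by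
      have h2 := Complex.norm_mul_exp_arg_mul_I (y t * e)
      have h3 : ‖e‖ = 1 := Complex.norm_exp_ofReal_mul_I _
      rw [norm_mul, h3, mul_one] at h2
      exact h2.symm
    have h4 : y t = ((‖y t‖ : ℝ) : ℂ) * Complex.exp ((G t : ℂ) * Complex.I) := by
      have h5 : Complex.exp ((G t : ℂ) * Complex.I) = Complex.exp ((α : ℂ) * Complex.I) *
          Complex.exp (((y t * e).arg : ℂ) * Complex.I) := by
        rw [← Complex.exp_add]
        congr 1
        simp only [G]; push_cast; ring
      rw [h5, mul_left_comm, ← h1, mul_comm, mul_assoc, hee, mul_one]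
    have h6 : ‖z t‖ = t * ‖y t‖ := by
      rw [hyt t hpos.ne', norm_mul, Complex.norm_real, Real.norm_of_nonneg hpos.le]
    rw [h6, hyt t hpos.ne', Complex.ofReal_mul, mul_assoc, ← h4]
  have hinv : ∀ t ∈ Icc 0 τ₀, Function.invFunOn N (Icc 0 τ₀) (N t) = t := fun t ht ↦
    hmono.injOn.leftInvOn_invFunOn ht
  refine ⟨τ₀, ⟨hτ₀, hτ₀τ⟩, G ∘ Function.invFunOn N (Icc 0 τ₀), hmono, ?_, ?_, ?_⟩
  · change ContinuousOn _ (Icc 0 (N τ₀))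
    rw [← himg]
    refine hGc.comp (continuousOn_invFunOn_image isCompact_Icc hNc hmono.injOn) ?_
    exact (surjOn_image N (Icc 0 τ₀)).mapsTo_invFunOn
  · have : Function.invFunOn N (Icc 0 τ₀) 0 = 0 := by
      have := hinv 0 (left_mem_Icc.mpr hτ₀.le)
      rwa [hN0] at this
    simp only [Function.comp_apply, this, G, hy0, hve, Complex.arg_ofReal_of_nonneg hvpos.le,
      add_zero]
  · intro t ht
    have : (G ∘ Function.invFunOn N (Icc 0 τ₀)) ‖z t‖ = G t := congrArg G (hinv t ht)
    rw [this]
    exact hG t ht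

section PolarArc

variable {M : Type*} [TopologicalSpace M] {Φ : OpenPartialHomeomorph M ℂ} {p : M} {R : ℝ}

/-- In the disc of radius `δ` about `p`, the curve `γ` on `[0, 1]` is its initial piece on `[0, τ]`,
along which the radius increases from `0` to `δ`, and has the polar equation `θ = g ρ`. -/
structure IsPolarArc (Φ : OpenPartialHomeomorph M ℂ) (γ : ℝ → M) (g : ℝ → ℝ) (δ τ : ℝ) :
    Prop where
  radius_pos : 0 < δ
  time_mem : τ ∈ Ioc 0 1
  continuousOn_angle : ContinuousOn g (Icc 0 δ)
  continuousOn : ContinuousOn γ (Icc 0 τ)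
  mem_source : ∀ t ∈ Icc 0 τ, γ t ∈ Φ.source
  strictMonoOn : StrictMonoOn (fun t ↦ ‖Φ (γ t)‖) (Icc 0 τ)
  norm_zero : ‖Φ (γ 0)‖ = 0
  norm_end : ‖Φ (γ τ)‖ = δ
  polar : ∀ t ∈ Icc 0 τ, γ t = polarPoint Φ ‖Φ (γ t)‖ (g ‖Φ (γ t)‖)
  away : ∀ t ∈ Icc τ 1, γ t ∉ complexDisc Φ δ

namespace IsPolarArc

variable {γ : ℝ → M} {g : ℝ → ℝ} {δ τ : ℝ}

theorem continuousOn_norm (h : IsPolarArc Φ γ g δ τ) :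
    ContinuousOn (fun t ↦ ‖Φ (γ t)‖) (Icc 0 τ) :=
  (Φ.continuousOn.comp h.continuousOn h.mem_source).norm

theorem norm_mem (h : IsPolarArc Φ γ g δ τ) {t : ℝ} (ht : t ∈ Ioo 0 τ) :
    ‖Φ (γ t)‖ ∈ Ioo 0 δ := by
  have h0 : (0 : ℝ) ∈ Icc 0 τ := left_mem_Icc.mpr h.time_mem.1.le
  have h1 : τ ∈ Icc 0 τ := right_mem_Icc.mpr h.time_mem.1.le
  constructor
  · have := h.strictMonoOn h0 (Ioo_subset_Icc_self ht) ht.1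
    simpa only [h.norm_zero] using this
  · have := h.strictMonoOn (Ioo_subset_Icc_self ht) h1 ht.2
    simpa only [h.norm_end] using this

theorem exists_time (h : IsPolarArc Φ γ g δ τ) {ρ : ℝ} (hρ : ρ ∈ Ioc 0 δ) :
    ∃ t ∈ Ioc 0 τ, ‖Φ (γ t)‖ = ρ := by
  have := intermediate_value_Icc h.time_mem.1.le h.continuousOn_norm
  simp only [h.norm_zero, h.norm_end] at this
  obtain ⟨t, ht, he⟩ := this (Ioc_subset_Icc_self hρ)
  refine ⟨t, ⟨lt_of_le_of_ne ht.1 ?_, ht.2⟩, he⟩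
  rintro rfl
  have : ‖Φ (γ 0)‖ = ρ := he
  rw [h.norm_zero] at this
  exact hρ.1.ne this

theorem mem_graph (h : IsPolarArc Φ γ g δ τ) {t : ℝ} (ht : t ∈ Ioo 0 τ) :
    γ t ∈ angularGraph Φ g δ :=
  ⟨_, h.norm_mem ht, h.polar t (Ioo_subset_Icc_self ht)⟩

theorem exists_time_polarPoint (h : IsPolarArc Φ γ g δ τ) {ρ : ℝ} (hρ : ρ ∈ Ioo 0 δ) :
    ∃ t ∈ Ioo 0 τ, γ t = polarPoint Φ ρ (g ρ) := by
  obtain ⟨t, ht, he⟩ := h.exists_time ⟨hρ.1, hρ.2.le⟩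
  refine ⟨t, ⟨ht.1, lt_of_le_of_ne ht.2 ?_⟩, ?_⟩
  · rintro rfl
    rw [h.norm_end] at he
    exact hρ.2.ne he.symm
  · have := h.polar t (Ioc_subset_Icc_self ht)
    rwa [he] at this

theorem image_Ioo (h : IsPolarArc Φ γ g δ τ) : γ '' Ioo 0 τ = angularGraph Φ g δ := by
  ext q
  constructor
  · rintro ⟨t, ht, rfl⟩
    exact h.mem_graph ht
  · rintro ⟨ρ, hρ, rfl⟩
    obtain ⟨t, ht, he⟩ := h.exists_time_polarPoint hρ
    exact ⟨t, ht, he⟩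

theorem start_eq (h : IsPolarArc Φ γ g δ τ) (hΦ : IsPolarChart Φ p R) : γ 0 = p := by
  have := h.polar 0 (left_mem_Icc.mpr h.time_mem.1.le)
  rwa [h.norm_zero, hΦ.polarPoint_zero] at this

theorem mem_disc_iff (h : IsPolarArc Φ γ g δ τ) (hΦ : IsPolarChart Φ p R) {t : ℝ}
    (ht : t ∈ Icc (0 : ℝ) 1) : γ t ∈ complexDisc Φ δ ↔ t < τ := by
  constructor
  · intro hm
    by_contra hle
    exact h.away t ⟨not_lt.mp hle, ht.2⟩ hm
  · intro hlt
    rcases ht.1.eq_or_lt with rfl | hpos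
    · rw [h.start_eq hΦ]
      exact hΦ.center_mem_disc h.radius_pos
    · exact ⟨h.mem_source t ⟨ht.1, hlt.le⟩, by simpa using (h.norm_mem ⟨hpos, hlt⟩).2⟩

/-- The part of the curve in the disc is its polar graph. -/
theorem image_inter_disc (h : IsPolarArc Φ γ g δ τ) (hΦ : IsPolarChart Φ p R) {s : Set ℝ}
    (hs : Ico 0 τ ⊆ s) (hs' : s ⊆ Icc 0 1) :
    γ '' s ∩ complexDisc Φ δ = insert p (angularGraph Φ g δ) := by
  ext q
  constructor
  · rintro ⟨⟨t, ht, rfl⟩, hm⟩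
    have hlt := (h.mem_disc_iff hΦ (hs' ht)).mp hm
    rcases (hs' ht).1.eq_or_lt with rfl | hpos
    · exact Or.inl (h.start_eq hΦ)
    · exact Or.inr (h.mem_graph ⟨hpos, hlt⟩)
  · rintro (rfl | hq)
    · exact ⟨⟨0, hs (left_mem_Ico.mpr h.time_mem.1), h.start_eq hΦ⟩,
        hΦ.center_mem_disc h.radius_pos⟩
    · rw [← h.image_Ioo] at hq
      obtain ⟨t, ht, rfl⟩ := hq
      exact ⟨⟨t, hs ⟨ht.1.le, ht.2⟩, rfl⟩, (h.mem_disc_iff hΦ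
        ⟨ht.1.le, ht.2.le.trans h.time_mem.2⟩).mpr ht.2⟩

theorem image_Ico {r : ℝ} (h : IsPolarArc Φ γ g r 1)
    (hΦ : IsPolarChart Φ p R) : γ '' Ico 0 1 = insert p (angularGraph Φ g r) := by
  rw [← h.image_inter_disc hΦ subset_rfl Ico_subset_Icc_self]
  refine (inter_eq_left.mpr ?_).symm
  rintro _ ⟨t, ht, rfl⟩
  exact (h.mem_disc_iff hΦ (Ico_subset_Icc_self ht)).mpr ht.2

/-- A polar equation persists in smaller discs. -/
theorem shrink (h : IsPolarArc Φ γ g δ τ) {r : ℝ} (hr : r ∈ Ioc 0 δ) :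
    ∃ τ' ∈ Ioc 0 τ, IsPolarArc Φ γ g r τ' := by
  obtain ⟨t, ht, he⟩ := h.exists_time hr
  have hsub : Icc 0 t ⊆ Icc 0 τ := Icc_subset_Icc_right ht.2
  refine ⟨t, ht, hr.1, ⟨ht.1, ht.2.trans h.time_mem.2⟩,
    h.continuousOn_angle.mono (Icc_subset_Icc_right hr.2), h.continuousOn.mono hsub,
    fun s hs ↦ h.mem_source s (hsub hs), h.strictMonoOn.mono hsub, h.norm_zero, he,
    fun s hs ↦ h.polar s (hsub hs), fun s hs hm ↦ ?_⟩
  rcases le_total s τ with hsτ | hsτ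
  · have h1 : ‖Φ (γ s)‖ < r := by simpa using hm.2
    have h2 := h.strictMonoOn.monotoneOn (Ioc_subset_Icc_self ht) ⟨ht.1.le.trans hs.1, hsτ⟩ hs.1
    simp only [he] at h2
    linarith
  · exact h.away s ⟨hsτ, hs.2⟩ (complexDisc_mono hr.2 hm)

/-- The angle function may be changed by a multiple of `2π`. -/
theorem add_int (h : IsPolarArc Φ γ g δ τ) (m : ℤ) :
    IsPolarArc Φ γ (fun ρ ↦ g ρ + m * (2 * Real.pi)) δ τ :=
  { h with
    continuousOn_angle := h.continuousOn_angle.add continuousOn_const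
    polar := fun t ht ↦ by rw [polarPoint_add_int]; exact h.polar t ht }

/-- Truncating a curve with a polar equation at radius `r` and reparametrising it on `[0, 1]`. -/
theorem comp_mul {r : ℝ} (hpol : IsPolarArc Φ γ g r τ) :
    IsPolarArc Φ (fun t ↦ γ (τ * t)) g r 1 := by
  have hτ := hpol.time_mem.1
  have hmaps : ∀ t ∈ Icc (0 : ℝ) 1, τ * t ∈ Icc 0 τ := fun t ht ↦
    ⟨mul_nonneg hτ.le ht.1, mul_le_of_le_one_right hτ.le ht.2⟩
  refine ⟨hpol.radius_pos, ⟨one_pos, le_rfl⟩, hpol.continuousOn_angle,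
    hpol.continuousOn.comp (by fun_prop) hmaps, fun t ht ↦ hpol.mem_source _ (hmaps t ht),
    fun s hs t ht hst ↦ hpol.strictMonoOn (hmaps s hs) (hmaps t ht)
      (mul_lt_mul_of_pos_left hst hτ), ?_, ?_, fun t ht ↦ hpol.polar _ (hmaps t ht),
    fun t ht ↦ ?_⟩
  · simp only [mul_zero, hpol.norm_zero]
  · simp only [mul_one, hpol.norm_end]
  · have ht1 : t = 1 := le_antisymm ht.2 ht.1
    subst ht1
    simp only [mul_one]
    exact hpol.away τ ⟨le_rfl, hpol.time_mem.2⟩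

theorem eventually_mem_graph (h : IsPolarArc Φ γ g δ τ) :
    ∀ᶠ t in 𝓝[>] (0 : ℝ), γ t ∈ angularGraph Φ g δ := by
  filter_upwards [Ioo_mem_nhdsGT h.time_mem.1] with t ht
  exact h.mem_graph ht

end IsPolarArc

/-- A curve which near its starting point `p` is `C¹`-regular, and which does not return to `p`,
has a polar equation in a small disc. -/
theorem exists_isPolarArc [T2Space M] (hΦ : IsPolarChart Φ p R) {γ : ℝ → M}
    (hγ : ContinuousOn γ (Icc 0 1)) (hγ0 : γ 0 = p) (hne : ∀ t ∈ Ioc (0 : ℝ) 1, γ t ≠ p)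
    {τ α : ℝ} (hτ : τ ∈ Ioc (0 : ℝ) 1) (hsrc : ∀ t ∈ Icc 0 τ, γ t ∈ Φ.source)
    (hz : ContDiffOn ℝ 1 (fun t ↦ Φ (γ t)) (Icc 0 τ)) {v : ℂ}
    (hv : HasDerivWithinAt (fun t ↦ Φ (γ t)) v (Icc 0 τ) 0)
    (hv0 : v ≠ 0) (hα : v = ((‖v‖ : ℝ) : ℂ) * Complex.exp ((α : ℂ) * Complex.I)) :
    ∃ δ ≤ R, ∃ τ', ∃ g, IsPolarArc Φ γ g δ τ' ∧ g 0 = α := by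
  obtain ⟨τ₀, hτ₀, g, hmono, hgc, hg0, hpol⟩ := exists_polar_equation hτ.1 hz
    (by simp only [hγ0, hΦ.map_center]) hv hv0 hα
  have hτ₀1 : τ₀ ≤ 1 := hτ₀.2.trans hτ.2
  -- the rest of the curve stays away from `p`
  have hcomp : IsCompact (γ '' Icc τ₀ 1) :=
    isCompact_Icc.image_of_continuousOn (hγ.mono (Icc_subset_Icc_left hτ₀.1.le))
  have hp : p ∈ (γ '' Icc τ₀ 1)ᶜ := by
    rintro ⟨t, ht, he⟩
    exact hne t ⟨hτ₀.1.trans_le ht.1, ht.2⟩ he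
  have hnhds : (γ '' Icc τ₀ 1)ᶜ ∈ 𝓝 p := hcomp.isClosed.isOpen_compl.mem_nhds hp
  have hpre : Φ.symm ⁻¹' (γ '' Icc τ₀ 1)ᶜ ∈ 𝓝 (0 : ℂ) := by
    have h0t : (0 : ℂ) ∈ Φ.target := hΦ.map_center ▸ Φ.map_source hΦ.mem_source
    refine (Φ.symm.continuousAt h0t).preimage_mem_nhds ?_
    rwa [← hΦ.map_center, Φ.left_inv hΦ.mem_source]
  obtain ⟨ε, hε, hball⟩ := Metric.mem_nhds_iff.mp hpre
  have hz0 : ‖Φ (γ 0)‖ = 0 := by rw [hγ0, hΦ.map_center, norm_zero]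
  have hNpos : 0 < ‖Φ (γ τ₀)‖ := by
    have := hmono (left_mem_Icc.mpr hτ₀.1.le) (right_mem_Icc.mpr hτ₀.1.le) hτ₀.1
    simpa only [hz0] using this
  let δ := min (min ε R) ‖Φ (γ τ₀)‖
  have hδ : 0 < δ := lt_min (lt_min hε hΦ.pos) hNpos
  have hsub₀ : Icc 0 τ₀ ⊆ Icc 0 τ := Icc_subset_Icc_right hτ₀.2
  have hNc : ContinuousOn (fun t ↦ ‖Φ (γ t)‖) (Icc 0 τ₀) := (hz.continuousOn.mono hsub₀).norm
  obtain ⟨t, ht, he⟩ : ∃ t ∈ Icc 0 τ₀, ‖Φ (γ t)‖ = δ := by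
    have := intermediate_value_Icc hτ₀.1.le hNc
    simp only [hz0] at this
    exact this ⟨hδ.le, min_le_right _ _⟩
  have ht0 : 0 < t := lt_of_le_of_ne ht.1 (by rintro rfl; rw [hz0] at he; exact hδ.ne he)
  have hsub : Icc 0 t ⊆ Icc 0 τ₀ := Icc_subset_Icc_right ht.2
  refine ⟨δ, (min_le_left _ _).trans (min_le_right _ _), t, g, ⟨hδ, ⟨ht0, ht.2.trans hτ₀1⟩,
    hgc.mono (Icc_subset_Icc_right (min_le_right _ _)),
    hγ.mono (Icc_subset_Icc_right (ht.2.trans hτ₀1)),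
    fun s hs ↦ hsrc s (hsub₀ (hsub hs)), hmono.mono hsub, hz0, he, fun s hs ↦ ?_,
    fun s hs hm ↦ ?_⟩, hg0⟩
  · rw [polarPoint, ← hpol s (hsub hs), Φ.left_inv (hsrc s (hsub₀ (hsub hs)))]
  · have h1 : ‖Φ (γ s)‖ < δ := by simpa using hm.2
    rcases le_total s τ₀ with hs0 | hs0
    · have h2 := hmono.monotoneOn ht ⟨ht.1.trans hs.1, hs0⟩ hs.1
      simp only [he] at h2
      linarith
    · have h2 : Φ (γ s) ∈ Metric.ball (0 : ℂ) ε := by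
        rw [mem_ball_zero_iff]
        exact h1.trans_le ((min_le_left _ _).trans (min_le_left _ _))
      have h3 := hball h2
      rw [mem_preimage, Φ.left_inv hm.1] at h3
      exact h3 ⟨s, ⟨hs0, hs.2⟩, rfl⟩

end PolarArc

/-! ### Regular curves in smooth complex coordinates -/

section Velocity

variable {M : Type*} [TopologicalSpace M] [ChartedSpace Plane M]

/-- The chain rule for a function along a curve. -/
theorem hasDerivWithinAt_comp_velocity {F : Type*} [NormedAddCommGroup F] [NormedSpace ℝ F]
    {f : M → F} {γ : ℝ → M} {s : Set ℝ} {t : ℝ}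
    (hf : MDifferentiableAt (𝓡 2) 𝓘(ℝ, F) f (γ t))
    (hγ : MDifferentiableWithinAt 𝓘(ℝ, ℝ) (𝓡 2) γ s t) :
    HasDerivWithinAt (fun u ↦ f (γ u)) (mfderiv (𝓡 2) 𝓘(ℝ, F) f (γ t) (velocity γ s t) : F) s t := by
  let A : Plane →L[ℝ] F := mfderiv (𝓡 2) 𝓘(ℝ, F) f (γ t)
  let B : ℝ →L[ℝ] Plane := mfderivWithin 𝓘(ℝ, ℝ) (𝓡 2) γ s t
  have h : HasFDerivWithinAt (fun u ↦ f (γ u)) (A.comp B) s t :=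
    (hf.hasMFDerivAt.comp_hasMFDerivWithinAt t hγ.hasMFDerivWithinAt).hasFDerivWithinAt
  exact h.hasDerivWithinAt

theorem IsRegularCurve.mdifferentiableWithinAt {γ : ℝ → M} {s : Set ℝ} (h : IsRegularCurve γ s)
    {t : ℝ} (ht : t ∈ s) : MDifferentiableWithinAt 𝓘(ℝ, ℝ) (𝓡 2) γ s t :=
  (h.1 t ht).mdifferentiableWithinAt one_ne_zero

theorem IsRegularCurve.continuousOn {γ : ℝ → M} {s : Set ℝ} (h : IsRegularCurve γ s) :
    ContinuousOn γ s := h.1.continuousOn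

theorem uniqueMDiffWithinAt_Icc {t : ℝ} (ht : t ∈ Icc (0 : ℝ) 1) :
    UniqueMDiffWithinAt 𝓘(ℝ, ℝ) (Icc (0 : ℝ) 1) t :=
  (uniqueDiffOn_Icc zero_lt_one t ht).uniqueMDiffWithinAt

/-- Velocity of a linearly reparametrised curve. -/
theorem velocity_comp_mul {γ : ℝ → M} (hγ : IsRegularCurve γ (Icc 0 1)) {c : ℝ}
    (hc : c ∈ Ioc (0 : ℝ) 1) {t : ℝ} (ht : t ∈ Icc (0 : ℝ) 1) :
    velocity (fun u ↦ γ (c * u)) (Icc 0 1) t = c • velocity γ (Icc 0 1) (c * t) := by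
  have hmaps : MapsTo (fun u : ℝ ↦ c * u) (Icc 0 1) (Icc 0 1) := fun u hu ↦
    ⟨mul_nonneg hc.1.le hu.1, mul_le_one₀ hc.2 hu.1 hu.2⟩
  have h1 : HasMFDerivWithinAt 𝓘(ℝ, ℝ) 𝓘(ℝ, ℝ) (fun u : ℝ ↦ c * u) (Icc 0 1) t
      (ContinuousLinearMap.toSpanSingleton ℝ c) := by
    have : HasDerivAt (fun u : ℝ ↦ c * u) c t := by
      simpa using (hasDerivAt_id t).const_mul c
    exact this.hasFDerivAt.hasMFDerivAt.hasMFDerivWithinAt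
  have h2 := (hγ.mdifferentiableWithinAt (hmaps ht)).hasMFDerivWithinAt
  have h3 := (HasMFDerivWithinAt.comp t h2 h1 hmaps).mfderivWithin (uniqueMDiffWithinAt_Icc ht)
  change mfderivWithin 𝓘(ℝ, ℝ) (𝓡 2) (γ ∘ fun u ↦ c * u) (Icc 0 1) t (1 : ℝ) = _
  rw [h3]
  change mfderivWithin 𝓘(ℝ, ℝ) (𝓡 2) γ (Icc 0 1) (c * t)
    ((ContinuousLinearMap.toSpanSingleton ℝ c) (1 : ℝ)) = _
  have h4 : (ContinuousLinearMap.toSpanSingleton ℝ c) (1 : ℝ) = c • (1 : ℝ) := by simp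
  rw [h4]
  exact (mfderivWithin 𝓘(ℝ, ℝ) (𝓡 2) γ (Icc 0 1) (c * t)).map_smul c (1 : ℝ)

theorem IsRegularCurve.comp_mul {γ : ℝ → M} (hγ : IsRegularCurve γ (Icc 0 1)) {c : ℝ}
    (hc : c ∈ Ioc (0 : ℝ) 1) : IsRegularCurve (fun u ↦ γ (c * u)) (Icc 0 1) := by
  have hmaps : MapsTo (fun u : ℝ ↦ c * u) (Icc 0 1) (Icc 0 1) := fun u hu ↦
    ⟨mul_nonneg hc.1.le hu.1, mul_le_one₀ hc.2 hu.1 hu.2⟩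
  refine ⟨hγ.1.comp (contMDiff_iff_contDiff.mpr (contDiff_const.mul contDiff_id)).contMDiffOn
    hmaps, fun t ht ↦ ?_⟩
  rw [velocity_comp_mul hγ hc ht]
  exact smul_ne_zero hc.1.ne' (hγ.2 _ (hmaps ht))

end Velocity

section SmoothChart

variable {M : Type*} [TopologicalSpace M] [ChartedSpace Plane M]

/-- A polar chart that is smooth together with its inverse. -/
structure IsSmoothPolarChart (Φ : OpenPartialHomeomorph M ℂ) (p : M) (R : ℝ) : Prop
    extends IsPolarChart Φ p R where
  contMDiffOn : ContMDiffOn (𝓡 2) 𝓘(ℝ, ℂ) ∞ Φ Φ.source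
  contMDiffOn_symm : ContMDiffOn 𝓘(ℝ, ℂ) (𝓡 2) ∞ Φ.symm Φ.target

/-- The complex coordinate of a tangent vector. -/
noncomputable def tangentCoord (Φ : OpenPartialHomeomorph M ℂ) (q : M) :
    TangentSpace (𝓡 2) q →L[ℝ] ℂ :=
  mfderiv (𝓡 2) 𝓘(ℝ, ℂ) Φ q

namespace IsSmoothPolarChart

variable {Φ : OpenPartialHomeomorph M ℂ} {p : M} {R : ℝ}

theorem shrink (h : IsSmoothPolarChart Φ p R) {r : ℝ} (hr : 0 < r) (hrR : r ≤ R) :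
    IsSmoothPolarChart Φ p r :=
  ⟨h.toIsPolarChart.mono hr hrR, h.contMDiffOn, h.contMDiffOn_symm⟩

theorem mdifferentiableAt (h : IsSmoothPolarChart Φ p R) {q : M} (hq : q ∈ Φ.source) :
    MDifferentiableAt (𝓡 2) 𝓘(ℝ, ℂ) Φ q :=
  ((h.contMDiffOn q hq).contMDiffAt (Φ.open_source.mem_nhds hq)).mdifferentiableAt (by simp)

theorem mdifferentiable (h : IsSmoothPolarChart Φ p R) : Φ.MDifferentiable (𝓡 2) 𝓘(ℝ, ℂ) :=
  ⟨h.contMDiffOn.mdifferentiableOn (by simp), h.contMDiffOn_symm.mdifferentiableOn (by simp)⟩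

theorem tangentCoord_bijective (h : IsSmoothPolarChart Φ p R) {q : M} (hq : q ∈ Φ.source) :
    Function.Bijective (tangentCoord Φ q) :=
  (h.mdifferentiable.mfderiv hq).bijective

theorem tangentCoord_ne_zero (h : IsSmoothPolarChart Φ p R) {q : M} (hq : q ∈ Φ.source)
    {v : TangentSpace (𝓡 2) q} (hv : v ≠ 0) : tangentCoord Φ q v ≠ 0 := fun h0 ↦
  hv ((h.tangentCoord_bijective hq).1 (h0.trans (map_zero _).symm))

theorem hasDerivWithinAt (h : IsSmoothPolarChart Φ p R) {γ : ℝ → M}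
    (hγ : IsRegularCurve γ (Icc 0 1)) {t : ℝ} (ht : t ∈ Icc (0 : ℝ) 1) (hs : γ t ∈ Φ.source) :
    HasDerivWithinAt (fun u ↦ Φ (γ u)) (tangentCoord Φ (γ t) (velocity γ (Icc 0 1) t))
      (Icc 0 1) t :=
  hasDerivWithinAt_comp_velocity (h.mdifferentiableAt hs) (hγ.mdifferentiableWithinAt ht)

theorem hasDerivWithinAt_zero (h : IsSmoothPolarChart Φ p R) {γ : ℝ → M}
    (hγ : IsRegularCurve γ (Icc 0 1)) (h0 : γ 0 = p) :
    HasDerivWithinAt (fun u ↦ Φ (γ u)) (tangentCoord Φ p (initialVelocity p γ)) (Icc 0 1) 0 := by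
  subst h0
  exact h.hasDerivWithinAt hγ (left_mem_Icc.mpr zero_le_one) h.mem_source

theorem initialVelocity_ne_zero {γ : ℝ → M} (hγ : IsRegularCurve γ (Icc 0 1)) :
    initialVelocity p γ ≠ 0 :=
  hγ.2 0 (left_mem_Icc.mpr zero_le_one)

theorem exists_isPolarArc [T2Space M] (h : IsSmoothPolarChart Φ p R) {γ : ℝ → M}
    (hγ : IsRegularCurve γ (Icc 0 1)) (h0 : γ 0 = p) (hne : ∀ t ∈ Ioc (0 : ℝ) 1, γ t ≠ p)
    {α : ℝ} (hα : tangentCoord Φ p (initialVelocity p γ) =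
      ((‖tangentCoord Φ p (initialVelocity p γ)‖ : ℝ) : ℂ) *
        Complex.exp ((α : ℂ) * Complex.I)) :
    ∃ δ ≤ R, ∃ τ, ∃ g, IsPolarArc Φ γ g δ τ ∧ g 0 = α := by
  have hsrc : γ ⁻¹' Φ.source ∈ 𝓝[Icc 0 1] (0 : ℝ) :=
    (hγ.continuousOn 0 (left_mem_Icc.mpr zero_le_one)).preimage_mem_nhdsWithin
      (Φ.open_source.mem_nhds (h0 ▸ h.mem_source))
  obtain ⟨ε, hε, hball⟩ := Metric.mem_nhdsWithin_iff.mp hsrc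
  have hτ : min 1 (ε / 2) ∈ Ioc (0 : ℝ) 1 := ⟨lt_min one_pos (half_pos hε), min_le_left _ _⟩
  have hsub : Icc 0 (min 1 (ε / 2)) ⊆ Icc (0 : ℝ) 1 := Icc_subset_Icc_right hτ.2
  have hmem : ∀ t ∈ Icc 0 (min 1 (ε / 2)), γ t ∈ Φ.source := fun t ht ↦ by
    refine hball ⟨?_, hsub ht⟩
    rw [Metric.mem_ball, Real.dist_eq, sub_zero, abs_of_nonneg ht.1]
    linarith [ht.2.trans (min_le_right _ _)]
  refine CoherentTangent.exists_isPolarArc h.toIsPolarChart hγ.continuousOn h0 hne hτ hmem ?_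
    ((h.hasDerivWithinAt_zero hγ h0).mono hsub)
    (h.tangentCoord_ne_zero h.mem_source (initialVelocity_ne_zero hγ)) hα
  rw [← contMDiffOn_iff_contDiffOn]
  exact (h.contMDiffOn.of_le (by exact_mod_cast le_top)).comp (hγ.1.mono hsub) hmem

/-- The straight ray of direction `θ` and length `r` in the coordinate `Φ`. -/
noncomputable def _root_.CoherentTangent.straightRay (Φ : OpenPartialHomeomorph M ℂ) (r θ : ℝ) :
    ℝ → M :=
  fun t ↦ polarPoint Φ (t * r) θ

theorem mem_target_ray (h : IsSmoothPolarChart Φ p R) {r : ℝ} (hr : r ∈ Ioc 0 R) (θ : ℝ)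
    {t : ℝ} (ht : t ∈ Icc (0 : ℝ) 1) :
    ((t * r : ℝ) : ℂ) * Complex.exp ((θ : ℂ) * Complex.I) ∈ Φ.target :=
  h.polar_mem_target ⟨mul_nonneg ht.1 hr.1.le,
    (mul_le_of_le_one_left hr.1.le ht.2).trans hr.2⟩ θ

theorem contMDiffOn_ray (h : IsSmoothPolarChart Φ p R) {r : ℝ} (hr : r ∈ Ioc 0 R) (θ : ℝ) :
    ContMDiffOn 𝓘(ℝ, ℝ) (𝓡 2) 1 (straightRay Φ r θ) (Icc 0 1) := by
  refine (h.contMDiffOn_symm.of_le (by exact_mod_cast le_top)).comp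
    (f := fun t : ℝ ↦ ((t * r : ℝ) : ℂ) * Complex.exp ((θ : ℂ) * Complex.I)) ?_
    fun t ht ↦ h.mem_target_ray hr θ ht
  refine (contMDiff_iff_contDiff.mpr ?_).contMDiffOn
  refine ContDiff.mul ?_ contDiff_const
  exact Complex.ofRealCLM.contDiff.comp (contDiff_id.mul contDiff_const)

theorem tangentCoord_velocity_ray (h : IsSmoothPolarChart Φ p R) {r : ℝ} (hr : r ∈ Ioc 0 R)
    (θ : ℝ) {t : ℝ} (ht : t ∈ Icc (0 : ℝ) 1) :
    tangentCoord Φ (straightRay Φ r θ t) (velocity (straightRay Φ r θ) (Icc 0 1) t) =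
      (r : ℂ) * Complex.exp ((θ : ℂ) * Complex.I) := by
  have hs : straightRay Φ r θ t ∈ Φ.source := Φ.map_target (h.mem_target_ray hr θ ht)
  have h1 := hasDerivWithinAt_comp_velocity (h.mdifferentiableAt hs)
    (((h.contMDiffOn_ray hr θ) t ht).mdifferentiableWithinAt one_ne_zero)
  have h2 : HasDerivWithinAt (fun u ↦ Φ (straightRay Φ r θ u))
      ((r : ℂ) * Complex.exp ((θ : ℂ) * Complex.I)) (Icc 0 1) t := by
    have h3 : HasDerivWithinAt (fun u : ℝ ↦ ((u * r : ℝ) : ℂ) *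
        Complex.exp ((θ : ℂ) * Complex.I)) ((r : ℂ) * Complex.exp ((θ : ℂ) * Complex.I))
        (Icc 0 1) t := by
      refine HasDerivWithinAt.mul_const ?_ _
      have h4 : HasDerivAt (fun u : ℝ ↦ u * r) r t := by
        simpa using (hasDerivAt_id t).mul_const r
      exact h4.ofReal_comp.hasDerivWithinAt
    refine h3.congr (fun u hu ↦ Φ.right_inv (h.mem_target_ray hr θ hu))
      (Φ.right_inv (h.mem_target_ray hr θ ht))
  exact (uniqueDiffOn_Icc zero_lt_one t ht).eq_deriv _ h1 h2

theorem isRegularCurve_ray (h : IsSmoothPolarChart Φ p R) {r : ℝ} (hr : r ∈ Ioc 0 R) (θ : ℝ) :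
    IsRegularCurve (straightRay Φ r θ) (Icc 0 1) := by
  refine ⟨h.contMDiffOn_ray hr θ, fun t ht h0 ↦ ?_⟩
  have := h.tangentCoord_velocity_ray hr θ ht
  rw [h0, map_zero] at this
  have hne : (r : ℂ) ≠ 0 := by exact_mod_cast hr.1.ne'
  exact mul_ne_zero hne (Complex.exp_ne_zero _) this.symm

theorem ray_zero (h : IsSmoothPolarChart Φ p R) (r θ : ℝ) : straightRay Φ r θ 0 = p := by
  simp only [straightRay, zero_mul, h.polarPoint_zero]

theorem tangentCoord_initialVelocity_ray (h : IsSmoothPolarChart Φ p R) {r : ℝ}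
    (hr : r ∈ Ioc 0 R) (θ : ℝ) :
    tangentCoord Φ p (initialVelocity p (straightRay Φ r θ)) =
      (r : ℂ) * Complex.exp ((θ : ℂ) * Complex.I) := by
  have h1 := h.hasDerivWithinAt_zero (h.isRegularCurve_ray hr θ) (h.ray_zero r θ)
  have h2 := h.tangentCoord_velocity_ray hr θ (left_mem_Icc.mpr zero_le_one)
  have h3 := h.hasDerivWithinAt (h.isRegularCurve_ray hr θ) (left_mem_Icc.mpr zero_le_one)
    (by rw [h.ray_zero]; exact h.mem_source)
  rw [h2] at h3
  exact (uniqueDiffOn_Icc zero_lt_one 0 (left_mem_Icc.mpr zero_le_one)).eq_deriv _ h1 h3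

theorem isPolarArc_ray (h : IsSmoothPolarChart Φ p R) {r : ℝ} (hr : r ∈ Ioc 0 R) (θ : ℝ) :
    IsPolarArc Φ (straightRay Φ r θ) (fun _ ↦ θ) r 1 := by
  have hmem : ∀ t ∈ Icc (0 : ℝ) 1, t * r ∈ Icc 0 R := fun t ht ↦
    ⟨mul_nonneg ht.1 hr.1.le, (mul_le_of_le_one_left hr.1.le ht.2).trans hr.2⟩
  have hn : ∀ t ∈ Icc (0 : ℝ) 1, ‖Φ (straightRay Φ r θ t)‖ = t * r := fun t ht ↦
    h.norm_apply_polarPoint (hmem t ht) θ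
  refine ⟨hr.1, ⟨one_pos, le_rfl⟩, continuousOn_const, (h.contMDiffOn_ray hr θ).continuousOn,
    fun t ht ↦ h.polarPoint_mem_source (hmem t ht) θ, fun s hs t ht hst ↦ ?_, ?_, ?_,
    fun t ht ↦ ?_, fun t ht hm ↦ ?_⟩
  · simp only [hn s hs, hn t ht]
    exact mul_lt_mul_of_pos_right hst hr.1
  · rw [hn 0 (by simp), zero_mul]
  · rw [hn 1 (by simp), one_mul]
  · rw [hn t ht]; rfl
  · have ht1 : t = 1 := le_antisymm ht.2 ht.1
    have : ‖Φ (straightRay Φ r θ t)‖ < r := by simpa using hm.2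
    rw [ht1, hn 1 (by simp), one_mul] at this
    exact lt_irrefl _ this

/-- A regular curve with a polar equation up to its end is an arc from the centre to the boundary
of the disc. -/
theorem isArc_of_isPolarArc (h : IsSmoothPolarChart Φ p R) {γ : ℝ → M}
    (hγ : IsRegularCurve γ (Icc 0 1)) {g : ℝ → ℝ} {r : ℝ} (hpol : IsPolarArc Φ γ g r 1) :
    IsArc p (complexDisc Φ r) γ := by
  have hinj : InjOn γ (Icc 0 1) := fun s hs t ht hst ↦
    hpol.strictMonoOn.injOn hs ht (by simp only [hst])
  have hmem : ∀ t ∈ Ico (0 : ℝ) 1, γ t ∈ complexDisc Φ r := fun t ht ↦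
    (hpol.mem_disc_iff h.toIsPolarChart (Ico_subset_Icc_self ht)).mpr ht.2
  refine ⟨hγ, hinj, hpol.start_eq h.toIsPolarChart, hmem, ?_⟩
  rw [(isOpen_complexDisc r).frontier_eq]
  refine ⟨?_, hpol.away 1 (by simp)⟩
  have hc : ContinuousWithinAt γ (Ico 0 1) 1 :=
    (hγ.continuousOn 1 (by simp)).mono Ico_subset_Icc_self
  have : (𝓝[Ico 0 1] (1 : ℝ)).NeBot := by
    rw [← mem_closure_iff_nhdsWithin_neBot, closure_Ico zero_ne_one]
    simp
  exact mem_closure_of_tendsto hc (by filter_upwards [self_mem_nhdsWithin] with t ht using hmem t ht)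

end IsSmoothPolarChart

end SmoothChart

section OrientedChart

theorem isPositivePair_iff_det {W : Type*} [AddCommGroup W] [Module ℝ W]
    (b : Module.Basis (Fin 2) ℝ W) (v w : W) :
    IsPositivePair b.orientation v w ↔ 0 < b.det ![v, w] := by
  constructor
  · rintro ⟨B, hB, rfl, rfl⟩
    have := (b.orientation_eq_iff_det_pos B).mp hB.symm
    have e : (B : Fin 2 → W) = ![B 0, B 1] := by
      funext i
      fin_cases i <;> rfl
    rwa [e] at this
  · intro h
    have hu : IsUnit (b.det ![v, w]) := h.ne'.isUnit
    obtain ⟨hli, hsp⟩ := (Module.Basis.is_basis_iff_det b).mpr hu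
    refine ⟨Module.Basis.mk hli hsp.ge, ?_, by simp, by simp⟩
    symm
    rw [b.orientation_eq_iff_det_pos, Module.Basis.coe_mk]
    exact h

theorem isPositivePair_neg_iff_det {W : Type*} [AddCommGroup W] [Module ℝ W]
    (b : Module.Basis (Fin 2) ℝ W) (v w : W) :
    IsPositivePair (-b.orientation) v w ↔ b.det ![v, w] < 0 := by
  have h := isPositivePair_iff_det (b.unitsSMul ![-1, 1]) v w
  have h1 : (b.unitsSMul ![-1, 1]).orientation = -b.orientation := by
    rw [Module.Basis.orientation_unitsSMul]
    simp
  have h2 : (b.unitsSMul ![-1, 1]).det ![v, w] = -b.det ![v, w] := by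
    rw [Module.Basis.det_unitsSMul]
    simp
  rw [h1, h2] at h
  rw [h]
  exact neg_pos

/-- The oriented area of the parallelogram spanned by two complex numbers. -/
theorem det_basisOneI (z w : ℂ) :
    Complex.basisOneI.det ![z, w] = ((starRingEnd ℂ) z * w).im := by
  rw [Module.Basis.det_apply, Matrix.det_fin_two]
  simp [Module.Basis.toMatrix_apply, Complex.coe_basisOneI_repr]
  ring

variable {M : Type*} [TopologicalSpace M]

/-- The coordinate `φ`, centred at `p` and identified with a complex number through `L`. -/
noncomputable def complexChart (φ : OpenPartialHomeomorph M Plane) (p : M) (L : Plane ≃ₗᵢ[ℝ] ℂ) :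
    OpenPartialHomeomorph M ℂ :=
  φ.transHomeomorph ((Homeomorph.subRight (φ p)).trans L.toHomeomorph)

theorem complexChart_apply (φ : OpenPartialHomeomorph M Plane) (p : M) (L : Plane ≃ₗᵢ[ℝ] ℂ)
    (q : M) : complexChart φ p L q = L (φ q - φ p) := rfl

theorem complexDisc_complexChart (φ : OpenPartialHomeomorph M Plane) (p : M)
    (L : Plane ≃ₗᵢ[ℝ] ℂ) (r : ℝ) : complexDisc (complexChart φ p L) r = coordinateDisc φ p r := by
  ext q
  simp only [complexDisc, coordinateDisc, mem_inter_iff, mem_preimage, mem_ball_zero_iff,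
    complexChart_apply, LinearIsometryEquiv.norm_map]
  rw [mem_ball_iff_norm]
  rfl

variable [ChartedSpace Plane M]

theorem exists_isSmoothPolarChart_complexChart [IsManifold (𝓡 2) ∞ M]
    {φ : OpenPartialHomeomorph M Plane} (hφ : φ ∈ IsManifold.maximalAtlas (𝓡 2) ∞ M) {p : M}
    (hp : p ∈ φ.source) (L : Plane ≃ₗᵢ[ℝ] ℂ) :
    ∃ R, IsSmoothPolarChart (complexChart φ p L) p R := by
  have h0 : complexChart φ p L p = 0 := by rw [complexChart_apply, sub_self, map_zero]
  have hnhds : (complexChart φ p L).target ∈ 𝓝 (0 : ℂ) := by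
    rw [← h0]
    exact (complexChart φ p L).open_target.mem_nhds ((complexChart φ p L).map_source hp)
  obtain ⟨R, hR, hball⟩ := Metric.nhds_basis_closedBall.mem_iff.mp hnhds
  refine ⟨R, ⟨hR, hp, h0, hball⟩, ?_, ?_⟩
  · have h1 : ContDiff ℝ ∞ (fun x : Plane ↦ L (x - φ p)) :=
      L.contDiff.comp (contDiff_id.sub contDiff_const)
    exact h1.contMDiff.comp_contMDiffOn (contMDiffOn_of_mem_maximalAtlas hφ)
  · have h1 : ContDiff ℝ ∞ (fun z : ℂ ↦ L.symm z + φ p) :=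
      L.symm.contDiff.add contDiff_const
    exact (contMDiffOn_symm_of_mem_maximalAtlas hφ).comp h1.contMDiff.contMDiffOn
      fun z hz ↦ hz

/-- `Φ` is compatible with the orientation at `p`. -/
def IsOrientedAt [IsManifold (𝓡 2) ∞ M] (o : SurfaceOrientation M)
    (Φ : OpenPartialHomeomorph M ℂ) (p : M) : Prop :=
  ∀ v w : TangentSpace (𝓡 2) p, IsPositivePair (o.at_point p) v w ↔
    0 < ((starRingEnd ℂ) (tangentCoord Φ p v) * tangentCoord Φ p w).im

theorem tangentCoord_complexChart [IsManifold (𝓡 2) ∞ M]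
    {φ : OpenPartialHomeomorph M Plane} (hφ : φ ∈ IsManifold.maximalAtlas (𝓡 2) ∞ M) {p : M}
    (hp : p ∈ φ.source) (L : Plane ≃ₗᵢ[ℝ] ℂ) (v : TangentSpace (𝓡 2) p) :
    tangentCoord (complexChart φ p L) p v = L (mfderiv (𝓡 2) 𝓘(ℝ, Plane) φ p v) := by
  have h1 : HasMFDerivAt (𝓡 2) 𝓘(ℝ, Plane) φ p (mfderiv (𝓡 2) 𝓘(ℝ, Plane) φ p) :=
    (((contMDiffOn_of_mem_maximalAtlas hφ).contMDiffAt
      (φ.open_source.mem_nhds hp)).mdifferentiableAt (by simp)).hasMFDerivAt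
  have h2 : HasFDerivAt (fun x : Plane ↦ L (x - φ p)) (L : Plane →L[ℝ] ℂ) (φ p) := by
    have h3 := ((L : Plane →L[ℝ] ℂ).hasFDerivAt (x := φ p)).sub_const (L (φ p))
    refine h3.congr_of_eventuallyEq (Eventually.of_forall fun x ↦ ?_)
    exact map_sub L x (φ p)
  have h3 := (h2.hasMFDerivAt.comp p h1).mfderiv
  change mfderiv (𝓡 2) 𝓘(ℝ, ℂ) ((fun x : Plane ↦ L (x - φ p)) ∘ φ) p v = _
  rw [h3]
  rfl

/-- Up to a reflection, which does not change the coordinate discs, every chart yields an oriented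
complex coordinate. -/
theorem exists_oriented_complexChart [IsManifold (𝓡 2) ∞ M] (o : SurfaceOrientation M)
    {φ : OpenPartialHomeomorph M Plane} (hφ : φ ∈ IsManifold.maximalAtlas (𝓡 2) ∞ M) {p : M}
    (hp : p ∈ φ.source) :
    ∃ (Φ : OpenPartialHomeomorph M ℂ) (R : ℝ), IsSmoothPolarChart Φ p R ∧ IsOrientedAt o Φ p ∧
      ∀ r, complexDisc Φ r = coordinateDisc φ p r := by
  let L : Plane ≃ₗᵢ[ℝ] ℂ := Complex.orthonormalBasisOneI.repr.symm
  obtain ⟨R, hR⟩ := exists_isSmoothPolarChart_complexChart hφ hp L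
  obtain ⟨R', hR'⟩ := exists_isSmoothPolarChart_complexChart hφ hp (L.trans Complex.conjLIE)
  let Λ : TangentSpace (𝓡 2) p ≃ₗ[ℝ] ℂ :=
    LinearEquiv.ofBijective (tangentCoord (complexChart φ p L) p).toLinearMap
      (hR.tangentCoord_bijective hp)
  let b := Complex.basisOneI.map Λ.symm
  have hb : ∀ v w, b.det ![v, w] = ((starRingEnd ℂ) (tangentCoord (complexChart φ p L) p v) *
      tangentCoord (complexChart φ p L) p w).im := by
    intro v w
    rw [Module.Basis.det_map, ← det_basisOneI]
    congr 1
    ext i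
    fin_cases i <;> rfl
  rcases b.orientation_eq_or_eq_neg (o.at_point p) with h | h
  · refine ⟨_, R, hR, fun v w ↦ ?_, fun r ↦ complexDisc_complexChart φ p _ r⟩
    rw [h, isPositivePair_iff_det, hb]
  · refine ⟨_, R', hR', fun v w ↦ ?_, fun r ↦ complexDisc_complexChart φ p _ r⟩
    rw [h, isPositivePair_neg_iff_det, hb]
    have hconj : ∀ u : TangentSpace (𝓡 2) p,
        tangentCoord (complexChart φ p (L.trans Complex.conjLIE)) p u =
          (starRingEnd ℂ) (tangentCoord (complexChart φ p L) p u) := fun u ↦ by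
      rw [tangentCoord_complexChart hφ hp, tangentCoord_complexChart hφ hp]
      rfl
    simp only [hconj, Complex.mul_im, Complex.conj_re, Complex.conj_im]
    constructor <;> intro h' <;> linarith

end OrientedChart

/-! ### Null curve of a one-form, and curves transverse to it -/

/-- A differential inequality of Gronwall type: `y' > -K|y|` and `y(0) = 0` force `y > 0`. -/
theorem pos_of_deriv_gt_neg_mul {y y' : ℝ → ℝ} {τ K : ℝ} (hy : ContinuousOn y (Ico 0 τ))
    (h0 : y 0 = 0) (hd : ∀ t ∈ Ioo 0 τ, HasDerivAt y (y' t) t)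
    (hgt : ∀ t ∈ Ioo 0 τ, -(K * |y t|) < y' t) : ∀ t ∈ Ioo 0 τ, 0 < y t := by
  -- `y exp(Ct)` increases on every interval on which `y' + C y > 0`
  have key : ∀ C s t : ℝ, 0 ≤ s → s < t → t < τ → (∀ u ∈ Ioo s t, 0 < y' u + C * y u) →
      y s * Real.exp (C * s) < y t * Real.exp (C * t) := by
    intro C s t hs hst ht hpos
    have hmono : StrictMonoOn (fun u ↦ y u * Real.exp (C * u)) (Icc s t) := by
      refine strictMonoOn_of_deriv_pos (convex_Icc _ _) ?_ fun u hu ↦ ?_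
      · refine ContinuousOn.mul (hy.mono fun u hu ↦ ⟨hs.trans hu.1, hu.2.trans_lt ht⟩) ?_
        exact Continuous.continuousOn (by fun_prop)
      · rw [interior_Icc] at hu
        have h1 := hd u ⟨hs.trans_lt hu.1, hu.2.trans ht⟩
        have h2 : HasDerivAt (fun u ↦ Real.exp (C * u)) (Real.exp (C * u) * C) u := by
          have h3 : HasDerivAt (fun u : ℝ ↦ C * u) C u := by
            simpa using (hasDerivAt_id u).const_mul C
          exact h3.exp
        rw [(h1.fun_mul h2).deriv]
        have := mul_pos (hpos u hu) (Real.exp_pos (C * u))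
        linarith
    exact hmono (left_mem_Icc.mpr hst.le) (right_mem_Icc.mpr hst.le) hst
  have hnonneg : ∀ t ∈ Ioo 0 τ, 0 ≤ y t := by
    intro t ht
    by_contra hneg
    push Not at hneg
    have hyc : ContinuousOn y (Icc 0 t) := hy.mono fun u hu ↦ ⟨hu.1, hu.2.trans_lt ht.2⟩
    have hcl : IsClosed (Icc 0 t ∩ y ⁻¹' Ici 0) :=
      hyc.preimage_isClosed_of_isClosed isClosed_Icc isClosed_Ici
    have hcomp : IsCompact (Icc 0 t ∩ y ⁻¹' Ici 0) :=
      isCompact_Icc.of_isClosed_subset hcl inter_subset_left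
    -- the last time before `t` at which `y` is non-negative
    obtain ⟨s, hs⟩ := hcomp.exists_isGreatest
      ⟨0, left_mem_Icc.mpr ht.1.le, by simp [h0]⟩
    have hst : s < t := lt_of_le_of_ne hs.1.1.2 (by
      rintro rfl
      exact absurd hs.1.2 (not_le.mpr hneg))
    have hlt : ∀ u ∈ Ioo s t, y u < 0 := fun u hu ↦ by
      by_contra hle
      have := hs.2 ⟨⟨hs.1.1.1.trans hu.1.le, hu.2.le⟩, not_lt.mp hle⟩
      linarith [hu.1]
    have := key (-K) s t hs.1.1.1 hst ht.2 fun u hu ↦ by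
      have h1 := hgt u ⟨hs.1.1.1.trans_lt hu.1, hu.2.trans ht.2⟩
      rw [abs_of_neg (hlt u hu)] at h1
      linarith
    have h2 : 0 ≤ y s * Real.exp (-K * s) := mul_nonneg hs.1.2 (Real.exp_pos _).le
    have h3 : y t * Real.exp (-K * t) < 0 := mul_neg_of_neg_of_pos hneg (Real.exp_pos _)
    linarith
  intro t ht
  have := key K 0 t le_rfl ht.1 ht.2 fun u hu ↦ by
    have hu' : u ∈ Ioo 0 τ := ⟨hu.1, hu.2.trans ht.2⟩
    have h1 := hgt u hu'
    rw [abs_of_nonneg (hnonneg u hu')] at h1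
    linarith
  rw [h0, zero_mul] at this
  exact pos_of_mul_pos_left this (Real.exp_pos _).le

variable {E : Type*} [NormedAddCommGroup E] [NormedSpace ℝ E]

/-- A curve along which the one-form `β` is positive lies on the side of the null curve `Γ`
(`Γ' = η + f n`, a null direction) into which `n` points. -/
theorem eventually_pos_of_form_pos {β : E → E →L[ℝ] ℝ} {x₀ n η : E} {a b : E →L[ℝ] ℝ}
    (hdec : ∀ x, x = a x • n + b x • η) (han : a n = 1) (haη : a η = 0) {f : E → ℝ} {K : NNReal} {N : Set E}
    (hN : N ∈ 𝓝 x₀) (hf : LipschitzOnWith K f N) (hβn : ∀ x ∈ N, 0 < β x n)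
    (hβη : ∀ x ∈ N, β x η = -(f x * β x n)) {Γ : ℝ → E} {ε : ℝ} (hε : 0 < ε) (hΓ0 : Γ 0 = x₀)
    (hΓ : ∀ t ∈ Ioo (-ε) ε, HasDerivAt Γ (η + f (Γ t) • n) t)
    (hΓN : ∀ t ∈ Ioo (-ε) ε, Γ t ∈ N) (hbΓ : ∀ t ∈ Ioo (-ε) ε, b (Γ t - x₀) = t)
    {x : ℝ → E} {T : ℝ} (hT : 0 < T) (hx : ContDiffOn ℝ 1 x (Icc 0 T)) (hx0 : x 0 = x₀)
    (hpos : ∀ᶠ t in 𝓝[>] (0 : ℝ), 0 < β (x t) (derivWithin x (Icc 0 T) t)) :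
    ∀ᶠ t in 𝓝[>] (0 : ℝ), 0 < a (x t - Γ (b (x t - x₀))) := by
  have h0mem : (0 : ℝ) ∈ Icc (0 : ℝ) T := left_mem_Icc.mpr hT.le
  have hxc := hx.continuousOn
  have hx'c : ContinuousOn (derivWithin x (Icc 0 T)) (Icc 0 T) :=
    hx.continuousOn_derivWithin (uniqueDiffOn_Icc hT) le_rfl
  have hle : 𝓝[>] (0 : ℝ) ≤ 𝓝[Icc 0 T] 0 := by
    rw [← nhdsWithin_Ioo_eq_nhdsGT hT]
    exact nhdsWithin_mono _ Ioo_subset_Icc_self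
  have hxt : Tendsto x (𝓝[>] 0) (𝓝 x₀) := by
    have := (hxc 0 h0mem).tendsto.mono_left hle
    rwa [hx0] at this
  have hb0 : Tendsto (fun t ↦ b (x t - x₀)) (𝓝[>] 0) (𝓝 0) := by
    have h1 : Tendsto (fun t ↦ b (x t - x₀)) (𝓝[>] 0) (𝓝 (b (x₀ - x₀))) :=
      (b.continuous.tendsto _).comp (hxt.sub_const x₀)
    simpa using h1
  have hE1 := hxt.eventually hN
  have hE2 := hb0.eventually (Ioo_mem_nhds (neg_lt_zero.mpr hε) hε)
  have hE3 : ∀ᶠ t in 𝓝[>] (0 : ℝ), ‖b (derivWithin x (Icc 0 T) t)‖ <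
      ‖b (derivWithin x (Icc 0 T) 0)‖ + 1 := by
    have h1 : Tendsto (fun t ↦ ‖b (derivWithin x (Icc 0 T) t)‖) (𝓝[>] 0)
        (𝓝 ‖b (derivWithin x (Icc 0 T) 0)‖) :=
      ((b.continuous.tendsto _).comp ((hx'c 0 h0mem).tendsto.mono_left hle)).norm
    exact h1.eventually (gt_mem_nhds (lt_add_one _))
  set C := ‖b (derivWithin x (Icc 0 T) 0)‖ + 1
  obtain ⟨τ, hτ, hall⟩ := mem_nhdsGT_iff_exists_Ioo_subset.mp
    ((((hpos.and hE1).and hE2).and hE3).and (Ioo_mem_nhdsGT hT))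
  let y : ℝ → ℝ := fun t ↦ a (x t - Γ (b (x t - x₀)))
  let x' := derivWithin x (Icc 0 T)
  let y' : ℝ → ℝ := fun t ↦ a (x' t) - f (Γ (b (x t - x₀))) * b (x' t)
  have hdx : ∀ t ∈ Ioo 0 τ, HasDerivAt x (x' t) t := fun t ht ↦
    ((hx.differentiableOn one_ne_zero) t (Ioo_subset_Icc_self (hall ht).2)).hasDerivWithinAt
      |>.hasDerivAt (Icc_mem_nhds (hall ht).2.1 (hall ht).2.2)
  have hdy : ∀ t ∈ Ioo 0 τ, HasDerivAt y (y' t) t := by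
    intro t ht
    have h1 := hdx t ht
    have h2 : HasDerivAt (fun s ↦ b (x s - x₀)) (b (x' t)) t :=
      b.hasFDerivAt.comp_hasDerivAt t (h1.sub_const x₀)
    have h3 := (hΓ _ (hall ht).1.1.2).scomp t h2
    have h4 := a.hasFDerivAt.comp_hasDerivAt t (h1.sub h3)
    refine h4.congr_deriv ?_
    simp only [map_sub, map_smul, map_add, haη, han, smul_eq_mul, y']
    ring
  have hyc : ContinuousOn y (Ico 0 τ) := by
    intro t ht
    rcases ht.1.eq_or_lt with rfl | hpos0
    · have h1 : ContinuousWithinAt x (Ico 0 τ) 0 := by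
        have h5 : ContinuousWithinAt x (Icc 0 T) 0 := hxc 0 h0mem
        refine h5.mono_of_mem_nhdsWithin ?_
        rw [mem_nhdsWithin]
        exact ⟨Iio T, isOpen_Iio, hT, fun u hu ↦ ⟨hu.2.1, le_of_lt hu.1⟩⟩
      have h2 : ContinuousWithinAt (fun s ↦ b (x s - x₀)) (Ico 0 τ) 0 :=
        b.continuous.continuousAt.comp_continuousWithinAt (h1.sub continuousWithinAt_const)
      have h3 : ContinuousAt Γ (b (x 0 - x₀)) := by
        rw [hx0, sub_self, map_zero]
        exact (hΓ 0 ⟨neg_lt_zero.mpr hε, hε⟩).continuousAt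
      have h4 : ContinuousWithinAt (fun s ↦ Γ (b (x s - x₀))) (Ico 0 τ) 0 :=
        h3.comp_continuousWithinAt (f := fun s ↦ b (x s - x₀)) h2
      exact a.continuous.continuousAt.comp_continuousWithinAt (h1.sub h4)
    · exact (hdy t ⟨hpos0, ht.2⟩).continuousAt.continuousWithinAt
  have hy0 : y 0 = 0 := by simp [y, hx0, hΓ0]
  have hgt : ∀ t ∈ Ioo 0 τ, -((K * ‖n‖ * C) * |y t|) < y' t := by
    intro t ht
    obtain ⟨⟨⟨⟨h1, h2⟩, h3⟩, h4⟩, h5⟩ := hall ht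
    have hn := hβn _ h2
    -- `x` and the point of `Γ` at the same height differ by a multiple of `n`
    have hdiff : x t - Γ (b (x t - x₀)) = y t • n := by
      have h6 := hdec (x t - Γ (b (x t - x₀)))
      have h7 : b (x t - Γ (b (x t - x₀))) = 0 := by
        have h8 : x t - Γ (b (x t - x₀)) = (x t - x₀) - (Γ (b (x t - x₀)) - x₀) := by abel
        rw [h8, map_sub b (x t - x₀) (Γ (b (x t - x₀)) - x₀), hbΓ _ h3, sub_self]
      rw [h7, zero_smul, add_zero] at h6
      exact h6
    have hlip : |f (x t) - f (Γ (b (x t - x₀)))| ≤ K * (|y t| * ‖n‖) := by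
      have := hf.norm_sub_le h2 (hΓN _ h3)
      rwa [hdiff, norm_smul, Real.norm_eq_abs, Real.norm_eq_abs] at this
    have hform : 0 < a (x' t) - f (x t) * b (x' t) := by
      have h6 : β (x t) (x' t) = (a (x' t) - f (x t) * b (x' t)) * β (x t) n := by
        conv_lhs => rw [hdec (x' t)]
        rw [map_add, map_smul, map_smul, hβη _ h2, smul_eq_mul, smul_eq_mul]
        ring
      have h7 : 0 < β (x t) (x' t) := h1
      rw [h6] at h7
      exact pos_of_mul_pos_left h7 hn.le
    have hb : |b (x' t)| ≤ C := h4.le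
    have hprod : |(f (x t) - f (Γ (b (x t - x₀)))) * b (x' t)| ≤ K * (|y t| * ‖n‖) * C := by
      rw [abs_mul]
      exact mul_le_mul hlip hb (abs_nonneg _) (by positivity)
    have := neg_abs_le ((f (x t) - f (Γ (b (x t - x₀)))) * b (x' t))
    have hy' : y' t = (a (x' t) - f (x t) * b (x' t)) +
        (f (x t) - f (Γ (b (x t - x₀)))) * b (x' t) := by simp only [y']; ring
    rw [hy']
    linarith
  filter_upwards [Ioo_mem_nhdsGT hτ] with t ht
  exact pos_of_deriv_gt_neg_mul hyc hy0 hdy hgt t ht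

/-- Through every point at which it does not vanish, a `C¹` one-form `β` in the plane has a null
curve `Γ`.  The function `x ↦ a (x - Γ (b (x - x₀)))` measures on which side of `Γ` a point lies;
curves starting on `Γ` along which `β` is positive (negative) stay on the positive (negative)
side. -/
theorem exists_null_curve [CompleteSpace E] {β : E → E →L[ℝ] ℝ} {x₀ n η : E} {a b : E →L[ℝ] ℝ}
    (hβ : ContDiffAt ℝ 1 β x₀) (hn : 0 < β x₀ n) (hη : β x₀ η = 0)
    (hdec : ∀ x, x = a x • n + b x • η) (han : a n = 1) (haη : a η = 0) (hbn : b n = 0)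
    (hbη : b η = 1) :
    ∃ (Γ : ℝ → E) (ε : ℝ), 0 < ε ∧ Γ 0 = x₀ ∧ ContDiffOn ℝ 1 Γ (Ioo (-ε) ε) ∧
      HasDerivAt Γ η 0 ∧ (∀ t ∈ Ioo (-ε) ε, b (Γ t - x₀) = t) ∧
      ∀ (x : ℝ → E) (T : ℝ), 0 < T → ContDiffOn ℝ 1 x (Icc 0 T) → x 0 = x₀ →
        ((∀ᶠ t in 𝓝[>] (0 : ℝ), 0 < β (x t) (derivWithin x (Icc 0 T) t)) →
          ∀ᶠ t in 𝓝[>] (0 : ℝ), 0 < a (x t - Γ (b (x t - x₀)))) ∧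
        ((∀ᶠ t in 𝓝[>] (0 : ℝ), β (x t) (derivWithin x (Icc 0 T) t) < 0) →
          ∀ᶠ t in 𝓝[>] (0 : ℝ), a (x t - Γ (b (x t - x₀))) < 0) := by
  let f : E → ℝ := fun x ↦ -(β x η / β x n)
  have hfd : ContDiffAt ℝ 1 f x₀ :=
    ((hβ.clm_apply contDiffAt_const).div (hβ.clm_apply contDiffAt_const) hn.ne').neg
  have hXd : ContDiffAt ℝ 1 (fun x ↦ η + f x • n) x₀ :=
    contDiffAt_const.add (hfd.smul contDiffAt_const)
  obtain ⟨Γ, hΓ0, ε₀, hε₀, hΓ⟩ :=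
    hXd.exists_forall_mem_closedBall_exists_eq_forall_mem_Ioo_hasDerivAt₀ 0
  simp only [zero_sub, zero_add] at hΓ
  obtain ⟨K, N₁, hN₁, hlip⟩ := hfd.exists_lipschitzOnWith
  have hN₂ : ∀ᶠ x in 𝓝 x₀, 0 < β x n := by
    have : ContinuousAt (fun x ↦ β x n) x₀ := hβ.continuousAt.clm_apply continuousAt_const
    exact this.eventually (lt_mem_nhds hn)
  let N := N₁ ∩ {x | 0 < β x n}
  have hN : N ∈ 𝓝 x₀ := inter_mem hN₁ hN₂
  have hΓc : ContinuousAt Γ 0 := (hΓ 0 ⟨neg_lt_zero.mpr hε₀, hε₀⟩).continuousAt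
  obtain ⟨ε₁, hε₁, hball⟩ := Metric.mem_nhds_iff.mp
    (hΓc.preimage_mem_nhds (hΓ0.symm ▸ hN : N ∈ 𝓝 (Γ 0)))
  have hε : 0 < min ε₀ ε₁ := lt_min hε₀ hε₁
  have hI₀ : Ioo (-min ε₀ ε₁) (min ε₀ ε₁) ⊆ Ioo (-ε₀) ε₀ :=
    Ioo_subset_Ioo (neg_le_neg (min_le_left _ _)) (min_le_left _ _)
  have hΓN : ∀ t ∈ Ioo (-min ε₀ ε₁) (min ε₀ ε₁), Γ t ∈ N := fun t ht ↦ by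
    refine hball ?_
    rw [Metric.mem_ball, Real.dist_eq, sub_zero, abs_lt]
    exact ⟨by linarith [ht.1, min_le_right ε₀ ε₁], ht.2.trans_le (min_le_right _ _)⟩
  have hΓd : ∀ t ∈ Ioo (-min ε₀ ε₁) (min ε₀ ε₁), HasDerivAt Γ (η + f (Γ t) • n) t := fun t ht ↦
    hΓ t (hI₀ ht)
  have h0I : (0 : ℝ) ∈ Ioo (-min ε₀ ε₁) (min ε₀ ε₁) := ⟨neg_lt_zero.mpr hε, hε⟩
  have hbΓ : ∀ t ∈ Ioo (-min ε₀ ε₁) (min ε₀ ε₁), b (Γ t - x₀) = t := by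
    have hconst : ∀ t ∈ Ioo (-min ε₀ ε₁) (min ε₀ ε₁),
        HasDerivAt (fun t ↦ b (Γ t - x₀) - t) 0 t := fun t ht ↦ by
      have h1 := (b.hasFDerivAt.comp_hasDerivAt t ((hΓd t ht).sub_const x₀)).sub (hasDerivAt_id t)
      refine h1.congr_deriv ?_
      simp [hbn, hbη]
    intro t ht
    have h2 := isOpen_Ioo.is_const_of_deriv_eq_zero isPreconnected_Ioo
      (fun t ht ↦ (hconst t ht).differentiableAt.differentiableWithinAt)
      (fun t ht ↦ (hconst t ht).deriv) ht h0I
    simp only [hΓ0, sub_self, map_zero] at h2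
    linarith
  have hη0 : η + f (Γ 0) • n = η := by
    rw [hΓ0]
    simp [f, hη]
  refine ⟨Γ, min ε₀ ε₁, hε, hΓ0, ?_, hη0 ▸ hΓd 0 h0I, hbΓ, fun x T hT hx hx0 ↦ ⟨fun h ↦ ?_, fun h ↦ ?_⟩⟩
  · have hΓcont : ContinuousOn Γ (Ioo (-min ε₀ ε₁) (min ε₀ ε₁)) := fun t ht ↦
      (hΓd t ht).continuousAt.continuousWithinAt
    rw [show (1 : ℕ∞ω) = 0 + 1 by rw [zero_add],
      contDiffOn_succ_iff_deriv_of_isOpen isOpen_Ioo]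
    refine ⟨fun t ht ↦ (hΓd t ht).differentiableAt.differentiableWithinAt, by simp, ?_⟩
    rw [contDiffOn_zero]
    refine ContinuousOn.congr (f := fun t ↦ η + f (Γ t) • n) ?_ fun t ht ↦ (hΓd t ht).deriv
    refine continuousOn_const.add (ContinuousOn.smul ?_ continuousOn_const)
    exact hlip.continuousOn.comp hΓcont fun t ht ↦ (hΓN t ht).1
  · refine eventually_pos_of_form_pos (N := N) hdec han haη hN (hlip.mono inter_subset_left)
      (fun x hx ↦ hx.2) (fun x hx ↦ ?_) hε hΓ0 hΓd hΓN hbΓ hT hx hx0 h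
    simp only [f, neg_mul, neg_neg]
    rw [div_mul_cancel₀ _ (ne_of_gt hx.2)]
  · -- apply the positive case to `-β`, `-n` and `-a`
    have := eventually_pos_of_form_pos (N := N) (β := fun x ↦ -β x) (n := -n) (a := -a) (b := b)
      (f := fun x ↦ -f x) (η := η) (K := K) (Γ := Γ) (x₀ := x₀) (x := x)
      (fun x ↦ by simpa using hdec x) (by simp [han]) (by simp [haη]) hN
      (by
        refine LipschitzOnWith.of_dist_le_mul fun u hu v hv ↦ ?_
        rw [dist_neg_neg]
        exact hlip.dist_le_mul u hu.1 v hv.1)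
      (fun x hx ↦ by simpa using hx.2) (fun x hx ↦ ?_) hε hΓ0
      (fun t ht ↦ by simpa using hΓd t ht) hΓN hbΓ hT hx hx0
      (by filter_upwards [h] with t ht; simpa using ht)
    · filter_upwards [this] with t ht
      rw [neg_apply] at ht
      linarith
    · have h1 : β x η / β x n * β x n = β x η := div_mul_cancel₀ _ (ne_of_gt hx.2)
      simp only [f, neg_apply, map_neg]
      linarith

/-! ### The bundle homomorphism in local coordinates -/

section LocalCoordinates

variable {M : Type*} [TopologicalSpace M] [ChartedSpace Plane M] [IsManifold (𝓡 2) ∞ M]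
  {V : M → Type*} [TopologicalSpace (TotalSpace Plane V)]
  [∀ x, NormedAddCommGroup (V x)] [∀ x, InnerProductSpace ℝ (V x)]
  [FiberBundle Plane V] [VectorBundle ℝ Plane V]

/-- The fibre coordinate of `V` in the preferred trivialization at `p`. -/
noncomputable def fibreCoord (V : M → Type*) [TopologicalSpace (TotalSpace Plane V)]
    [∀ x, NormedAddCommGroup (V x)] [∀ x, InnerProductSpace ℝ (V x)]
    [FiberBundle Plane V] [VectorBundle ℝ Plane V] (p q : M) : V q →L[ℝ] Plane :=
  (trivializationAt Plane V p).continuousLinearMapAt ℝ q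

/-- The coordinates of a tangent vector in the preferred chart at `p`. -/
noncomputable def chartDeriv (p q : M) : TangentSpace (𝓡 2) q →L[ℝ] Plane :=
  mfderiv (𝓡 2) 𝓘(ℝ, Plane) (extChartAt (𝓡 2) p) q

theorem fibreCoord_injective {p q : M} (hq : q ∈ (trivializationAt Plane V p).baseSet) :
    Function.Injective (fibreCoord V p q) :=
  Function.LeftInverse.injective (g := (trivializationAt Plane V p).symmL ℝ q) fun y ↦
    (trivializationAt Plane V p).symmL_continuousLinearMapAt hq y

theorem fibreCoord_bijective {p q : M} (hq : q ∈ (trivializationAt Plane V p).baseSet) :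
    Function.Bijective (fibreCoord V p q) :=
  ⟨fibreCoord_injective hq,
    Function.RightInverse.surjective (g := (trivializationAt Plane V p).symmL ℝ q) fun y ↦
      (trivializationAt Plane V p).continuousLinearMapAt_symmL hq y⟩

theorem chartDeriv_bijective {p q : M} (hq : q ∈ (chartAt Plane p).source) :
    Function.Bijective (chartDeriv p q) := by
  obtain ⟨A, hA⟩ := isInvertible_mfderiv_extChartAt (I := 𝓡 2) (x := p) (y := q)
    (by rwa [extChartAt_source])
  have : (chartDeriv p q : TangentSpace (𝓡 2) q → Plane) = A := by
    unfold chartDeriv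
    rw [← hA]
    rfl
  rw [this]
  exact A.bijective

variable (C : CoherentTangentBundle V)

/-- The matrix of `ψ` in the preferred coordinates at `p`. -/
noncomputable def localMap (p q : M) : Plane →L[ℝ] Plane :=
  ContinuousLinearMap.inCoordinates Plane (TangentSpace (𝓡 2) : M → Type _) Plane V p q p q (C.ψ q)

theorem localMap_chartDeriv {p q : M} (hq : q ∈ (chartAt Plane p).source)
    (v : TangentSpace (𝓡 2) q) :
    localMap C p q (chartDeriv p q v) = fibreCoord V p q (C.ψ q v) := by
  have h1 : chartDeriv p q =
      (trivializationAt Plane (TangentSpace (𝓡 2)) p).continuousLinearMapAt ℝ q :=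
    (TangentBundle.continuousLinearMapAt_trivializationAt hq).symm
  have h2 : (trivializationAt Plane (TangentSpace (𝓡 2)) p).symmL ℝ q (chartDeriv p q v) = v := by
    rw [h1]
    exact (trivializationAt Plane (TangentSpace (𝓡 2)) p).symmL_continuousLinearMapAt
      (by simpa using hq) v
  change fibreCoord V p q (C.ψ q
    ((trivializationAt Plane (TangentSpace (𝓡 2)) p).symmL ℝ q (chartDeriv p q v))) = _
  rw [h2]

theorem contMDiffAt_localMap (p : M) :
    ContMDiffAt (𝓡 2) 𝓘(ℝ, Plane →L[ℝ] Plane) ∞ (localMap C p) p :=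
  ((contMDiffAt_hom_bundle _).mp (C.smooth_ψ p)).2

/-- The matrix of `ψ` as a function of the coordinates in the preferred chart at `p`. -/
theorem contDiffAt_localMap_symm (p : M) :
    ContDiffAt ℝ 1 (fun y ↦ localMap C p ((extChartAt (𝓡 2) p).symm y)) (extChartAt (𝓡 2) p p) := by
  rw [← contMDiffAt_iff_contDiffAt]
  have h1 : ContMDiffAt 𝓘(ℝ, Plane) (𝓡 2) ∞ (extChartAt (𝓡 2) p).symm (extChartAt (𝓡 2) p p) :=
    (contMDiffOn_extChartAt_symm p).contMDiffAt (extChartAt_target_mem_nhds p)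
  have h2 := (contMDiffAt_localMap C p).comp_of_eq h1 (extChartAt_to_inv p)
  exact h2.of_le (by exact_mod_cast le_top)

/-- At a singular point `ψ` has a non-trivial kernel. -/
theorem exists_ne_zero_map_eq_zero {q : M} (hq : q ∈ singularSet C) :
    ∃ v : TangentSpace (𝓡 2) q, v ≠ 0 ∧ C.ψ q v = 0 := by
  by_contra hcon
  push Not at hcon
  apply hq
  have hinj : Function.Injective (C.ψ q) := by
    rw [injective_iff_map_eq_zero]
    intro v hv
    by_contra hne
    exact hcon v hne hv
  have hb := fibreCoord_bijective (V := V) (FiberBundle.mem_baseSet_trivializationAt' (F := Plane) (E := V) q)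
  let f : Plane →ₗ[ℝ] Plane := ((fibreCoord V q q).comp (C.ψ q)).toLinearMap
  have hfi : Function.Injective f := hb.1.comp hinj
  have hfs : Function.Surjective f := LinearMap.injective_iff_surjective.mp hfi
  refine ⟨hinj, fun w ↦ ?_⟩
  obtain ⟨v, hv⟩ := hfs (fibreCoord V q q w)
  exact ⟨v, hb.1 hv⟩

theorem Plane.exists_dual_basis {n η : Plane} (h : LinearIndependent ℝ ![n, η]) :
    ∃ a b : Plane →L[ℝ] ℝ, (∀ x, x = a x • n + b x • η) ∧ a n = 1 ∧ a η = 0 ∧ b n = 0 ∧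
      b η = 1 := by
  let B := basisOfLinearIndependentOfCardEqFinrank h (by simp)
  have h0 : B 0 = n := by simp [B]
  have h1 : B 1 = η := by simp [B]
  refine ⟨LinearMap.toContinuousLinearMap (B.coord 0), LinearMap.toContinuousLinearMap (B.coord 1),
    fun x ↦ ?_, ?_, ?_, ?_, ?_⟩
  · have := B.sum_repr x
    rw [Fin.sum_univ_two, h0, h1] at this
    exact this.symm
  all_goals simp only [LinearMap.coe_toContinuousLinearMap', Module.Basis.coord_apply]
  · rw [← h0]; simp
  · rw [← h1]; simp
  · rw [← h0]; simp
  · rw [← h1]; simp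

/-- Two vectors, one in the kernel of a linear map and one not, form a basis of the plane. -/
theorem linearIndependent_of_map_eq_zero {W W' : Type*} [AddCommGroup W] [Module ℝ W]
    [AddCommGroup W'] [Module ℝ W'] (A : W →ₗ[ℝ] W') {n η : W} (hn : A n ≠ 0) (hη : A η = 0)
    (hη0 : η ≠ 0) : LinearIndependent ℝ ![n, η] := by
  rw [LinearIndependent.pair_iff]
  intro s t hst
  have h1 := congrArg A hst
  rw [map_add, map_smul, map_smul, hη, smul_zero, add_zero, map_zero] at h1
  have hs : s = 0 := (smul_eq_zero.mp h1).resolve_right hn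
  rw [hs, zero_smul, zero_add] at hst
  exact ⟨hs, (smul_eq_zero.mp hst).resolve_right hη0⟩

end LocalCoordinates

section Normalize

variable {M : Type*} [TopologicalSpace M] [ChartedSpace Plane M]
  {V : M → Type*} [TopologicalSpace (TotalSpace Plane V)]
  [∀ x, NormedAddCommGroup (V x)] [∀ x, InnerProductSpace ℝ (V x)]
  [FiberBundle Plane V] [VectorBundle ℝ Plane V]

theorem fibreCoord_apply {p q : M} (hq : q ∈ (trivializationAt Plane V p).baseSet) (v : V q) :
    fibreCoord V p q v = ((trivializationAt Plane V p) ⟨q, v⟩).2 := by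
  change (trivializationAt Plane V p).linearMapAt ℝ q v = _
  rw [(trivializationAt Plane V p).coe_linearMapAt_of_mem hq]

/-- Convergence in the total space, in terms of the fibre coordinate at the limit point. -/
theorem tendsto_totalSpace_iff {X : Type*} {l : Filter X} {p : M} {b : X → M} (Z : ∀ x, V (b x))
    (Y : V p) (hb : Tendsto b l (𝓝 p)) :
    Tendsto (fun x ↦ (⟨b x, Z x⟩ : TotalSpace Plane V)) l (𝓝 ⟨p, Y⟩) ↔
      Tendsto (fun x ↦ fibreCoord V p (b x) (Z x)) l (𝓝 (fibreCoord V p p Y)) := by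
  have hp : p ∈ (trivializationAt Plane V p).baseSet := FiberBundle.mem_baseSet_trivializationAt' p
  have hz : (⟨p, Y⟩ : TotalSpace Plane V) ∈ (trivializationAt Plane V p).source := by
    rw [Trivialization.mem_source]; exact hp
  rw [(trivializationAt Plane V p).tendsto_nhds_iff hz]
  have hev : ∀ᶠ x in l, b x ∈ (trivializationAt Plane V p).baseSet :=
    hb.eventually ((trivializationAt Plane V p).open_baseSet.mem_nhds hp)
  have hcongr : (fun x ↦ ((trivializationAt Plane V p) ⟨b x, Z x⟩).2) =ᶠ[l]
      fun x ↦ fibreCoord V p (b x) (Z x) := by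
    filter_upwards [hev] with x hx
    exact (fibreCoord_apply hx _).symm
  rw [fibreCoord_apply hp]
  constructor
  · rintro ⟨-, h⟩
    exact h.congr' hcongr
  · intro h
    exact ⟨hb, h.congr' hcongr.symm⟩

variable [IsContMDiffRiemannianBundle (𝓡 2) ∞ Plane V]

/-- The fibre norm is a continuous function on the total space. -/
theorem continuous_norm_totalSpace : Continuous (fun z : TotalSpace Plane V ↦ ‖z.2‖) := by
  have : IsContinuousRiemannianBundle Plane V := by
    obtain ⟨g, hg, hg'⟩ :=
      IsContMDiffRiemannianBundle.exists_contMDiff (IB := 𝓡 2) (n := ∞) (F := Plane) (E := V)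
    exact ⟨g, hg.continuous, hg'⟩
  have h1 : Continuous (fun z : TotalSpace Plane V ↦ (inner ℝ z.2 z.2 : ℝ)) :=
    Continuous.inner_bundle (b := fun z : TotalSpace Plane V ↦ z.1) (v := fun z ↦ z.2)
      (w := fun z ↦ z.2) continuous_id continuous_id
  have h2 : (fun z : TotalSpace Plane V ↦ ‖z.2‖) = fun z ↦ Real.sqrt (inner ℝ z.2 z.2) := by
    funext z
    rw [real_inner_self_eq_norm_sq, Real.sqrt_sq (norm_nonneg _)]
  rw [h2]
  exact h1.sqrt

/-- Normalisation of vectors is continuous on the total space. -/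
theorem tendsto_normalize {X : Type*} {l : Filter X} {p : M} {b : X → M} (Z : ∀ x, V (b x))
    (Y : V p) (hY : Y ≠ 0) (hb : Tendsto b l (𝓝 p))
    (h : Tendsto (fun x ↦ fibreCoord V p (b x) (Z x)) l (𝓝 (fibreCoord V p p Y))) :
    Tendsto (fun x ↦ (⟨b x, ‖Z x‖⁻¹ • Z x⟩ : TotalSpace Plane V)) l (𝓝 ⟨p, ‖Y‖⁻¹ • Y⟩) := by
  rw [tendsto_totalSpace_iff (fun x ↦ ‖Z x‖⁻¹ • Z x) _ hb]
  simp only [map_smul]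
  refine Tendsto.smul (Tendsto.inv₀ ?_ (norm_ne_zero_iff.mpr hY)) h
  exact (continuous_norm_totalSpace.tendsto _).comp ((tendsto_totalSpace_iff Z Y hb).mpr h)

end Normalize

/-! ### The two sides of the null curve -/

section Curves

variable {M : Type*} [TopologicalSpace M] [ChartedSpace Plane M] [IsManifold (𝓡 2) ∞ M]

theorem mdifferentiableAt_extChartAt_plane {p q : M} (hq : q ∈ (chartAt Plane p).source) :
    MDifferentiableAt (𝓡 2) 𝓘(ℝ, Plane) (extChartAt (𝓡 2) p) q :=
  mdifferentiableAt_extChartAt hq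

theorem nhdsGT_le_nhdsWithin_Icc {T : ℝ} (hT : 0 < T) : 𝓝[>] (0 : ℝ) ≤ 𝓝[Icc 0 T] 0 := by
  rw [← nhdsWithin_Ioo_eq_nhdsGT hT]
  exact nhdsWithin_mono _ Ioo_subset_Icc_self

theorem IsRegularCurve.tendsto_start {γ : ℝ → M} {p : M} (hγ : IsRegularCurve γ (Icc 0 1))
    (h0 : γ 0 = p) : Tendsto γ (𝓝[>] 0) (𝓝 p) := by
  have := (hγ.continuousOn 0 (left_mem_Icc.mpr zero_le_one)).tendsto.mono_left
    (nhdsGT_le_nhdsWithin_Icc one_pos)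
  rwa [h0] at this

/-- An initial piece of a regular curve, in the preferred coordinates at its starting point. -/
theorem IsRegularCurve.exists_chart_piece {γ : ℝ → M} {p : M} (hγ : IsRegularCurve γ (Icc 0 1))
    (h0 : γ 0 = p) {O : Set M} (hO : O ∈ 𝓝 p) :
    ∃ T ∈ Ioc (0 : ℝ) 1, (∀ t ∈ Icc 0 T, γ t ∈ (chartAt Plane p).source ∧ γ t ∈ O) ∧
      ContDiffOn ℝ 1 (fun t ↦ extChartAt (𝓡 2) p (γ t)) (Icc 0 T) ∧
      ∀ t ∈ Icc 0 T, HasDerivWithinAt (fun t ↦ extChartAt (𝓡 2) p (γ t))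
        (chartDeriv p (γ t) (velocity γ (Icc 0 1) t)) (Icc 0 T) t := by
  have hsrc : γ ⁻¹' ((chartAt Plane p).source ∩ O) ∈ 𝓝[Icc 0 1] (0 : ℝ) := by
    refine (hγ.continuousOn 0 (left_mem_Icc.mpr zero_le_one)).preimage_mem_nhdsWithin ?_
    rw [h0]
    exact inter_mem (chart_source_mem_nhds _ p) hO
  obtain ⟨ε, hε, hball⟩ := Metric.mem_nhdsWithin_iff.mp hsrc
  have hT : min 1 (ε / 2) ∈ Ioc (0 : ℝ) 1 := ⟨lt_min one_pos (half_pos hε), min_le_left _ _⟩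
  have hsub : Icc 0 (min 1 (ε / 2)) ⊆ Icc (0 : ℝ) 1 := Icc_subset_Icc_right hT.2
  have hmem : ∀ t ∈ Icc 0 (min 1 (ε / 2)), γ t ∈ (chartAt Plane p).source ∧ γ t ∈ O :=
    fun t ht ↦ by
    refine hball ⟨?_, hsub ht⟩
    rw [Metric.mem_ball, Real.dist_eq, sub_zero, abs_of_nonneg ht.1]
    linarith [ht.2.trans (min_le_right _ _)]
  refine ⟨_, hT, hmem, ?_, fun t ht ↦ ?_⟩
  · rw [← contMDiffOn_iff_contDiffOn]
    exact (contMDiffOn_extChartAt (I := 𝓡 2) (n := 1) (x := p)).comp (hγ.1.mono hsub)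
      fun t ht ↦ (hmem t ht).1
  · exact (hasDerivWithinAt_comp_velocity (mdifferentiableAt_extChartAt_plane (hmem t ht).1)
      (hγ.mdifferentiableWithinAt (hsub ht))).mono hsub

/-- Half of a plane curve that is a graph over an axis, as a curve in `M`. -/
theorem isRegularCurve_half {p : M} {Γ : ℝ → Plane} {ε ε' c : ℝ} {η : Plane} {b : Plane →L[ℝ] ℝ}
    (hΓ0 : Γ 0 = extChartAt (𝓡 2) p p) (hΓC : ContDiffOn ℝ 1 Γ (Ioo (-ε) ε))
    (hΓη : HasDerivAt Γ η 0) (hb : ∀ t ∈ Ioo (-ε) ε, b (Γ t - extChartAt (𝓡 2) p p) = t)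
    (hε' : ε' < ε) (htar : ∀ t ∈ Icc (-ε') ε', Γ t ∈ (extChartAt (𝓡 2) p).target)
    (hc : |c| ≤ ε') (hc0 : c ≠ 0) :
    IsRegularCurve (fun t ↦ (extChartAt (𝓡 2) p).symm (Γ (c * t))) (Icc 0 1) ∧
      chartDeriv p p (initialVelocity p fun t ↦ (extChartAt (𝓡 2) p).symm (Γ (c * t))) = c • η := by
  have hmaps : ∀ t ∈ Icc (0 : ℝ) 1, c * t ∈ Icc (-ε') ε' := fun t ht ↦ by
    rw [mem_Icc, ← abs_le, abs_mul, abs_of_nonneg ht.1]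
    exact (mul_le_of_le_one_right (abs_nonneg c) ht.2).trans hc
  have hmaps' : ∀ t ∈ Icc (0 : ℝ) 1, c * t ∈ Ioo (-ε) ε := fun t ht ↦
    ⟨by linarith [(hmaps t ht).1], (hmaps t ht).2.trans_lt hε'⟩
  let γ : ℝ → M := fun t ↦ (extChartAt (𝓡 2) p).symm (Γ (c * t))
  have hlin : ∀ t, HasDerivAt (fun t : ℝ ↦ c * t) c t := fun t ↦ by
    simpa using (hasDerivAt_id t).const_mul c
  have hC1 : ContDiffOn ℝ 1 (fun t ↦ Γ (c * t)) (Icc 0 1) :=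
    hΓC.comp (contDiff_const.mul contDiff_id).contDiffOn hmaps'
  have hγ : ContMDiffOn 𝓘(ℝ, ℝ) (𝓡 2) 1 γ (Icc 0 1) :=
    (contMDiffOn_extChartAt_symm (I := 𝓡 2) (n := 1) p).comp hC1.contMDiffOn
      fun t ht ↦ htar _ (hmaps t ht)
  have hx : ∀ t ∈ Icc (0 : ℝ) 1, extChartAt (𝓡 2) p (γ t) = Γ (c * t) := fun t ht ↦
    (extChartAt (𝓡 2) p).right_inv (htar _ (hmaps t ht))
  have hsrc : ∀ t ∈ Icc (0 : ℝ) 1, γ t ∈ (chartAt Plane p).source := fun t ht ↦ by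
    rw [← extChartAt_source (𝓡 2)]
    exact (extChartAt (𝓡 2) p).map_target (htar _ (hmaps t ht))
  have hder : ∀ t ∈ Icc (0 : ℝ) 1, HasDerivWithinAt (fun t ↦ Γ (c * t))
      (chartDeriv p (γ t) (velocity γ (Icc 0 1) t)) (Icc 0 1) t := fun t ht ↦
    (hasDerivWithinAt_comp_velocity (mdifferentiableAt_extChartAt_plane (hsrc t ht))
      ((hγ t ht).mdifferentiableWithinAt one_ne_zero)).congr (fun u hu ↦ (hx u hu).symm)
      (hx t ht).symm
  refine ⟨⟨hγ, fun t ht h0 ↦ ?_⟩, ?_⟩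
  · -- the velocity has component `c ≠ 0` along the axis
    have h1 := hder t ht
    rw [h0, map_zero] at h1
    have h2 := b.hasFDerivAt.comp_hasDerivWithinAt t (h1.sub_const (extChartAt (𝓡 2) p p))
    rw [map_zero] at h2
    have h3 : HasDerivWithinAt (fun t ↦ c * t) (0 : ℝ) (Icc 0 1) t :=
      h2.congr (fun u hu ↦ (hb _ (hmaps' u hu)).symm) (hb _ (hmaps' t ht)).symm
    exact hc0 ((uniqueDiffOn_Icc zero_lt_one t ht).eq_deriv _ (hlin t).hasDerivWithinAt h3)
  · have h0 : (0 : ℝ) ∈ Icc (0 : ℝ) 1 := left_mem_Icc.mpr zero_le_one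
    have hγ0 : γ 0 = p := by
      simp only [γ, mul_zero, hΓ0, extChartAt_to_inv]
    have h1 := hder 0 h0
    have h2 : HasDerivWithinAt (fun t ↦ Γ (c * t)) (c • η) (Icc 0 1) 0 := by
      have h3 : HasDerivAt Γ η (c * 0) := by rwa [mul_zero]
      exact (h3.scomp 0 (hlin 0)).hasDerivWithinAt
    have h3 := (uniqueDiffOn_Icc zero_lt_one 0 h0).eq_deriv _ h1 h2
    have h4 : ∀ q : M, q = p → chartDeriv p q (velocity γ (Icc 0 1) 0 : Plane) =
        chartDeriv p p (velocity γ (Icc 0 1) 0 : Plane) := by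
      rintro q rfl; rfl
    rw [← h3]
    exact (h4 _ hγ0).symm

end Curves

section Side

variable {M : Type*} [TopologicalSpace M] [ChartedSpace Plane M] [IsManifold (𝓡 2) ∞ M]
  {V : M → Type*} [TopologicalSpace (TotalSpace Plane V)]
  [∀ x, NormedAddCommGroup (V x)] [∀ x, InnerProductSpace ℝ (V x)]
  [FiberBundle Plane V] [VectorBundle ℝ Plane V]
  (C : CoherentTangentBundle V)

/-- The curve `γ` starts transversally to the null direction, or it starts as a curve of singular
points whose velocities are not null vectors. -/
def IsAdmissible (p : M) (γ : ℝ → M) : Prop :=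
  IsRegularCurve γ (Icc 0 1) ∧ γ 0 = p ∧
    (C.ψ p (initialVelocity p γ) ≠ 0 ∨
      ∀ᶠ t in 𝓝[>] (0 : ℝ), γ t ∈ singularSet C ∧ C.ψ (γ t) (velocity γ (Icc 0 1) t) ≠ 0)

/-- Near `p`, the zero set of the continuous function `W` is a `C¹`-curve through `p` with null
velocity at `p`, made of two halves `Γ₁`, `Γ₂`.  The unit vector `e` spans the image of `ψ_p`.
An admissible curve stays, near `p`, on one side of the null curve; its initial vector is `e` on the
side `W > 0` and `-e` on the side `W < 0`. -/
structure IsNullCurve (p : M) (W : M → ℝ) (N : Set M) (Γ₁ Γ₂ : ℝ → M) (e : V p) : Prop where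
  isOpen : IsOpen N
  mem : p ∈ N
  continuousOn : ContinuousOn W N
  zero_iff : ∀ q ∈ N, W q = 0 ↔ q ∈ Γ₁ '' Icc 0 1 ∪ Γ₂ '' Icc 0 1
  regular₁ : IsRegularCurve Γ₁ (Icc 0 1)
  regular₂ : IsRegularCurve Γ₂ (Icc 0 1)
  start₁ : Γ₁ 0 = p
  start₂ : Γ₂ 0 = p
  ne₁ : ∀ t ∈ Ioc (0 : ℝ) 1, Γ₁ t ≠ p
  ne₂ : ∀ t ∈ Ioc (0 : ℝ) 1, Γ₂ t ≠ p
  opposite : initialVelocity p Γ₂ = -initialVelocity p Γ₁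
  ker_iff : ∀ v : TangentSpace (𝓡 2) p, C.ψ p v = 0 ↔ ∃ k : ℝ, v = k • initialVelocity p Γ₁
  norm_eq_one : ‖e‖ = 1
  side : ∀ γ, IsAdmissible C p γ → ∃ s : ℝ, (s = 1 ∨ s = -1) ∧
    (∀ᶠ t in 𝓝[>] (0 : ℝ), 0 < s * W (γ t)) ∧
    (∀ Ψ : V p, IsInitialVector C p γ Ψ ↔ Ψ = s • e) ∧
    (C.ψ p (initialVelocity p γ) ≠ 0 → 0 < s * inner ℝ (C.ψ p (initialVelocity p γ)) e)

theorem normalize_smul {E : Type*} [NormedAddCommGroup E] [NormedSpace ℝ E] {c s : ℝ}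
    (hs : s = 1 ∨ s = -1) (hsc : 0 < s * c) (v : E) :
    ‖c • v‖⁻¹ • c • v = s • ‖v‖⁻¹ • v := by
  have hc : |c| = s * c := by
    rcases hs with rfl | rfl
    · rw [one_mul] at hsc ⊢; exact abs_of_pos hsc
    · rw [neg_one_mul] at hsc ⊢; exact abs_of_neg (neg_pos.mp hsc)
  have hc0 : c ≠ 0 := fun h ↦ by rw [h, mul_zero] at hsc; exact lt_irrefl _ hsc
  have hss : s * s = 1 := by rcases hs with rfl | rfl <;> norm_num
  have hs0 : s ≠ 0 := fun h ↦ by rw [h, mul_zero] at hss; exact zero_ne_one hss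
  rw [norm_smul, Real.norm_eq_abs, hc, smul_smul, smul_smul]
  congr 1
  rw [mul_inv, mul_inv]
  field_simp
  rw [sq, hss]

variable {C} in
/-- A limit vector that is attained is the only initial vector. -/
theorem isInitialVector_iff_of_tendsto {p : M} {γ : ℝ → M} (hγ : Tendsto γ (𝓝[>] 0) (𝓝 p))
    {Y : V p} (hY : IsInitialVector C p γ Y) (Ψ : V p) : IsInitialVector C p γ Ψ ↔ Ψ = Y := by
  constructor
  · intro h
    have h1 := (tendsto_totalSpace_iff (fun t ↦ ‖C.ψ (γ t) (velocity γ (Icc 0 1) t)‖⁻¹ •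
      C.ψ (γ t) (velocity γ (Icc 0 1) t)) _ hγ).mp h
    have h2 := (tendsto_totalSpace_iff (fun t ↦ ‖C.ψ (γ t) (velocity γ (Icc 0 1) t)‖⁻¹ •
      C.ψ (γ t) (velocity γ (Icc 0 1) t)) _ hγ).mp hY
    exact fibreCoord_injective (FiberBundle.mem_baseSet_trivializationAt' p)
      (tendsto_nhds_unique h1 h2)
  · rintro rfl
    exact hY

/-- A continuous nowhere vanishing function on an interval has a constant sign. -/
theorem exists_sign_of_ne_zero {h : ℝ → ℝ} {τ : ℝ} (hτ : 0 < τ) (hc : ContinuousOn h (Ioo 0 τ))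
    (hne : ∀ t ∈ Ioo 0 τ, h t ≠ 0) :
    ∃ s : ℝ, (s = 1 ∨ s = -1) ∧ ∀ t ∈ Ioo 0 τ, 0 < s * h t := by
  have hm : τ / 2 ∈ Ioo 0 τ := ⟨by linarith, by linarith⟩
  rcases lt_or_gt_of_ne (hne _ hm) with hlt | hgt
  · refine ⟨-1, Or.inr rfl, fun t ht ↦ ?_⟩
    have := lt_on_of_ne isPreconnected_Ioo hc continuousOn_const hne hm hlt t ht
    linarith
  · refine ⟨1, Or.inl rfl, fun t ht ↦ ?_⟩
    have := lt_on_of_ne isPreconnected_Ioo continuousOn_const hc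
      (fun x hx ↦ (hne x hx).symm) hm hgt t ht
    linarith

variable {C} in
/-- The sign of the one-form `v ↦ ⟨A_p n, A v⟩` along an admissible curve determines the initial
vector of the curve. -/
theorem exists_sign_of_isAdmissible [IsContMDiffRiemannianBundle (𝓡 2) ∞ Plane V]
    {p : M} {n₀ η₀ : TangentSpace (𝓡 2) p} (hn₀ : C.ψ p n₀ ≠ 0) (hη₀ : C.ψ p η₀ = 0)
    (hη0 : η₀ ≠ 0) {γ : ℝ → M} (hγ : IsAdmissible C p γ) :
    ∃ s : ℝ, (s = 1 ∨ s = -1) ∧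
      (∀ᶠ t in 𝓝[>] (0 : ℝ), 0 < s * inner ℝ (fibreCoord V p p (C.ψ p n₀))
        (localMap C p (γ t) (chartDeriv p (γ t) (velocity γ (Icc 0 1) t)))) ∧
      IsInitialVector C p γ (s • ‖C.ψ p n₀‖⁻¹ • C.ψ p n₀) ∧
      (C.ψ p (initialVelocity p γ) ≠ 0 → 0 < s * inner ℝ (C.ψ p (initialVelocity p γ))
        (‖C.ψ p n₀‖⁻¹ • C.ψ p n₀)) := by
  obtain ⟨hreg, h0, hadm⟩ := hγ
  have hpV : p ∈ (trivializationAt Plane V p).baseSet := FiberBundle.mem_baseSet_trivializationAt' p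
  have hpM : p ∈ (chartAt Plane p).source := mem_chart_source _ p
  have hnhds : (trivializationAt Plane V p).baseSet ∈ 𝓝 p :=
    (trivializationAt Plane V p).open_baseSet.mem_nhds hpV
  -- near `p` the matrix of `ψ` is continuous
  have hcont : ∀ᶠ q in 𝓝 p, ContinuousAt (localMap C p) q := by
    have h1 := (contMDiffAt_localMap C p).of_le
      (show (1 : WithTop ℕ∞) ≤ ∞ by exact_mod_cast le_top)
    filter_upwards [(contMDiffAt_iff_contMDiffAt_nhds (by simp)).mp h1] with q hq
      using hq.continuousAt
  obtain ⟨T, hT, hmem, hxC, hxd⟩ := hreg.exists_chart_piece h0 (inter_mem hnhds hcont)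
  have h0T : (0 : ℝ) ∈ Icc 0 T := left_mem_Icc.mpr hT.1.le
  have hud : UniqueDiffOn ℝ (Icc 0 T) := uniqueDiffOn_Icc hT.1
  let x' : ℝ → Plane := fun t ↦ chartDeriv p (γ t) (velocity γ (Icc 0 1) t)
  have hx'c : ContinuousOn x' (Icc 0 T) :=
    (hxC.continuousOn_derivWithin hud le_rfl).congr fun t ht ↦ ((hxd t ht).derivWithin (hud t ht)).symm
  have hx'0 : x' 0 = chartDeriv p p (initialVelocity p γ) := by
    have h4 : ∀ q : M, q = p → chartDeriv p q (velocity γ (Icc 0 1) 0 : Plane) =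
        chartDeriv p p (velocity γ (Icc 0 1) 0 : Plane) := by
      rintro q rfl; rfl
    exact h4 _ h0
  have hγc : ContinuousOn γ (Icc 0 T) := hreg.continuousOn.mono (Icc_subset_Icc_right hT.2)
  have hAc : ContinuousOn (fun t ↦ localMap C p (γ t)) (Icc 0 T) := fun t ht ↦
    ContinuousAt.comp_continuousWithinAt (f := γ) (g := localMap C p) (hmem t ht).2.2 (hγc t ht)
  have hAx'c : ContinuousOn (fun t ↦ localMap C p (γ t) (x' t)) (Icc 0 T) := hAc.clm_apply hx'c
  set Y := C.ψ p n₀ with hYdef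
  set ℓ := fibreCoord V p p Y with hℓdef
  have hℓ0 : ℓ ≠ 0 := fun h ↦ hn₀ (fibreCoord_injective hpV (h.trans (map_zero _).symm))
  have hℓpos : 0 < inner ℝ ℓ ℓ := by rw [real_inner_self_eq_norm_sq]; positivity
  have hAn : localMap C p p (chartDeriv p p n₀) = ℓ := localMap_chartDeriv C hpM n₀
  let h : ℝ → ℝ := fun t ↦ inner ℝ ℓ (localMap C p (γ t) (x' t))
  have hhc : ContinuousOn h (Icc 0 T) := continuousOn_const.inner hAx'c
  have hψ : ∀ t ∈ Icc 0 T, fibreCoord V p (γ t) (C.ψ (γ t) (velocity γ (Icc 0 1) t)) =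
      localMap C p (γ t) (x' t) := fun t ht ↦ (localMap_chartDeriv C (hmem t ht).1 _).symm
  have hle := nhdsGT_le_nhdsWithin_Icc hT.1
  have hγp := hreg.tendsto_start h0
  have hIoo : ∀ᶠ t in 𝓝[>] (0 : ℝ), t ∈ Ioo 0 T := Ioo_mem_nhdsGT hT.1
  by_cases hv : C.ψ p (initialVelocity p γ) = 0
  · -- a curve of singular points
    have hsing := hadm.resolve_left (not_not.mpr hv)
    have hAnt : Tendsto (fun t ↦ localMap C p (γ t) (chartDeriv p p n₀)) (𝓝[>] 0) (𝓝 ℓ) := by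
      have h1 := ((hAc 0 h0T).clm_apply
        (continuousWithinAt_const (b := chartDeriv p p n₀))).tendsto.mono_left hle
      simp only [h0] at h1
      rwa [hAn] at h1
    have hpos : ∀ᶠ t in 𝓝[>] (0 : ℝ),
        0 < inner ℝ ℓ (localMap C p (γ t) (chartDeriv p p n₀)) :=
      (tendsto_const_nhds.inner hAnt).eventually (lt_mem_nhds hℓpos)
    let Nt : ∀ t, V (γ t) := fun t ↦ (trivializationAt Plane V p).symmL ℝ (γ t)
      (localMap C p (γ t) (chartDeriv p p n₀))
    have hNt : ∀ t ∈ Icc 0 T, fibreCoord V p (γ t) (Nt t) =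
        localMap C p (γ t) (chartDeriv p p n₀) := fun t ht ↦
      (trivializationAt Plane V p).continuousLinearMapAt_symmL (hmem t ht).2.1 _
    -- at singular points all values of `ψ` are multiples of its value in the direction `n₀`
    have hmult : ∀ t ∈ Ioo 0 T, γ t ∈ singularSet C →
        0 < inner ℝ ℓ (localMap C p (γ t) (chartDeriv p p n₀)) →
        ∃ c : ℝ, C.ψ (γ t) (velocity γ (Icc 0 1) t) = c • Nt t ∧
          h t = c * inner ℝ ℓ (localMap C p (γ t) (chartDeriv p p n₀)) := by
      intro t ht hS hp0
      have ht' := Ioo_subset_Icc_self ht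
      obtain ⟨k, hk0, hk⟩ := exists_ne_zero_map_eq_zero C hS
      have hk' : localMap C p (γ t) (chartDeriv p (γ t) k) = 0 := by
        rw [localMap_chartDeriv C (hmem t ht').1, hk, map_zero]
      have hk0' : chartDeriv p (γ t) k ≠ 0 := fun hz ↦
        hk0 ((chartDeriv_bijective (hmem t ht').1).1 (hz.trans (map_zero _).symm))
      have hne : localMap C p (γ t) (chartDeriv p p n₀) ≠ 0 := fun hz ↦ by
        rw [hz, inner_zero_right] at hp0; exact lt_irrefl _ hp0
      obtain ⟨a, b, hdec, -⟩ := Plane.exists_dual_basis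
        (linearIndependent_of_map_eq_zero (localMap C p (γ t)).toLinearMap hne hk' hk0')
      have hAx : localMap C p (γ t) (x' t) =
          a (x' t) • localMap C p (γ t) (chartDeriv p p n₀) := by
        conv_lhs => rw [hdec (x' t)]
        rw [map_add, map_smul, map_smul, hk', smul_zero, add_zero]
      refine ⟨a (x' t), fibreCoord_injective (hmem t ht').2.1 ?_, ?_⟩
      · rw [map_smul, hψ t ht', hNt t ht', hAx]
      · simp only [h, hAx, inner_smul_right]
    obtain ⟨τ, hτ, hall⟩ := mem_nhdsGT_iff_exists_Ioo_subset.mp ((hsing.and hpos).and hIoo)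
    have hhne : ∀ t ∈ Ioo 0 τ, h t ≠ 0 := fun t ht ↦ by
      obtain ⟨⟨⟨hS, hnz⟩, hp0⟩, hI⟩ := hall ht
      obtain ⟨c, hc, hh⟩ := hmult t hI hS hp0
      rw [hh]
      refine mul_ne_zero (fun hc0 ↦ hnz ?_) hp0.ne'
      rw [hc, hc0, zero_smul]
    obtain ⟨s, hs, hsh⟩ := exists_sign_of_ne_zero hτ
      (hhc.mono fun t ht ↦ Ioo_subset_Icc_self (hall ht).2) hhne
    refine ⟨s, hs, ?_, ?_, fun hne ↦ absurd hv hne⟩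
    · filter_upwards [Ioo_mem_nhdsGT hτ] with t ht using hsh t ht
    · have h1 : Tendsto (fun t ↦ fibreCoord V p (γ t) (s • Nt t)) (𝓝[>] 0)
          (𝓝 (fibreCoord V p p (s • Y))) := by
        simp only [map_smul]
        refine Tendsto.const_smul (hAnt.congr' ?_) s
        filter_upwards [hIoo] with t ht using (hNt t (Ioo_subset_Icc_self ht)).symm
      have hs0 : s ≠ 0 := by rcases hs with rfl | rfl <;> norm_num
      have hss : 0 < s * s := mul_self_pos.mpr hs0
      have h2 := tendsto_normalize (fun t ↦ s • Nt t) (s • Y) (smul_ne_zero hs0 hn₀) hγp h1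
      rw [normalize_smul hs hss] at h2
      refine h2.congr' ?_
      filter_upwards [Ioo_mem_nhdsGT hτ] with t ht
      obtain ⟨⟨⟨hS, hnz⟩, hp0⟩, hI⟩ := hall ht
      obtain ⟨c, hc, hh⟩ := hmult t hI hS hp0
      have hsc : 0 < s * c := by
        have := hsh t ht
        rw [hh, ← mul_assoc] at this
        exact pos_of_mul_pos_left this hp0.le
      rw [hc, normalize_smul hs hsc, normalize_smul hs hss]
  · -- a curve transversal to the null direction
    have hdec : ∃ c : ℝ, C.ψ p (initialVelocity p γ) = c • Y := by
      obtain ⟨a, b, hd, -⟩ := Plane.exists_dual_basis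
        (linearIndependent_of_map_eq_zero (W := Plane) (W' := V p) (C.ψ p).toLinearMap hn₀ hη₀ hη0)
      refine ⟨a (initialVelocity p γ), ?_⟩
      have h1 : initialVelocity p γ = a (initialVelocity p γ) • n₀ + b (initialVelocity p γ) • η₀ :=
        hd (initialVelocity p γ)
      have h2 := congrArg (C.ψ p) h1
      rw [h2, map_add, map_smul, map_smul, hη₀, smul_zero, add_zero]
    obtain ⟨c, hc⟩ := hdec
    have hc0 : c ≠ 0 := fun h ↦ hv (by rw [hc, h, zero_smul])
    have hAx0 : localMap C p (γ 0) (x' 0) = c • ℓ := by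
      rw [hx'0, h0, localMap_chartDeriv C hpM, hc, map_smul]
    obtain ⟨s, hs, hsc⟩ : ∃ s : ℝ, (s = 1 ∨ s = -1) ∧ 0 < s * c := by
      rcases lt_or_gt_of_ne hc0 with hlt | hgt
      · exact ⟨-1, Or.inr rfl, by linarith⟩
      · exact ⟨1, Or.inl rfl, by linarith⟩
    refine ⟨s, hs, ?_, ?_, fun _ ↦ ?_⟩
    · have h1 : Tendsto (fun t ↦ s * h t) (𝓝[>] 0) (𝓝 (s * h 0)) :=
        ((hhc 0 h0T).tendsto.mono_left hle).const_mul s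
      refine h1.eventually (lt_mem_nhds ?_)
      simp only [h, hAx0, inner_smul_right]
      rw [← mul_assoc]
      exact mul_pos hsc hℓpos
    · have h1 : Tendsto (fun t ↦ fibreCoord V p (γ t) (C.ψ (γ t) (velocity γ (Icc 0 1) t)))
          (𝓝[>] 0) (𝓝 (fibreCoord V p p (c • Y))) := by
        have h2 := (hAx'c 0 h0T).tendsto.mono_left hle
        simp only [hAx0] at h2
        rw [map_smul]
        refine h2.congr' ?_
        filter_upwards [hIoo] with t ht using (hψ t (Ioo_subset_Icc_self ht)).symm
      have h2 := tendsto_normalize (fun t ↦ C.ψ (γ t) (velocity γ (Icc 0 1) t)) (c • Y)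
        (smul_ne_zero hc0 hn₀) hγp h1
      rwa [normalize_smul hs hsc] at h2
    · rw [hc, inner_smul_left, inner_smul_right, real_inner_self_eq_norm_sq, ← mul_assoc]
      have : 0 < ‖Y‖ := norm_pos_iff.mpr hn₀
      exact mul_pos hsc (by positivity)

end Side

/-! ### Existence of the null curve -/

section NullCurve

variable {M : Type*} [TopologicalSpace M] [ChartedSpace Plane M] [IsManifold (𝓡 2) ∞ M]
  {V : M → Type*} [TopologicalSpace (TotalSpace Plane V)]
  [∀ x, NormedAddCommGroup (V x)] [∀ x, InnerProductSpace ℝ (V x)]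
  [FiberBundle Plane V] [VectorBundle ℝ Plane V]
  (C : CoherentTangentBundle V)

/-- At a singular point of rank one there is a null curve: an integral curve of the kernel of the
one-form `v ↦ ⟨A_p n, A v⟩`, where `A` is the matrix of `ψ` and `n` is not a null vector. -/
theorem exists_isNullCurve [IsContMDiffRiemannianBundle (𝓡 2) ∞ Plane V] {p : M}
    (hp : p ∈ singularSet C)
    (hrank : Module.finrank ℝ (LinearMap.range (C.ψ p).toLinearMap) = 1) :
    ∃ W N Γ₁ Γ₂ e, IsNullCurve C p W N Γ₁ Γ₂ e := by
  obtain ⟨η₀, hη0, hη⟩ := exists_ne_zero_map_eq_zero C hp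
  obtain ⟨n₀, hn₀⟩ : ∃ n₀, C.ψ p n₀ ≠ 0 := by
    by_contra hcon
    push Not at hcon
    have : LinearMap.range (C.ψ p).toLinearMap = ⊥ := by
      rw [LinearMap.range_eq_bot]
      ext v
      exact hcon v
    rw [this, finrank_bot] at hrank
    exact zero_ne_one hrank
  have hpM : p ∈ (chartAt Plane p).source := mem_chart_source _ p
  have hpV : p ∈ (trivializationAt Plane V p).baseSet := FiberBundle.mem_baseSet_trivializationAt' p
  set Y := C.ψ p n₀ with hY
  set ℓ := fibreCoord V p p Y with hℓ
  have hℓ0 : ℓ ≠ 0 := fun h ↦ hn₀ (fibreCoord_injective hpV (h.trans (map_zero _).symm))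
  have hinj := (chartDeriv_bijective hpM).1
  set x₀ : Plane := extChartAt (𝓡 2) p p with hx₀
  set n : Plane := chartDeriv p p n₀ with hn
  set η : Plane := chartDeriv p p η₀ with hηdef
  have hAn : localMap C p p n = ℓ := localMap_chartDeriv C hpM n₀
  have hAη : localMap C p p η = 0 := by
    rw [hηdef, localMap_chartDeriv C hpM, hη, map_zero]
  have hη1 : η ≠ 0 := fun h ↦ hη0 (hinj (h.trans (map_zero _).symm))
  obtain ⟨a, b, hdec, han, haη, hbn, hbη⟩ := Plane.exists_dual_basis
    (linearIndependent_of_map_eq_zero (localMap C p p).toLinearMap (n := n) (η := η)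
      (by change localMap C p p n ≠ 0; rwa [hAn]) hAη hη1)
  let β : Plane → Plane →L[ℝ] ℝ := fun y ↦
    (innerSL ℝ ℓ).comp (localMap C p ((extChartAt (𝓡 2) p).symm y))
  have hβ : ContDiffAt ℝ 1 β x₀ := contDiffAt_const.clm_comp (contDiffAt_localMap_symm C p)
  have hβv : ∀ q ∈ (chartAt Plane p).source, ∀ v, β (extChartAt (𝓡 2) p q) v =
      inner ℝ ℓ (localMap C p q v) := fun q hq v ↦ by
    change inner ℝ ℓ (localMap C p ((extChartAt (𝓡 2) p).symm (extChartAt (𝓡 2) p q)) v) = _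
    rw [(extChartAt (𝓡 2) p).left_inv (by rwa [extChartAt_source])]
  obtain ⟨Γ, ε, hε, hΓ0, hΓC, hΓη, hbΓ, hside⟩ := exists_null_curve (n := n) (η := η) hβ
    (by rw [hβv p hpM, hAn, real_inner_self_eq_norm_sq]; positivity)
    (by rw [hβv p hpM, hAη, inner_zero_right]) hdec han haη hbn hbη
  -- the piece of the curve that stays in the chart
  obtain ⟨ε', hε'0, hε'ε, htar⟩ : ∃ ε', 0 < ε' ∧ ε' < ε ∧
      ∀ t ∈ Icc (-ε') ε', Γ t ∈ (extChartAt (𝓡 2) p).target := by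
    have h1 : ∀ᶠ t in 𝓝 (0 : ℝ), Γ t ∈ (extChartAt (𝓡 2) p).target :=
      hΓη.continuousAt.eventually (by rw [hΓ0]; exact extChartAt_target_mem_nhds p)
    obtain ⟨ε₁, hε₁, h2⟩ := Metric.eventually_nhds_iff.mp h1
    refine ⟨min ε ε₁ / 2, by positivity, ?_, fun t ht ↦ h2 ?_⟩
    · linarith [min_le_left ε ε₁]
    · rw [Real.dist_eq, sub_zero]
      have := abs_le.mpr ht
      have := lt_min hε hε₁
      linarith [min_le_right ε ε₁]
  obtain ⟨hreg₁, hv₁⟩ := isRegularCurve_half hΓ0 hΓC hΓη hbΓ hε'ε htar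
    (abs_of_pos hε'0).le hε'0.ne'
  obtain ⟨hreg₂, hv₂⟩ := isRegularCurve_half hΓ0 hΓC hΓη hbΓ hε'ε htar
    (by rw [abs_neg, abs_of_pos hε'0]) (neg_ne_zero.mpr hε'0.ne')
  have hvel₁ : initialVelocity p (fun t ↦ (extChartAt (𝓡 2) p).symm (Γ (ε' * t))) = ε' • η₀ := by
    apply hinj
    rw [hv₁, map_smul]
  have hvel₂ : initialVelocity p (fun t ↦ (extChartAt (𝓡 2) p).symm (Γ (-ε' * t))) =
      -(ε' • η₀) := by
    apply hinj
    rw [hv₂, map_neg, map_smul, neg_smul]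
  have hIoo : ∀ c : ℝ, |c| ≤ ε' → ∀ t ∈ Icc (0 : ℝ) 1, c * t ∈ Icc (-ε') ε' := fun c hc t ht ↦ by
    rw [mem_Icc, ← abs_le, abs_mul, abs_of_nonneg ht.1]
    exact (mul_le_of_le_one_right (abs_nonneg c) ht.2).trans hc
  have hsub : Icc (-ε') ε' ⊆ Ioo (-ε) ε := fun t ht ↦ ⟨by linarith [ht.1], by linarith [ht.2]⟩
  have hxΓ : ∀ t ∈ Icc (-ε') ε', extChartAt (𝓡 2) p ((extChartAt (𝓡 2) p).symm (Γ t)) = Γ t :=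
    fun t ht ↦ (extChartAt (𝓡 2) p).right_inv (htar t ht)
  have hΓp : ∀ c : ℝ, |c| ≤ ε' → c ≠ 0 → ∀ t ∈ Ioc (0 : ℝ) 1,
      (extChartAt (𝓡 2) p).symm (Γ (c * t)) ≠ p := fun c hc hc0 t ht heq ↦ by
    have hct := hIoo c hc t (Ioc_subset_Icc_self ht)
    have h1 := hxΓ _ hct
    rw [heq] at h1
    have h2 := hbΓ _ (hsub hct)
    rw [← h1, ← hx₀, sub_self, map_zero] at h2
    exact mul_ne_zero hc0 ht.1.ne' h2.symm
  have hW0 : ∀ t ∈ Icc (-ε') ε', a (Γ t - Γ (b (Γ t - x₀))) = 0 := fun t ht ↦ by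
    rw [hbΓ t (hsub ht), sub_self, map_zero]
  refine ⟨fun q ↦ a (extChartAt (𝓡 2) p q - Γ (b (extChartAt (𝓡 2) p q - x₀))),
    (extChartAt (𝓡 2) p).source ∩
      extChartAt (𝓡 2) p ⁻¹' {y | b (y - x₀) ∈ Ioo (-ε') ε'},
    fun t ↦ (extChartAt (𝓡 2) p).symm (Γ (ε' * t)),
    fun t ↦ (extChartAt (𝓡 2) p).symm (Γ (-ε' * t)), ‖Y‖⁻¹ • Y, ?_⟩
  have hbc : Continuous fun y : Plane ↦ b (y - x₀) := b.continuous.comp (continuous_id.sub continuous_const)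
  constructor
  · exact (continuousOn_extChartAt p).isOpen_inter_preimage (isOpen_extChartAt_source p)
      (isOpen_Ioo.preimage hbc)
  · refine ⟨mem_extChartAt_source p, ?_⟩
    simp only [mem_preimage, mem_ofPred_eq, ← hx₀, sub_self, map_zero]
    exact ⟨by linarith, hε'0⟩
  · have hxc : ContinuousOn (extChartAt (𝓡 2) p) ((extChartAt (𝓡 2) p).source ∩
        extChartAt (𝓡 2) p ⁻¹' {y | b (y - x₀) ∈ Ioo (-ε') ε'}) :=
      (continuousOn_extChartAt p).mono inter_subset_left
    refine a.continuous.comp_continuousOn (hxc.sub ?_)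
    exact hΓC.continuousOn.comp (hbc.comp_continuousOn hxc) fun q hq ↦
      hsub (Ioo_subset_Icc_self hq.2)
  · rintro q ⟨hq, hbq⟩
    constructor
    · intro h0
      have hbq' := hsub (Ioo_subset_Icc_self hbq)
      have h1 : extChartAt (𝓡 2) p q = Γ (b (extChartAt (𝓡 2) p q - x₀)) := by
        have h2 := hdec (extChartAt (𝓡 2) p q - Γ (b (extChartAt (𝓡 2) p q - x₀)))
        have h3 : b (extChartAt (𝓡 2) p q - Γ (b (extChartAt (𝓡 2) p q - x₀))) = 0 := by
          have h4 := hbΓ _ hbq'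
          have h5 : extChartAt (𝓡 2) p q - Γ (b (extChartAt (𝓡 2) p q - x₀)) =
            (extChartAt (𝓡 2) p q - x₀) - (Γ (b (extChartAt (𝓡 2) p q - x₀)) - x₀) := by abel
          rw [h5, map_sub, h4, sub_self]
        rw [h0, h3, zero_smul, zero_smul, add_zero] at h2
        exact sub_eq_zero.mp h2
      have h2 : q = (extChartAt (𝓡 2) p).symm (Γ (b (extChartAt (𝓡 2) p q - x₀))) := by
        rw [← h1, (extChartAt (𝓡 2) p).left_inv hq]
      have hbq : b (extChartAt (𝓡 2) p q - x₀) ∈ Ioo (-ε') ε' := hbq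
      set s := b (extChartAt (𝓡 2) p q - x₀)
      rcases le_total 0 s with hs | hs
      · refine Or.inl ⟨s / ε', ⟨by positivity, (div_le_one hε'0).mpr hbq.2.le⟩, ?_⟩
        change (extChartAt (𝓡 2) p).symm (Γ (ε' * (s / ε'))) = q
        rw [mul_div_cancel₀ _ hε'0.ne', ← h2]
      · refine Or.inr ⟨-s / ε', ⟨div_nonneg (by linarith) hε'0.le,
          (div_le_one hε'0).mpr (by linarith [hbq.1])⟩, ?_⟩
        change (extChartAt (𝓡 2) p).symm (Γ (-ε' * (-s / ε'))) = q
        rw [show -ε' * (-s / ε') = s by field_simp, ← h2]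
    · rintro (⟨t, ht, rfl⟩ | ⟨t, ht, rfl⟩)
      · have h1 := hIoo ε' (abs_of_pos hε'0).le t ht
        change a (extChartAt (𝓡 2) p ((extChartAt (𝓡 2) p).symm (Γ (ε' * t))) -
          Γ (b (extChartAt (𝓡 2) p ((extChartAt (𝓡 2) p).symm (Γ (ε' * t))) - x₀))) = 0
        rw [hxΓ _ h1, hW0 _ h1]
      · have h1 := hIoo (-ε') (by rw [abs_neg, abs_of_pos hε'0]) t ht
        change a (extChartAt (𝓡 2) p ((extChartAt (𝓡 2) p).symm (Γ (-ε' * t))) -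
          Γ (b (extChartAt (𝓡 2) p ((extChartAt (𝓡 2) p).symm (Γ (-ε' * t))) - x₀))) = 0
        rw [hxΓ _ h1, hW0 _ h1]
  · exact hreg₁
  · exact hreg₂
  · simp only [mul_zero, hΓ0, hx₀, extChartAt_to_inv]
  · simp only [mul_zero, hΓ0, hx₀, extChartAt_to_inv]
  · exact fun t ht ↦ hΓp ε' (abs_of_pos hε'0).le hε'0.ne' t ht
  · exact fun t ht ↦ hΓp (-ε') (by rw [abs_neg, abs_of_pos hε'0]) (neg_ne_zero.mpr hε'0.ne') t ht
  · rw [hvel₁, hvel₂]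
  · intro v
    rw [hvel₁]
    constructor
    · intro hv
      have h1 := hdec (chartDeriv p p v)
      have h2 : localMap C p p (chartDeriv p p v) = 0 := by
        rw [localMap_chartDeriv C hpM, hv, map_zero]
      rw [h1, map_add, map_smul, map_smul, hAη, smul_zero, add_zero, hAn] at h2
      have h3 := (smul_eq_zero.mp h2).resolve_right hℓ0
      rw [h3, zero_smul, zero_add] at h1
      refine ⟨b (chartDeriv p p v) / ε', hinj ?_⟩
      rw [map_smul, map_smul, ← hηdef, smul_smul, div_mul_cancel₀ _ hε'0.ne']
      exact h1
    · rintro ⟨k, rfl⟩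
      rw [map_smul, map_smul, hη, smul_zero, smul_zero]
  · have : ‖Y‖ ≠ 0 := norm_ne_zero_iff.mpr hn₀
    rw [norm_smul, norm_inv, norm_norm, inv_mul_cancel₀ this]
  · intro γ hγ
    obtain ⟨s, hs, hpos, hinit, hinner⟩ := exists_sign_of_isAdmissible hn₀ hη hη0 hγ
    refine ⟨s, hs, ?_, isInitialVector_iff_of_tendsto (hγ.1.tendsto_start hγ.2.1) hinit, hinner⟩
    obtain ⟨T, hT, hmem, hxC, hxd⟩ := hγ.1.exists_chart_piece hγ.2.1 univ_mem
    obtain ⟨hs1, hs2⟩ := hside _ T hT.1 hxC (by rw [hγ.2.1])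
    have hβt : ∀ᶠ t in 𝓝[>] (0 : ℝ), β (extChartAt (𝓡 2) p (γ t))
        (derivWithin (fun t ↦ extChartAt (𝓡 2) p (γ t)) (Icc 0 T) t) =
        inner ℝ ℓ (localMap C p (γ t) (chartDeriv p (γ t) (velocity γ (Icc 0 1) t))) := by
      filter_upwards [Ioo_mem_nhdsGT hT.1] with t ht
      have ht' := Ioo_subset_Icc_self ht
      rw [(hxd t ht').derivWithin (uniqueDiffOn_Icc hT.1 t ht'), hβv _ (hmem t ht').1]
    rcases hs with rfl | rfl
    · simp only [one_mul] at hpos ⊢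
      refine hs1 ?_
      filter_upwards [hpos, hβt] with t h1 h2
      rwa [h2]
    · simp only [neg_one_mul, neg_pos] at hpos ⊢
      refine hs2 ?_
      filter_upwards [hpos, hβt] with t h1 h2
      rwa [h2]

end NullCurve

/-! ### The signed area form -/

section SignedArea

variable {M : Type*} [TopologicalSpace M] [ChartedSpace Plane M] [IsManifold (𝓡 2) ∞ M]
  (o : SurfaceOrientation M)
  {V : M → Type*} [TopologicalSpace (TotalSpace Plane V)]
  [∀ x, NormedAddCommGroup (V x)] [∀ x, InnerProductSpace ℝ (V x)]
  [FiberBundle Plane V] [VectorBundle ℝ Plane V]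
  {C : CoherentTangentBundle V} {μ : CoOrientation V}

theorem signedArea_self (q : M) (v : TangentSpace (𝓡 2) q) : signedArea C μ q v v = 0 := by
  have := μ.skew q (C.ψ q v) (C.ψ q v)
  unfold signedArea
  linarith

theorem signedArea_swap (q : M) (v w : TangentSpace (𝓡 2) q) :
    signedArea C μ q w v = -signedArea C μ q v w := μ.skew q _ _

theorem signedArea_basis {q : M} (B : Module.Basis (Fin 2) ℝ (TangentSpace (𝓡 2) q))
    (v w : TangentSpace (𝓡 2) q) :
    signedArea C μ q v w = B.det ![v, w] * signedArea C μ q (B 0) (B 1) := by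
  have hv : v = B.repr v 0 • B 0 + B.repr v 1 • B 1 := by
    rw [← Fin.sum_univ_two (f := fun i ↦ B.repr v i • B i), B.sum_repr]
  have hw : w = B.repr w 0 • B 0 + B.repr w 1 • B 1 := by
    rw [← Fin.sum_univ_two (f := fun i ↦ B.repr w i • B i), B.sum_repr]
  have hdet : B.det ![v, w] = B.repr v 0 * B.repr w 1 - B.repr w 0 * B.repr v 1 := by
    rw [Module.Basis.det_apply, Matrix.det_fin_two]
    simp [Module.Basis.toMatrix_apply]
  have h1 := signedArea_self (C := C) (μ := μ) q (B 0)
  have h2 := signedArea_self (C := C) (μ := μ) q (B 1)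
  have h3 := signedArea_swap (C := C) (μ := μ) q (B 0) (B 1)
  rw [hdet]
  generalize B.repr v 0 = a at *
  generalize B.repr v 1 = b at *
  generalize B.repr w 0 = c at *
  generalize B.repr w 1 = d at *
  subst hv hw
  unfold signedArea at *
  simp only [map_add, map_smul, add_apply, smul_apply, smul_eq_mul, h1, h2, h3]
  ring

theorem exists_isPositivePair (q : M) :
    ∃ X Y : TangentSpace (𝓡 2) q, IsPositivePair (o.at_point q) X Y := by
  obtain ⟨U, hU, X, Y, -, -, h⟩ := o.exists_frame q
  exact ⟨X q, Y q, h q (mem_of_mem_nhds hU)⟩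

include o in
theorem signedArea_eq_zero_of_mem {q : M} (hq : q ∈ singularSet C) (v w : TangentSpace (𝓡 2) q) :
    signedArea C μ q v w = 0 := by
  obtain ⟨X, Y, B, -, rfl, rfl⟩ := exists_isPositivePair o q
  obtain ⟨k, hk0, hk⟩ := exists_ne_zero_map_eq_zero C hq
  rw [signedArea_basis B]
  have hk' : k = B.repr k 0 • B 0 + B.repr k 1 • B 1 := by
    rw [← Fin.sum_univ_two (f := fun i ↦ B.repr k i • B i), B.sum_repr]
  have h1 : signedArea C μ q k (B 1) = B.repr k 0 * signedArea C μ q (B 0) (B 1) := by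
    rw [signedArea_basis B k, Module.Basis.det_apply, Matrix.det_fin_two]
    simp [Module.Basis.toMatrix_apply]
  have h2 : signedArea C μ q (B 0) k = B.repr k 1 * signedArea C μ q (B 0) (B 1) := by
    rw [signedArea_basis B _ k, Module.Basis.det_apply, Matrix.det_fin_two]
    simp [Module.Basis.toMatrix_apply]
  have h3 : signedArea C μ q k (B 1) = 0 := by simp [signedArea, hk]
  have h4 : signedArea C μ q (B 0) k = 0 := by simp [signedArea, hk]
  rcases mul_eq_zero.mp (h1.symm.trans h3) with h5 | h5
  · rcases mul_eq_zero.mp (h2.symm.trans h4) with h6 | h6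
    · rw [h5, h6, zero_smul, zero_smul, add_zero] at hk'
      exact absurd hk' hk0
    · rw [h6, mul_zero]
  · rw [h5, mul_zero]

theorem mem_singularSet_of_signedArea_eq_zero {q : M}
    (B : Module.Basis (Fin 2) ℝ (TangentSpace (𝓡 2) q))
    (h : signedArea C μ q (B 0) (B 1) = 0) : q ∈ singularSet C := by
  intro hbij
  have hb := fibreCoord_bijective (V := V)
    (FiberBundle.mem_baseSet_trivializationAt' (F := Plane) (E := V) q)
  let e : V q ≃ₗ[ℝ] Plane := LinearEquiv.ofBijective (fibreCoord V q q).toLinearMap hb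
  have hdim : Module.finrank ℝ (V q) = 2 := by rw [e.finrank_eq]; simp
  have : FiniteDimensional ℝ (V q) := Module.finite_of_finrank_pos (by omega)
  let E := (stdOrthonormalBasis ℝ (V q)).reindex (finCongr hdim)
  obtain ⟨v, hv⟩ := hbij.2 (E 0)
  obtain ⟨w, hw⟩ := hbij.2 (E 1)
  have h1 : signedArea C μ q v w = 0 := by rw [signedArea_basis B, h, mul_zero]
  unfold signedArea at h1
  rw [hv, hw] at h1
  have := μ.orthonormal q (E 0) (E 1) (E.norm_eq_one 0) (E.norm_eq_one 1)
    (E.inner_eq_zero (by decide))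
  rw [h1] at this
  norm_num at this

variable {o}

theorem signedArea_of_isPositivePair {q : M} {X Y : TangentSpace (𝓡 2) q}
    (hXY : IsPositivePair (o.at_point q) X Y) {v w : TangentSpace (𝓡 2) q}
    (hvw : IsPositivePair (o.at_point q) v w) :
    ∃ c : ℝ, 0 < c ∧ signedArea C μ q v w = c * signedArea C μ q X Y := by
  obtain ⟨B, hB, rfl, rfl⟩ := hXY
  rw [← hB, isPositivePair_iff_det] at hvw
  exact ⟨_, hvw, signedArea_basis B v w⟩

theorem mem_singularSet_of_isPositivePair {q : M} {X Y : TangentSpace (𝓡 2) q}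
    (hXY : IsPositivePair (o.at_point q) X Y) (h : signedArea C μ q X Y = 0) :
    q ∈ singularSet C := by
  obtain ⟨B, -, rfl, rfl⟩ := hXY
  exact mem_singularSet_of_signedArea_eq_zero B h

theorem mem_positiveRegion_of_pos {q : M} {X Y : TangentSpace (𝓡 2) q}
    (hXY : IsPositivePair (o.at_point q) X Y) (h : 0 < signedArea C μ q X Y) :
    q ∈ positiveRegion o C μ := by
  refine ⟨fun hq ↦ h.ne' (signedArea_eq_zero_of_mem o hq X Y), fun v w hvw ↦ ?_⟩
  obtain ⟨c, hc, hcw⟩ := signedArea_of_isPositivePair (C := C) (μ := μ) hXY hvw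
  rw [abs_of_pos]
  rw [hcw]
  exact mul_pos hc h

theorem mem_negativeRegion_of_neg {q : M} {X Y : TangentSpace (𝓡 2) q}
    (hXY : IsPositivePair (o.at_point q) X Y) (h : signedArea C μ q X Y < 0) :
    q ∈ negativeRegion o C μ := by
  refine ⟨fun hq ↦ h.ne (signedArea_eq_zero_of_mem o hq X Y), fun v w hvw ↦ ?_⟩
  obtain ⟨c, hc, hcw⟩ := signedArea_of_isPositivePair (C := C) (μ := μ) hXY hvw
  rw [abs_of_neg, neg_neg]
  rw [hcw]
  exact mul_neg_of_pos_of_neg hc h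

theorem disjoint_positiveRegion_negativeRegion :
    Disjoint (positiveRegion o C μ) (negativeRegion o C μ) := by
  rw [Set.disjoint_left]
  rintro q ⟨hq, h1⟩ ⟨-, h2⟩
  obtain ⟨X, Y, hXY⟩ := exists_isPositivePair o q
  have h3 := h1 X Y hXY
  have h4 := h2 X Y hXY
  exact hq (mem_singularSet_of_isPositivePair hXY (by linarith))

variable (o C μ)

/-- Near `p`, connected sets of regular points lie in one of the two regions. -/
theorem exists_nhds_subset_region (p : M) : ∃ N : Set M, IsOpen N ∧ p ∈ N ∧
    ∀ A : Set M, IsPreconnected A → A ⊆ N → Disjoint A (singularSet C) →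
      A ⊆ positiveRegion o C μ ∨ A ⊆ negativeRegion o C μ := by
  obtain ⟨U, hU, X, Y, hX, hY, hXY⟩ := o.exists_frame p
  refine ⟨interior U, isOpen_interior, mem_interior_iff_mem_nhds.mpr hU, fun A hA hAU hAS ↦ ?_⟩
  have hAU' : A ⊆ U := hAU.trans interior_subset
  have hcont : ContinuousOn (fun q ↦ signedArea C μ q (X q) (Y q)) U := by
    intro q hq
    have hψ := (C.smooth_ψ.continuous.continuousWithinAt (s := U) (x := q))
    have hψX := hψ.clm_bundle_apply (hX.continuousOn q hq)
    have hψY := hψ.clm_bundle_apply (hY.continuousOn q hq)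
    have h := ContinuousWithinAt.clm_bundle_apply₂ (E₃ := Bundle.Trivial M ℝ)
      (μ.smooth_μ.continuous.continuousWithinAt (s := U) (x := q)) hψX hψY
    exact ((FiberBundle.continuousWithinAt_totalSpace ..).mp h).2
  have hne : ∀ q ∈ A, signedArea C μ q (X q) (Y q) ≠ 0 := fun q hq h0 ↦
    Set.disjoint_left.mp hAS hq (mem_singularSet_of_isPositivePair (hXY q (hAU' hq)) h0)
  rcases A.eq_empty_or_nonempty with rfl | ⟨q₀, hq₀⟩
  · exact Or.inl (empty_subset _)
  rcases lt_or_gt_of_ne (hne q₀ hq₀) with h | h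
  · right
    intro q hq
    exact mem_negativeRegion_of_neg (hXY q (hAU' hq))
      (lt_on_of_ne hA (hcont.mono hAU') continuousOn_const hne hq₀ h q hq)
  · left
    intro q hq
    exact mem_positiveRegion_of_pos (hXY q (hAU' hq))
      (lt_on_of_ne hA continuousOn_const (hcont.mono hAU') (fun x hx ↦ (hne x hx).symm) hq₀ h q hq)

variable {o C μ}

theorem mfderiv_eq_zero_of_isLocalMin {f : M → ℝ} {q : M} (h : IsLocalMin f q) :
    mfderiv (𝓡 2) 𝓘(ℝ, ℝ) f q = 0 := by
  by_cases hf : MDifferentiableAt (𝓡 2) 𝓘(ℝ, ℝ) f q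
  · have h1 : IsLocalMin (writtenInExtChartAt (𝓡 2) 𝓘(ℝ, ℝ) q f) (extChartAt (𝓡 2) q q) := by
      have h2 : Tendsto (extChartAt (𝓡 2) q).symm (𝓝 (extChartAt (𝓡 2) q q)) (𝓝 q) := by
        have := continuousAt_extChartAt_symm (I := 𝓡 2) q
        rwa [ContinuousAt, extChartAt_to_inv] at this
      filter_upwards [h2.eventually h] with y hy
      change f ((extChartAt (𝓡 2) q).symm (extChartAt (𝓡 2) q q)) ≤ f ((extChartAt (𝓡 2) q).symm y)
      rwa [extChartAt_to_inv]
    have hr : range (𝓡 2) = univ := by simp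
    have h2 : fderivWithin ℝ (writtenInExtChartAt (𝓡 2) 𝓘(ℝ, ℝ) q f) (range (𝓡 2))
        (extChartAt (𝓡 2) q q) = 0 := by
      rw [hr, fderivWithin_univ, h1.fderiv_eq_zero]
    unfold mfderiv
    exact (if_pos hf).trans h2
  · exact mfderiv_zero_of_not_mdifferentiableAt hf

/-- Near a non-degenerate singular point there are points of both regions. -/
theorem IsNondegenerate.nonempty_inter {q : M} (h : IsNondegenerate o C μ q) {O : Set M}
    (hO : O ∈ 𝓝 q) :
    (O ∩ positiveRegion o C μ).Nonempty ∧ (O ∩ negativeRegion o C μ).Nonempty := by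
  obtain ⟨hq, φ, hφ, hqφ, hd⟩ := h
  have hO' : O ∩ φ.source ∈ 𝓝 q := inter_mem hO (φ.open_source.mem_nhds hqφ)
  have h0 : areaDensity C μ φ q = 0 := signedArea_eq_zero_of_mem o hq _ _
  constructor
  · by_contra hcon
    refine hd ?_
    have hmax : IsLocalMin (fun x ↦ -areaDensity C μ φ x) q := by
      filter_upwards [hO'] with x hx
      simp only [h0, neg_zero, Left.nonneg_neg_iff]
      by_contra hlt
      exact hcon ⟨x, hx.1, mem_positiveRegion_of_pos (hφ.2 x hx.2) (not_le.mp hlt)⟩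
    have h1 := mfderiv_eq_zero_of_isLocalMin hmax
    have h2 : mfderiv (𝓡 2) 𝓘(ℝ, ℝ) (fun x ↦ -areaDensity C μ φ x) q =
        -mfderiv (𝓡 2) 𝓘(ℝ, ℝ) (areaDensity C μ φ) q := mfderiv_neg
    rw [h2] at h1
    exact neg_eq_zero.mp h1
  · by_contra hcon
    refine hd (mfderiv_eq_zero_of_isLocalMin ?_)
    filter_upwards [hO'] with x hx
    rw [h0]
    by_contra hlt
    exact hcon ⟨x, hx.1, mem_negativeRegion_of_neg (hφ.2 x hx.2) (not_le.mp hlt)⟩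

/-- The derivative of a function in the direction of a curve on which the function vanishes. -/
theorem mfderiv_velocity_eq_zero {f : M → ℝ} {γ : ℝ → M} {s : Set ℝ} {t : ℝ}
    (hs : UniqueDiffWithinAt ℝ s t) (hf : MDifferentiableAt (𝓡 2) 𝓘(ℝ, ℝ) f (γ t))
    (hγ : MDifferentiableWithinAt 𝓘(ℝ, ℝ) (𝓡 2) γ s t) (h0 : f (γ t) = 0)
    (h : ∀ᶠ u in 𝓝[s] t, f (γ u) = 0) :
    mfderiv (𝓡 2) 𝓘(ℝ, ℝ) f (γ t) (velocity γ s t) = (0 : ℝ) := by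
  have h1 := hasDerivWithinAt_comp_velocity hf hγ
  have h2 : HasDerivWithinAt (fun u ↦ f (γ u)) 0 s t :=
    (hasDerivWithinAt_const t s (0 : ℝ)).congr_of_eventuallyEq h h0
  exact hs.eq_deriv _ h1 h2

theorem IsA2Point.exists_function {q : M} (h : IsA2Point o C μ q) :
    ∃ f : M → ℝ, MDifferentiableAt (𝓡 2) 𝓘(ℝ, ℝ) f q ∧ mfderiv (𝓡 2) 𝓘(ℝ, ℝ) f q ≠ 0 ∧
      (∀ x ∈ singularSet C, f x = 0) ∧
      ∃ w : TangentSpace (𝓡 2) q, mfderiv (𝓡 2) 𝓘(ℝ, ℝ) f q w = (0 : ℝ) ∧ C.ψ q w ≠ 0 := by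
  obtain ⟨⟨hq, φ, hφ, hqφ, hd⟩, γ, hγ, rfl, hsing, hψ⟩ := h
  have hf : MDifferentiableAt (𝓡 2) 𝓘(ℝ, ℝ) (areaDensity C μ φ) (γ 0) := by
    by_contra hcon
    exact hd (mfderiv_zero_of_not_mdifferentiableAt hcon)
  have hz : ∀ x ∈ singularSet C, areaDensity C μ φ x = 0 := fun x hx ↦
    signedArea_eq_zero_of_mem o hx _ _
  have h0 : (0 : ℝ) ∈ Ioo (-1 : ℝ) 1 := by norm_num
  refine ⟨_, hf, hd, hz, _, ?_, hψ⟩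
  refine mfderiv_velocity_eq_zero (isOpen_Ioo.uniqueDiffWithinAt h0) hf
    (hγ.mdifferentiableWithinAt h0) (hz _ hq) ?_
  filter_upwards [self_mem_nhdsWithin] with u hu using hz _ (hsing u hu)

theorem Plane.eq_zero_of_linearIndependent {n η : Plane} (h : LinearIndependent ℝ ![n, η])
    {L : Plane →L[ℝ] ℝ} (hn : L n = 0) (hη : L η = 0) : L = 0 := by
  obtain ⟨a, b, hdec, -⟩ := Plane.exists_dual_basis h
  ext1 x
  rw [hdec x, map_add, map_smul, map_smul, hn, hη, smul_zero, smul_zero, add_zero]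
  rfl

/-- The velocity of a regular curve of singular points is not null at `A₂`-points. -/
theorem IsA2Point.map_velocity_ne_zero {γ : ℝ → M} (hγ : IsRegularCurve γ (Icc 0 1)) {t : ℝ}
    (ht : t ∈ Icc (0 : ℝ) 1) (hA : IsA2Point o C μ (γ t))
    (hsing : ∀ᶠ u in 𝓝[Icc 0 1] t, γ u ∈ singularSet C) :
    C.ψ (γ t) (velocity γ (Icc 0 1) t) ≠ 0 := by
  obtain ⟨f, hf, hd, hz, w, hw, hψw⟩ := hA.exists_function
  have h1 := mfderiv_velocity_eq_zero (uniqueDiffOn_Icc zero_lt_one t ht) hf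
    (hγ.mdifferentiableWithinAt ht) (hz _ hA.1.1) (hsing.mono fun u hu ↦ hz _ hu)
  have hv := hγ.2 t ht
  intro hψv
  -- otherwise the kernel of the differential would be the whole tangent plane
  have hli := linearIndependent_of_map_eq_zero (W := Plane) (W' := V (γ t))
    (C.ψ (γ t)).toLinearMap (n := w) (η := velocity γ (Icc 0 1) t) hψw hψv hv
  exact hd (Plane.eq_zero_of_linearIndependent hli hw h1)

end SignedArea

/-! ### The null fan -/

theorem exists_int_between {u : ℤ → ℝ}
    (hper : ∀ m, u (m + 2) = u m + 2 * Real.pi) {y : ℝ} (hy : ∀ m, y ≠ u m) :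
    ∃ Q : ℤ, u Q < y ∧ y < u (Q + 1) := by
  have hpi := Real.pi_pos
  have hmul : ∀ k : ℤ, u (2 * k) = u 0 + k * (2 * Real.pi) := by
    intro k
    induction k using Int.induction_on with
    | zero => simp
    | succ i ih =>
      have := hper (2 * i)
      rw [show (2 * ((i : ℤ) + 1)) = 2 * i + 2 by ring, this, ih]
      push_cast; ring
    | pred i ih =>
      have := hper (2 * (-(i : ℤ) - 1))
      rw [show 2 * (-(i : ℤ) - 1) + 2 = 2 * -i by ring, ih] at this
      push_cast at this ⊢; linarith
  let k := ⌊(y - u 0) / (2 * Real.pi)⌋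
  have h1 : u (2 * k) ≤ y := by
    rw [hmul]
    have := Int.floor_le ((y - u 0) / (2 * Real.pi))
    rw [le_div_iff₀ (by positivity)] at this
    linarith
  have h2 : y < u (2 * k + 2) := by
    rw [hper, hmul]
    have := Int.lt_floor_add_one ((y - u 0) / (2 * Real.pi))
    rw [div_lt_iff₀ (by positivity)] at this
    linarith
  rcases lt_or_gt_of_ne (hy (2 * k + 1)) with h | h
  · exact ⟨2 * k, lt_of_le_of_ne h1 (hy _).symm, h⟩
  · exact ⟨2 * k + 1, h, by rwa [add_assoc]⟩

section NullFan

variable {M : Type*} [TopologicalSpace M] [ChartedSpace Plane M] [IsManifold (𝓡 2) ∞ M]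
  {V : M → Type*} [TopologicalSpace (TotalSpace Plane V)]
  [∀ x, NormedAddCommGroup (V x)] [∀ x, InnerProductSpace ℝ (V x)]
  [FiberBundle Plane V] [VectorBundle ℝ Plane V]
  (C : CoherentTangentBundle V)

/-- The null curve in polar coordinates: `H m`, for `m` even (odd), are the lifts of the angle
function of its first (second) half.  An admissible curve lies between two consecutive lifts
`H Q` and `H (Q + 1)`, and the parity of `Q` decides whether its initial vector is `e` or `-e`. -/
structure IsNullFan (p : M) (Φ : OpenPartialHomeomorph M ℂ) (R : ℝ) (Γ₁ Γ₂ : ℝ → M) (e : V p)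
    (H : ℤ → ℝ → ℝ) : Prop where
  norm_eq_one : ‖e‖ = 1
  continuousOn : ∀ m, ContinuousOn (H m) (Icc 0 R)
  lt_succ : ∀ m, ∀ ρ ∈ Icc 0 R, H m ρ < H (m + 1) ρ
  add_two : ∀ m ρ, H (m + 2) ρ = H m ρ + 2 * Real.pi
  start : ∀ m, H m 0 = H 0 0 + m * Real.pi
  half₁ : ∀ r ∈ Ioc 0 R, ∀ᶠ t in 𝓝[>] (0 : ℝ), Γ₁ t ∈ angularGraph Φ (H 0) r
  half₂ : ∀ r ∈ Ioc 0 R, ∀ᶠ t in 𝓝[>] (0 : ℝ), Γ₂ t ∈ angularGraph Φ (H 1) r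
  ker_iff : ∀ v : TangentSpace (𝓡 2) p, C.ψ p v = 0 ↔
    ∃ k : ℝ, tangentCoord Φ p v = k * Complex.exp ((H 0 0 : ℂ) * Complex.I)
  side : ∀ γ, IsAdmissible C p γ → ∀ g δ τ, IsPolarArc Φ γ g δ τ →
    ∃ Q : ℤ, (∀ᶠ ρ in 𝓝[>] (0 : ℝ), H Q ρ < g ρ ∧ g ρ < H (Q + 1) ρ) ∧
      ∀ Ψ : V p, IsInitialVector C p γ Ψ ↔ Ψ = if Even Q then e else -e

/-- The lifts of two angle functions. -/
noncomputable def fanAngle (h₁ h₂ : ℝ → ℝ) (m : ℤ) (ρ : ℝ) : ℝ :=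
  if Even m then h₁ ρ + m * Real.pi else h₂ ρ + (m - 1) * Real.pi

theorem fanAngle_even (h₁ h₂ : ℝ → ℝ) (k : ℤ) :
    fanAngle h₁ h₂ (2 * k) = fun ρ ↦ h₁ ρ + k * (2 * Real.pi) := by
  funext ρ
  rw [fanAngle, if_pos (even_two_mul k)]
  push_cast; ring

theorem fanAngle_odd (h₁ h₂ : ℝ → ℝ) (k : ℤ) :
    fanAngle h₁ h₂ (2 * k + 1) = fun ρ ↦ h₂ ρ + k * (2 * Real.pi) := by
  funext ρ
  rw [fanAngle, if_neg (Int.not_even_two_mul_add_one k)]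
  push_cast; ring

theorem fanAngle_even_sector {Φ : OpenPartialHomeomorph M ℂ} (h₁ h₂ : ℝ → ℝ) (k : ℤ) (r : ℝ) :
    angularSector Φ (fanAngle h₁ h₂ (2 * k)) (fanAngle h₁ h₂ (2 * k + 1)) r =
      angularSector Φ h₁ h₂ r := by
  rw [fanAngle_even, fanAngle_odd, angularSector_add_int]

theorem fanAngle_odd_sector {Φ : OpenPartialHomeomorph M ℂ} (h₁ h₂ : ℝ → ℝ) (k : ℤ) (r : ℝ) :
    angularSector Φ (fanAngle h₁ h₂ (2 * k + 1)) (fanAngle h₁ h₂ (2 * k + 1 + 1)) r =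
      angularSector Φ h₂ (fun ρ ↦ h₁ ρ + 2 * Real.pi) r := by
  rw [show 2 * k + 1 + 1 = 2 * (k + 1) by ring, fanAngle_even, fanAngle_odd,
    ← angularSector_add_int h₂ _ r k]
  congr 1
  funext ρ
  push_cast; ring

theorem IsPolarArc.eventually_radius {Φ : OpenPartialHomeomorph M ℂ} {γ : ℝ → M} {g : ℝ → ℝ}
    {δ τ : ℝ} (h : IsPolarArc Φ γ g δ τ) {P : M → Prop} (hP : ∀ᶠ t in 𝓝[>] (0 : ℝ), P (γ t)) :
    ∃ r ∈ Ioc 0 δ, ∀ ρ ∈ Ioo 0 r, P (polarPoint Φ ρ (g ρ)) := by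
  obtain ⟨t₀, ht₀, hsub⟩ := mem_nhdsGT_iff_exists_Ioo_subset.mp hP
  have ht₀ : 0 < t₀ := ht₀
  have hm : min (t₀ / 2) (τ / 2) ∈ Ioo 0 τ := by
    have := h.time_mem.1
    exact ⟨lt_min (by positivity) (by positivity), by linarith [min_le_right (t₀ / 2) (τ / 2)]⟩
  refine ⟨‖Φ (γ (min (t₀ / 2) (τ / 2)))‖, ⟨(h.norm_mem hm).1, (h.norm_mem hm).2.le⟩,
    fun ρ hρ ↦ ?_⟩
  obtain ⟨t, ht, hteq⟩ := h.exists_time (ρ := ρ) ⟨hρ.1, (hρ.2.trans (h.norm_mem hm).2).le⟩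
  have htt : t < min (t₀ / 2) (τ / 2) := by
    by_contra hcon
    have := h.strictMonoOn.monotoneOn (Ioo_subset_Icc_self hm) (Ioc_subset_Icc_self ht)
      (not_lt.mp hcon)
    simp only [hteq] at this
    exact absurd hρ.2 (not_lt.mpr this)
  have h1 := h.polar t (Ioc_subset_Icc_self ht)
  rw [hteq] at h1
  rw [← h1]
  exact hsub ⟨ht.1, by linarith [min_le_left (t₀ / 2) (τ / 2)]⟩

variable {C}

theorem exists_isNullFan [T2Space M] {p : M} {W : M → ℝ} {N : Set M} {Γ₁ Γ₂ : ℝ → M} {e : V p}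
    (hN : IsNullCurve C p W N Γ₁ Γ₂ e) {Φ : OpenPartialHomeomorph M ℂ} {R₀ : ℝ}
    (hΦ : IsSmoothPolarChart Φ p R₀) :
    ∃ R ∈ Ioc 0 R₀, ∃ e' H, IsNullFan C p Φ R Γ₁ Γ₂ e' H := by
  have hpi := Real.pi_pos
  set v₁ := tangentCoord Φ p (initialVelocity p Γ₁) with hv₁
  have hv₁0 : v₁ ≠ 0 :=
    hΦ.tangentCoord_ne_zero hΦ.mem_source (IsSmoothPolarChart.initialVelocity_ne_zero hN.regular₁)
  have hv₁n : (0 : ℝ) < ‖v₁‖ := norm_pos_iff.mpr hv₁0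
  obtain ⟨α, -, -, hα⟩ := exists_polar_form v₁ 0
  have hv₂ : tangentCoord Φ p (initialVelocity p Γ₂) = -v₁ := by rw [hN.opposite, map_neg]
  have hexp : Complex.exp (((α + Real.pi : ℝ) : ℂ) * Complex.I) =
      -Complex.exp ((α : ℂ) * Complex.I) := by
    push_cast
    rw [add_mul, Complex.exp_add, Complex.exp_pi_mul_I, mul_neg_one]
  obtain ⟨δ₁, hδ₁R, τ₁, h₁, hp₁, h₁0⟩ := hΦ.exists_isPolarArc hN.regular₁ hN.start₁ hN.ne₁ hα
  obtain ⟨δ₂, hδ₂R, τ₂, h₂, hp₂, h₂0⟩ := hΦ.exists_isPolarArc hN.regular₂ hN.start₂ hN.ne₂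
    (α := α + Real.pi) (by
      rw [hv₂, norm_neg, hexp, mul_neg, ← hα])
  -- a disc in which `W` is defined
  have hdisc : ∃ δ₃ > 0, δ₃ ≤ R₀ ∧ complexDisc Φ δ₃ ⊆ N := by
    have h1 : Φ.symm ⁻¹' N ∈ 𝓝 (0 : ℂ) := by
      rw [← hΦ.map_center]
      refine (Φ.continuousAt_symm (Φ.map_source hΦ.mem_source)).preimage_mem_nhds ?_
      rw [Φ.left_inv hΦ.mem_source]
      exact hN.isOpen.mem_nhds hN.mem
    obtain ⟨d, hd, hsub⟩ := Metric.mem_nhds_iff.mp h1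
    refine ⟨min d R₀, lt_min hd hΦ.pos, min_le_right _ _, fun q hq ↦ ?_⟩
    have := hsub (Metric.ball_subset_ball (min_le_left d R₀) hq.2)
    rwa [mem_preimage, Φ.left_inv hq.1] at this
  obtain ⟨δ₃, hδ₃, hδ₃R, hδ₃N⟩ := hdisc
  have hδ : 0 < min δ₁ (min δ₂ δ₃) := lt_min hp₁.radius_pos (lt_min hp₂.radius_pos hδ₃)
  -- a radius for which the two halves are almost opposite
  have hopp : ∃ R ∈ Ioc 0 (min δ₁ (min δ₂ δ₃)), ∀ ρ ∈ Icc 0 R, |h₂ ρ - h₁ ρ - Real.pi| < Real.pi := by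
    have hc : ContinuousOn (fun ρ ↦ |h₂ ρ - h₁ ρ - Real.pi|) (Icc 0 (min δ₁ (min δ₂ δ₃))) :=
      (((hp₂.continuousOn_angle.mono (Icc_subset_Icc_right
        ((min_le_right _ _).trans (min_le_left _ _)))).sub
        (hp₁.continuousOn_angle.mono (Icc_subset_Icc_right (min_le_left _ _)))).sub
        continuousOn_const).abs
    have h1 := (hc 0 (left_mem_Icc.mpr hδ.le)).eventually
      (gt_mem_nhds (show |h₂ 0 - h₁ 0 - Real.pi| < Real.pi by
        rw [h₁0, h₂0]; simp [hpi]))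
    obtain ⟨d, hd, hsub⟩ := Metric.mem_nhdsWithin_iff.mp h1
    refine ⟨min (d / 2) (min δ₁ (min δ₂ δ₃)), ⟨lt_min (half_pos hd) hδ, min_le_right _ _⟩,
      fun ρ hρ ↦ hsub ⟨?_, hρ.1, hρ.2.trans (min_le_right _ _)⟩⟩
    rw [Metric.mem_ball, Real.dist_eq, sub_zero, abs_of_nonneg hρ.1]
    linarith [hρ.2.trans (min_le_left _ _)]
  obtain ⟨R, hR, hlt⟩ := hopp
  have hRδ₁ : R ≤ δ₁ := hR.2.trans (min_le_left _ _)
  have hRδ₂ : R ≤ δ₂ := hR.2.trans ((min_le_right _ _).trans (min_le_left _ _))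
  have hRδ₃ : R ≤ δ₃ := hR.2.trans ((min_le_right _ _).trans (min_le_right _ _))
  have hRR₀ : R ≤ R₀ := hRδ₃.trans hδ₃R
  have hΦR := hΦ.shrink hR.1 hRR₀
  have hΦP := hΦR.toIsPolarChart
  obtain ⟨τ₁', -, hp₁'⟩ := hp₁.shrink ⟨hR.1, hRδ₁⟩
  obtain ⟨τ₂', -, hp₂'⟩ := hp₂.shrink ⟨hR.1, hRδ₂⟩
  have hlt₁ : ∀ ρ ∈ Icc 0 R, h₁ ρ < h₂ ρ := fun ρ hρ ↦ by
    have := (abs_lt.mp (hlt ρ hρ)).1; linarith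
  have hlt₂ : ∀ ρ ∈ Icc 0 R, h₂ ρ < h₁ ρ + 2 * Real.pi := fun ρ hρ ↦ by
    have := (abs_lt.mp (hlt ρ hρ)).2; linarith
  have hIoo : Ioo 0 R ⊆ Icc 0 R := Ioo_subset_Icc_self
  have hc₁ := hp₁'.continuousOn_angle
  have hc₂ := hp₂'.continuousOn_angle
  have hzero : ∀ q ∈ complexDisc Φ R, W q = 0 →
      q = p ∨ q ∈ angularGraph Φ h₁ R ∨ q ∈ angularGraph Φ h₂ R := by
    intro q hq hW
    have hqN := hδ₃N (complexDisc_mono hRδ₃ hq)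
    rcases (hN.zero_iff q hqN).mp hW with h | h
    · have h1 : q ∈ Γ₁ '' Icc 0 1 ∩ complexDisc Φ R := ⟨h, hq⟩
      rw [hp₁'.image_inter_disc hΦP (Ico_subset_Icc_self.trans
        (Icc_subset_Icc_right hp₁'.time_mem.2)) subset_rfl] at h1
      rcases h1 with h1 | h1
      · exact Or.inl h1
      · exact Or.inr (Or.inl h1)
    · have h1 : q ∈ Γ₂ '' Icc 0 1 ∩ complexDisc Φ R := ⟨h, hq⟩
      rw [hp₂'.image_inter_disc hΦP (Ico_subset_Icc_self.trans
        (Icc_subset_Icc_right hp₂'.time_mem.2)) subset_rfl] at h1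
      rcases h1 with h1 | h1
      · exact Or.inl h1
      · exact Or.inr (Or.inr h1)
  have hWgraph : ∀ ρ ∈ Ioo 0 R, W (polarPoint Φ ρ (h₁ ρ)) = 0 ∧ W (polarPoint Φ ρ (h₂ ρ)) = 0 := by
    intro ρ hρ
    have hmem : ∀ θ, polarPoint Φ ρ θ ∈ N := fun θ ↦ hδ₃N (complexDisc_mono hRδ₃
      ((hΦP.polarPoint_mem_disc_iff (hIoo hρ)).mpr hρ.2))
    obtain ⟨t, ht, hteq⟩ := hp₁'.exists_time_polarPoint hρ
    obtain ⟨s, hs, hseq⟩ := hp₂'.exists_time_polarPoint hρ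
    exact ⟨(hN.zero_iff _ (hmem _)).mpr (Or.inl ⟨t, ⟨ht.1.le, ht.2.le.trans hp₁'.time_mem.2⟩, hteq⟩),
      (hN.zero_iff _ (hmem _)).mpr (Or.inr ⟨s, ⟨hs.1.le, hs.2.le.trans hp₂'.time_mem.2⟩, hseq⟩)⟩
  -- the two sides
  have hS₁ := hΦP.isPreconnected_angularSector le_rfl (hc₁.mono hIoo) (hc₂.mono hIoo)
    fun ρ hρ ↦ hlt₁ ρ (hIoo hρ)
  have hS₂ := hΦP.isPreconnected_angularSector (b := fun ρ ↦ h₁ ρ + 2 * Real.pi) le_rfl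
    (hc₂.mono hIoo) ((hc₁.mono hIoo).add continuousOn_const) fun ρ hρ ↦ hlt₂ ρ (hIoo hρ)
  have hgraph : angularGraph Φ (fun ρ ↦ h₁ ρ + 2 * Real.pi) R = angularGraph Φ h₁ R := by
    simpa using angularGraph_add_int (Φ := Φ) h₁ R 1
  have hne₁ : ∀ q ∈ angularSector Φ h₁ h₂ R, W q ≠ 0 := fun q hq hW ↦ by
    have hqd := hΦP.angularSector_subset_disc le_rfl hq
    rcases hzero q hqd.1 hW with h | h | h
    · exact hqd.2 h
    · exact Set.disjoint_left.mp (hΦP.disjoint_sector_graph_left le_rfl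
        fun ρ hρ ↦ (hlt₂ ρ (hIoo hρ)).le) hq h
    · exact Set.disjoint_left.mp (hΦP.disjoint_sector_graph_right le_rfl
        (fun ρ hρ ↦ hlt₁ ρ (hIoo hρ)) fun ρ hρ ↦ (hlt₂ ρ (hIoo hρ)).le) hq h
  have hne₂ : ∀ q ∈ angularSector Φ h₂ (fun ρ ↦ h₁ ρ + 2 * Real.pi) R, W q ≠ 0 := fun q hq hW ↦ by
    have hqd := hΦP.angularSector_subset_disc le_rfl hq
    rcases hzero q hqd.1 hW with h | h | h
    · exact hqd.2 h
    · refine Set.disjoint_left.mp (hΦP.disjoint_sector_graph_right le_rfl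
        (fun ρ hρ ↦ hlt₂ ρ (hIoo hρ)) fun ρ hρ ↦ ?_) hq (hgraph ▸ h)
      have := hlt₁ ρ (hIoo hρ)
      linarith
    · refine Set.disjoint_left.mp (hΦP.disjoint_sector_graph_left le_rfl fun ρ hρ ↦ ?_) hq h
      have := hlt₁ ρ (hIoo hρ)
      linarith
  have hWc : ∀ S ⊆ complexDisc Φ R, ContinuousOn W S := fun S hS ↦
    hN.continuousOn.mono (hS.trans ((complexDisc_mono hRδ₃).trans hδ₃N))
  have hd₁ : angularSector Φ h₁ h₂ R ⊆ complexDisc Φ R := fun q hq ↦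
    (hΦP.angularSector_subset_disc le_rfl hq).1
  have hd₂ : angularSector Φ h₂ (fun ρ ↦ h₁ ρ + 2 * Real.pi) R ⊆ complexDisc Φ R := fun q hq ↦
    (hΦP.angularSector_subset_disc le_rfl hq).1
  have hconst : ∀ (S : Set M), IsPreconnected S → S ⊆ complexDisc Φ R → (∀ q ∈ S, W q ≠ 0) →
      ∀ s : ℝ, ∀ q₀ ∈ S, 0 < s * W q₀ → ∀ q ∈ S, 0 < s * W q := by
    intro S hS hSd hne s q₀ hq₀ hpos
    have hs0 : s ≠ 0 := fun h ↦ by rw [h, zero_mul] at hpos; exact lt_irrefl _ hpos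
    exact lt_on_of_ne hS continuousOn_const (continuousOn_const.mul (hWc S hSd))
      (fun q hq ↦ (mul_ne_zero hs0 (hne q hq)).symm) hq₀ hpos
  -- the sign of `W` on the two sides, from two opposite rays
  have hker : ∀ v : TangentSpace (𝓡 2) p, C.ψ p v = 0 ↔
      ∃ k : ℝ, tangentCoord Φ p v = k * Complex.exp ((α : ℂ) * Complex.I) := by
    intro v
    rw [hN.ker_iff]
    constructor
    · rintro ⟨k, rfl⟩
      refine ⟨k * ‖v₁‖, ?_⟩
      rw [map_smul, ← hv₁, Complex.real_smul]
      conv_lhs => rw [hα]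
      push_cast; ring
    · rintro ⟨k, hk⟩
      refine ⟨k / ‖v₁‖, (hΦ.tangentCoord_bijective hΦ.mem_source).1 ?_⟩
      have h1 : (‖v₁‖ : ℂ) ≠ 0 := by exact_mod_cast hv₁n.ne'
      have h2 : ((k / ‖v₁‖ : ℝ) : ℂ) * v₁ =
          ((k / ‖v₁‖ : ℝ) : ℂ) * (((‖v₁‖ : ℝ) : ℂ) * Complex.exp ((α : ℂ) * Complex.I)) :=
        congrArg _ hα
      rw [map_smul, ← hv₁, Complex.real_smul, hk, h2, ← mul_assoc]
      push_cast
      rw [div_mul_cancel₀ _ h1]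
  have hray : ∀ θ, tangentCoord Φ p (initialVelocity p (straightRay Φ R θ)) =
      (R : ℂ) * Complex.exp ((θ : ℂ) * Complex.I) := fun θ ↦
    hΦR.tangentCoord_initialVelocity_ray ⟨hR.1, le_rfl⟩ θ
  have hperp : Complex.exp (((α + Real.pi / 2 : ℝ) : ℂ) * Complex.I) =
      Complex.I * Complex.exp ((α : ℂ) * Complex.I) := by
    push_cast
    rw [add_mul, Complex.exp_add, Complex.exp_pi_div_two_mul_I, mul_comm]
  have hray0 : C.ψ p (initialVelocity p (straightRay Φ R (α + Real.pi / 2))) ≠ 0 := fun h ↦ by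
    obtain ⟨k, hk⟩ := (hker _).mp h
    rw [hray, hperp, ← mul_assoc] at hk
    have h1 := congrArg Complex.im (mul_right_cancel₀ (Complex.exp_ne_zero _) hk)
    simp at h1
    exact hR.1.ne' h1
  have hopp : initialVelocity p (straightRay Φ R (α + 3 * (Real.pi / 2))) =
      -initialVelocity p (straightRay Φ R (α + Real.pi / 2)) := by
    apply (hΦ.tangentCoord_bijective hΦ.mem_source).1
    rw [map_neg, hray, hray, ← mul_neg]
    congr 1
    rw [show α + 3 * (Real.pi / 2) = α + Real.pi / 2 + Real.pi by ring, Complex.ofReal_add, add_mul,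
      Complex.exp_add, Complex.exp_pi_mul_I, mul_neg_one]
  have hadm : ∀ θ, C.ψ p (initialVelocity p (straightRay Φ R θ)) ≠ 0 →
      IsAdmissible C p (straightRay Φ R θ) := fun θ h ↦
    ⟨hΦR.isRegularCurve_ray ⟨hR.1, le_rfl⟩ θ, hΦR.ray_zero R θ, Or.inl h⟩
  obtain ⟨s, hs, hsW, -, hsi⟩ := hN.side _ (hadm _ hray0)
  obtain ⟨s', hs', hsW', -, hsi'⟩ := hN.side _ (hadm (α + 3 * (Real.pi / 2))
    (by rw [hopp, map_neg]; exact neg_ne_zero.mpr hray0))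
  have hss' : s' = -s := by
    have h1 := hsi hray0
    have h2 := hsi' (by rw [hopp, map_neg]; exact neg_ne_zero.mpr hray0)
    rw [hopp, map_neg, inner_neg_left] at h2
    rcases hs with rfl | rfl <;> rcases hs' with rfl | rfl <;> linarith
  have hev : ∀ {f g : ℝ → ℝ}, ContinuousOn f (Icc 0 R) → ContinuousOn g (Icc 0 R) → f 0 < g 0 →
      ∀ᶠ ρ in 𝓝[>] (0 : ℝ), f ρ < g ρ := by
    intro f g hf hg h
    have h0 : (0 : ℝ) ∈ Icc 0 R := left_mem_Icc.mpr hR.1.le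
    have hle := nhdsGT_le_nhdsWithin_Icc hR.1
    exact ((hf 0 h0).tendsto.mono_left hle).eventually_lt ((hg 0 h0).tendsto.mono_left hle) h
  have hside₁ : ∀ q ∈ angularSector Φ h₁ h₂ R, 0 < s * W q := by
    obtain ⟨r, hr, hrW⟩ := (hΦR.isPolarArc_ray ⟨hR.1, le_rfl⟩ (α + Real.pi / 2)).eventually_radius
      (P := fun q ↦ 0 < s * W q) hsW
    obtain ⟨ρ, ⟨⟨ha, hb⟩, hρ⟩⟩ := (((hev hc₁ (continuousOn_const (c := α + Real.pi / 2))
      (by rw [h₁0]; linarith)).and (hev (continuousOn_const (c := α + Real.pi / 2)) hc₂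
      (by rw [h₂0]; linarith))).and (Ioo_mem_nhdsGT hr.1)).exists
    exact hconst _ hS₁ hd₁ hne₁ s _ ⟨ρ, ⟨hρ.1, hρ.2.trans_le hr.2⟩, α + Real.pi / 2, ⟨ha, hb⟩, rfl⟩
      (hrW ρ hρ)
  have hside₂ : ∀ q ∈ angularSector Φ h₂ (fun ρ ↦ h₁ ρ + 2 * Real.pi) R, 0 < -s * W q := by
    obtain ⟨r, hr, hrW⟩ :=
      (hΦR.isPolarArc_ray ⟨hR.1, le_rfl⟩ (α + 3 * (Real.pi / 2))).eventually_radius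
        (P := fun q ↦ 0 < s' * W q) hsW'
    obtain ⟨ρ, ⟨⟨ha, hb⟩, hρ⟩⟩ := (((hev hc₂ (continuousOn_const (c := α + 3 * (Real.pi / 2)))
      (by rw [h₂0]; linarith)).and (hev (continuousOn_const (c := α + 3 * (Real.pi / 2)))
      (hc₁.add (continuousOn_const (c := 2 * Real.pi)))
      (by change _ < h₁ 0 + 2 * Real.pi; rw [h₁0]; linarith))).and (Ioo_mem_nhdsGT hr.1)).exists
    exact hconst _ hS₂ hd₂ hne₂ (-s) _
      ⟨ρ, ⟨hρ.1, hρ.2.trans_le hr.2⟩, α + 3 * (Real.pi / 2), ⟨ha, hb⟩, rfl⟩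
      (hss' ▸ hrW ρ hρ)
  have hss : s * s = 1 := by rcases hs with rfl | rfl <;> norm_num
  have hcH : ∀ m, ContinuousOn (fanAngle h₁ h₂ m) (Icc 0 R) := fun m ↦ by
    rcases Int.even_or_odd' m with ⟨k, rfl | rfl⟩
    · rw [fanAngle_even]; exact hc₁.add continuousOn_const
    · rw [fanAngle_odd]; exact hc₂.add continuousOn_const
  have hltH : ∀ m, ∀ ρ ∈ Icc 0 R, fanAngle h₁ h₂ m ρ < fanAngle h₁ h₂ (m + 1) ρ := by
    intro m ρ hρ
    have h1 := hlt₁ ρ hρ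
    have h2 := hlt₂ ρ hρ
    rcases Int.even_or_odd' m with ⟨k, rfl | rfl⟩
    · rw [fanAngle_even, fanAngle_odd]; linarith
    · rw [show 2 * k + 1 + 1 = 2 * (k + 1) by ring, fanAngle_even, fanAngle_odd]
      push_cast; linarith
  have hperH : ∀ m ρ, fanAngle h₁ h₂ (m + 2) ρ = fanAngle h₁ h₂ m ρ + 2 * Real.pi := by
    intro m ρ
    rcases Int.even_or_odd' m with ⟨k, rfl | rfl⟩
    · rw [show 2 * k + 2 = 2 * (k + 1) by ring, fanAngle_even, fanAngle_even]
      push_cast; ring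
    · rw [show 2 * k + 1 + 2 = 2 * (k + 1) + 1 by ring, fanAngle_odd, fanAngle_odd]
      push_cast; ring
  have hH0 : fanAngle h₁ h₂ 0 = h₁ := by
    have := fanAngle_even h₁ h₂ 0
    simpa using this
  have hH1 : fanAngle h₁ h₂ 1 = h₂ := by
    have := fanAngle_odd h₁ h₂ 0
    simpa using this
  refine ⟨R, ⟨hR.1, hRR₀⟩, s • e, fanAngle h₁ h₂, ?_, hcH, hltH, hperH, ?_, ?_, ?_, ?_, ?_⟩
  · rw [norm_smul, hN.norm_eq_one, mul_one]
    rcases hs with rfl | rfl <;> simp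
  · intro m
    rw [hH0, h₁0]
    rcases Int.even_or_odd' m with ⟨k, rfl | rfl⟩
    · rw [fanAngle_even]; simp only [h₁0]; push_cast; ring
    · rw [fanAngle_odd]; simp only [h₂0]; push_cast; ring
  · intro r hr
    rw [hH0]
    obtain ⟨τ, -, h⟩ := hp₁'.shrink hr
    exact h.eventually_mem_graph
  · intro r hr
    rw [hH1]
    obtain ⟨τ, -, h⟩ := hp₂'.shrink hr
    exact h.eventually_mem_graph
  · rw [hH0, h₁0]
    exact hker
  · intro γ hγ g δ τ hpol
    obtain ⟨s₁, hs₁, hsW₁, hinit, -⟩ := hN.side γ hγ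
    obtain ⟨r, hr, hrW⟩ := hpol.eventually_radius (P := fun q ↦ 0 < s₁ * W q) hsW₁
    have hr' : 0 < min r R := lt_min hr.1 hR.1
    have hIr : Ioo 0 (min r R) ⊆ Icc 0 R := fun ρ hρ ↦ ⟨hρ.1.le, (hρ.2.trans_le (min_le_right _ _)).le⟩
    have hIr' : Ioo 0 (min r R) ⊆ Ioo 0 R := Ioo_subset_Ioo_right (min_le_right _ _)
    have hgc : ContinuousOn g (Ioo 0 (min r R)) := hpol.continuousOn_angle.mono fun ρ hρ ↦
      ⟨hρ.1.le, (hρ.2.trans_le ((min_le_left _ _).trans hr.2)).le⟩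
    have hW : ∀ ρ ∈ Ioo 0 (min r R), 0 < s₁ * W (polarPoint Φ ρ (g ρ)) := fun ρ hρ ↦
      hrW ρ ⟨hρ.1, hρ.2.trans_le (min_le_left _ _)⟩
    have hne : ∀ m, ∀ ρ ∈ Ioo 0 (min r R), g ρ ≠ fanAngle h₁ h₂ m ρ := by
      intro m ρ hρ heq
      have h1 := hW ρ hρ
      have h2 := hWgraph ρ (hIr' hρ)
      rw [heq] at h1
      rcases Int.even_or_odd' m with ⟨k, rfl | rfl⟩
      · rw [fanAngle_even, polarPoint_add_int, h2.1, mul_zero] at h1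
        exact lt_irrefl _ h1
      · rw [fanAngle_odd, polarPoint_add_int, h2.2, mul_zero] at h1
        exact lt_irrefl _ h1
    have hm : min r R / 2 ∈ Ioo 0 (min r R) := ⟨by linarith, by linarith⟩
    obtain ⟨Q, hQ1, hQ2⟩ := exists_int_between (u := fun m ↦ fanAngle h₁ h₂ m (min r R / 2))
      (fun m ↦ hperH m _) (fun m ↦ hne m _ hm)
    have hQ1' := lt_on_of_ne isPreconnected_Ioo ((hcH Q).mono hIr) hgc
      (fun ρ hρ ↦ (hne Q ρ hρ).symm) hm hQ1
    have hQ2' := lt_on_of_ne isPreconnected_Ioo hgc ((hcH (Q + 1)).mono hIr)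
      (fun ρ hρ ↦ hne (Q + 1) ρ hρ) hm hQ2
    refine ⟨Q, ?_, fun Ψ ↦ ?_⟩
    · filter_upwards [Ioo_mem_nhdsGT hr'] with ρ hρ using ⟨hQ1' ρ hρ, hQ2' ρ hρ⟩
    · rw [hinit Ψ]
      have hmem : polarPoint Φ (min r R / 2) (g (min r R / 2)) ∈
          angularSector Φ (fanAngle h₁ h₂ Q) (fanAngle h₁ h₂ (Q + 1)) R :=
        ⟨_, hIr' hm, _, ⟨hQ1, hQ2⟩, rfl⟩
      have hWm := hW _ hm
      rcases Int.even_or_odd' Q with ⟨k, rfl | rfl⟩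
      · rw [fanAngle_even_sector] at hmem
        have h1 := hside₁ _ hmem
        have h2 : s₁ = s := by
          rcases hs with rfl | rfl <;> rcases hs₁ with rfl | rfl <;> linarith
        rw [if_pos (even_two_mul k), h2]
      · rw [fanAngle_odd_sector] at hmem
        have h1 := hside₂ _ hmem
        have h2 : s₁ = -s := by
          rcases hs with rfl | rfl <;> rcases hs₁ with rfl | rfl <;> linarith
        rw [if_neg (Int.not_even_two_mul_add_one k), h2, neg_smul]

end NullFan

/-! ### The singular set near a peak -/

section SingularFan

variable {M : Type*} [TopologicalSpace M] [ChartedSpace Plane M] [IsManifold (𝓡 2) ∞ M]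
  (o : SurfaceOrientation M)
  {V : M → Type*} [TopologicalSpace (TotalSpace Plane V)]
  [∀ x, NormedAddCommGroup (V x)] [∀ x, InnerProductSpace ℝ (V x)]
  [FiberBundle Plane V] [VectorBundle ℝ Plane V]
  (C : CoherentTangentBundle V) (μ : CoOrientation V)

/-- The singular set in the disc of radius `R` about `p`, in polar coordinates: it consists of `p`
and of the `k ≠ 1` curves of polar equation `θ = f i ρ`. -/
structure IsSingularFan (p : M) (Φ : OpenPartialHomeomorph M ℂ) (R : ℝ) {k : ℕ}
    (f : Fin k → ℝ → ℝ) : Prop where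
  continuousOn : ∀ i, ContinuousOn (f i) (Icc 0 R)
  ne : ∀ i j, i ≠ j → ∀ ρ ∈ Ioo 0 R, ∀ m : ℤ, f i ρ ≠ f j ρ + m * (2 * Real.pi)
  singular : singularSet C ∩ complexDisc Φ R = insert p (⋃ i, angularGraph Φ (f i) R)
  exists_curve : ∀ i, ∃ c τ, IsRegularCurve c (Icc 0 1) ∧ IsPolarArc Φ c (f i) R τ
  card_ne_one : k ≠ 1
  admissible : ∀ γ, IsRegularCurve γ (Icc 0 1) → γ 0 = p → (∀ t ∈ Ioc (0 : ℝ) 1, γ t ≠ p) →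
    (∀ᶠ t in 𝓝[>] (0 : ℝ), γ t ∈ singularSet C) → IsAdmissible C p γ
  region : ∀ A : Set M, IsPreconnected A → A ⊆ complexDisc Φ R → Disjoint A (singularSet C) →
      A ⊆ positiveRegion o C μ ∨ A ⊆ negativeRegion o C μ
  oscillation : ∀ i, ∀ ρ ∈ Icc 0 R, |f i ρ - f i 0| < 1 / 2

variable {o C μ}

/-- The singular arcs of a peak start as curves whose velocities are not null vectors. -/
theorem isAdmissible_of_singular {p : M} {O : Set M} (hO : IsOpen O) (hp : p ∈ O)
    (hA : ∀ q ∈ O \ {p}, q ∈ singularSet C → IsA2Point o C μ q) {γ : ℝ → M}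
    (hγ : IsRegularCurve γ (Icc 0 1)) (h0 : γ 0 = p) (hne : ∀ t ∈ Ioc (0 : ℝ) 1, γ t ≠ p)
    (hS : ∀ᶠ t in 𝓝[>] (0 : ℝ), γ t ∈ singularSet C) : IsAdmissible C p γ := by
  refine ⟨hγ, h0, Or.inr ?_⟩
  have h1 : ∀ᶠ t in 𝓝[>] (0 : ℝ), γ t ∈ O :=
    (hγ.tendsto_start h0).eventually (hO.mem_nhds hp)
  obtain ⟨t₀, ht₀, hsub⟩ := mem_nhdsGT_iff_exists_Ioo_subset.mp
    ((hS.and h1).and (Ioo_mem_nhdsGT one_pos))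
  filter_upwards [Ioo_mem_nhdsGT ht₀] with t ht
  obtain ⟨⟨htS, htO⟩, ht1⟩ := hsub ht
  refine ⟨htS, (hA _ ⟨htO, hne t (Ioo_subset_Ioc_self ht1)⟩ htS).map_velocity_ne_zero hγ
    (Ioo_subset_Icc_self ht1) ?_⟩
  have h2 : Ioo 0 t₀ ∈ 𝓝[Icc 0 1] t := mem_nhdsWithin_of_mem_nhds (isOpen_Ioo.mem_nhds ht)
  filter_upwards [h2] with u hu using (hsub hu).1.1

theorem IsPolarChart.eventually_disc_subset {Φ : OpenPartialHomeomorph M ℂ} {p : M} {R : ℝ}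
    (h : IsPolarChart Φ p R) {O : Set M} (hO : O ∈ 𝓝 p) :
    ∀ᶠ r in 𝓝[>] (0 : ℝ), complexDisc Φ r ⊆ O := by
  have h1 : Φ.symm ⁻¹' O ∈ 𝓝 (0 : ℂ) := by
    rw [← h.map_center]
    refine (Φ.continuousAt_symm (Φ.map_source h.mem_source)).preimage_mem_nhds ?_
    rwa [Φ.left_inv h.mem_source]
  obtain ⟨d, hd, hsub⟩ := Metric.mem_nhds_iff.mp h1
  filter_upwards [Ioo_mem_nhdsGT hd] with r hr q hq
  have := hsub (Metric.ball_subset_ball hr.2.le hq.2)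
  rwa [mem_preimage, Φ.left_inv hq.1] at this

theorem eventually_le_const {d : ℝ} (hd : 0 < d) : ∀ᶠ r in 𝓝[>] (0 : ℝ), r ≤ d := by
  filter_upwards [Ioo_mem_nhdsGT hd] with r hr using hr.2.le

/-- The singular set at a peak is a fan.  A single singular curve is impossible, since its
complement would be connected, while both signs of the area density occur near an `A₂`-point. -/
theorem exists_isSingularFan [T2Space M] {p : M} (hp : IsPeak o C μ p)
    {Φ : OpenPartialHomeomorph M ℂ} {R₀ : ℝ} (hΦ : IsSmoothPolarChart Φ p R₀) :
    ∃ R ∈ Ioc 0 R₀, ∃ (k : ℕ) (f : Fin k → ℝ → ℝ), IsSingularFan o C μ p Φ R f := by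
  have hpi := Real.pi_pos
  obtain ⟨hpS, -, φ, -, hpφ, hA, -, k, c, hc, hdisj, hsing⟩ := hp
  obtain ⟨N, hN, hpN, hreg⟩ := exists_nhds_subset_region o C μ p
  have hne : ∀ i, ∀ t ∈ Ioc (0 : ℝ) 1, c i t ≠ p := fun i t ht heq ↦ by
    have := (hc i).2.1 (Ioc_subset_Icc_self ht) (left_mem_Icc.mpr zero_le_one)
      (heq.trans (hc i).2.2.symm)
    exact ht.1.ne' this
  have harc : ∀ i, ∃ δ ≤ R₀, ∃ τ, ∃ g, IsPolarArc Φ (c i) g δ τ := fun i ↦ by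
    obtain ⟨α, -, -, hα⟩ := exists_polar_form (tangentCoord Φ p (initialVelocity p (c i))) 0
    obtain ⟨δ, hδ, τ, g, h, -⟩ := hΦ.exists_isPolarArc (hc i).1 (hc i).2.2 (hne i) hα
    exact ⟨δ, hδ, τ, g, h⟩
  choose δ hδR τ f hf using harc
  have hosc : ∀ i, ∀ᶠ r in 𝓝[>] (0 : ℝ), ∀ ρ ∈ Icc 0 r, |f i ρ - f i 0| < 1 / 2 := fun i ↦ by
    have h1 := ((hf i).continuousOn_angle 0 (left_mem_Icc.mpr (hf i).radius_pos.le)).eventually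
      (Metric.ball_mem_nhds _ (show (0 : ℝ) < 1 / 2 by norm_num))
    obtain ⟨d, hd, hsub⟩ := Metric.mem_nhdsWithin_iff.mp h1
    filter_upwards [Ioo_mem_nhdsGT hd, eventually_le_const (hf i).radius_pos] with r hr hrδ ρ hρ
    have h2 : ρ ∈ Metric.ball 0 d ∩ Icc 0 (δ i) := by
      refine ⟨?_, hρ.1, hρ.2.trans hrδ⟩
      rw [Metric.mem_ball, Real.dist_eq, sub_zero, abs_of_nonneg hρ.1]
      exact hρ.2.trans_lt hr.2
    simpa [Real.dist_eq] using hsub h2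
  obtain ⟨R, ⟨⟨hRpos, hRR₀⟩, hRδ⟩, hRO, hRosc⟩ := ((((eventually_mem_nhdsWithin (s := Ioi (0 : ℝ))).and
    (eventually_le_const hΦ.pos)).and (eventually_all.mpr fun i ↦
      eventually_le_const (hf i).radius_pos)).and
    ((hΦ.toIsPolarChart.eventually_disc_subset (inter_mem (φ.open_source.mem_nhds hpφ)
      (hN.mem_nhds hpN))).and (eventually_all.mpr hosc))).exists
  have hR : 0 < R := hRpos
  have hΦR := (hΦ.shrink hR hRR₀).toIsPolarChart
  have hf' : ∀ i, ∃ τ', IsPolarArc Φ (c i) (f i) R τ' := fun i ↦ by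
    obtain ⟨τ', -, h⟩ := (hf i).shrink ⟨hR, hRδ i⟩
    exact ⟨τ', h⟩
  choose τ' hf' using hf'
  have hcR : ∀ i, c i '' Icc 0 1 ∩ complexDisc Φ R = insert p (angularGraph Φ (f i) R) := fun i ↦
    (hf' i).image_inter_disc hΦR (Ico_subset_Icc_self.trans
      (Icc_subset_Icc_right (hf' i).time_mem.2)) subset_rfl
  have hsingR : singularSet C ∩ complexDisc Φ R = insert p (⋃ i, angularGraph Φ (f i) R) := by
    have h1 : ∀ q ∈ complexDisc Φ R, (q ∈ singularSet C ↔ q = p ∨ ∃ i, q ∈ c i '' Icc 0 1) := by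
      intro q hq
      have hqφ := (hRO hq).1
      have h2 := Set.ext_iff.mp hsing q
      simp only [mem_inter_iff, hqφ, and_true, mem_union, mem_singleton_iff, mem_iUnion] at h2
      exact h2
    ext q
    constructor
    · rintro ⟨hqS, hq⟩
      rcases (h1 q hq).mp hqS with h | ⟨i, h⟩
      · exact Or.inl h
      · have h3 : q ∈ insert p (angularGraph Φ (f i) R) := hcR i ▸ ⟨h, hq⟩
        rcases h3 with h3 | h3
        · exact Or.inl h3
        · exact Or.inr (mem_iUnion.mpr ⟨i, h3⟩)
    · rintro (rfl | h)
      · exact ⟨hpS, hΦR.center_mem_disc hR⟩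
      · obtain ⟨i, hi⟩ := mem_iUnion.mp h
        have h3 : q ∈ c i '' Icc 0 1 ∩ complexDisc Φ R := (hcR i).symm ▸ Or.inr hi
        exact ⟨(h1 q h3.2).mpr (Or.inr ⟨i, h3.1⟩), h3.2⟩
  have hregR : ∀ A : Set M, IsPreconnected A → A ⊆ complexDisc Φ R → Disjoint A (singularSet C) →
      A ⊆ positiveRegion o C μ ∨ A ⊆ negativeRegion o C μ := fun A hA hAd hAS ↦
    hreg A hA (fun q hq ↦ (hRO (hAd hq)).2) hAS
  refine ⟨R, ⟨hR, hRR₀⟩, k, f, fun i ↦ (hf' i).continuousOn_angle, ?_, hsingR,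
    fun i ↦ ⟨c i, τ' i, (hc i).1, hf' i⟩, ?_,
    fun γ hγ h0 hγp hγS ↦ isAdmissible_of_singular φ.open_source hpφ hA hγ h0 hγp hγS, hregR,
    fun i ρ hρ ↦ hRosc i ρ hρ⟩
  · intro i j hij ρ hρ m heq
    obtain ⟨t, ht, hteq⟩ := (hf' i).exists_time_polarPoint hρ
    obtain ⟨s, hs, hseq⟩ := (hf' j).exists_time_polarPoint hρ
    rw [heq, polarPoint_add_int, ← hseq] at hteq
    exact Set.disjoint_left.mp (hdisj i j hij)
      ⟨t, ⟨ht.1, ht.2.le.trans (hf' i).time_mem.2⟩, rfl⟩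
      ⟨s, ⟨hs.1, hs.2.le.trans (hf' j).time_mem.2⟩, hteq.symm⟩
  · rintro rfl
    have hIoo : Ioo 0 R ⊆ Icc 0 R := Ioo_subset_Icc_self
    have hfc := ((hf' 0).continuousOn_angle).mono hIoo
    have hgr : angularGraph Φ (fun ρ ↦ f 0 ρ + 2 * Real.pi) R = angularGraph Φ (f 0) R := by
      simpa using angularGraph_add_int (Φ := Φ) (f 0) R 1
    have hlt : ∀ ρ ∈ Ioo 0 R, f 0 ρ < f 0 ρ + 2 * Real.pi := fun ρ _ ↦ by linarith
    have hpre := hΦR.isPreconnected_angularSector (b := fun ρ ↦ f 0 ρ + 2 * Real.pi) le_rfl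
      hfc (hfc.add continuousOn_const) hlt
    have hSd : Disjoint (angularSector Φ (f 0) (fun ρ ↦ f 0 ρ + 2 * Real.pi) R)
        (singularSet C) := by
      rw [Set.disjoint_left]
      intro q hq hqS
      have hqd := hΦR.angularSector_subset_disc le_rfl hq
      have h1 : q ∈ insert p (⋃ i, angularGraph Φ (f i) R) := hsingR ▸ ⟨hqS, hqd.1⟩
      rcases h1 with h1 | h1
      · exact hqd.2 h1
      · obtain ⟨i, hi⟩ := mem_iUnion.mp h1
        rw [Fin.fin_one_eq_zero i] at hi
        exact Set.disjoint_left.mp (hΦR.disjoint_sector_graph_left le_rfl fun ρ _ ↦ le_rfl) hq hi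
    have hm : R / 2 ∈ Ioo 0 R := ⟨by linarith, by linarith⟩
    have hq₀g : polarPoint Φ (R / 2) (f 0 (R / 2)) ∈ angularGraph Φ (f 0) R := ⟨_, hm, rfl⟩
    have hq₀ : polarPoint Φ (R / 2) (f 0 (R / 2)) ∈ singularSet C ∩ complexDisc Φ R :=
      hsingR ▸ Or.inr (mem_iUnion.mpr ⟨0, hq₀g⟩)
    have hA2 := hA _ ⟨(hRO hq₀.2).1, (hΦR.angularGraph_subset_disc le_rfl hq₀g).2⟩ hq₀.1
    obtain ⟨⟨x, hxR, hx⟩, ⟨y, hyR, hy⟩⟩ :=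
      hA2.1.nonempty_inter ((isOpen_complexDisc R).mem_nhds hq₀.2)
    have hmem : ∀ q ∈ complexDisc Φ R, q ∉ singularSet C →
        q ∈ angularSector Φ (f 0) (fun ρ ↦ f 0 ρ + 2 * Real.pi) R := by
      intro q hq hqS
      have hnot : ¬ (q = p ∨ q ∈ angularGraph Φ (f 0) R) := by
        rintro (h | h)
        · exact hqS (h ▸ hpS)
        · have : q ∈ singularSet C ∩ complexDisc Φ R :=
            hsingR ▸ Or.inr (mem_iUnion.mpr ⟨0, h⟩)
          exact hqS this.1
      obtain ⟨ρ, hρ, θ, h1, h2, h3⟩ := hΦR.exists_polar_of_mem_disc hq (fun h ↦ hnot (Or.inl h)) (f 0)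
      refine ⟨ρ, hρ, θ, ⟨lt_of_le_of_ne h1 fun h ↦ hnot (Or.inr ⟨ρ, hρ, ?_⟩), h2⟩, h3⟩
      rw [h3, h]
    have hx' := hmem x hxR hx.1
    have hy' := hmem y hyR hy.1
    rcases hregR _ hpre (fun q hq ↦ (hΦR.angularSector_subset_disc le_rfl hq).1) hSd with h | h
    · exact Set.disjoint_left.mp disjoint_positiveRegion_negativeRegion (h hy') hy
    · exact Set.disjoint_left.mp disjoint_positiveRegion_negativeRegion hx (h hx')

end SingularFan

/-! ### Singular sectors are strips between consecutive singular curves -/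

/-- `a` and `b` are consecutive lifts of the angle functions `f i`. -/
structure IsSingularStrip {k : ℕ} (f : Fin k → ℝ → ℝ) (R : ℝ) (a b : ℝ → ℝ) : Prop where
  left : ∃ i, ∃ m : ℤ, a = fun ρ ↦ f i ρ + m * (2 * Real.pi)
  right : ∃ i, ∃ m : ℤ, b = fun ρ ↦ f i ρ + m * (2 * Real.pi)
  lt : ∀ ρ ∈ Ioo 0 R, a ρ < b ρ
  le : ∀ ρ ∈ Ioo 0 R, b ρ ≤ a ρ + 2 * Real.pi
  gap : ∀ ρ ∈ Ioo 0 R, ∀ i, ∀ m : ℤ,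
    ¬ (a ρ < f i ρ + m * (2 * Real.pi) ∧ f i ρ + m * (2 * Real.pi) < b ρ)

theorem IsSingularStrip.add_int {k : ℕ} {f : Fin k → ℝ → ℝ} {R : ℝ} {a b : ℝ → ℝ}
    (h : IsSingularStrip f R a b) (n : ℤ) :
    IsSingularStrip f R (fun ρ ↦ a ρ + n * (2 * Real.pi)) (fun ρ ↦ b ρ + n * (2 * Real.pi)) := by
  obtain ⟨i, m, hi⟩ := h.left
  obtain ⟨j, l, hj⟩ := h.right
  refine ⟨⟨i, m + n, ?_⟩, ⟨j, l + n, ?_⟩, fun ρ hρ ↦ ?_, fun ρ hρ ↦ ?_, fun ρ hρ i' m' h' ↦ ?_⟩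
  · rw [hi]; funext ρ; push_cast; ring
  · rw [hj]; funext ρ; push_cast; ring
  · linarith [h.lt ρ hρ]
  · linarith [h.le ρ hρ]
  · refine h.gap ρ hρ i' (m' - n) ⟨?_, ?_⟩
    · push_cast; linarith [h'.1]
    · push_cast; linarith [h'.2]

section Strips

variable {M : Type*} [TopologicalSpace M] [ChartedSpace Plane M] [IsManifold (𝓡 2) ∞ M]
  {o : SurfaceOrientation M}
  {V : M → Type*} [TopologicalSpace (TotalSpace Plane V)]
  [∀ x, NormedAddCommGroup (V x)] [∀ x, InnerProductSpace ℝ (V x)]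
  [FiberBundle Plane V] [VectorBundle ℝ Plane V]
  {C : CoherentTangentBundle V} {μ : CoOrientation V}
  {p : M} {Φ : OpenPartialHomeomorph M ℂ} {R : ℝ} {k : ℕ} {f : Fin k → ℝ → ℝ}

namespace IsSingularFan

theorem lift_lt (hF : IsSingularFan o C μ p Φ R f) {i j : Fin k} {m n : ℤ} {ρ₀ : ℝ}
    (hρ₀ : ρ₀ ∈ Ioo 0 R)
    (h : f i ρ₀ + m * (2 * Real.pi) < f j ρ₀ + n * (2 * Real.pi)) {ρ : ℝ} (hρ : ρ ∈ Ioo 0 R) :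
    f i ρ + m * (2 * Real.pi) < f j ρ + n * (2 * Real.pi) := by
  rcases eq_or_ne i j with rfl | hij
  · linarith
  · refine lt_on_of_ne isPreconnected_Ioo (f := fun ρ ↦ f i ρ + m * (2 * Real.pi))
      (g := fun ρ ↦ f j ρ + n * (2 * Real.pi))
      (((hF.continuousOn i).mono Ioo_subset_Icc_self).add continuousOn_const)
      (((hF.continuousOn j).mono Ioo_subset_Icc_self).add continuousOn_const)
      (fun x hx heq ↦ hF.ne i j hij x hx (n - m) ?_) hρ₀ h ρ hρ
    push_cast
    linarith

/-- The singular set in a smaller disc. -/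
theorem mono (hF : IsSingularFan o C μ p Φ R f) (hΦ : IsPolarChart Φ p R) {r : ℝ}
    (hr : r ∈ Ioc 0 R) : IsSingularFan o C μ p Φ r f := by
  refine ⟨fun i ↦ (hF.continuousOn i).mono (Icc_subset_Icc_right hr.2),
    fun i j hij ρ hρ ↦ hF.ne i j hij ρ (Ioo_subset_Ioo_right hr.2 hρ), ?_, fun i ↦ ?_,
    hF.card_ne_one, hF.admissible,
    fun A hA hAd ↦ hF.region A hA (hAd.trans (complexDisc_mono hr.2)),
    fun i ρ hρ ↦ hF.oscillation i ρ (Icc_subset_Icc_right hr.2 hρ)⟩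
  · rw [← inter_eq_right.mpr (complexDisc_mono (Φ := Φ) hr.2), ← inter_assoc, hF.singular]
    ext q
    constructor
    · rintro ⟨rfl | h, hq⟩
      · exact mem_insert _ _
      · obtain ⟨i, ρ, hρ, rfl⟩ := mem_iUnion.mp h
        exact Or.inr (mem_iUnion.mpr ⟨i, ρ, ⟨hρ.1,
          (hΦ.polarPoint_mem_disc_iff (Ioo_subset_Icc_self hρ)).mp hq⟩, rfl⟩)
    · rintro (rfl | h)
      · exact ⟨mem_insert _ _, hΦ.center_mem_disc hr.1⟩
      · obtain ⟨i, hi⟩ := mem_iUnion.mp h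
        exact ⟨Or.inr (mem_iUnion.mpr ⟨i, angularGraph_mono_radius hr.2 hi⟩),
          (hΦ.angularGraph_subset_disc hr.2 hi).1⟩
  · obtain ⟨c, τ, hc, h⟩ := hF.exists_curve i
    obtain ⟨τ', -, h'⟩ := h.shrink hr
    exact ⟨c, τ', hc, h'⟩

/-- Every angle that is not singular lies in a strip. -/
theorem exists_strip (hF : IsSingularFan o C μ p Φ R f) (hk : k ≠ 0) {ρ₀ θ : ℝ}
    (hρ₀ : ρ₀ ∈ Ioo 0 R) (hθ : ∀ i, ∀ m : ℤ, θ ≠ f i ρ₀ + m * (2 * Real.pi)) :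
    ∃ a b, IsSingularStrip f R a b ∧ a ρ₀ < θ ∧ θ < b ρ₀ := by
  have hpi := Real.pi_pos
  have : Nonempty (Fin k) := ⟨⟨0, Nat.pos_of_ne_zero hk⟩⟩
  have hm : ∀ i, ∃ m : ℤ, f i ρ₀ + m * (2 * Real.pi) < θ ∧
      θ < f i ρ₀ + ((m + 1 : ℤ) : ℝ) * (2 * Real.pi) := fun i ↦ by
    refine ⟨⌊(θ - f i ρ₀) / (2 * Real.pi)⌋, lt_of_le_of_ne ?_ (hθ i _).symm, ?_⟩
    · have := Int.floor_le ((θ - f i ρ₀) / (2 * Real.pi))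
      rw [le_div_iff₀ (by positivity)] at this
      linarith
    · have := Int.lt_floor_add_one ((θ - f i ρ₀) / (2 * Real.pi))
      rw [div_lt_iff₀ (by positivity)] at this
      push_cast
      linarith
  choose m hm1 hm2 using hm
  obtain ⟨i₀, hi₀⟩ := Finite.exists_max fun i ↦ f i ρ₀ + m i * (2 * Real.pi)
  obtain ⟨i₁, hi₁⟩ := Finite.exists_min fun i ↦ f i ρ₀ + ((m i + 1 : ℤ) : ℝ) * (2 * Real.pi)
  refine ⟨_, _, ⟨⟨i₀, m i₀, rfl⟩, ⟨i₁, m i₁ + 1, rfl⟩, ?_, ?_, ?_⟩, hm1 i₀, hm2 i₁⟩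
  · exact fun ρ hρ ↦ hF.lift_lt hρ₀ ((hm1 i₀).trans (hm2 i₁)) hρ
  · intro ρ hρ
    by_contra hcon
    have h1 : f i₀ ρ + ((m i₀ + 1 : ℤ) : ℝ) * (2 * Real.pi) <
        f i₁ ρ + ((m i₁ + 1 : ℤ) : ℝ) * (2 * Real.pi) := by
      push_cast at hcon ⊢
      linarith
    have h2 := hF.lift_lt hρ h1 hρ₀
    exact absurd (hi₁ i₀) (not_le.mpr h2)
  · rintro ρ hρ l n ⟨h1, h2⟩
    have h3 := hF.lift_lt hρ h1 hρ₀
    have h4 := hF.lift_lt hρ h2 hρ₀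
    have h5 := hi₀ l
    have h6 := hi₁ l
    have h7 : (m l : ℝ) < n := by
      by_contra hcon
      have := mul_le_mul_of_nonneg_right (not_lt.mp hcon) (show 0 ≤ 2 * Real.pi by positivity)
      linarith
    have h8 : (n : ℝ) < ((m l + 1 : ℤ) : ℝ) := by
      by_contra hcon
      have := mul_le_mul_of_nonneg_right (not_lt.mp hcon) (show 0 ≤ 2 * Real.pi by positivity)
      linarith
    have h7' : m l < n := by exact_mod_cast h7
    have h8' : n < m l + 1 := by exact_mod_cast h8
    omega

theorem center_mem (hF : IsSingularFan o C μ p Φ R f) : p ∈ singularSet C := by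
  have : p ∈ singularSet C ∩ complexDisc Φ R := hF.singular.symm ▸ mem_insert _ _
  exact this.1

theorem graph_subset (hF : IsSingularFan o C μ p Φ R f) (i : Fin k) :
    angularGraph Φ (f i) R ⊆ singularSet C := fun q hq ↦ by
  have : q ∈ singularSet C ∩ complexDisc Φ R :=
    hF.singular.symm ▸ Or.inr (mem_iUnion.mpr ⟨i, hq⟩)
  exact this.1

theorem polarPoint_mem_iff (hF : IsSingularFan o C μ p Φ R f) (hΦ : IsPolarChart Φ p R) {ρ θ : ℝ}
    (hρ : ρ ∈ Ioo 0 R) : polarPoint Φ ρ θ ∈ singularSet C ↔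
      ∃ i, ∃ m : ℤ, θ = f i ρ + m * (2 * Real.pi) := by
  have hd : polarPoint Φ ρ θ ∈ complexDisc Φ R :=
    (hΦ.polarPoint_mem_disc_iff (Ioo_subset_Icc_self hρ)).mpr hρ.2
  constructor
  · intro h
    have h1 : polarPoint Φ ρ θ ∈ insert p (⋃ i, angularGraph Φ (f i) R) := hF.singular ▸ ⟨h, hd⟩
    rcases h1 with h1 | h1
    · exact absurd h1 (hΦ.polarPoint_ne (Ioo_subset_Ioc_self hρ) θ)
    · obtain ⟨i, hi⟩ := mem_iUnion.mp h1
      exact ⟨i, (hΦ.polarPoint_mem_graph_iff le_rfl hρ).mp hi⟩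
  · rintro ⟨i, hm⟩
    exact hF.graph_subset i ((hΦ.polarPoint_mem_graph_iff le_rfl hρ).mpr hm)

theorem mem_disc_singular (hF : IsSingularFan o C μ p Φ R f) {r : ℝ} (hΦ : IsPolarChart Φ p R)
    (hr : r ≤ R) {q : M} (hq : q ∈ complexDisc Φ r) (hqS : q ∈ singularSet C) :
    q = p ∨ ∃ i, q ∈ angularGraph Φ (f i) r := by
  rcases eq_or_ne q p with h | h
  · exact Or.inl h
  · obtain ⟨ρ, hρ, θ, -, -, rfl⟩ := hΦ.exists_polar_of_mem_disc hq h (fun _ ↦ 0)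
    have hρR : ρ ∈ Ioo 0 R := ⟨hρ.1, hρ.2.trans_le hr⟩
    obtain ⟨i, hm⟩ := (hF.polarPoint_mem_iff hΦ hρR).mp hqS
    exact Or.inr ⟨i, (hΦ.polarPoint_mem_graph_iff hr hρ).mpr hm⟩

end IsSingularFan

namespace IsSingularStrip

variable {a b : ℝ → ℝ}

theorem continuousOn_left (h : IsSingularStrip f R a b) (hF : IsSingularFan o C μ p Φ R f) :
    ContinuousOn a (Icc 0 R) := by
  obtain ⟨i, m, rfl⟩ := h.left
  exact (hF.continuousOn i).add continuousOn_const

theorem continuousOn_right (h : IsSingularStrip f R a b) (hF : IsSingularFan o C μ p Φ R f) :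
    ContinuousOn b (Icc 0 R) := by
  obtain ⟨i, m, rfl⟩ := h.right
  exact (hF.continuousOn i).add continuousOn_const

theorem lt_add (h : IsSingularStrip f R a b) (hF : IsSingularFan o C μ p Φ R f) :
    ∀ ρ ∈ Ioo 0 R, b ρ < a ρ + 2 * Real.pi := by
  have hpi := Real.pi_pos
  intro ρ hρ
  refine lt_of_le_of_ne (h.le ρ hρ) fun heq ↦ ?_
  obtain ⟨i, m, ha⟩ := h.left
  have hk : 2 ≤ k := by
    have := hF.card_ne_one
    have := i.pos
    omega
  have : Nontrivial (Fin k) := Fin.nontrivial_iff_two_le.mpr hk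
  obtain ⟨l, hl⟩ := exists_ne i
  have haρ : a ρ = f i ρ + m * (2 * Real.pi) := by rw [ha]
  set n := ⌈(a ρ - f l ρ) / (2 * Real.pi)⌉ with hn
  have h1 : a ρ ≤ f l ρ + n * (2 * Real.pi) := by
    have := Int.le_ceil ((a ρ - f l ρ) / (2 * Real.pi))
    rw [div_le_iff₀ (by positivity), ← hn] at this
    linarith
  have h2 : f l ρ + n * (2 * Real.pi) < a ρ + 2 * Real.pi := by
    have := Int.ceil_lt_add_one ((a ρ - f l ρ) / (2 * Real.pi))
    rw [← hn, ← sub_lt_iff_lt_add, lt_div_iff₀ (by positivity)] at this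
    linarith
  refine h.gap ρ hρ l n ⟨lt_of_le_of_ne h1 fun h3 ↦ ?_, by linarith⟩
  refine hF.ne l i hl ρ hρ (m - n) ?_
  push_cast
  linarith

theorem disjoint_singularSet (h : IsSingularStrip f R a b) (hF : IsSingularFan o C μ p Φ R f)
    (hΦ : IsPolarChart Φ p R) {r : ℝ} (hr : r ≤ R) :
    Disjoint (angularSector Φ a b r) (singularSet C) := by
  rw [Set.disjoint_left]
  rintro _ ⟨ρ, hρ, θ, hθ, rfl⟩ hS
  have hρR : ρ ∈ Ioo 0 R := ⟨hρ.1, hρ.2.trans_le hr⟩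
  obtain ⟨i, m, hm⟩ := (hF.polarPoint_mem_iff hΦ hρR).mp hS
  exact h.gap ρ hρR i m (hm ▸ hθ)

theorem frontier_subset (h : IsSingularStrip f R a b) (hF : IsSingularFan o C μ p Φ R f)
    (hΦ : IsPolarChart Φ p R) {r : ℝ} (h0 : 0 < r) (hr : r ≤ R) :
    frontier (angularSector Φ a b r) ∩ complexDisc Φ r =
      insert p (angularGraph Φ a r ∪ angularGraph Φ b r) :=
  have hsub : Ioo 0 r ⊆ Ioo 0 R := Ioo_subset_Ioo_right hr
  hΦ.frontier_angularSector h0 hr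
    ((h.continuousOn_left hF).mono (hsub.trans Ioo_subset_Icc_self))
    ((h.continuousOn_right hF).mono (hsub.trans Ioo_subset_Icc_self))
    (fun ρ hρ ↦ h.lt ρ (hsub hρ)) fun ρ hρ ↦ h.le ρ (hsub hρ)

theorem isOpen (h : IsSingularStrip f R a b) (hF : IsSingularFan o C μ p Φ R f)
    (hΦ : IsPolarChart Φ p R) {r : ℝ} (hr : r ≤ R) : IsOpen (angularSector Φ a b r) :=
  have hsub : Ioo 0 r ⊆ Icc 0 R := (Ioo_subset_Ioo_right hr).trans Ioo_subset_Icc_self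
  hΦ.isOpen_angularSector hr ((h.continuousOn_left hF).mono hsub)
    ((h.continuousOn_right hF).mono hsub)

theorem isConnected (h : IsSingularStrip f R a b) (hF : IsSingularFan o C μ p Φ R f)
    (hΦ : IsPolarChart Φ p R) {r : ℝ} (h0 : 0 < r) (hr : r ≤ R) :
    IsConnected (angularSector Φ a b r) :=
  have hsub : Ioo 0 r ⊆ Ioo 0 R := Ioo_subset_Ioo_right hr
  hΦ.isConnected_angularSector h0 hr
    ((h.continuousOn_left hF).mono (hsub.trans Ioo_subset_Icc_self))
    ((h.continuousOn_right hF).mono (hsub.trans Ioo_subset_Icc_self))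
    fun ρ hρ ↦ h.lt ρ (hsub hρ)

theorem frontier_subset_singularSet (h : IsSingularStrip f R a b)
    (hF : IsSingularFan o C μ p Φ R f) (hΦ : IsPolarChart Φ p R) {r : ℝ} (h0 : 0 < r)
    (hr : r ≤ R) : frontier (angularSector Φ a b r) ∩ complexDisc Φ r ⊆ singularSet C := by
  rw [h.frontier_subset hF hΦ h0 hr]
  obtain ⟨i, m, rfl⟩ := h.left
  obtain ⟨j, n, rfl⟩ := h.right
  rw [angularGraph_add_int, angularGraph_add_int]
  rintro q (rfl | hq | hq)
  · exact hF.center_mem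
  · exact hF.graph_subset i (angularGraph_mono_radius hr hq)
  · exact hF.graph_subset j (angularGraph_mono_radius hr hq)

/-- A strip meets a singular sector only if the two coincide. -/
theorem eq_of_meet (h : IsSingularStrip f R a b) (hF : IsSingularFan o C μ p Φ R f)
    (hΦ : IsPolarChart Φ p R) {r : ℝ} (h0 : 0 < r) (hr : r ≤ R) {Ω : Set M}
    {σ₁ σ₂ : ℝ → M} (hΩ : IsSectorBetween C p (complexDisc Φ r) Ω σ₁ σ₂)
    (hne : (Ω ∩ angularSector Φ a b r).Nonempty) : Ω = angularSector Φ a b r := by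
  obtain ⟨hσ₁, hσ₂, -, ⟨hO, hc, hsub, hfr⟩, hS⟩ := hΩ
  have hfrS : frontier Ω ∩ complexDisc Φ r ⊆ singularSet C := by
    rw [hfr]
    rintro _ (⟨t, ht, rfl⟩ | ⟨t, ht, rfl⟩)
    · exact hσ₁.2 t ht
    · exact hσ₂.2 t ht
  exact eq_of_meet_of_frontier_subset hO hc.isPreconnected hsub hS hfrS (h.isOpen hF hΦ hr)
    (h.isConnected hF hΦ h0 hr).isPreconnected
    (fun q hq ↦ (hΦ.angularSector_subset_disc hr hq).1) (h.disjoint_singularSet hF hΦ hr)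
    (h.frontier_subset_singularSet hF hΦ h0 hr) hne

end IsSingularStrip

namespace IsSingularFan

/-- The singular curves, reparametrised so as to end on the boundary of the disc of radius `r`. -/
theorem exists_arc (hF : IsSingularFan o C μ p Φ R f) (hΦ : IsSmoothPolarChart Φ p R) {r : ℝ}
    (h0 : 0 < r) (hr : r ≤ R) (i : Fin k) (m : ℤ) :
    ∃ σ, IsPolarArc Φ σ (fun ρ ↦ f i ρ + m * (2 * Real.pi)) r 1 ∧
      IsSingularArc C p (complexDisc Φ r) σ := by
  obtain ⟨c, τ, hc, hpol⟩ := hF.exists_curve i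
  obtain ⟨τ', -, hpol'⟩ := hpol.shrink ⟨h0, hr⟩
  have h1 := (hpol'.comp_mul).add_int m
  have hreg := hc.comp_mul hpol'.time_mem
  refine ⟨_, h1, hΦ.isArc_of_isPolarArc hreg h1, fun t ht ↦ ?_⟩
  have h2 : (fun t ↦ c (τ' * t)) t ∈ insert p (angularGraph Φ
      (fun ρ ↦ f i ρ + m * (2 * Real.pi)) r) := by
    rw [← h1.image_inter_disc hΦ.toIsPolarChart subset_rfl Ico_subset_Icc_self]
    exact ⟨⟨t, ht, rfl⟩, (h1.mem_disc_iff hΦ.toIsPolarChart (Ico_subset_Icc_self ht)).mpr ht.2⟩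
  rcases h2 with h2 | h2
  · rw [h2]
    exact hF.center_mem
  · rw [angularGraph_add_int] at h2
    exact hF.graph_subset i (angularGraph_mono_radius hr h2)

/-- Strips are singular sectors. -/
theorem isSectorBetween_strip (hF : IsSingularFan o C μ p Φ R f) (hΦ : IsSmoothPolarChart Φ p R)
    {r : ℝ} (h0 : 0 < r) (hr : r ≤ R) {a b : ℝ → ℝ} (h : IsSingularStrip f R a b) :
    ∃ σ₁ σ₂, IsPolarArc Φ σ₁ a r 1 ∧ IsPolarArc Φ σ₂ b r 1 ∧
      IsSectorBetween C p (complexDisc Φ r) (angularSector Φ a b r) σ₁ σ₂ := by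
  have hΦ' := hΦ.toIsPolarChart
  obtain ⟨i, m, ha⟩ := h.left
  obtain ⟨j, n, hb⟩ := h.right
  obtain ⟨σ₁, hp₁, hs₁⟩ := hF.exists_arc hΦ h0 hr i m
  obtain ⟨σ₂, hp₂, hs₂⟩ := hF.exists_arc hΦ h0 hr j n
  rw [← ha] at hp₁
  rw [← hb] at hp₂
  refine ⟨σ₁, σ₂, hp₁, hp₂, hs₁, hs₂, ?_, ⟨h.isOpen hF hΦ' hr, h.isConnected hF hΦ' h0 hr,
    fun q hq ↦ (hΦ'.angularSector_subset_disc hr hq).1, ?_⟩, h.disjoint_singularSet hF hΦ' hr⟩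
  · rw [hp₁.image_Ioo, hp₂.image_Ioo, Set.disjoint_left]
    rintro _ ⟨ρ, hρ, rfl⟩ h2
    have hρR : ρ ∈ Ioo 0 R := ⟨hρ.1, hρ.2.trans_le hr⟩
    obtain ⟨l, hl⟩ := (hΦ'.polarPoint_mem_graph_iff hr hρ).mp h2
    have h3 := h.lt ρ hρR
    have h4 := h.lt_add hF ρ hρR
    have h5 := int_eq_zero_of_abs_lt (m := l) (by linarith) (by linarith)
    rw [h5, Int.cast_zero, zero_mul, add_zero] at hl
    exact h3.ne hl
  · rw [h.frontier_subset hF hΦ' h0 hr, hp₁.image_Ico hΦ', hp₂.image_Ico hΦ']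
    ext q
    simp only [mem_insert_iff, mem_union]
    tauto

theorem inter_disc_eq (hF : IsSingularFan o C μ p Φ R f) (hΦ : IsPolarChart Φ p R) {r : ℝ}
    (h0 : 0 < r) (hr : r ≤ R) (hk : k = 0) : singularSet C ∩ complexDisc Φ r = {p} := by
  subst hk
  ext q
  rw [mem_singleton_iff]
  constructor
  · rintro ⟨hS, hq⟩
    rcases hF.mem_disc_singular hΦ hr hq hS with h | ⟨i, -⟩
    · exact h
    · exact i.elim0
  · rintro rfl
    exact ⟨hF.center_mem, hΦ.center_mem_disc h0⟩

theorem not_isSingularArc (hF : IsSingularFan o C μ p Φ R f) (hΦ : IsPolarChart Φ p R) {r : ℝ}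
    (h0 : 0 < r) (hr : r ≤ R) (hk : k = 0) {σ : ℝ → M} :
    ¬ IsSingularArc C p (complexDisc Φ r) σ := by
  rintro ⟨hσ, hσS⟩
  have hm : (1 / 2 : ℝ) ∈ Ico (0 : ℝ) 1 := by norm_num
  have h1 : σ (1 / 2) ∈ singularSet C ∩ complexDisc Φ r := ⟨hσS _ hm, hσ.mem _ hm⟩
  rw [hF.inter_disc_eq hΦ h0 hr hk] at h1
  have h2 := hσ.injOn (Ico_subset_Icc_self hm) (left_mem_Icc.mpr zero_le_one)
    ((mem_singleton_iff.mp h1).trans hσ.start.symm)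
  norm_num at h2

/-- Without singular curves, the punctured disc is the only singular sector. -/
theorem isSingularSector_iff_of_eq_zero (hF : IsSingularFan o C μ p Φ R f)
    (hΦ : IsPolarChart Φ p R) {r : ℝ} (h0 : 0 < r) (hr : r ≤ R) (hk : k = 0) {Ω : Set M} :
    IsSingularSector C p (complexDisc Φ r) Ω ↔ Ω = complexDisc Φ r \ {p} := by
  constructor
  · rintro (⟨σ₁, σ₂, hσ, -⟩ | h)
    · exact absurd hσ (hF.not_isSingularArc hΦ h0 hr hk)
    · exact h.2
  · rintro rfl
    exact Or.inr ⟨hF.inter_disc_eq hΦ h0 hr hk, rfl⟩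

theorem not_isPuncturedSector (hF : IsSingularFan o C μ p Φ R f) (hΦ : IsPolarChart Φ p R) {r : ℝ}
    (h0 : 0 < r) (hr : r ≤ R) (hk : k ≠ 0) {Ω : Set M} :
    ¬ IsPuncturedSector C p (complexDisc Φ r) Ω := by
  rintro ⟨hS, -⟩
  have hm : r / 2 ∈ Ioo 0 r := ⟨by linarith, by linarith⟩
  have hmR : r / 2 ∈ Ioo 0 R := ⟨hm.1, hm.2.trans_le hr⟩
  let i : Fin k := ⟨0, Nat.pos_of_ne_zero hk⟩
  have h1 : polarPoint Φ (r / 2) (f i (r / 2)) ∈ singularSet C ∩ complexDisc Φ r :=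
    ⟨hF.graph_subset i ⟨_, hmR, rfl⟩,
      (hΦ.polarPoint_mem_disc_iff (Ioo_subset_Icc_self hmR)).mpr hm.2⟩
  rw [hS] at h1
  exact hΦ.polarPoint_ne (Ioo_subset_Ioc_self hmR) _ h1

/-- If there are singular curves, then the singular sectors are the strips. -/
theorem exists_strip_of_isSingularSector (hF : IsSingularFan o C μ p Φ R f)
    (hΦ : IsPolarChart Φ p R) {r : ℝ} (h0 : 0 < r) (hr : r ≤ R) (hk : k ≠ 0) {Ω : Set M}
    (hΩ : IsSingularSector C p (complexDisc Φ r) Ω) :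
    ∃ a b, IsSingularStrip f R a b ∧ Ω = angularSector Φ a b r ∧
      ∃ σ₁ σ₂, IsSectorBetween C p (complexDisc Φ r) Ω σ₁ σ₂ := by
  rcases hΩ with ⟨σ₁, σ₂, hΩ⟩ | hΩ
  · obtain ⟨q, hq⟩ := hΩ.2.2.2.1.2.1.nonempty
    have hqU := hΩ.2.2.2.1.2.2.1 hq
    have hqS : q ∉ singularSet C := fun h ↦ Set.disjoint_left.mp hΩ.2.2.2.2 hq h
    have hqp : q ≠ p := fun h ↦ hqS (h ▸ hF.center_mem)
    obtain ⟨ρ, hρ, θ, -, -, rfl⟩ := hΦ.exists_polar_of_mem_disc hqU hqp (fun _ ↦ 0)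
    have hρR : ρ ∈ Ioo 0 R := ⟨hρ.1, hρ.2.trans_le hr⟩
    obtain ⟨a, b, hab, ha, hb⟩ := hF.exists_strip hk hρR (θ := θ)
      fun i m hm ↦ hqS ((hF.polarPoint_mem_iff hΦ hρR).mpr ⟨i, m, hm⟩)
    exact ⟨a, b, hab, hab.eq_of_meet hF hΦ h0 hr hΩ ⟨_, hq, ρ, hρ, θ, ⟨ha, hb⟩, rfl⟩, σ₁, σ₂, hΩ⟩
  · exact absurd hΩ (hF.not_isPuncturedSector hΦ h0 hr hk)

/-- Two singular sectors that meet are equal. -/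
theorem sector_eq_of_meet (hF : IsSingularFan o C μ p Φ R f)
    (hΦ : IsPolarChart Φ p R) {r : ℝ} (h0 : 0 < r) (hr : r ≤ R) {Ω Ω' : Set M}
    (hΩ : IsSingularSector C p (complexDisc Φ r) Ω)
    (hΩ' : IsSingularSector C p (complexDisc Φ r) Ω') (hne : (Ω ∩ Ω').Nonempty) : Ω = Ω' := by
  rcases eq_or_ne k 0 with hk | hk
  · rw [(hF.isSingularSector_iff_of_eq_zero hΦ h0 hr hk).mp hΩ,
      (hF.isSingularSector_iff_of_eq_zero hΦ h0 hr hk).mp hΩ']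
  · obtain ⟨-, -, -, -, σ₁, σ₂, hσ⟩ := hF.exists_strip_of_isSingularSector hΦ h0 hr hk hΩ
    obtain ⟨a, b, hab, rfl, -⟩ := hF.exists_strip_of_isSingularSector hΦ h0 hr hk hΩ'
    exact hab.eq_of_meet hF hΦ h0 hr hσ hne

theorem finite_sectors (hF : IsSingularFan o C μ p Φ R f) (hΦ : IsSmoothPolarChart Φ p R) {r : ℝ}
    (h0 : 0 < r) (hr : r ≤ R) : {Ω | IsSingularSector C p (complexDisc Φ r) Ω}.Finite := by
  have hΦ' := hΦ.toIsPolarChart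
  rcases eq_or_ne k 0 with hk | hk
  · refine (finite_singleton (complexDisc Φ r \ {p})).subset fun Ω hΩ ↦ ?_
    exact (hF.isSingularSector_iff_of_eq_zero hΦ' h0 hr hk).mp hΩ
  · have hsub : {Ω | IsSingularSector C p (complexDisc Φ r) Ω} ⊆
        ⋃ i, {Ω | ∃ b, IsSingularStrip f R (f i) b ∧ Ω = angularSector Φ (f i) b r} := by
      intro Ω hΩ
      obtain ⟨a, b, hab, rfl, -⟩ := hF.exists_strip_of_isSingularSector hΦ' h0 hr hk hΩ
      obtain ⟨i, m, rfl⟩ := hab.left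
      have h1 := hab.add_int (-m)
      have h2 : (fun ρ ↦ f i ρ + (m : ℝ) * (2 * Real.pi) + ((-m : ℤ) : ℝ) * (2 * Real.pi)) =
          f i := by
        funext ρ; push_cast; ring
      rw [h2] at h1
      refine mem_iUnion.mpr ⟨i, _, h1, ?_⟩
      rw [← angularSector_add_int _ b r (-m), h2]
    refine (finite_iUnion fun i ↦ Set.Subsingleton.finite ?_).subset hsub
    rintro _ ⟨b, hb, rfl⟩ _ ⟨b', hb', rfl⟩
    obtain ⟨σ₁, σ₂, -, -, hσ⟩ := hF.isSectorBetween_strip hΦ h0 hr hb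
    refine hb'.eq_of_meet hF hΦ' h0 hr hσ ?_
    have hm : r / 2 ∈ Ioo 0 r := ⟨by linarith, by linarith⟩
    have hmR : r / 2 ∈ Ioo 0 R := ⟨hm.1, hm.2.trans_le hr⟩
    obtain ⟨θ, hθ1, hθ2⟩ := exists_between (lt_min (hb.lt _ hmR) (hb'.lt _ hmR))
    exact ⟨polarPoint Φ (r / 2) θ, ⟨_, hm, θ, ⟨hθ1, hθ2.trans_le (min_le_left _ _)⟩, rfl⟩,
      ⟨_, hm, θ, ⟨hθ1, hθ2.trans_le (min_le_right _ _)⟩, rfl⟩⟩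

end IsSingularFan

end Strips

/-! ### Counting null directions -/

/-- Near `0`, the angle function `g` lies between the null lifts `H Q` and `H (Q + 1)`. -/
def IsFanIndex (H : ℤ → ℝ → ℝ) (g : ℝ → ℝ) (Q : ℤ) : Prop :=
  ∀ᶠ ρ in 𝓝[>] (0 : ℝ), H Q ρ < g ρ ∧ g ρ < H (Q + 1) ρ

theorem le_of_eventually_le {f g : ℝ → ℝ} {r : ℝ} (hr : 0 < r) (hf : ContinuousOn f (Icc 0 r))
    (hg : ContinuousOn g (Icc 0 r)) (h : ∀ᶠ ρ in 𝓝[>] (0 : ℝ), f ρ ≤ g ρ) : f 0 ≤ g 0 := by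
  have h0 : (0 : ℝ) ∈ Icc 0 r := left_mem_Icc.mpr hr.le
  have hle := nhdsGT_le_nhdsWithin_Icc hr
  exact le_of_tendsto_of_tendsto ((hf 0 h0).tendsto.mono_left hle)
    ((hg 0 h0).tendsto.mono_left hle) h

theorem le_of_eventually_lt {f g : ℝ → ℝ} {r : ℝ} (hr : 0 < r) (hf : ContinuousOn f (Icc 0 r))
    (hg : ContinuousOn g (Icc 0 r)) (h : ∀ᶠ ρ in 𝓝[>] (0 : ℝ), f ρ < g ρ) : f 0 ≤ g 0 :=
  le_of_eventually_le hr hf hg (h.mono fun _ h ↦ h.le)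

/-- A sequence of distinct reals that starts at its minimum, and in which no term separates two
consecutive ones, is increasing. -/
theorem increasing_of_not_between {n : ℕ} {y : ℕ → ℝ} (hne : ∀ i j, i < j → j ≤ n → y i ≠ y j)
    (hmin : ∀ j ≤ n, y 0 ≤ y j)
    (hup : ∀ j < n, ∀ l ≤ n, ¬ (y j < y l ∧ y l < y (j + 1)))
    (hdown : ∀ j < n, ∀ l ≤ n, ¬ (y (j + 1) < y l ∧ y l < y j)) :
    ∀ j < n, y j < y (j + 1) := by
  intro j
  induction j with
  | zero => exact fun h ↦ lt_of_le_of_ne (hmin 1 h) (hne 0 1 one_pos h)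
  | succ j ih =>
    intro hj
    have h1 := ih (by omega)
    refine lt_of_le_of_ne (not_lt.mp fun h2 ↦ ?_) (hne _ _ (by omega) hj)
    rcases lt_or_gt_of_ne (hne j (j + 1 + 1) (by omega) hj) with h3 | h3
    · exact hup j (by omega) (j + 1 + 1) hj ⟨h3, h2⟩
    · exact hdown (j + 1) hj j (by omega) ⟨h3, h1⟩

section Chain

variable {M : Type*} [TopologicalSpace M] [ChartedSpace Plane M] [IsManifold (𝓡 2) ∞ M]
  {V : M → Type*} [TopologicalSpace (TotalSpace Plane V)]
  [∀ x, NormedAddCommGroup (V x)] [∀ x, InnerProductSpace ℝ (V x)]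
  [FiberBundle Plane V] [VectorBundle ℝ Plane V]
  {C : CoherentTangentBundle V} {p : M} {Φ : OpenPartialHomeomorph M ℂ} {R : ℝ}
  {Γ₁ Γ₂ : ℝ → M} {e : V p} {H : ℤ → ℝ → ℝ}

theorem arccos_inner_of_parity {W : Type*} [NormedAddCommGroup W] [InnerProductSpace ℝ W] {e : W}
    (he : ‖e‖ = 1) {Q Q' : ℤ} (h1 : Q ≤ Q') (h2 : Q' ≤ Q + 1) :
    Real.arccos (inner ℝ (if Even Q then e else -e) (if Even Q' then e else -e)) =
      Real.pi * (Q' - Q) := by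
  rcases h1.eq_or_lt with rfl | hlt
  · rw [sub_self, mul_zero]
    split_ifs <;> simp [he]
  · obtain rfl : Q' = Q + 1 := by omega
    have : (((Q + 1 : ℤ) : ℝ) - Q) = 1 := by push_cast; ring
    rw [this, mul_one]
    simp only [Int.even_add_one]
    split_ifs <;> simp [he]

namespace IsNullFan

theorem strictMono (hN : IsNullFan C p Φ R Γ₁ Γ₂ e H) {ρ : ℝ} (hρ : ρ ∈ Icc 0 R) :
    StrictMono fun m ↦ H m ρ :=
  strictMono_int_of_lt_succ fun m ↦ hN.lt_succ m ρ hρ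

theorem add_two_mul (hN : IsNullFan C p Φ R Γ₁ Γ₂ e H) (m k : ℤ) (ρ : ℝ) :
    H (m + 2 * k) ρ = H m ρ + k * (2 * Real.pi) := by
  induction k using Int.induction_on with
  | zero => simp
  | succ i ih =>
    rw [show m + 2 * ((i : ℤ) + 1) = m + 2 * i + 2 by ring, hN.add_two, ih]
    push_cast; ring
  | pred i ih =>
    have := hN.add_two (m + 2 * (-(i : ℤ) - 1)) ρ
    rw [show m + 2 * (-(i : ℤ) - 1) + 2 = m + 2 * -i by ring, ih] at this
    push_cast at this ⊢; linarith

theorem index_le (hN : IsNullFan C p Φ R Γ₁ Γ₂ e H) (hR : 0 < R) {g g' : ℝ → ℝ} {Q Q' : ℤ}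
    (hg : IsFanIndex H g Q) (hg' : IsFanIndex H g' Q') (h : ∀ᶠ ρ in 𝓝[>] (0 : ℝ), g ρ ≤ g' ρ) :
    Q ≤ Q' := by
  obtain ⟨ρ, ⟨⟨h1, h2⟩, h3⟩, h4⟩ := (((hg.and hg').and h).and (Ioo_mem_nhdsGT hR)).exists
  have h5 : H Q ρ < H (Q' + 1) ρ := (h1.1.trans_le h3).trans h2.2
  have h6 := (hN.strictMono (Ioo_subset_Icc_self h4)).lt_iff_lt.mp h5
  omega

theorem index_add_int (hN : IsNullFan C p Φ R Γ₁ Γ₂ e H) {g : ℝ → ℝ} {Q : ℤ}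
    (hg : IsFanIndex H g Q) (m : ℤ) :
    IsFanIndex H (fun ρ ↦ g ρ + m * (2 * Real.pi)) (Q + 2 * m) := by
  filter_upwards [hg] with ρ hρ
  rw [add_right_comm, hN.add_two_mul, hN.add_two_mul]
  exact ⟨by linarith [hρ.1], by linarith [hρ.2]⟩

/-- Between angle functions whose indices differ by at least two, the limit opening is at
least `π`. -/
theorem pi_le_of_index (hN : IsNullFan C p Φ R Γ₁ Γ₂ e H) {r : ℝ} (hr : r ∈ Ioc 0 R)
    {g g' : ℝ → ℝ} {Q Q' : ℤ} (hg : IsFanIndex H g Q) (hg' : IsFanIndex H g' Q')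
    (hc : ContinuousOn g (Icc 0 r)) (hc' : ContinuousOn g' (Icc 0 r)) (h : Q + 2 ≤ Q') :
    Real.pi ≤ g' 0 - g 0 := by
  have hH := fun m ↦ (hN.continuousOn m).mono (Icc_subset_Icc_right hr.2)
  have h1 : g 0 ≤ H (Q + 1) 0 := le_of_eventually_lt hr.1 hc (hH _) (hg.mono fun _ h ↦ h.2)
  have h2 : H Q' 0 ≤ g' 0 := le_of_eventually_lt hr.1 (hH _) hc' (hg'.mono fun _ h ↦ h.1)
  have h3 : H (Q + 2) 0 ≤ H Q' 0 :=
    (hN.strictMono (left_mem_Icc.mpr (hr.1.le.trans hr.2))).monotone h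
  rw [hN.start (Q + 1)] at h1
  rw [hN.start (Q + 2)] at h3
  push_cast at h1 h3
  linarith

/-- The angles between the initial vectors along an increasing chain with steps of less than `π`
add up to `π` times the number of null directions that are passed. -/
theorem sum_arccos_of_increasing (hN : IsNullFan C p Φ R Γ₁ Γ₂ e H) {r : ℝ} (hr : r ∈ Ioc 0 R)
    {n : ℕ} {y : ℕ → ℝ → ℝ} {Q : ℕ → ℤ} {Ψ : ℕ → V p}
    (hc : ∀ j ≤ n, ContinuousOn (y j) (Icc 0 r)) (hQ : ∀ j ≤ n, IsFanIndex H (y j) (Q j))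
    (hΨ : ∀ j ≤ n, Ψ j = if Even (Q j) then e else -e)
    (hlt : ∀ j < n, ∀ ρ ∈ Ioo 0 r, y j ρ < y (j + 1) ρ)
    (hpi : ∀ j < n, y (j + 1) 0 - y j 0 < Real.pi) :
    ∑ j ∈ Finset.range n, Real.arccos (inner ℝ (Ψ j) (Ψ (j + 1))) = Real.pi * (Q n - Q 0) := by
  rw [← Finset.sum_range_sub (fun j ↦ (Q j : ℝ)) n, Finset.mul_sum]
  refine Finset.sum_congr rfl fun j hj ↦ ?_
  have hj := Finset.mem_range.mp hj
  rw [hΨ j hj.le, hΨ (j + 1) hj]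
  refine arccos_inner_of_parity hN.norm_eq_one ?_ ?_
  · refine hN.index_le (hr.1.trans_le hr.2) (hQ j hj.le) (hQ (j + 1) hj) ?_
    filter_upwards [Ioo_mem_nhdsGT hr.1] with ρ hρ using (hlt j hj ρ hρ).le
  · by_contra hcon
    have := hN.pi_le_of_index hr (hQ j hj.le) (hQ (j + 1) hj) (hc j hj.le) (hc (j + 1) hj)
      (by omega)
    exact absurd (hpi j hj) (not_lt.mpr this)

/-- The sum of the angles along a monotone chain, whose consecutive directions are positively
oriented.  A decreasing chain has only one step: otherwise it would open by more than `2π`. -/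
theorem sum_arccos_of_chain (hN : IsNullFan C p Φ R Γ₁ Γ₂ e H) {r : ℝ} (hr : r ∈ Ioc 0 R)
    {n : ℕ} (hn : 1 ≤ n) {y : ℕ → ℝ → ℝ} {Q : ℕ → ℤ} {Ψ : ℕ → V p}
    (hc : ∀ j ≤ n, ContinuousOn (y j) (Icc 0 r)) (hQ : ∀ j ≤ n, IsFanIndex H (y j) (Q j))
    (hΨ : ∀ j ≤ n, Ψ j = if Even (Q j) then e else -e)
    (hlt : (∀ j < n, ∀ ρ ∈ Ioo 0 r, y j ρ < y (j + 1) ρ) ∨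
      ∀ j < n, ∀ ρ ∈ Ioo 0 r, y (j + 1) ρ < y j ρ)
    (htot : |y n 0 - y 0 0| ≤ 2 * Real.pi)
    (hsin : 2 ≤ n → ∀ j < n, 0 < Real.sin (y (j + 1) 0 - y j 0))
    (hone : n = 1 → |y 1 0 - y 0 0| < Real.pi) :
    ∑ j ∈ Finset.range n, Real.arccos (inner ℝ (Ψ j) (Ψ (j + 1))) = Real.pi * |Q n - Q 0| := by
  have hIoo := Ioo_mem_nhdsGT hr.1
  have hR := hr.1.trans_le hr.2
  rcases hlt with hlt | hlt
  · have hmono : ∀ j < n, y j 0 ≤ y (j + 1) 0 := fun j hj ↦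
      le_of_eventually_lt hr.1 (hc j hj.le) (hc (j + 1) hj)
        (by filter_upwards [hIoo] with ρ hρ using hlt j hj ρ hρ)
    have hle : ∀ j ≤ n, y 0 0 ≤ y j 0 := by
      intro j
      induction j with
      | zero => exact fun _ ↦ le_rfl
      | succ j ih => exact fun hj ↦ (ih (by omega)).trans (hmono j hj)
    have hle' : ∀ i j, i + j ≤ n → y i 0 ≤ y (i + j) 0 := by
      intro i j
      induction j with
      | zero => exact fun _ ↦ le_rfl
      | succ j ih => exact fun hj ↦ (ih (by omega)).trans (hmono (i + j) hj)
    rw [hN.sum_arccos_of_increasing hr hc hQ hΨ hlt]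
    · have hQ0n : Q 0 ≤ Q n := by
        have hle0 : ∀ j ≤ n, Q 0 ≤ Q j := by
          intro j
          induction j with
          | zero => exact fun _ ↦ le_rfl
          | succ j ih =>
            intro hj
            refine (ih (by omega)).trans (hN.index_le hR (hQ j (by omega)) (hQ (j + 1) hj) ?_)
            filter_upwards [hIoo] with ρ hρ using (hlt j hj ρ hρ).le
        exact hle0 n le_rfl
      rw [abs_of_nonneg (by linarith)]
      push_cast
      ring
    · intro j hj
      rcases hn.eq_or_lt with rfl | h2
      · obtain rfl : j = 0 := by omega
        exact (abs_lt.mp (hone rfl)).2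
      · by_contra hcon
        have h3 := hsin h2 j hj
        have h4 : y (j + 1) 0 - y j 0 ≤ 2 * Real.pi := by
          have h5 := hle j hj.le
          have h6 := hle' (j + 1) (n - (j + 1)) (by omega)
          rw [show j + 1 + (n - (j + 1)) = n by omega] at h6
          have := (abs_le.mp htot).2
          linarith
        have h7 : Real.sin (y (j + 1) 0 - y j 0) ≤ 0 := by
          rw [← Real.sin_sub_two_pi]
          refine Real.sin_nonpos_of_nonpos_of_neg_pi_le (by linarith) (by linarith)
        linarith
  · have hmono : ∀ j < n, y (j + 1) 0 ≤ y j 0 := fun j hj ↦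
      le_of_eventually_lt hr.1 (hc (j + 1) hj) (hc j hj.le)
        (by filter_upwards [hIoo] with ρ hρ using hlt j hj ρ hρ)
    rcases hn.eq_or_lt with rfl | h2
    · have h01 := hlt 0 one_pos
      have hQ10 : Q 1 ≤ Q 0 := by
        refine hN.index_le hR (hQ 1 le_rfl) (hQ 0 zero_le_one) ?_
        filter_upwards [hIoo] with ρ hρ using (h01 ρ hρ).le
      rw [Finset.sum_range_one, hΨ 0 zero_le_one, hΨ 1 le_rfl, real_inner_comm,
        arccos_inner_of_parity hN.norm_eq_one hQ10, abs_of_nonpos (by linarith)]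
      · push_cast; ring
      · by_contra hcon
        have := hN.pi_le_of_index hr (hQ 1 le_rfl) (hQ 0 zero_le_one) (hc 1 le_rfl)
          (hc 0 zero_le_one) (by omega)
        have h3 := (abs_lt.mp (hone rfl)).1
        linarith
    · exfalso
      have hle' : ∀ i j, i + j ≤ n → y (i + j) 0 ≤ y i 0 := by
        intro i j
        induction j with
        | zero => exact fun _ ↦ le_rfl
        | succ j ih => exact fun hj ↦ (hmono (i + j) hj).trans (ih (by omega))
      have h3 : ∀ j < n, y (j + 1) 0 < y j 0 - Real.pi := by
        intro j hj
        by_contra hcon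
        have h4 := hsin h2 j hj
        have h5 : Real.sin (y (j + 1) 0 - y j 0) ≤ 0 :=
          Real.sin_nonpos_of_nonpos_of_neg_pi_le (by linarith [hmono j hj]) (by linarith)
        linarith
      have h4 := h3 0 (by omega)
      have h5 := h3 1 h2
      have h6 := hle' 2 (n - 2) (by omega)
      rw [show 2 + (n - 2) = n by omega] at h6
      have := (abs_le.mp htot).1
      norm_num at h4 h5
      linarith

end IsNullFan

end Chain

/-! ### Arcs in a singular sector -/

theorem im_conj_mul_polar (c d α β : ℝ) :
    ((starRingEnd ℂ) ((c : ℂ) * Complex.exp ((α : ℂ) * Complex.I)) *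
      ((d : ℂ) * Complex.exp ((β : ℂ) * Complex.I))).im = c * d * Real.sin (β - α) := by
  have h1 : (starRingEnd ℂ) ((c : ℂ) * Complex.exp ((α : ℂ) * Complex.I)) *
      ((d : ℂ) * Complex.exp ((β : ℂ) * Complex.I)) =
      ((c * d : ℝ) : ℂ) * Complex.exp (((β - α : ℝ) : ℂ) * Complex.I) := by
    rw [map_mul, Complex.conj_ofReal, ← Complex.exp_conj, map_mul, Complex.conj_ofReal,
      Complex.conj_I, mul_mul_mul_comm, ← Complex.exp_add]
    push_cast
    congr 2
    ring
  rw [h1, Complex.im_ofReal_mul, Complex.exp_ofReal_mul_I_im]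

section Reparametrization

variable {M : Type*} [TopologicalSpace M] [ChartedSpace Plane M]

theorem velocity_comp {γ : ℝ → M} (hγ : IsRegularCurve γ (Icc 0 1)) {σ : ℝ → ℝ} {s : ℝ}
    (hmaps : MapsTo σ (Icc 0 1) (Icc 0 1)) {t : ℝ} (ht : t ∈ Icc (0 : ℝ) 1)
    (hσ : HasDerivAt σ s t) :
    velocity (fun u ↦ γ (σ u)) (Icc 0 1) t = s • velocity γ (Icc 0 1) (σ t) := by
  have h1 : HasMFDerivWithinAt 𝓘(ℝ, ℝ) 𝓘(ℝ, ℝ) σ (Icc 0 1) t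
      (ContinuousLinearMap.toSpanSingleton ℝ s) := hσ.hasFDerivAt.hasMFDerivAt.hasMFDerivWithinAt
  have h2 := (hγ.mdifferentiableWithinAt (hmaps ht)).hasMFDerivWithinAt
  have h3 := (HasMFDerivWithinAt.comp t h2 h1 hmaps).mfderivWithin (uniqueMDiffWithinAt_Icc ht)
  change mfderivWithin 𝓘(ℝ, ℝ) (𝓡 2) (γ ∘ σ) (Icc 0 1) t (1 : ℝ) = _
  rw [h3]
  change mfderivWithin 𝓘(ℝ, ℝ) (𝓡 2) γ (Icc 0 1) (σ t)
    ((ContinuousLinearMap.toSpanSingleton ℝ s) (1 : ℝ)) = _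
  have h4 : (ContinuousLinearMap.toSpanSingleton ℝ s) (1 : ℝ) = s • (1 : ℝ) := by simp
  rw [h4]
  exact (mfderivWithin 𝓘(ℝ, ℝ) (𝓡 2) γ (Icc 0 1) (σ t)).map_smul s (1 : ℝ)

/-- A regular curve can be reparametrised, without changing its image near the starting point, so
that its initial velocity is multiplied by an arbitrary positive number. -/
theorem IsRegularCurve.exists_initialVelocity_smul {p : M} {γ : ℝ → M}
    (hγ : IsRegularCurve γ (Icc 0 1)) {c : ℝ} (hc : 0 < c) :
    ∃ σ : ℝ → ℝ, (∀ t ∈ Ioc (0 : ℝ) 1, σ t ∈ Ioo (0 : ℝ) 1) ∧ σ 0 = 0 ∧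
      IsRegularCurve (fun t ↦ γ (σ t)) (Icc 0 1) ∧
      initialVelocity p (fun t ↦ γ (σ t)) = c • initialVelocity p γ := by
  let σ : ℝ → ℝ := fun t ↦ c * t / (1 + c * t)
  have hpos : ∀ t ∈ Icc (0 : ℝ) 1, 0 < 1 + c * t := fun t ht ↦ by
    have := mul_nonneg hc.le ht.1; linarith
  have hσd : ∀ t ∈ Icc (0 : ℝ) 1, HasDerivAt σ (c / (1 + c * t) ^ 2) t := fun t ht ↦ by
    have h1 : HasDerivAt (fun t : ℝ ↦ c * t) c t := by simpa using (hasDerivAt_id t).const_mul c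
    have h2 := h1.div (h1.const_add 1) (hpos t ht).ne'
    refine h2.congr_deriv ?_
    ring
  have hσI : ∀ t ∈ Ioc (0 : ℝ) 1, σ t ∈ Ioo (0 : ℝ) 1 := fun t ht ↦ by
    have h1 := hpos t (Ioc_subset_Icc_self ht)
    have h2 := mul_pos hc ht.1
    exact ⟨div_pos h2 h1, by rw [div_lt_one h1]; linarith⟩
  have hσ0 : σ 0 = 0 := by simp [σ]
  have hmaps : MapsTo σ (Icc 0 1) (Icc 0 1) := fun t ht ↦ by
    rcases ht.1.eq_or_lt with rfl | h
    · rw [hσ0]; exact left_mem_Icc.mpr zero_le_one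
    · exact Ioo_subset_Icc_self (hσI t ⟨h, ht.2⟩)
  have hσC : ContDiffOn ℝ 1 σ (Icc 0 1) :=
    (contDiff_const.mul contDiff_id).contDiffOn.div
      (contDiff_const.add (contDiff_const.mul contDiff_id)).contDiffOn fun t ht ↦ (hpos t ht).ne'
  refine ⟨σ, hσI, hσ0, ⟨hγ.1.comp hσC.contMDiffOn hmaps, fun t ht ↦ ?_⟩, ?_⟩
  · rw [velocity_comp hγ hmaps ht (hσd t ht)]
    exact smul_ne_zero (div_pos hc (pow_pos (hpos t ht) 2)).ne' (hγ.2 _ (hmaps ht))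
  · have h0 : (0 : ℝ) ∈ Icc (0 : ℝ) 1 := left_mem_Icc.mpr zero_le_one
    have h1 := velocity_comp hγ hmaps h0 (hσd 0 h0)
    have h2 : velocity γ (Icc 0 1) (σ 0) = velocity γ (Icc 0 1) 0 := by rw [hσ0]
    unfold initialVelocity
    refine h1.trans ?_
    rw [mul_zero, add_zero, one_pow, div_one]
    exact congrArg (fun v : Plane ↦ c • v) h2

end Reparametrization

section Arcs

variable {M : Type*} [TopologicalSpace M] {Φ : OpenPartialHomeomorph M ℂ} {p : M} {R : ℝ}

/-- The lift of an arc that runs in a sector. -/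
theorem exists_lift_of_mem_sector (hΦ : IsPolarChart Φ p R) {a b g : ℝ → ℝ} {r r' : ℝ}
    (hr' : r' ∈ Ioc 0 r) (hr : r ≤ R) (ha : ContinuousOn a (Icc 0 R)) (hb : ContinuousOn b (Icc 0 R))
    (hg : ContinuousOn g (Icc 0 r')) (hab : ∀ ρ ∈ Ioo 0 R, a ρ < b ρ)
    (hba : ∀ ρ ∈ Ioo 0 R, b ρ ≤ a ρ + 2 * Real.pi)
    (hmem : ∀ ρ ∈ Ioo 0 r', polarPoint Φ ρ (g ρ) ∈ angularSector Φ a b r) :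
    ∃ m : ℤ, ∀ ρ ∈ Ioo 0 r', a ρ < g ρ + m * (2 * Real.pi) ∧ g ρ + m * (2 * Real.pi) < b ρ := by
  have hsub : Ioo 0 r' ⊆ Ioo 0 r := Ioo_subset_Ioo_right hr'.2
  have hsubR : Ioo 0 r' ⊆ Ioo 0 R := hsub.trans (Ioo_subset_Ioo_right hr)
  have h0 : r' / 2 ∈ Ioo 0 r' := ⟨by linarith [hr'.1], by linarith [hr'.1]⟩
  obtain ⟨m, hm⟩ := (hΦ.polarPoint_mem_sector_iff hr (hsub h0)).mp (hmem _ h0)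
  have hgc : ContinuousOn (fun ρ ↦ g ρ + m * (2 * Real.pi)) (Ioo 0 r') :=
    (hg.mono Ioo_subset_Icc_self).add continuousOn_const
  have hac := ha.mono (hsubR.trans Ioo_subset_Icc_self)
  have hbc := hb.mono (hsubR.trans Ioo_subset_Icc_self)
  have hpt : ∀ ρ ∈ Ioo 0 r', ∀ c : ℝ → ℝ, c ρ = g ρ + m * (2 * Real.pi) →
      polarPoint Φ ρ (g ρ) ∈ angularGraph Φ c r := fun ρ hρ c hc ↦
    ⟨ρ, hsub hρ, by rw [hc, polarPoint_add_int]⟩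
  have hd₁ := hΦ.disjoint_sector_graph_left hr fun ρ hρ ↦
    hba ρ (Ioo_subset_Ioo_right hr hρ)
  have hd₂ := hΦ.disjoint_sector_graph_right hr (fun ρ hρ ↦ hab ρ (Ioo_subset_Ioo_right hr hρ))
    fun ρ hρ ↦ hba ρ (Ioo_subset_Ioo_right hr hρ)
  have h1 := lt_on_of_ne isPreconnected_Ioo hac hgc (fun ρ hρ heq ↦
    Set.disjoint_left.mp hd₁ (hmem ρ hρ) (hpt ρ hρ a heq)) h0 hm.1
  have h2 := lt_on_of_ne isPreconnected_Ioo hgc hbc (fun ρ hρ heq ↦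
    Set.disjoint_left.mp hd₂ (hmem ρ hρ) (hpt ρ hρ b heq.symm)) h0 hm.2
  exact ⟨m, fun ρ hρ ↦ ⟨h1 ρ hρ, h2 ρ hρ⟩⟩

theorem eq_on_of_lifts {r : ℝ} {a b g : ℝ → ℝ} (ha : ContinuousOn a (Ioo 0 r))
    (hb : ContinuousOn b (Ioo 0 r)) (hg : ContinuousOn g (Ioo 0 r))
    (hab : ∀ ρ ∈ Ioo 0 r, a ρ < b ρ) (hba : ∀ ρ ∈ Ioo 0 r, b ρ < a ρ + 2 * Real.pi)
    (h : ∀ ρ ∈ Ioo 0 r, ∃ m : ℤ, g ρ = a ρ + m * (2 * Real.pi) ∨ g ρ = b ρ + m * (2 * Real.pi))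
    {ρ₀ : ℝ} (hρ₀ : ρ₀ ∈ Ioo 0 r) (heq : g ρ₀ = a ρ₀) : ∀ ρ ∈ Ioo 0 r, g ρ = a ρ := by
  have hpi := Real.pi_pos
  have hint : ∀ {ρ : ℝ}, ρ ∈ Ioo 0 r → ∀ m : ℤ, (b ρ - a ρ) / 2 ≠ m * (2 * Real.pi) := by
    intro ρ hρ m hm
    have h1 := hab ρ hρ
    have h2 := hba ρ hρ
    have h3 := int_eq_zero_of_abs_lt (m := m) (by linarith) (by linarith)
    rw [h3, Int.cast_zero, zero_mul] at hm
    linarith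
  -- `g` stays between the midpoints of the gaps next to `a`
  have h1 := lt_on_of_ne isPreconnected_Ioo hg ((ha.add hb).div_const 2)
    (fun ρ hρ h1 ↦ by
      have h1 : g ρ = (a ρ + b ρ) / 2 := h1
      obtain ⟨m, hm | hm⟩ := h ρ hρ
      · exact hint hρ m (by linarith)
      · exact hint hρ (-m) (by push_cast; linarith))
    hρ₀ (by
      change g ρ₀ < (a ρ₀ + b ρ₀) / 2
      linarith [hab ρ₀ hρ₀])
  have h2 := lt_on_of_ne isPreconnected_Ioo (((ha.add hb).div_const 2).sub
      (continuousOn_const (c := Real.pi))) hg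
    (fun ρ hρ h1 ↦ by
      have h1 : (a ρ + b ρ) / 2 - Real.pi = g ρ := h1
      have h3 := hab ρ hρ
      have h4 := hba ρ hρ
      obtain ⟨m, hm | hm⟩ := h ρ hρ
      · have h5 := int_eq_zero_of_abs_lt (m := m) (by linarith) (by linarith)
        rw [h5, Int.cast_zero, zero_mul] at hm
        linarith
      · have h5 := int_eq_zero_of_abs_lt (m := m + 1) (by push_cast; linarith)
          (by push_cast; linarith)
        have h6 : (m : ℝ) = -1 := by
          have : m = -1 := by omega
          rw [this]; norm_num
        rw [h6] at hm
        linarith)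
    hρ₀ (by
      change (a ρ₀ + b ρ₀) / 2 - Real.pi < g ρ₀
      linarith [hba ρ₀ hρ₀])
  intro ρ hρ
  have h3 : g ρ < (a ρ + b ρ) / 2 := h1 ρ hρ
  have h4 : (a ρ + b ρ) / 2 - Real.pi < g ρ := h2 ρ hρ
  have h5 := hab ρ hρ
  have h6 := hba ρ hρ
  obtain ⟨m, hm | hm⟩ := h ρ hρ
  · have h7 := int_eq_zero_of_abs_lt (m := m) (by linarith) (by linarith)
    rw [hm, h7, Int.cast_zero, zero_mul, add_zero]
  · exfalso
    have h7 : (-1 : ℝ) < m := by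
      by_contra hcon
      have := mul_le_mul_of_nonneg_right (not_lt.mp hcon) (show 0 ≤ 2 * Real.pi by positivity)
      linarith
    have h8 : (m : ℝ) < 0 := by
      by_contra hcon
      have := mul_nonneg (not_lt.mp hcon) (show 0 ≤ 2 * Real.pi by positivity)
      linarith
    have h7' : -1 < m := by exact_mod_cast h7
    have h8' : m < 0 := by exact_mod_cast h8
    omega

/-- The lift of an arc that runs in the boundary of a sector. -/
theorem exists_lift_of_mem_boundary (hΦ : IsPolarChart Φ p R) {a b g : ℝ → ℝ} {r r' : ℝ}
    (hr' : r' ∈ Ioc 0 r) (hr : r ≤ R) (ha : ContinuousOn a (Icc 0 R)) (hb : ContinuousOn b (Icc 0 R))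
    (hg : ContinuousOn g (Icc 0 r')) (hab : ∀ ρ ∈ Ioo 0 R, a ρ < b ρ)
    (hba : ∀ ρ ∈ Ioo 0 R, b ρ < a ρ + 2 * Real.pi)
    (hmem : ∀ ρ ∈ Ioo 0 r', polarPoint Φ ρ (g ρ) ∈ angularGraph Φ a r ∪ angularGraph Φ b r) :
    ∃ m : ℤ, (∀ ρ ∈ Ioo 0 r', g ρ + m * (2 * Real.pi) = a ρ) ∨
      ∀ ρ ∈ Ioo 0 r', g ρ + m * (2 * Real.pi) = b ρ := by
  have hsub : Ioo 0 r' ⊆ Ioo 0 r := Ioo_subset_Ioo_right hr'.2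
  have hsubR : Ioo 0 r' ⊆ Ioo 0 R := hsub.trans (Ioo_subset_Ioo_right hr)
  have h0 : r' / 2 ∈ Ioo 0 r' := ⟨by linarith [hr'.1], by linarith [hr'.1]⟩
  have hac := ha.mono (hsubR.trans Ioo_subset_Icc_self)
  have hbc := hb.mono (hsubR.trans Ioo_subset_Icc_self)
  have hl : ∀ ρ ∈ Ioo 0 r', ∃ m : ℤ, g ρ = a ρ + m * (2 * Real.pi) ∨
      g ρ = b ρ + m * (2 * Real.pi) := fun ρ hρ ↦ by
    rcases hmem ρ hρ with h | h
    · obtain ⟨m, hm⟩ := (hΦ.polarPoint_mem_graph_iff hr (hsub hρ)).mp h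
      exact ⟨m, Or.inl hm⟩
    · obtain ⟨m, hm⟩ := (hΦ.polarPoint_mem_graph_iff hr (hsub hρ)).mp h
      exact ⟨m, Or.inr hm⟩
  obtain ⟨m, hm⟩ := hl _ h0
  have hgc : ContinuousOn (fun ρ ↦ g ρ + ((-m : ℤ) : ℝ) * (2 * Real.pi)) (Ioo 0 r') :=
    (hg.mono Ioo_subset_Icc_self).add continuousOn_const
  refine ⟨-m, ?_⟩
  rcases hm with hm | hm
  · left
    refine eq_on_of_lifts hac hbc hgc (fun ρ hρ ↦ hab ρ (hsubR hρ)) (fun ρ hρ ↦ hba ρ (hsubR hρ))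
      (fun ρ hρ ↦ ?_) h0 (by rw [hm]; push_cast; ring)
    obtain ⟨l, hl | hl⟩ := hl ρ hρ
    · exact ⟨l - m, Or.inl (by rw [hl]; push_cast; ring)⟩
    · exact ⟨l - m, Or.inr (by rw [hl]; push_cast; ring)⟩
  · right
    refine eq_on_of_lifts (b := fun ρ ↦ a ρ + 2 * Real.pi) hbc (hac.add continuousOn_const) hgc
      (fun ρ hρ ↦ hba ρ (hsubR hρ))
      (fun ρ hρ ↦ by have := hab ρ (hsubR hρ); linarith)
      (fun ρ hρ ↦ ?_) h0 (by rw [hm]; push_cast; ring)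
    obtain ⟨l, hl | hl⟩ := hl ρ hρ
    · exact ⟨l - m - 1, Or.inr (by rw [hl]; push_cast; ring)⟩
    · exact ⟨l - m, Or.inl (by rw [hl]; push_cast; ring)⟩

/-- A subsector bounded by two arcs, that does not contain the complementary sector, contains no
arc between them if it is disjoint from that arc. -/
theorem not_between_of_isBoundedBy (hΦ : IsPolarChart Φ p R) {r r' : ℝ} (hr' : r' ∈ Ioc 0 r)
    (hr : r ≤ R) {T : Set M} {γ₁ γ₂ γ₃ : ℝ → M} {y₁ y₂ y₃ : ℝ → ℝ} {τ₁ τ₂ τ₃ : ℝ}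
    (hT : IsOpen T) (hfr : frontier T ∩ complexDisc Φ r = γ₁ '' Ico 0 1 ∪ γ₂ '' Ico 0 1)
    (hp₁ : IsPolarArc Φ γ₁ y₁ r' τ₁) (hp₂ : IsPolarArc Φ γ₂ y₂ r' τ₂)
    (hp₃ : IsPolarArc Φ γ₃ y₃ r' τ₃) (hne : ∀ ρ ∈ Ioo 0 r', y₁ ρ ≠ y₂ ρ)
    (hlt : ∀ ρ ∈ Ioo 0 r', y₂ ρ < y₁ ρ + 2 * Real.pi)
    (hmiss : ¬ angularSector Φ y₂ (fun ρ ↦ y₁ ρ + 2 * Real.pi) r' ⊆ T)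
    (hdisj : Disjoint T (γ₃ '' Ico 0 1)) {ρ : ℝ} (hρ : ρ ∈ Ioo 0 r') :
    ¬ (y₁ ρ < y₃ ρ ∧ y₃ ρ < y₂ ρ) := by
  rintro ⟨h1, h2⟩
  have hc₁ := hp₁.continuousOn_angle.mono (Ioo_subset_Icc_self)
  have hc₂ := hp₂.continuousOn_angle.mono (Ioo_subset_Icc_self)
  have h12 := lt_on_of_ne isPreconnected_Ioo hc₁ hc₂ hne hρ (h1.trans h2)
  have himg : ∀ {γ : ℝ → M} {y : ℝ → ℝ} {τ : ℝ}, IsPolarArc Φ γ y r' τ →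
      γ '' Ico 0 1 ∩ complexDisc Φ r' = insert p (angularGraph Φ y r') := fun hp ↦
    hp.image_inter_disc hΦ (Ico_subset_Ico_right hp.time_mem.2) Ico_subset_Icc_self
  have hfr' : frontier T ∩ complexDisc Φ r' =
      insert p (angularGraph Φ y₁ r' ∪ angularGraph Φ y₂ r') := by
    have h3 : frontier T ∩ complexDisc Φ r' =
        (γ₁ '' Ico 0 1 ∪ γ₂ '' Ico 0 1) ∩ complexDisc Φ r' := by
      rw [← hfr, inter_assoc, inter_eq_right.mpr (complexDisc_mono hr'.2)]
    rw [h3, union_inter_distrib_right, himg hp₁, himg hp₂]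
    ext q
    simp only [mem_insert_iff, mem_union]
    tauto
  have hsub := hΦ.sector_subset_of_frontier hr'.1 (hr'.2.trans hr) hc₁ hc₂ h12 hlt hT hfr' hmiss
  obtain ⟨t, ht, hteq⟩ := hp₃.exists_time_polarPoint hρ
  refine Set.disjoint_left.mp hdisj (hsub ⟨ρ, hρ, y₃ ρ, ⟨h1, h2⟩, rfl⟩) ?_
  rw [← hteq]
  exact ⟨t, ⟨ht.1.le, ht.2.trans_le hp₃.time_mem.2⟩, rfl⟩

end Arcs

section Directions

variable {M : Type*} [TopologicalSpace M] [ChartedSpace Plane M]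
  {Φ : OpenPartialHomeomorph M ℂ} {p : M} {R : ℝ}

/-- A sector contains the directions that lie strictly between its sides. -/
theorem IsSmoothPolarChart.containsDirection_sector (hΦ : IsSmoothPolarChart Φ p R) {a b : ℝ → ℝ}
    {r : ℝ} (hr : r ∈ Ioc 0 R) (ha : ContinuousOn a (Icc 0 R)) (hb : ContinuousOn b (Icc 0 R))
    {θ : ℝ} (h1 : a 0 < θ) (h2 : θ < b 0) {w : TangentSpace (𝓡 2) p} {c : ℝ} (hc : 0 < c)
    (hw : tangentCoord Φ p w = (c : ℂ) * Complex.exp ((θ : ℂ) * Complex.I)) :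
    ContainsDirection p (angularSector Φ a b r) w := by
  have hR := hr.1.trans_le hr.2
  have h0 : (0 : ℝ) ∈ Icc 0 R := left_mem_Icc.mpr hR.le
  have hev : ∀ᶠ ρ in 𝓝[Icc 0 R] (0 : ℝ), a ρ < θ ∧ θ < b ρ :=
    ((ha 0 h0).eventually (gt_mem_nhds h1)).and ((hb 0 h0).eventually (lt_mem_nhds h2))
  obtain ⟨d, hd, hsub⟩ := Metric.mem_nhdsWithin_iff.mp hev
  have hd' : 0 < min (d / 2) r := lt_min (half_pos hd) hr.1
  have hr' : min (d / 2) r ∈ Ioc 0 R := ⟨hd', (min_le_right _ _).trans hr.2⟩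
  have hreg := hΦ.isRegularCurve_ray hr' θ
  obtain ⟨σ, hσ, hσ0, hreg', hv⟩ := hreg.exists_initialVelocity_smul (p := p) (div_pos hc hd')
  refine ⟨_, hreg', ?_, ?_, fun t ht ↦ ?_⟩
  · change straightRay Φ _ θ (σ 0) = p
    rw [hσ0, hΦ.ray_zero]
  · rw [hv]
    apply (hΦ.tangentCoord_bijective hΦ.mem_source).1
    rw [map_smul, hΦ.tangentCoord_initialVelocity_ray hr', hw, Complex.real_smul, ← mul_assoc,
      ← Complex.ofReal_mul, div_mul_cancel₀ _ hd'.ne']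
  · have h3 : σ t * min (d / 2) r ∈ Ioo 0 (min (d / 2) r) :=
      ⟨mul_pos (hσ t ht).1 hd', mul_lt_of_lt_one_left hd' (hσ t ht).2⟩
    have h4 : σ t * min (d / 2) r ∈ Metric.ball 0 d ∩ Icc 0 R := by
      refine ⟨?_, h3.1.le, h3.2.le.trans hr'.2⟩
      rw [Metric.mem_ball, Real.dist_eq, sub_zero, abs_of_pos h3.1]
      linarith [h3.2, min_le_left (d / 2) r]
    exact ⟨_, ⟨h3.1, h3.2.trans_le (min_le_right _ _)⟩, θ, hsub h4, rfl⟩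

end Directions

/-! ### The angle of a subdivision -/

section Directions

variable {M : Type*} [TopologicalSpace M] [ChartedSpace Plane M]
  {Φ : OpenPartialHomeomorph M ℂ} {p : M} {R : ℝ}

theorem OpensLessThanPi.symm {Ω : Set M} {v w : TangentSpace (𝓡 2) p}
    (h : OpensLessThanPi p Ω v w) : OpensLessThanPi p Ω w v := by
  refine ⟨?_, h.2.2, h.2.1⟩
  rintro ⟨k, hk, rfl⟩
  refine h.1 ⟨k⁻¹, inv_pos.mpr hk, ?_⟩
  rw [smul_neg, neg_neg, smul_smul, inv_mul_cancel₀ hk.ne', one_smul]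

theorem neg_polar (c α : ℝ) : -((c : ℂ) * Complex.exp ((α : ℂ) * Complex.I)) =
    (c : ℂ) * Complex.exp (((α + Real.pi : ℝ) : ℂ) * Complex.I) := by
  push_cast
  rw [add_mul, Complex.exp_add, Complex.exp_pi_mul_I]
  ring

/-- A sector that opens by less than `π` in the sense of directions does so in polar
coordinates. -/
theorem IsSmoothPolarChart.opening_lt_pi (hΦ : IsSmoothPolarChart Φ p R) {a b : ℝ → ℝ} {r : ℝ}
    (hr : r ∈ Ioc 0 R) (ha : ContinuousOn a (Icc 0 R)) (hb : ContinuousOn b (Icc 0 R))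
    {v w : TangentSpace (𝓡 2) p} {c d : ℝ} (hc : 0 < c) (hd : 0 < d)
    (hv : tangentCoord Φ p v = (c : ℂ) * Complex.exp ((a 0 : ℂ) * Complex.I))
    (hw : tangentCoord Φ p w = (d : ℂ) * Complex.exp ((b 0 : ℂ) * Complex.I))
    (h : OpensLessThanPi p (angularSector Φ a b r) v w) : b 0 - a 0 < Real.pi := by
  have hpi := Real.pi_pos
  by_contra hcon
  rcases (not_lt.mp hcon).eq_or_lt with heq | hlt
  · refine h.1 ⟨c / d, div_pos hc hd, ?_⟩
    apply (hΦ.tangentCoord_bijective hΦ.mem_source).1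
    have h1 : b 0 + Real.pi = a 0 + ((1 : ℤ) : ℝ) * (2 * Real.pi) := by push_cast; linarith
    have h2 : Complex.exp (((b 0 + Real.pi : ℝ) : ℂ) * Complex.I) =
        Complex.exp ((a 0 : ℂ) * Complex.I) := exp_angle_eq_iff.mpr ⟨1, h1⟩
    have hd' : (d : ℂ) ≠ 0 := by exact_mod_cast hd.ne'
    rw [map_neg, map_smul, hw, ← smul_neg, neg_polar, h2, hv, Complex.real_smul]
    push_cast
    field_simp
  · refine h.2.1 (hΦ.containsDirection_sector hr ha hb (θ := a 0 + Real.pi) (by linarith)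
      (by linarith) hc ?_)
    rw [map_neg, hv, neg_polar]

end Directions

section FanArcs

variable {M : Type*} [TopologicalSpace M] [ChartedSpace Plane M] [IsManifold (𝓡 2) ∞ M]
  {o : SurfaceOrientation M}
  {V : M → Type*} [TopologicalSpace (TotalSpace Plane V)]
  [∀ x, NormedAddCommGroup (V x)] [∀ x, InnerProductSpace ℝ (V x)]
  [FiberBundle Plane V] [VectorBundle ℝ Plane V]
  {C : CoherentTangentBundle V} {μ : CoOrientation V}
  {p : M} {Φ : OpenPartialHomeomorph M ℂ} {R : ℝ} {k : ℕ} {f : Fin k → ℝ → ℝ}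
  {Γ₁ Γ₂ : ℝ → M} {e : V p} {H : ℤ → ℝ → ℝ}

variable (C p Φ e H) in
/-- The curve `γ` has the polar equation `θ = g ρ`, and near `p` it runs between the null lifts
`H Q` and `H (Q + 1)`. -/
structure IsFanArc (γ : ℝ → M) (g : ℝ → ℝ) (δ τ : ℝ) (Q : ℤ) : Prop where
  polarArc : IsPolarArc Φ γ g δ τ
  index : IsFanIndex H g Q
  initial : ∀ Ψ : V p, IsInitialVector C p γ Ψ → Ψ = if Even Q then e else -e
  tangent : ∃ c : ℝ, 0 < c ∧
    tangentCoord Φ p (initialVelocity p γ) = (c : ℂ) * Complex.exp ((g 0 : ℂ) * Complex.I)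

namespace IsFanArc

variable {γ : ℝ → M} {g : ℝ → ℝ} {δ τ : ℝ} {Q : ℤ}

theorem shrink (h : IsFanArc C p Φ e H γ g δ τ Q) {r : ℝ} (hr : r ∈ Ioc 0 δ) :
    ∃ τ', IsFanArc C p Φ e H γ g r τ' Q := by
  obtain ⟨τ', -, h'⟩ := h.polarArc.shrink hr
  exact ⟨τ', { h with polarArc := h' }⟩

theorem add_int (h : IsFanArc C p Φ e H γ g δ τ Q) (hN : IsNullFan C p Φ R Γ₁ Γ₂ e H) (m : ℤ) :
    IsFanArc C p Φ e H γ (fun ρ ↦ g ρ + m * (2 * Real.pi)) δ τ (Q + 2 * m) := by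
  refine ⟨h.polarArc.add_int m, hN.index_add_int h.index m, fun Ψ hΨ ↦ ?_, ?_⟩
  · have h1 : Even (Q + 2 * m) ↔ Even Q := by simp [Int.even_add]
    simp only [h.initial Ψ hΨ, h1]
  · obtain ⟨c, hc, h1⟩ := h.tangent
    refine ⟨c, hc, h1.trans ?_⟩
    congr 1
    exact (exp_angle_eq_iff.mpr ⟨m, rfl⟩).symm

theorem exists_mem (h : IsFanArc C p Φ e H γ g δ τ Q) {ρ : ℝ} (hρ : ρ ∈ Ioo 0 δ) :
    ∃ t ∈ Ioo (0 : ℝ) 1, γ t = polarPoint Φ ρ (g ρ) := by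
  obtain ⟨t, ht, heq⟩ := h.polarArc.exists_time_polarPoint hρ
  exact ⟨t, ⟨ht.1, ht.2.trans_le h.polarArc.time_mem.2⟩, heq⟩

/-- Disjoint curves have different angles. -/
theorem angle_ne {γ' : ℝ → M} {g' : ℝ → ℝ} {τ' : ℝ} {Q' : ℤ}
    (h : IsFanArc C p Φ e H γ g δ τ Q) (h' : IsFanArc C p Φ e H γ' g' δ τ' Q')
    (hd : Disjoint (γ '' Ioo 0 1) (γ' '' Ioo 0 1)) {ρ : ℝ} (hρ : ρ ∈ Ioo 0 δ) :
    g ρ ≠ g' ρ := fun heq ↦ by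
  obtain ⟨t, ht, h1⟩ := h.exists_mem hρ
  obtain ⟨s, hs, h2⟩ := h'.exists_mem hρ
  exact Set.disjoint_left.mp hd ⟨t, ht, rfl⟩ ⟨s, hs, by rw [h1, h2, heq]⟩

end IsFanArc

theorem IsArc.ne {U : Set M} {γ : ℝ → M} (hγ : IsArc p U γ) : ∀ t ∈ Ioc (0 : ℝ) 1, γ t ≠ p :=
  fun t ht heq ↦ ht.1.ne' (hγ.injOn (Ioc_subset_Icc_self ht) (left_mem_Icc.mpr zero_le_one)
    (heq.trans hγ.start.symm))

theorem IsSingularFan.isAdmissible (hF : IsSingularFan o C μ p Φ R f) {U : Set M} {γ : ℝ → M}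
    (hγ : IsArc p U γ)
    (hi : C.ψ p (initialVelocity p γ) ≠ 0 ∨ IsSingularArc C p U γ) : IsAdmissible C p γ := by
  rcases hi with h | h
  · exact ⟨hγ.regular, hγ.start, Or.inl h⟩
  · refine hF.admissible γ hγ.regular hγ.start hγ.ne ?_
    filter_upwards [Ioo_mem_nhdsGT one_pos] with t ht using h.2 t (Ioo_subset_Ico_self ht)

/-- Every curve of a subdivision has a polar equation and an index. -/
theorem IsSingularFan.exists_isFanArc [T2Space M] (hF : IsSingularFan o C μ p Φ R f)
    (hN : IsNullFan C p Φ R Γ₁ Γ₂ e H) (hΦ : IsSmoothPolarChart Φ p R) {U : Set M} {γ : ℝ → M}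
    (hγ : IsArc p U γ)
    (hi : C.ψ p (initialVelocity p γ) ≠ 0 ∨ IsSingularArc C p U γ) :
    ∃ δ τ g Q, IsFanArc C p Φ e H γ g δ τ Q := by
  obtain ⟨α, -, -, hα⟩ := exists_polar_form (tangentCoord Φ p (initialVelocity p γ)) 0
  obtain ⟨δ, hδ, τ, g, h, hg⟩ := hΦ.exists_isPolarArc hγ.regular hγ.start hγ.ne hα
  obtain ⟨Q, hQ, hΨ⟩ := hN.side γ (hF.isAdmissible hγ hi) g δ τ h
  refine ⟨δ, τ, g, Q, h, hQ, fun Ψ hΨ' ↦ (hΨ Ψ).mp hΨ', _, ?_, hg ▸ hα⟩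
  exact norm_pos_iff.mpr (hΦ.tangentCoord_ne_zero hΦ.mem_source (IsSmoothPolarChart.initialVelocity_ne_zero hγ.regular))

/-- The sum of the angles along a monotone chain of curves. -/
theorem IsNullFan.sum_arccos_of_arcs (hN : IsNullFan C p Φ R Γ₁ Γ₂ e H) (ho : IsOrientedAt o Φ p)
    {r : ℝ} (hr : r ∈ Ioc 0 R) {n : ℕ} (hn : 1 ≤ n) {γ : ℕ → ℝ → M} {y : ℕ → ℝ → ℝ} {τ : ℕ → ℝ}
    {Q : ℕ → ℤ} {Ψ : ℕ → V p} (hy : ∀ j ≤ n, IsFanArc C p Φ e H (γ j) (y j) r (τ j) (Q j))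
    (hΨ : ∀ j ≤ n, IsInitialVector C p (γ j) (Ψ j))
    (hlt : (∀ j < n, ∀ ρ ∈ Ioo 0 r, y j ρ < y (j + 1) ρ) ∨
      ∀ j < n, ∀ ρ ∈ Ioo 0 r, y (j + 1) ρ < y j ρ)
    (htot : |y n 0 - y 0 0| ≤ 2 * Real.pi)
    (hpos : 2 ≤ n → ∀ j < n,
      IsPositivePair (o.at_point p) (initialVelocity p (γ j)) (initialVelocity p (γ (j + 1))))
    (hone : n = 1 → |y 1 0 - y 0 0| < Real.pi) :
    ∑ j ∈ Finset.range n, Real.arccos (inner ℝ (Ψ j) (Ψ (j + 1))) = Real.pi * |Q n - Q 0| := by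
  refine hN.sum_arccos_of_chain hr hn (fun j hj ↦ (hy j hj).polarArc.continuousOn_angle)
    (fun j hj ↦ (hy j hj).index) (fun j hj ↦ (hy j hj).initial _ (hΨ j hj)) hlt htot
    (fun h2 j hj ↦ ?_) hone
  obtain ⟨c, hc, h3⟩ := (hy j hj.le).tangent
  obtain ⟨d, hd, h4⟩ := (hy (j + 1) hj).tangent
  have h5 := (ho _ _).mp (hpos h2 j hj)
  rw [h3, h4, im_conj_mul_polar] at h5
  exact (mul_pos_iff_of_pos_left (mul_pos hc hd)).mp h5

theorem IsNullFan.index_eq (hN : IsNullFan C p Φ R Γ₁ Γ₂ e H) {r : ℝ} (hr : r ∈ Ioc 0 R)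
    {g g' : ℝ → ℝ} {Q Q' : ℤ} (hg : IsFanIndex H g Q) (hg' : IsFanIndex H g' Q')
    (h : ∀ ρ ∈ Ioo 0 r, g ρ = g' ρ) : Q = Q' := by
  have hR := hr.1.trans_le hr.2
  have hI := Ioo_mem_nhdsGT hr.1
  refine le_antisymm (hN.index_le hR hg hg' ?_) (hN.index_le hR hg' hg ?_)
  · filter_upwards [hI] with ρ hρ using (h ρ hρ).le
  · filter_upwards [hI] with ρ hρ using (h ρ hρ).ge

theorem eq_zero_of_eqOn {r : ℝ} (hr : 0 < r) {g g' : ℝ → ℝ} (hg : ContinuousOn g (Icc 0 r))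
    (hg' : ContinuousOn g' (Icc 0 r)) (h : ∀ ρ ∈ Ioo 0 r, g ρ = g' ρ) : g 0 = g' 0 := by
  have hI := Ioo_mem_nhdsGT hr
  refine le_antisymm (le_of_eventually_le hr hg hg' ?_) (le_of_eventually_le hr hg' hg ?_)
  · filter_upwards [hI] with ρ hρ using (h ρ hρ).le
  · filter_upwards [hI] with ρ hρ using (h ρ hρ).ge

/-- The interior angle of a sector between two singular curves is `π` times the number of null
directions in it. -/
theorem IsSingularFan.sum_arccos_of_subdividesSector [T2Space M]
    (hF : IsSingularFan o C μ p Φ R f)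
    (hN : IsNullFan C p Φ R Γ₁ Γ₂ e H) (hΦ : IsSmoothPolarChart Φ p R) (ho : IsOrientedAt o Φ p)
    {r : ℝ} (hr : r ∈ Ioc 0 R) {a b : ℝ → ℝ} (hab : IsSingularStrip f R a b) {Qa Qb : ℤ}
    (hQa : IsFanIndex H a Qa) (hQb : IsFanIndex H b Qb) {n : ℕ} {γ : ℕ → ℝ → M} {Ψ : ℕ → V p}
    (hS : SubdividesSector o C p (complexDisc Φ r) (angularSector Φ a b r) n γ)
    (hΨ : ∀ j ≤ n, IsInitialVector C p (γ j) (Ψ j)) :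
    ∑ j ∈ Finset.range n, Real.arccos (inner ℝ (Ψ j) (Ψ (j + 1))) = Real.pi * (Qb - Qa) := by
  have hpi := Real.pi_pos
  obtain ⟨hn, ⟨-, -, -, ⟨-, -, -, hfr⟩, -⟩, hsub, hint, hdisj, hopen⟩ := hS
  have hΦ' := hΦ.toIsPolarChart
  have hR := hΦ.pos
  have hac := hab.continuousOn_left hF
  have hbc := hab.continuousOn_right hF
  have hba := hab.lt_add hF
  have harc : ∀ j : ℕ, ∃ δ τ g Q, j ≤ n → IsFanArc C p Φ e H (γ j) g δ τ Q := fun j ↦ by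
    by_cases hj : j ≤ n
    · obtain ⟨δ, τ, g, Q, h⟩ := hF.exists_isFanArc hN hΦ (hsub.arc j hj) (hsub.initial j hj)
      exact ⟨δ, τ, g, Q, fun _ ↦ h⟩
    · exact ⟨0, 0, 0, 0, fun h ↦ absurd h hj⟩
  choose δ τ g Q harc using harc
  obtain ⟨r', hr'0, hr'r, hr'δ⟩ := (eventually_mem_nhdsWithin.and ((eventually_le_const hr.1).and
    ((eventually_all_finset (Finset.range (n + 1))).mpr fun j hj ↦ eventually_le_const
      (harc j (Nat.lt_succ_iff.mp (Finset.mem_range.mp hj))).polarArc.radius_pos))).exists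
  have hr' : r' ∈ Ioc 0 r := ⟨hr'0, hr'r⟩
  have hr'R : r' ∈ Ioc 0 R := ⟨hr'0, hr'r.trans hr.2⟩
  have hIR : Ioo 0 r' ⊆ Ioo 0 R := Ioo_subset_Ioo_right hr'R.2
  have hIr : Ioo 0 r' ⊆ Ioo 0 r := Ioo_subset_Ioo_right hr'r
  have harc' : ∀ j : ℕ, ∃ τ', j ≤ n → IsFanArc C p Φ e H (γ j) (g j) r' τ' (Q j) := fun j ↦ by
    by_cases hj : j ≤ n
    · obtain ⟨τ', h⟩ := (harc j hj).shrink
        ⟨hr'0, hr'δ j (Finset.mem_range.mpr (Nat.lt_succ_iff.mpr hj))⟩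
      exact ⟨τ', fun _ ↦ h⟩
    · exact ⟨0, fun h ↦ absurd h hj⟩
  choose τ' harc' using harc'
  -- the outer curves run in the boundary of the sector, the inner ones in its interior
  have houter : ∀ j ≤ n, (j = 0 ∨ j = n) → ∃ m : ℤ,
      (∀ ρ ∈ Ioo 0 r', g j ρ + m * (2 * Real.pi) = a ρ) ∨
      ∀ ρ ∈ Ioo 0 r', g j ρ + m * (2 * Real.pi) = b ρ := fun j hj hj' ↦ by
    refine exists_lift_of_mem_boundary hΦ' hr' hr.2 hac hbc
      (harc' j hj).polarArc.continuousOn_angle hab.lt hba fun ρ hρ ↦ ?_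
    obtain ⟨t, ht, hteq⟩ := (harc' j hj).exists_mem hρ
    have hρR := Ioo_subset_Ioc_self (hIR hρ)
    have h1 : polarPoint Φ ρ (g j ρ) ∈ frontier (angularSector Φ a b r) ∩ complexDisc Φ r := by
      rw [hfr, ← hteq]
      rcases hj' with rfl | rfl
      · exact Or.inl ⟨t, Ioo_subset_Ico_self ht, rfl⟩
      · exact Or.inr ⟨t, Ioo_subset_Ico_self ht, rfl⟩
    rw [hab.frontier_subset hF hΦ' hr.1 hr.2] at h1
    exact h1.resolve_left (hΦ'.polarPoint_ne hρR _)
  have hinner : ∀ j, 0 < j → j < n → ∃ m : ℤ, ∀ ρ ∈ Ioo 0 r',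
      a ρ < g j ρ + m * (2 * Real.pi) ∧ g j ρ + m * (2 * Real.pi) < b ρ := fun j hj0 hjn ↦ by
    refine exists_lift_of_mem_sector hΦ' hr' hr.2 hac hbc
      (harc' j hjn.le).polarArc.continuousOn_angle hab.lt hab.le fun ρ hρ ↦ ?_
    obtain ⟨t, ht, hteq⟩ := (harc' j hjn.le).exists_mem hρ
    rw [← hteq]
    exact hint j hj0 hjn t ht
  have hlift : ∀ j : ℕ, ∃ m : ℤ, j ≤ n →
      ((∀ ρ ∈ Ioo 0 r', a ρ ≤ g j ρ + m * (2 * Real.pi) ∧ g j ρ + m * (2 * Real.pi) ≤ b ρ) ∧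
      ((j = 0 ∨ j = n) → (∀ ρ ∈ Ioo 0 r', g j ρ + m * (2 * Real.pi) = a ρ) ∨
        ∀ ρ ∈ Ioo 0 r', g j ρ + m * (2 * Real.pi) = b ρ)) := fun j ↦ by
    by_cases hj : j ≤ n
    · by_cases hj' : j = 0 ∨ j = n
      · obtain ⟨m, hm⟩ := houter j hj hj'
        refine ⟨m, fun _ ↦ ⟨fun ρ hρ ↦ ?_, fun _ ↦ hm⟩⟩
        have h1 := hab.lt ρ (hIR hρ)
        rcases hm with hm | hm <;> rw [hm ρ hρ]
        · exact ⟨le_rfl, h1.le⟩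
        · exact ⟨h1.le, le_rfl⟩
      · obtain ⟨m, hm⟩ := hinner j (by omega) (by omega)
        exact ⟨m, fun _ ↦ ⟨fun ρ hρ ↦ ⟨(hm ρ hρ).1.le, (hm ρ hρ).2.le⟩, fun h ↦ absurd h hj'⟩⟩
    · exact ⟨0, fun h ↦ absurd h hj⟩
  choose m hlift using hlift
  let y : ℕ → ℝ → ℝ := fun j ρ ↦ g j ρ + m j * (2 * Real.pi)
  have hy : ∀ j ≤ n, IsFanArc C p Φ e H (γ j) (y j) r' (τ' j) (Q j + 2 * m j) := fun j hj ↦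
    (harc' j hj).add_int hN (m j)
  have hya : ∀ j ≤ n, ∀ ρ ∈ Ioo 0 r', a ρ ≤ y j ρ := fun j hj ρ hρ ↦ ((hlift j hj).1 ρ hρ).1
  have hyb : ∀ j ≤ n, ∀ ρ ∈ Ioo 0 r', y j ρ ≤ b ρ := fun j hj ρ hρ ↦ ((hlift j hj).1 ρ hρ).2
  have hy0 : (∀ ρ ∈ Ioo 0 r', y 0 ρ = a ρ) ∨ ∀ ρ ∈ Ioo 0 r', y 0 ρ = b ρ :=
    (hlift 0 (Nat.zero_le n)).2 (Or.inl rfl)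
  have hyn : (∀ ρ ∈ Ioo 0 r', y n ρ = a ρ) ∨ ∀ ρ ∈ Ioo 0 r', y n ρ = b ρ :=
    (hlift n le_rfl).2 (Or.inr rfl)
  have hne : ∀ i j, i < j → j ≤ n → ∀ ρ ∈ Ioo 0 r', y i ρ ≠ y j ρ := fun i j hij hj ρ hρ ↦
    (hy i (hij.le.trans hj)).angle_ne (hy j hj) (hdisj i j hij hj) hρ
  have hmid : r' / 2 ∈ Ioo 0 r' := ⟨by linarith [hr'.1], by linarith [hr'.1]⟩
  -- the subsector between two consecutive curves contains no point outside `Ω`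
  have hmiss : ∀ {T : Set M}, T ⊆ angularSector Φ a b r → ∀ i ≤ n, ∀ j ≤ n,
      ¬ angularSector Φ (y j) (fun ρ ↦ y i ρ + 2 * Real.pi) r' ⊆ T := by
    intro T hT i hi j hj hcon
    have h1 := hyb j hj _ hmid
    have h2 := hya i hi _ hmid
    have h3 := hba _ (hIR hmid)
    have h4 := hab.lt _ (hIR hmid)
    have h5 : polarPoint Φ (r' / 2) ((b (r' / 2) + (a (r' / 2) + 2 * Real.pi)) / 2) ∈
        angularSector Φ a b r :=
      hT (hcon ⟨_, hmid, _, ⟨by linarith, by linarith⟩, rfl⟩)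
    have h6 := (hΦ'.polarPoint_mem_sector_iff_of_mem hr.2 (hIr hmid) (hab.le _ (hIR hmid))
      (by linarith) (by linarith)).mp h5
    linarith [h6.2]
  have hbetween : ∀ j < n, ∀ l ≤ n, ∀ ρ ∈ Ioo 0 r',
      ¬ (y j ρ < y l ρ ∧ y l ρ < y (j + 1) ρ) ∧ ¬ (y (j + 1) ρ < y l ρ ∧ y l ρ < y j ρ) := by
    intro j hj l hl ρ hρ
    rcases eq_or_ne l j with rfl | hlj
    · exact ⟨fun h ↦ lt_irrefl _ h.1, fun h ↦ lt_irrefl _ h.2⟩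
    rcases eq_or_ne l (j + 1) with rfl | hlj'
    · exact ⟨fun h ↦ lt_irrefl _ h.2, fun h ↦ lt_irrefl _ h.1⟩
    obtain ⟨T, hTΩ, ⟨hTo, -, -, hTfr⟩, hTd⟩ := hsub.subsector j hj
    have hlt : ∀ i ≤ n, ∀ i' ≤ n, ∀ ρ ∈ Ioo 0 r', y i' ρ < y i ρ + 2 * Real.pi :=
      fun i hi i' hi' ρ hρ ↦ by
        linarith [hyb i' hi' ρ hρ, hya i hi ρ hρ, hba ρ (hIR hρ)]
    constructor
    · exact not_between_of_isBoundedBy hΦ' hr' hr.2 hTo hTfr (hy j hj.le).polarArc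
        (hy (j + 1) hj).polarArc (hy l hl).polarArc (hne j (j + 1) (by omega) hj)
        (hlt _ hj.le _ hj) (hmiss hTΩ _ hj.le _ hj) (hTd l hl hlj hlj') hρ
    · exact not_between_of_isBoundedBy hΦ' hr' hr.2 hTo (hTfr.trans (union_comm _ _))
        (hy (j + 1) hj).polarArc (hy j hj.le).polarArc (hy l hl).polarArc
        (fun ρ hρ ↦ (hne j (j + 1) (by omega) hj ρ hρ).symm)
        (hlt _ hj _ hj.le) (hmiss hTΩ _ hj _ hj.le) (hTd l hl hlj hlj') hρ
  have hac' := hac.mono (Icc_subset_Icc_right hr'R.2)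
  have hbc' := hbc.mono (Icc_subset_Icc_right hr'R.2)
  have hyc := fun j hj ↦ (hy j hj).polarArc.continuousOn_angle
  have hab0 : a 0 ≤ b 0 := le_of_eventually_lt hr'0 hac' hbc'
    (by filter_upwards [Ioo_mem_nhdsGT hr'0] with ρ hρ using hab.lt ρ (hIR hρ))
  have hba0 : b 0 ≤ a 0 + 2 * Real.pi :=
    le_of_eventually_lt (g := fun ρ ↦ a ρ + 2 * Real.pi) hr'0 hbc' (hac'.add continuousOn_const)
      (by filter_upwards [Ioo_mem_nhdsGT hr'0] with ρ hρ using hba ρ (hIR hρ))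
  have hQab : Qa ≤ Qb := hN.index_le hR hQa hQb
    (by filter_upwards [Ioo_mem_nhdsGT hr'0] with ρ hρ using (hab.lt ρ (hIR hρ)).le)
  have h0n : (0 : ℕ) < n := hn
  rcases hy0 with hy0 | hy0
  · have hyn : ∀ ρ ∈ Ioo 0 r', y n ρ = b ρ := hyn.resolve_left fun h ↦
      hne 0 n h0n le_rfl _ hmid ((hy0 _ hmid).trans (h _ hmid).symm)
    have e0 := eq_zero_of_eqOn hr'0 (hyc 0 h0n.le) hac' hy0
    have en := eq_zero_of_eqOn hr'0 (hyc n le_rfl) hbc' hyn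
    have hQ0 := hN.index_eq hr'R (hy 0 h0n.le).index hQa hy0
    have hQn := hN.index_eq hr'R (hy n le_rfl).index hQb hyn
    refine (hN.sum_arccos_of_arcs ho hr'R hn hy hΨ (Or.inl fun j hj ρ hρ ↦ ?_) ?_ hsub.positive
      ?_).trans ?_
    · exact increasing_of_not_between (y := fun j ↦ y j ρ) (fun i j hij hj ↦ hne i j hij hj ρ hρ)
        (fun j hj ↦ (hy0 ρ hρ).trans_le (hya j hj ρ hρ))
        (fun j hj l hl ↦ (hbetween j hj l hl ρ hρ).1)
        (fun j hj l hl ↦ (hbetween j hj l hl ρ hρ).2) j hj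
    · rw [e0, en, abs_of_nonneg (by linarith)]
      linarith
    · intro h1
      subst h1
      obtain ⟨c, hc, hv⟩ := (hy 0 h0n.le).tangent
      obtain ⟨d, hd, hw⟩ := (hy 1 le_rfl).tangent
      rw [e0] at hv
      rw [en] at hw
      rw [e0, en, abs_of_nonneg (by linarith)]
      exact hΦ.opening_lt_pi hr hac hbc hc hd hv hw (hopen rfl)
    · rw [hQ0, hQn, abs_of_nonneg (by omega), Int.cast_sub]
  · have hyn : ∀ ρ ∈ Ioo 0 r', y n ρ = a ρ := hyn.resolve_right fun h ↦
      hne 0 n h0n le_rfl _ hmid ((hy0 _ hmid).trans (h _ hmid).symm)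
    have e0 := eq_zero_of_eqOn hr'0 (hyc 0 h0n.le) hbc' hy0
    have en := eq_zero_of_eqOn hr'0 (hyc n le_rfl) hac' hyn
    have hQ0 := hN.index_eq hr'R (hy 0 h0n.le).index hQb hy0
    have hQn := hN.index_eq hr'R (hy n le_rfl).index hQa hyn
    refine (hN.sum_arccos_of_arcs ho hr'R hn hy hΨ (Or.inr fun j hj ρ hρ ↦ ?_) ?_ hsub.positive
      ?_).trans ?_
    · refine neg_lt_neg_iff.mp (increasing_of_not_between (n := n) (y := fun j ↦ -y j ρ)
        (fun i j hij hj heq ↦ hne i j hij hj ρ hρ (neg_injective heq))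
        (fun j hj ↦ neg_le_neg ((hyb j hj ρ hρ).trans_eq (hy0 ρ hρ).symm))
        (fun j hj l hl h ↦ (hbetween j hj l hl ρ hρ).2
          ⟨neg_lt_neg_iff.mp h.2, neg_lt_neg_iff.mp h.1⟩)
        (fun j hj l hl h ↦ (hbetween j hj l hl ρ hρ).1
          ⟨neg_lt_neg_iff.mp h.2, neg_lt_neg_iff.mp h.1⟩) j hj)
    · rw [e0, en, abs_of_nonpos (by linarith)]
      linarith
    · intro h1
      subst h1
      obtain ⟨c, hc, hv⟩ := (hy 0 h0n.le).tangent
      obtain ⟨d, hd, hw⟩ := (hy 1 le_rfl).tangent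
      rw [e0] at hv
      rw [en] at hw
      rw [e0, en, abs_of_nonpos (by linarith), neg_sub]
      exact hΦ.opening_lt_pi hr hac hbc hd hc hw hv (hopen rfl).symm
    · rw [hQ0, hQn, abs_of_nonpos (by omega), neg_sub, Int.cast_sub]

/-- The interior angle of a punctured disc is `2π`. -/
theorem IsSingularFan.sum_arccos_of_subdividesPunctured [T2Space M]
    (hF : IsSingularFan o C μ p Φ R f)
    (hN : IsNullFan C p Φ R Γ₁ Γ₂ e H) (hΦ : IsSmoothPolarChart Φ p R) (ho : IsOrientedAt o Φ p)
    {r : ℝ} {Ω : Set M} {γ : ℕ → ℝ → M} {Ψ : ℕ → V p}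
    (hS : SubdividesPunctured o C p (complexDisc Φ r) Ω γ)
    (hΨ : ∀ j ≤ 3, IsInitialVector C p (γ j) (Ψ j)) :
    ∑ j ∈ Finset.range 3, Real.arccos (inner ℝ (Ψ j) (Ψ (j + 1))) = 2 * Real.pi := by
  have hpi := Real.pi_pos
  obtain ⟨-, h30, hsub, hdisj⟩ := hS
  have hΦ' := hΦ.toIsPolarChart
  have harc : ∀ j ≤ 3, ∃ δ τ g Q, IsFanArc C p Φ e H (γ j) g δ τ Q := fun j hj ↦
    hF.exists_isFanArc hN hΦ (hsub.arc j hj) (hsub.initial j hj)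
  obtain ⟨δ₀, τ₀, g₀, Q₀, h₀⟩ := harc 0 (by omega)
  obtain ⟨δ₁, τ₁, g₁, Q₁, h₁⟩ := harc 1 (by omega)
  obtain ⟨δ₂, τ₂, g₂, Q₂, h₂⟩ := harc 2 (by omega)
  obtain ⟨r', ⟨⟨⟨hr'0, hr'R⟩, hr₀⟩, hr₁⟩, hr₂⟩ := ((((eventually_mem_nhdsWithin.and
    (eventually_le_const hΦ.pos)).and (eventually_le_const h₀.polarArc.radius_pos)).and
    (eventually_le_const h₁.polarArc.radius_pos)).and
    (eventually_le_const h₂.polarArc.radius_pos)).exists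
  obtain ⟨τ₀, h₀⟩ := h₀.shrink ⟨hr'0, hr₀⟩
  obtain ⟨τ₁, h₁⟩ := h₁.shrink ⟨hr'0, hr₁⟩
  obtain ⟨τ₂, h₂⟩ := h₂.shrink ⟨hr'0, hr₂⟩
  have hr' : r' ∈ Ioc 0 R := ⟨hr'0, hr'R⟩
  have hΦr := hΦ'.mono hr'0 hr'R
  have hmid : r' / 2 ∈ Ioo 0 r' := ⟨by linarith [hr'.1], by linarith [hr'.1]⟩
  -- the lifts of the other two curves to the interval `(g₀, g₀ + 2π)`
  have hlift : ∀ {γ' : ℝ → M} {g' : ℝ → ℝ} {τ' : ℝ} {Q' : ℤ},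
      IsFanArc C p Φ e H γ' g' r' τ' Q' → Disjoint (γ 0 '' Ioo 0 1) (γ' '' Ioo 0 1) →
      ∃ m : ℤ, ∀ ρ ∈ Ioo 0 r', g₀ ρ < g' ρ + m * (2 * Real.pi) ∧
        g' ρ + m * (2 * Real.pi) < g₀ ρ + 2 * Real.pi := by
    intro γ' g' τ' Q' h' hd
    refine exists_lift_of_mem_sector (b := fun ρ ↦ g₀ ρ + 2 * Real.pi) hΦr
      (right_mem_Ioc.mpr hr'0) le_rfl h₀.polarArc.continuousOn_angle
      (h₀.polarArc.continuousOn_angle.add continuousOn_const) h'.polarArc.continuousOn_angle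
      (fun ρ _ ↦ by linarith) (fun ρ _ ↦ le_rfl) fun ρ hρ ↦ ?_
    obtain ⟨ρ', hρ', θ, hθ1, hθ2, hθ⟩ := hΦr.exists_polar_of_mem_disc
      ((hΦr.polarPoint_mem_disc_iff (θ := g' ρ) (Ioo_subset_Icc_self hρ)).mpr hρ.2)
      (hΦr.polarPoint_ne (Ioo_subset_Ioc_self hρ) _) g₀
    refine ⟨ρ', hρ', θ, ⟨lt_of_le_of_ne hθ1 fun heq ↦ ?_, hθ2⟩, hθ⟩
    obtain ⟨t, ht, h1⟩ := h₀.exists_mem hρ'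
    obtain ⟨s, hs, h2⟩ := h'.exists_mem hρ
    exact Set.disjoint_left.mp hd ⟨t, ht, rfl⟩ ⟨s, hs, by rw [h1, h2, heq, hθ]⟩
  obtain ⟨m₁, hm₁⟩ := hlift h₁ (hdisj 0 1 (by omega) (by omega))
  obtain ⟨m₂, hm₂⟩ := hlift h₂ (hdisj 0 2 (by omega) (by omega))
  have h₁' := h₁.add_int hN m₁
  have h₂' := h₂.add_int hN m₂
  have h₀' := h₀.add_int hN 1
  have hsum : |Q₀ + 2 * 1 - Q₀| = 2 := by
    rw [add_sub_cancel_left]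
    rfl
  rcases lt_or_gt_of_ne (h₁'.angle_ne h₂' (hdisj 1 2 (by omega) le_rfl) hmid) with h12 | h12
  · have hlt := lt_on_of_ne isPreconnected_Ioo
      (h₁'.polarArc.continuousOn_angle.mono Ioo_subset_Icc_self)
      (h₂'.polarArc.continuousOn_angle.mono Ioo_subset_Icc_self)
      (fun ρ hρ ↦ h₁'.angle_ne h₂' (hdisj 1 2 (by omega) le_rfl) hρ) hmid h12
    let y : ℕ → ℝ → ℝ := fun j ↦ match j with
      | 0 => g₀
      | 1 => fun ρ ↦ g₁ ρ + m₁ * (2 * Real.pi)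
      | 2 => fun ρ ↦ g₂ ρ + m₂ * (2 * Real.pi)
      | _ => fun ρ ↦ g₀ ρ + (1 : ℤ) * (2 * Real.pi)
    let Q : ℕ → ℤ := fun j ↦ match j with
      | 0 => Q₀
      | 1 => Q₁ + 2 * m₁
      | 2 => Q₂ + 2 * m₂
      | _ => Q₀ + 2 * 1
    let τ : ℕ → ℝ := fun j ↦ match j with
      | 0 => τ₀
      | 1 => τ₁
      | 2 => τ₂
      | _ => τ₀
    have hy : ∀ j ≤ 3, IsFanArc C p Φ e H (γ j) (y j) r' (τ j) (Q j) := by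
      intro j hj
      interval_cases j
      · exact h₀
      · exact h₁'
      · exact h₂'
      · rw [h30]; exact h₀'
    refine (hN.sum_arccos_of_arcs ho hr' (by norm_num) hy hΨ (Or.inl ?_) ?_ hsub.positive
      (by norm_num)).trans ?_
    rotate_left 2
    · change Real.pi * ((|Q₀ + 2 * 1 - Q₀| : ℤ) : ℝ) = _
      rw [hsum, mul_comm, Int.cast_ofNat]
    · intro j hj ρ hρ
      interval_cases j
      · exact (hm₁ ρ hρ).1
      · exact hlt ρ hρ
      · change g₂ ρ + m₂ * (2 * Real.pi) < g₀ ρ + (1 : ℤ) * (2 * Real.pi)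
        rw [Int.cast_one, one_mul]
        exact (hm₂ ρ hρ).2
    · change |g₀ 0 + (1 : ℤ) * (2 * Real.pi) - g₀ 0| ≤ _
      rw [Int.cast_one, one_mul, add_sub_cancel_left, abs_of_pos (by positivity)]
  · have hlt := lt_on_of_ne isPreconnected_Ioo
      (h₂'.polarArc.continuousOn_angle.mono Ioo_subset_Icc_self)
      (h₁'.polarArc.continuousOn_angle.mono Ioo_subset_Icc_self)
      (fun ρ hρ ↦ (h₁'.angle_ne h₂' (hdisj 1 2 (by omega) le_rfl) hρ).symm) hmid h12
    let y : ℕ → ℝ → ℝ := fun j ↦ match j with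
      | 0 => fun ρ ↦ g₀ ρ + (1 : ℤ) * (2 * Real.pi)
      | 1 => fun ρ ↦ g₁ ρ + m₁ * (2 * Real.pi)
      | 2 => fun ρ ↦ g₂ ρ + m₂ * (2 * Real.pi)
      | _ => g₀
    let Q : ℕ → ℤ := fun j ↦ match j with
      | 0 => Q₀ + 2 * 1
      | 1 => Q₁ + 2 * m₁
      | 2 => Q₂ + 2 * m₂
      | _ => Q₀
    let τ : ℕ → ℝ := fun j ↦ match j with
      | 0 => τ₀
      | 1 => τ₁
      | 2 => τ₂
      | _ => τ₀
    have hy : ∀ j ≤ 3, IsFanArc C p Φ e H (γ j) (y j) r' (τ j) (Q j) := by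
      intro j hj
      interval_cases j
      · exact h₀'
      · exact h₁'
      · exact h₂'
      · rw [h30]; exact h₀
    refine (hN.sum_arccos_of_arcs ho hr' (by norm_num) hy hΨ (Or.inr ?_) ?_ hsub.positive
      (by norm_num)).trans ?_
    rotate_left 2
    · change Real.pi * ((|Q₀ - (Q₀ + 2 * 1)| : ℤ) : ℝ) = _
      rw [abs_sub_comm, hsum, mul_comm, Int.cast_ofNat]
    · intro j hj ρ hρ
      interval_cases j
      · change g₁ ρ + m₁ * (2 * Real.pi) < g₀ ρ + (1 : ℤ) * (2 * Real.pi)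
        rw [Int.cast_one, one_mul]
        exact (hm₁ ρ hρ).2
      · exact hlt ρ hρ
      · exact (hm₂ ρ hρ).1
    · change |g₀ 0 - (g₀ 0 + (1 : ℤ) * (2 * Real.pi))| ≤ _
      rw [Int.cast_one, one_mul, abs_sub_comm, add_sub_cancel_left, abs_of_pos (by positivity)]

end FanArcs

/-! ### Existence of subdivisions -/

theorem angle_eq_of_polar_eq {c d α β : ℝ} (hc : 0 < c) (hd : 0 < d)
    (h : (c : ℂ) * Complex.exp ((α : ℂ) * Complex.I) =
      (d : ℂ) * Complex.exp ((β : ℂ) * Complex.I)) : ∃ m : ℤ, α = β + m * (2 * Real.pi) := by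
  have h1 : c = d := by
    have := congrArg norm h
    rwa [norm_polar hc.le, norm_polar hd.le] at this
  subst h1
  have h2 : (c : ℂ) ≠ 0 := by exact_mod_cast hc.ne'
  exact exp_angle_eq_iff.mp (mul_left_cancel₀ h2 h)

section Directions

variable {M : Type*} [TopologicalSpace M] [ChartedSpace Plane M]
  {Φ : OpenPartialHomeomorph M ℂ} {p : M} {R : ℝ}

/-- The direction in which a curve leaves `p` is the value at `0` of its angle function. -/
theorem IsSmoothPolarChart.exists_tangentCoord_eq [T2Space M] (hΦ : IsSmoothPolarChart Φ p R)
    {γ : ℝ → M} (hγ : IsRegularCurve γ (Icc 0 1)) (hne : ∀ t ∈ Ioc (0 : ℝ) 1, γ t ≠ p)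
    {g : ℝ → ℝ} {δ τ : ℝ} (h : IsPolarArc Φ γ g δ τ) :
    ∃ c : ℝ, 0 < c ∧
      tangentCoord Φ p (initialVelocity p γ) = (c : ℂ) * Complex.exp ((g 0 : ℂ) * Complex.I) := by
  obtain ⟨α, -, -, hα⟩ := exists_polar_form (tangentCoord Φ p (initialVelocity p γ)) 0
  obtain ⟨δ', hδ', τ', g', h', rfl⟩ :=
    hΦ.exists_isPolarArc hγ (h.start_eq hΦ.toIsPolarChart) hne hα
  refine ⟨_, norm_pos_iff.mpr (hΦ.tangentCoord_ne_zero hΦ.mem_source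
    (IsSmoothPolarChart.initialVelocity_ne_zero hγ)), hα.trans ?_⟩
  congr 1
  have hlim : ∀ {u : ℝ → ℝ} {d : ℝ}, 0 < d → ContinuousOn u (Icc 0 d) →
      Tendsto (fun ρ ↦ Complex.exp ((u ρ : ℂ) * Complex.I)) (𝓝[>] 0)
        (𝓝 (Complex.exp ((u 0 : ℂ) * Complex.I))) := fun {u d} hd hu ↦ by
    have h1 := (hu 0 (left_mem_Icc.mpr hd.le)).tendsto.mono_left (nhdsGT_le_nhdsWithin_Icc hd)
    have h2 : Continuous fun x : ℝ ↦ Complex.exp ((x : ℂ) * Complex.I) := by fun_prop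
    exact (h2.tendsto _).comp h1
  refine tendsto_nhds_unique (hlim h'.radius_pos h'.continuousOn_angle)
    ((hlim h.radius_pos h.continuousOn_angle).congr' ?_)
  filter_upwards [Ioo_mem_nhdsGT h.radius_pos, Ioo_mem_nhdsGT h'.radius_pos] with ρ hρ hρ'
  obtain ⟨t, ht, hteq⟩ := h'.exists_time ⟨hρ'.1, hρ'.2.le⟩
  have htτ : t ≤ τ := by
    by_contra hcon
    refine h.away t ⟨(not_le.mp hcon).le, ht.2.trans h'.time_mem.2⟩
      ⟨h'.mem_source t (Ioc_subset_Icc_self ht), ?_⟩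
    rw [mem_preimage, mem_ball_zero_iff, hteq]
    exact hρ.2
  have h1 := h'.polar t (Ioc_subset_Icc_self ht)
  have h2 := h.polar t ⟨ht.1.le, htτ⟩
  rw [hteq] at h1 h2
  have hρR : ρ ∈ Ioc 0 R := ⟨hρ.1, hρ'.2.le.trans hδ'⟩
  exact exp_angle_eq_iff.mpr ((hΦ.polarPoint_eq_iff hρR hρR).mp (h2.symm.trans h1)).2

/-- The directions in a sector lie between its sides. -/
theorem IsSmoothPolarChart.angle_mem_of_containsDirection [T2Space M]
    (hΦ : IsSmoothPolarChart Φ p R) {a b : ℝ → ℝ} {r : ℝ} (hr : r ∈ Ioc 0 R)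
    (ha : ContinuousOn a (Icc 0 R)) (hb : ContinuousOn b (Icc 0 R))
    (hab : ∀ ρ ∈ Ioo 0 R, a ρ < b ρ) (hba : ∀ ρ ∈ Ioo 0 R, b ρ ≤ a ρ + 2 * Real.pi)
    {w : TangentSpace (𝓡 2) p} {c θ : ℝ} (hc : 0 < c)
    (hw : tangentCoord Φ p w = (c : ℂ) * Complex.exp ((θ : ℂ) * Complex.I))
    (h : ContainsDirection p (angularSector Φ a b r) w) :
    ∃ m : ℤ, a 0 ≤ θ + m * (2 * Real.pi) ∧ θ + m * (2 * Real.pi) ≤ b 0 := by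
  have hΦ' := hΦ.toIsPolarChart
  obtain ⟨γ, hγ, h0, rfl, hmem⟩ := h
  have hne : ∀ t ∈ Ioc (0 : ℝ) 1, γ t ≠ p := fun t ht ↦
    (hΦ'.angularSector_subset_disc hr.2 (hmem t ht)).2
  obtain ⟨α, -, -, hα⟩ := exists_polar_form (tangentCoord Φ p (initialVelocity p γ)) 0
  obtain ⟨δ, hδ, τ, g, h, rfl⟩ := hΦ.exists_isPolarArc hγ h0 hne hα
  obtain ⟨l, hl⟩ := angle_eq_of_polar_eq (norm_pos_iff.mpr (hΦ.tangentCoord_ne_zero hΦ.mem_source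
    (IsSmoothPolarChart.initialVelocity_ne_zero hγ))) hc (hα.symm.trans hw)
  have hr' : min δ r ∈ Ioc 0 r := ⟨lt_min h.radius_pos hr.1, min_le_right _ _⟩
  have hr'R := hr'.2.trans hr.2
  have hgc := h.continuousOn_angle.mono (Icc_subset_Icc_right (min_le_left δ r))
  obtain ⟨m, hm⟩ := exists_lift_of_mem_sector hΦ' hr' hr.2 ha hb hgc hab hba fun ρ hρ ↦ by
    obtain ⟨t, ht, hteq⟩ := h.exists_time_polarPoint ⟨hρ.1, hρ.2.trans_le (min_le_left _ _)⟩
    rw [← hteq]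
    exact hmem t ⟨ht.1, ht.2.le.trans h.time_mem.2⟩
  have hI := Ioo_mem_nhdsGT hr'.1
  have hgc' : ContinuousOn (fun ρ ↦ g ρ + m * (2 * Real.pi)) (Icc 0 (min δ r)) :=
    hgc.add continuousOn_const
  have h1 := le_of_eventually_lt hr'.1 (ha.mono (Icc_subset_Icc_right hr'R)) hgc'
    (by filter_upwards [hI] with ρ hρ using (hm ρ hρ).1)
  have h2 := le_of_eventually_lt hr'.1 hgc' (hb.mono (Icc_subset_Icc_right hr'R))
    (by filter_upwards [hI] with ρ hρ using (hm ρ hρ).2)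
  rw [hl] at h1 h2
  refine ⟨l + m, ?_, ?_⟩ <;> push_cast <;> linarith

theorem IsSmoothPolarChart.opensLessThanPi [T2Space M] (hΦ : IsSmoothPolarChart Φ p R)
    {a b : ℝ → ℝ} {r : ℝ} (hr : r ∈ Ioc 0 R)
    (ha : ContinuousOn a (Icc 0 R)) (hb : ContinuousOn b (Icc 0 R))
    (hab : ∀ ρ ∈ Ioo 0 R, a ρ < b ρ) (hba : ∀ ρ ∈ Ioo 0 R, b ρ ≤ a ρ + 2 * Real.pi)
    {v w : TangentSpace (𝓡 2) p} {c d : ℝ} (hc : 0 < c) (hd : 0 < d)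
    (hv : tangentCoord Φ p v = (c : ℂ) * Complex.exp ((a 0 : ℂ) * Complex.I))
    (hw : tangentCoord Φ p w = (d : ℂ) * Complex.exp ((b 0 : ℂ) * Complex.I))
    (hab0 : a 0 ≤ b 0) (h : b 0 - a 0 < Real.pi) :
    OpensLessThanPi p (angularSector Φ a b r) v w := by
  have hpi := Real.pi_pos
  -- an odd multiple of `π` is not smaller than `π` in absolute value
  have hodd : ∀ m : ℤ, ∀ x : ℝ, x = Real.pi + m * (2 * Real.pi) → -Real.pi < x → x < Real.pi →
      False := fun m x hx h1 h2 ↦ by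
    have h3 : (-1 : ℝ) < m := by
      by_contra hcon
      nlinarith
    have h4 : (m : ℝ) < 0 := by
      by_contra hcon
      nlinarith
    have h5 : -1 < m := by exact_mod_cast h3
    have h6 : m < 0 := by exact_mod_cast h4
    omega
  refine ⟨?_, fun hcon ↦ ?_, fun hcon ↦ ?_⟩
  · rintro ⟨k, hk, hvw⟩
    rw [hvw, map_neg, map_smul, hw, Complex.real_smul, ← mul_assoc, ← Complex.ofReal_mul,
      neg_polar] at hv
    obtain ⟨m, hm⟩ := angle_eq_of_polar_eq (mul_pos hk hd) hc hv
    exact hodd (-m) (a 0 - b 0) (by push_cast; linarith) (by linarith) (by linarith)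
  · obtain ⟨m, h1, h2⟩ := hΦ.angle_mem_of_containsDirection hr ha hb hab hba hc
      (by rw [map_neg, hv, neg_polar]) hcon
    exact hodd m _ rfl (by linarith) (by linarith)
  · obtain ⟨m, h1, h2⟩ := hΦ.angle_mem_of_containsDirection hr ha hb hab hba hd
      (by rw [map_neg, hw, neg_polar]) hcon
    exact hodd m _ rfl (by linarith) (by linarith)

/-- A chain of arcs, in the order of increasing angle, in the disc of radius `r`. -/
structure IsPolarChain (Φ : OpenPartialHomeomorph M ℂ) (r : ℝ) (n : ℕ) (γ : ℕ → ℝ → M)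
    (g : ℕ → ℝ → ℝ) : Prop where
  regular : ∀ j ≤ n, IsRegularCurve (γ j) (Icc 0 1)
  polarArc : ∀ j ≤ n, IsPolarArc Φ (γ j) (g j) r 1
  lt : ∀ j < n, ∀ ρ ∈ Ioo 0 r, g j ρ < g (j + 1) ρ
  le : ∀ ρ ∈ Ioo 0 r, g n ρ ≤ g 0 ρ + 2 * Real.pi

namespace IsPolarChain

variable {r : ℝ} {n : ℕ} {γ : ℕ → ℝ → M} {g : ℕ → ℝ → ℝ}

theorem mono (h : IsPolarChain Φ r n γ g) {i j : ℕ} (hij : i ≤ j) (hj : j ≤ n) {ρ : ℝ}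
    (hρ : ρ ∈ Ioo 0 r) : g i ρ ≤ g j ρ := by
  induction j, hij using Nat.le_induction with
  | base => exact le_rfl
  | succ j hij ih => exact (ih (by omega)).trans (h.lt j hj ρ hρ).le

theorem strictMono (h : IsPolarChain Φ r n γ g) {i j : ℕ} (hij : i < j) (hj : j ≤ n) {ρ : ℝ}
    (hρ : ρ ∈ Ioo 0 r) : g i ρ < g j ρ :=
  (h.lt i (hij.trans_le hj) ρ hρ).trans_le (h.mono hij hj hρ)

theorem arc (h : IsPolarChain Φ r n γ g) (hΦ : IsSmoothPolarChart Φ p R) {j : ℕ} (hj : j ≤ n) :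
    IsArc p (complexDisc Φ r) (γ j) :=
  hΦ.isArc_of_isPolarArc (h.regular j hj) (h.polarArc j hj)

theorem exists_tangentCoord_eq [T2Space M] (h : IsPolarChain Φ r n γ g)
    (hΦ : IsSmoothPolarChart Φ p R) {j : ℕ} (hj : j ≤ n) : ∃ c : ℝ, 0 < c ∧
      tangentCoord Φ p (initialVelocity p (γ j)) =
        (c : ℂ) * Complex.exp ((g j 0 : ℂ) * Complex.I) :=
  hΦ.exists_tangentCoord_eq (h.regular j hj) (fun t ht heq ↦ ht.1.ne' ((h.arc hΦ hj).injOn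
    (Ioc_subset_Icc_self ht) (left_mem_Icc.mpr zero_le_one) (heq.trans (h.arc hΦ hj).start.symm)))
    (h.polarArc j hj)

theorem disjoint (h : IsPolarChain Φ r n γ g) (hΦ : IsPolarChart Φ p R) (hr : r ≤ R) {i j : ℕ}
    (hij : i < j) (hj : j ≤ n) (hlt : ∀ ρ ∈ Ioo 0 r, g j ρ < g i ρ + 2 * Real.pi) :
    Disjoint (γ i '' Ioo 0 1) (γ j '' Ioo 0 1) := by
  rw [(h.polarArc i (by omega)).image_Ioo, (h.polarArc j hj).image_Ioo, Set.disjoint_left]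
  rintro _ ⟨ρ, hρ, rfl⟩ h2
  obtain ⟨l, hl⟩ := (hΦ.polarPoint_mem_graph_iff hr hρ).mp h2
  have h3 := h.strictMono hij hj hρ
  have h4 := hlt ρ hρ
  have h5 := int_eq_zero_of_abs_lt (m := l) (by linarith) (by linarith [Real.pi_pos])
  rw [h5, Int.cast_zero, zero_mul, add_zero] at hl
  exact h3.ne hl

theorem mem_sector (h : IsPolarChain Φ r n γ g) {j : ℕ} (h0 : 0 < j) (hj : j < n) :
    ∀ t ∈ Ioo (0 : ℝ) 1, γ j t ∈ angularSector Φ (g 0) (g n) r := fun t ht ↦ by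
  obtain ⟨ρ, hρ, heq⟩ := (h.polarArc j hj.le).mem_graph ht
  exact ⟨ρ, hρ, _, ⟨h.strictMono h0 hj.le hρ, h.strictMono hj le_rfl hρ⟩, heq⟩

end IsPolarChain

end Directions

section Existence

variable {M : Type*} [TopologicalSpace M] [T2Space M] [ChartedSpace Plane M]
  [IsManifold (𝓡 2) ∞ M]
  {o : SurfaceOrientation M}
  {V : M → Type*} [TopologicalSpace (TotalSpace Plane V)]
  [∀ x, NormedAddCommGroup (V x)] [∀ x, InnerProductSpace ℝ (V x)]
  [FiberBundle Plane V] [VectorBundle ℝ Plane V]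
  {C : CoherentTangentBundle V} {μ : CoOrientation V}
  {p : M} {Φ : OpenPartialHomeomorph M ℂ} {R : ℝ} {k : ℕ} {f : Fin k → ℝ → ℝ}
  {Γ₁ Γ₂ : ℝ → M} {e : V p} {H : ℤ → ℝ → ℝ}

/-- A chain of arcs subdivides the sector between its first and its last arc. -/
theorem IsPolarChain.isSubdivision {r : ℝ} {n : ℕ} {γ : ℕ → ℝ → M} {g : ℕ → ℝ → ℝ}
    (h : IsPolarChain Φ r n γ g) (hΦ : IsSmoothPolarChart Φ p R) (ho : IsOrientedAt o Φ p)
    (hr : r ∈ Ioc 0 R)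
    (hinit : ∀ j ≤ n, C.ψ p (initialVelocity p (γ j)) ≠ 0 ∨
      IsSingularArc C p (complexDisc Φ r) (γ j))
    (hsin : 2 ≤ n → ∀ j < n, 0 < Real.sin (g (j + 1) 0 - g j 0)) {Ω : Set M}
    (hΩ : angularSector Φ (g 0) (g n) r ⊆ Ω) :
    IsSubdivision o C p (complexDisc Φ r) Ω n γ := by
  have hpi := Real.pi_pos
  have hΦ' := hΦ.toIsPolarChart
  have hc : ∀ j ≤ n, ContinuousOn (g j) (Ioo 0 r) := fun j hj ↦
    (h.polarArc j hj).continuousOn_angle.mono Ioo_subset_Icc_self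
  refine ⟨fun j hj ↦ h.arc hΦ hj, hinit, fun j hj ↦
    ⟨angularSector Φ (g j) (g (j + 1)) r, ?_, ⟨?_, ?_, ?_, ?_⟩, fun l hl _ _ ↦ ?_⟩, fun h2 j hj ↦ ?_⟩
  · rintro _ ⟨ρ, hρ, θ, hθ, rfl⟩
    exact hΩ ⟨ρ, hρ, θ, ⟨(h.mono (Nat.zero_le j) hj.le hρ).trans_lt hθ.1,
      hθ.2.trans_le (h.mono hj le_rfl hρ)⟩, rfl⟩
  · exact hΦ'.isOpen_angularSector hr.2 (hc j hj.le) (hc (j + 1) hj)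
  · exact hΦ'.isConnected_angularSector hr.1 hr.2 (hc j hj.le) (hc (j + 1) hj) (h.lt j hj)
  · exact fun q hq ↦ (hΦ'.angularSector_subset_disc hr.2 hq).1
  · rw [hΦ'.frontier_angularSector hr.1 hr.2 (hc j hj.le) (hc (j + 1) hj) (h.lt j hj) fun ρ hρ ↦ by
      linarith [h.mono (Nat.zero_le j) hj.le hρ, h.mono hj le_rfl hρ, h.le ρ hρ],
      (h.polarArc j hj.le).image_Ico hΦ', (h.polarArc (j + 1) hj).image_Ico hΦ']
    ext q
    simp only [mem_insert_iff, mem_union]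
    tauto
  · rw [(h.polarArc l hl).image_Ico hΦ', Set.disjoint_left]
    rintro q hq (rfl | ⟨ρ, hρ, rfl⟩)
    · exact (hΦ'.angularSector_subset_disc hr.2 hq).2 rfl
    · obtain ⟨m, hm⟩ := (hΦ'.polarPoint_mem_sector_iff hr.2 hρ).mp hq
      have h1 := h.mono (Nat.zero_le l) hl hρ
      have h2 := h.mono hl le_rfl hρ
      have h3 := h.mono (Nat.zero_le j) hj.le hρ
      have h4 := h.mono hj le_rfl hρ
      have h5 := h.le ρ hρ
      have h6 := int_eq_zero_of_abs_lt (m := m) (by linarith [hm.1]) (by linarith [hm.2])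
      rw [h6, Int.cast_zero, zero_mul, add_zero] at hm
      rcases le_or_gt l j with hlj | hlj
      · exact absurd hm.1 (not_lt.mpr (h.mono hlj hj.le hρ))
      · exact absurd hm.2 (not_lt.mpr (h.mono hlj hl hρ))
  · obtain ⟨c, hc, hv⟩ := h.exists_tangentCoord_eq hΦ hj.le
    obtain ⟨d, hd, hw⟩ := h.exists_tangentCoord_eq hΦ (j := j + 1) hj
    rw [ho, hv, hw, im_conj_mul_polar]
    exact mul_pos (mul_pos hc hd) (hsin h2 j hj)

/-- A ray is not tangent to the null direction unless its angle differs from that of the null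
direction by a multiple of `π`. -/
theorem IsNullFan.map_initialVelocity_ray_ne_zero (hN : IsNullFan C p Φ R Γ₁ Γ₂ e H)
    (hΦ : IsSmoothPolarChart Φ p R) {r θ : ℝ} (hr : r ∈ Ioc 0 R)
    (hθ : Real.sin (θ - H 0 0) ≠ 0) :
    C.ψ p (initialVelocity p (straightRay Φ r θ)) ≠ 0 := by
  intro h0
  obtain ⟨k, hk⟩ := (hN.ker_iff _).mp h0
  rw [hΦ.tangentCoord_initialVelocity_ray hr] at hk
  have h1 := im_conj_mul_polar 1 r (H 0 0) θ
  rw [hk, im_conj_mul_polar, sub_self, Real.sin_zero, mul_zero, one_mul] at h1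
  exact mul_ne_zero hr.1.ne' hθ h1.symm

theorem exists_sin_ne_zero (c α : ℝ) :
    ∃ θ, c ≤ θ ∧ θ ≤ c + 1 / 10 ∧ Real.sin (θ - α) ≠ 0 := by
  by_cases h : Real.sin (c - α) = 0
  · refine ⟨c + 1 / 10, by linarith, le_rfl, ?_⟩
    have h1 : Real.cos (c - α) ≠ 0 := fun h2 ↦ by
      have := Real.sin_sq_add_cos_sq (c - α)
      rw [h, h2] at this
      norm_num at this
    rw [show c + 1 / 10 - α = c - α + 1 / 10 by ring, Real.sin_add, h, zero_mul, zero_add]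
    exact mul_ne_zero h1 (Real.sin_pos_of_pos_of_lt_pi (by norm_num)
      (by linarith [Real.pi_gt_three])).ne'
  · exact ⟨c, le_rfl, by linarith, h⟩

theorem IsSingularFan.oscillation_lift (hF : IsSingularFan o C μ p Φ R f) {a : ℝ → ℝ}
    (ha : ∃ i, ∃ m : ℤ, a = fun ρ ↦ f i ρ + m * (2 * Real.pi)) {ρ : ℝ} (hρ : ρ ∈ Icc 0 R) :
    |a ρ - a 0| < 1 / 2 := by
  obtain ⟨i, m, rfl⟩ := ha
  rw [add_sub_add_right_eq_sub]
  exact hF.oscillation i ρ hρ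

/-- A sector that opens by less than `π` needs no interpolating curve, and two suitable rays
subdivide any other one. -/
theorem IsSingularFan.exists_subdividesSector (hF : IsSingularFan o C μ p Φ R f)
    (hN : IsNullFan C p Φ R Γ₁ Γ₂ e H) (hΦ : IsSmoothPolarChart Φ p R) (ho : IsOrientedAt o Φ p)
    {r : ℝ} (hr : r ∈ Ioc 0 R) {a b : ℝ → ℝ} (hab : IsSingularStrip f R a b) :
    ∃ n γ, SubdividesSector o C p (complexDisc Φ r) (angularSector Φ a b r) n γ := by
  have hpi := Real.pi_gt_three
  have hpi4 := Real.pi_le_four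
  obtain ⟨σ₁, σ₂, hp₁, hp₂, hσ⟩ := hF.isSectorBetween_strip hΦ hr.1 hr.2 hab
  have hIR : Ioo 0 r ⊆ Ioo 0 R := Ioo_subset_Ioo_right hr.2
  have hac := hab.continuousOn_left hF
  have hbc := hab.continuousOn_right hF
  have hac' := hac.mono (Icc_subset_Icc_right hr.2)
  have hbc' := hbc.mono (Icc_subset_Icc_right hr.2)
  have hI := Ioo_mem_nhdsGT hr.1
  have hab0 : a 0 ≤ b 0 := le_of_eventually_lt hr.1 hac' hbc'
    (by filter_upwards [hI] with ρ hρ using hab.lt ρ (hIR hρ))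
  have hba0 : b 0 ≤ a 0 + 2 * Real.pi :=
    le_of_eventually_le (g := fun ρ ↦ a ρ + 2 * Real.pi) hr.1 hbc' (hac'.add continuousOn_const)
      (by filter_upwards [hI] with ρ hρ using hab.le ρ (hIR hρ))
  rcases lt_or_ge (b 0 - a 0) Real.pi with hD | hD
  · let γ : ℕ → ℝ → M := fun j ↦ match j with
      | 0 => σ₁
      | _ => σ₂
    let g : ℕ → ℝ → ℝ := fun j ↦ match j with
      | 0 => a
      | _ => b
    have hch : IsPolarChain Φ r 1 γ g := by
      refine ⟨fun j hj ↦ ?_, fun j hj ↦ ?_, fun j hj ρ hρ ↦ ?_, fun ρ hρ ↦ hab.le ρ (hIR hρ)⟩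
      · interval_cases j
        · exact hσ.1.1.regular
        · exact hσ.2.1.1.regular
      · interval_cases j
        · exact hp₁
        · exact hp₂
      · interval_cases j
        exact hab.lt ρ (hIR hρ)
    refine ⟨1, γ, le_rfl, hσ, hch.isSubdivision hΦ ho hr (fun j hj ↦ Or.inr ?_)
      (fun h ↦ by omega) subset_rfl, fun j h0 h1 ↦ by omega, fun i j hij hj ↦ ?_, fun _ ↦ ?_⟩
    · interval_cases j
      · exact hσ.1
      · exact hσ.2.1
    · obtain rfl : j = 1 := by omega
      obtain rfl : i = 0 := by omega
      exact hσ.2.2.1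
    · obtain ⟨c, hc, hv⟩ := hch.exists_tangentCoord_eq hΦ zero_le_one
      obtain ⟨d, hd, hw⟩ := hch.exists_tangentCoord_eq hΦ (le_refl 1)
      exact hΦ.opensLessThanPi hr hac hbc hab.lt hab.le hc hd hv hw hab0 hD
  · obtain ⟨θ₁, h1, h1', hs1⟩ := exists_sin_ne_zero (a 0 + (b 0 - a 0) / 3) (H 0 0)
    obtain ⟨θ₂, h2, h2', hs2⟩ := exists_sin_ne_zero (a 0 + 2 * (b 0 - a 0) / 3) (H 0 0)
    have haθ : ∀ ρ ∈ Ioo 0 r, a ρ < θ₁ := fun ρ hρ ↦ by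
      have := (abs_lt.mp (hF.oscillation_lift hab.left (Ioo_subset_Icc_self (hIR hρ)))).2
      linarith
    have hθb : ∀ ρ ∈ Ioo 0 r, θ₂ < b ρ := fun ρ hρ ↦ by
      have := (abs_lt.mp (hF.oscillation_lift hab.right (Ioo_subset_Icc_self (hIR hρ)))).1
      linarith
    let γ : ℕ → ℝ → M := fun j ↦ match j with
      | 0 => σ₁
      | 1 => straightRay Φ r θ₁
      | 2 => straightRay Φ r θ₂
      | _ => σ₂
    let g : ℕ → ℝ → ℝ := fun j ↦ match j with
      | 0 => a
      | 1 => fun _ ↦ θ₁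
      | 2 => fun _ ↦ θ₂
      | _ => b
    have hch : IsPolarChain Φ r 3 γ g := by
      refine ⟨fun j hj ↦ ?_, fun j hj ↦ ?_, fun j hj ρ hρ ↦ ?_, fun ρ hρ ↦ hab.le ρ (hIR hρ)⟩
      · interval_cases j
        · exact hσ.1.1.regular
        · exact hΦ.isRegularCurve_ray hr θ₁
        · exact hΦ.isRegularCurve_ray hr θ₂
        · exact hσ.2.1.1.regular
      · interval_cases j
        · exact hp₁
        · exact hΦ.isPolarArc_ray hr θ₁
        · exact hΦ.isPolarArc_ray hr θ₂
        · exact hp₂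
      · interval_cases j
        · exact haθ ρ hρ
        · change θ₁ < θ₂
          linarith
        · exact hθb ρ hρ
    refine ⟨3, γ, by norm_num, hσ, hch.isSubdivision hΦ ho hr (fun j hj ↦ ?_)
      (fun _ j hj ↦ ?_) subset_rfl, fun j h0 h1 ↦ hch.mem_sector h0 h1,
      fun i j hij hj ↦ hch.disjoint hΦ.toIsPolarChart hr.2 hij hj fun ρ hρ ↦ ?_,
      fun h ↦ by omega⟩
    · interval_cases j
      · exact Or.inr hσ.1
      · exact Or.inl (hN.map_initialVelocity_ray_ne_zero hΦ hr hs1)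
      · exact Or.inl (hN.map_initialVelocity_ray_ne_zero hΦ hr hs2)
      · exact Or.inr hσ.2.1
    · interval_cases j
      · change 0 < Real.sin (θ₁ - a 0)
        exact Real.sin_pos_of_pos_of_lt_pi (by linarith) (by linarith)
      · change 0 < Real.sin (θ₂ - θ₁)
        exact Real.sin_pos_of_pos_of_lt_pi (by linarith) (by linarith)
      · change 0 < Real.sin (b 0 - θ₂)
        exact Real.sin_pos_of_pos_of_lt_pi (by linarith) (by linarith)
    · have h3 : g 3 ρ < g 0 ρ + 2 * Real.pi := hab.lt_add hF ρ (hIR hρ)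
      linarith [hch.mono (Nat.zero_le i) (hij.le.trans hj) hρ, hch.mono hj le_rfl hρ]

/-- Three rays subdivide the punctured disc. -/
theorem IsSingularFan.exists_subdividesPunctured (hF : IsSingularFan o C μ p Φ R f)
    (hN : IsNullFan C p Φ R Γ₁ Γ₂ e H) (hΦ : IsSmoothPolarChart Φ p R) (ho : IsOrientedAt o Φ p)
    {r : ℝ} (hr : r ∈ Ioc 0 R) (hk : k = 0) :
    ∃ γ, SubdividesPunctured o C p (complexDisc Φ r) (complexDisc Φ r \ {p}) γ := by
  have hpi := Real.pi_pos
  have hΦ' := hΦ.toIsPolarChart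
  let θ : ℕ → ℝ := fun j ↦ H 0 0 + Real.pi / 2 + j * (2 * Real.pi / 3)
  have hch : IsPolarChain Φ r 3 (fun j ↦ straightRay Φ r (θ j)) (fun j _ ↦ θ j) := by
    refine ⟨fun j _ ↦ hΦ.isRegularCurve_ray hr _, fun j _ ↦ hΦ.isPolarArc_ray hr _,
      fun j _ ρ _ ↦ ?_, fun ρ _ ↦ ?_⟩
    · simp only [θ]
      push_cast
      linarith
    · simp only [θ]
      push_cast
      linarith
  refine ⟨fun j ↦ straightRay Φ r (θ j), ⟨hF.inter_disc_eq hΦ' hr.1 hr.2 hk, rfl⟩, ?_,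
    hch.isSubdivision hΦ ho hr (fun j hj ↦ Or.inl (hN.map_initialVelocity_ray_ne_zero hΦ hr ?_))
      (fun _ j hj ↦ ?_) (hΦ'.angularSector_subset_disc hr.2),
    fun i j hij hj ↦ hch.disjoint hΦ' hr.2 hij (by omega) fun ρ hρ ↦ ?_⟩
  · have h1 : θ 3 = θ 0 + (1 : ℤ) * (2 * Real.pi) := by
      simp only [θ]
      push_cast
      ring
    funext t
    change polarPoint Φ (t * r) (θ 3) = polarPoint Φ (t * r) (θ 0)
    rw [h1, polarPoint_add_int]
  · have h6 := Real.sin_pi_div_six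
    interval_cases j
    · rw [show θ 0 - H 0 0 = Real.pi / 2 by simp only [θ]; push_cast; ring, Real.sin_pi_div_two]
      exact one_ne_zero
    · rw [show θ 1 - H 0 0 = Real.pi / 6 + Real.pi by simp only [θ]; push_cast; ring,
        Real.sin_add_pi, h6]
      norm_num
    · rw [show θ 2 - H 0 0 = -(Real.pi / 6) + 2 * Real.pi by simp only [θ]; push_cast; ring,
        Real.sin_add_two_pi, Real.sin_neg, h6]
      norm_num
    · rw [show θ 3 - H 0 0 = Real.pi / 2 + 2 * Real.pi by simp only [θ]; push_cast; ring,
        Real.sin_add_two_pi, Real.sin_pi_div_two]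
      exact one_ne_zero
  · have h1 : θ (j + 1) - θ j = 2 * Real.pi / 3 := by
      simp only [θ]
      push_cast
      ring
    rw [h1]
    exact Real.sin_pos_of_pos_of_lt_pi (by positivity) (by linarith)
  · have h1 := hch.mono (Nat.zero_le i) (hij.le.trans (hj.trans (by norm_num))) hρ
    have h2 := hch.lt 2 (by norm_num) ρ hρ
    have h3 := hch.le ρ hρ
    have h4 := hch.mono hj (by norm_num) hρ
    linarith

/-- The curves of a subdivision have initial vectors. -/
theorem IsSingularFan.exists_initialVectors (hF : IsSingularFan o C μ p Φ R f)
    (hN : IsNullFan C p Φ R Γ₁ Γ₂ e H) (hΦ : IsSmoothPolarChart Φ p R) {U Ω : Set M} {n : ℕ}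
    {γ : ℕ → ℝ → M} (h : IsSubdivision o C p U Ω n γ) :
    ∃ Ψ : ℕ → V p, ∀ j ≤ n, IsInitialVector C p (γ j) (Ψ j) := by
  have h1 : ∀ j : ℕ, ∃ Ψ : V p, j ≤ n → IsInitialVector C p (γ j) Ψ := fun j ↦ by
    by_cases hj : j ≤ n
    · obtain ⟨α, -, -, hα⟩ := exists_polar_form (tangentCoord Φ p (initialVelocity p (γ j))) 0
      have harc := h.arc j hj
      obtain ⟨δ, -, τ, g, hpol, -⟩ := hΦ.exists_isPolarArc harc.regular harc.start harc.ne hα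
      obtain ⟨Q, -, hΨ⟩ := hN.side _ (hF.isAdmissible harc (h.initial j hj)) g δ τ hpol
      exact ⟨_, fun _ ↦ (hΨ _).mpr rfl⟩
    · exact ⟨0, fun h ↦ absurd h hj⟩
  choose Ψ hΨ using h1
  exact ⟨Ψ, hΨ⟩

end Existence

/-! ### The sum of the interior angles -/

section Sums

variable {M : Type*}

open Classical in
/-- The contribution of one half `Γ` of the null curve to the interior angle of a sector `Ω`: it is
`π` if `Γ` starts in `Ω`, and `0` otherwise. -/
noncomputable def halfAngle (Γ : ℝ → M) (Ω : Set M) : ℝ :=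
  if ∀ᶠ t in 𝓝[>] (0 : ℝ), Γ t ∈ Ω then Real.pi else 0

theorem halfAngle_of_mem {Γ : ℝ → M} {Ω : Set M} (h : ∀ᶠ t in 𝓝[>] (0 : ℝ), Γ t ∈ Ω) :
    halfAngle Γ Ω = Real.pi := if_pos h

theorem halfAngle_of_not {Γ : ℝ → M} {Ω : Set M} (h : ¬ ∀ᶠ t in 𝓝[>] (0 : ℝ), Γ t ∈ Ω) :
    halfAngle Γ Ω = 0 := if_neg h

/-- A curve contributes to the sum over the sectors in `A` if and only if it starts in `A`. -/
theorem finsum_halfAngle {S : Set (Set M)} {A B : Set M} {Γ : ℝ → M} (hAB : Disjoint A B)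
    (hS : ∀ Ω ∈ S, Ω ⊆ A ∨ Ω ⊆ B)
    (hmeet : ∀ Ω ∈ S, ∀ Ω' ∈ S, (Ω ∩ Ω').Nonempty → Ω = Ω')
    (hΓ : ∃ Ω ∈ S, ∀ᶠ t in 𝓝[>] (0 : ℝ), Γ t ∈ Ω) :
    ∑ᶠ Ω ∈ {Ω | Ω ∈ S ∧ Ω ⊆ A}, halfAngle Γ Ω = halfAngle Γ A := by
  obtain ⟨Ω₀, hΩ₀, hev⟩ := hΓ
  have huniq : ∀ Ω ∈ S, (∀ᶠ t in 𝓝[>] (0 : ℝ), Γ t ∈ Ω) → Ω = Ω₀ := fun Ω hΩ h ↦ by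
    obtain ⟨t, ht⟩ := (h.and hev).exists
    exact hmeet Ω hΩ Ω₀ hΩ₀ ⟨_, ht⟩
  rcases hS Ω₀ hΩ₀ with hA | hB
  · rw [halfAngle_of_mem (hev.mono fun t ht ↦ hA ht), ← halfAngle_of_mem hev]
    refine (finsum_mem_inter_support_eq _ _ {Ω₀} ?_).trans
      (finsum_mem_singleton (f := halfAngle Γ))
    ext Ω
    constructor
    · rintro ⟨⟨h1, -⟩, h2⟩
      refine ⟨huniq Ω h1 ?_, h2⟩
      by_contra hcon
      exact h2 (halfAngle_of_not hcon)
    · rintro ⟨h1, h2⟩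
      rw [mem_singleton_iff.mp h1] at h2 ⊢
      exact ⟨⟨hΩ₀, hA⟩, h2⟩
  · rw [halfAngle_of_not fun h ↦ ?_]
    · refine finsum_mem_eq_zero_of_forall_eq_zero fun Ω hΩ ↦ halfAngle_of_not fun h ↦ ?_
      obtain ⟨t, h1, h2⟩ := (h.and hev).exists
      exact Set.disjoint_left.mp hAB (hΩ.2 h1) (hB h2)
    · obtain ⟨t, h1, h2⟩ := (h.and hev).exists
      exact Set.disjoint_left.mp hAB h1 (hB h2)

end Sums

section Angles

variable {M : Type*} [TopologicalSpace M] [T2Space M] [ChartedSpace Plane M]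
  [IsManifold (𝓡 2) ∞ M]
  {o : SurfaceOrientation M}
  {V : M → Type*} [TopologicalSpace (TotalSpace Plane V)]
  [∀ x, NormedAddCommGroup (V x)] [∀ x, InnerProductSpace ℝ (V x)]
  [FiberBundle Plane V] [VectorBundle ℝ Plane V]
  {C : CoherentTangentBundle V} {μ : CoOrientation V}
  {p : M} {Φ : OpenPartialHomeomorph M ℂ} {R : ℝ} {k : ℕ} {f : Fin k → ℝ → ℝ}
  {Γ₁ Γ₂ : ℝ → M} {e : V p} {H : ℤ → ℝ → ℝ}

/-- The sides of a strip have indices. -/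
theorem IsSingularFan.exists_index (hF : IsSingularFan o C μ p Φ R f)
    (hN : IsNullFan C p Φ R Γ₁ Γ₂ e H) (hΦ : IsSmoothPolarChart Φ p R) {a : ℝ → ℝ}
    (ha : ∃ i, ∃ m : ℤ, a = fun ρ ↦ f i ρ + m * (2 * Real.pi)) : ∃ Q, IsFanIndex H a Q := by
  obtain ⟨i, m, rfl⟩ := ha
  obtain ⟨σ, hp, hσ⟩ := hF.exists_arc hΦ hΦ.pos le_rfl i m
  obtain ⟨Q, hQ, -⟩ := hN.side σ (hF.isAdmissible hσ.1 (Or.inr hσ)) _ _ _ hp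
  exact ⟨Q, hQ⟩

/-- Near `p`, the null lifts `H (i + 2 m)` with index between those of `a` and `b` are in the
sector. -/
theorem IsNullFan.eventually_mem_sector_iff (hN : IsNullFan C p Φ R Γ₁ Γ₂ e H)
    (hΦ : IsPolarChart Φ p R) {r : ℝ} (hr : r ∈ Ioc 0 R) {a b : ℝ → ℝ} {Qa Qb : ℤ}
    (hQa : IsFanIndex H a Qa) (hQb : IsFanIndex H b Qb) {i : ℤ} {Γ : ℝ → M}
    (hΓ : ∀ r ∈ Ioc 0 R, ∀ᶠ t in 𝓝[>] (0 : ℝ), Γ t ∈ angularGraph Φ (H i) r) :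
    ∀ᶠ t in 𝓝[>] (0 : ℝ), (Γ t ∈ angularSector Φ a b r ↔
      ∃ m : ℤ, Qa < i + 2 * m ∧ i + 2 * m ≤ Qb) := by
  obtain ⟨d, hd, hsub⟩ := mem_nhdsGT_iff_exists_Ioo_subset.mp
    ((hQa.and hQb).and (Ioo_mem_nhdsGT hr.1))
  filter_upwards [hΓ (min d r) ⟨lt_min hd hr.1, (min_le_right _ _).trans hr.2⟩] with t ht
  obtain ⟨ρ, hρ, hq⟩ := ht
  obtain ⟨⟨h1, h2⟩, hρr⟩ := hsub ⟨hρ.1, hρ.2.trans_le (min_le_left _ _)⟩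
  have hmono := hN.strictMono (ρ := ρ) ⟨hρ.1.le, hρr.2.le.trans hr.2⟩
  rw [hq, hΦ.polarPoint_mem_sector_iff hr.2 hρr]
  refine exists_congr fun m ↦ ?_
  rw [← hN.add_two_mul]
  constructor
  · rintro ⟨h3, h4⟩
    have h5 := hmono.lt_iff_lt.mp (h1.1.trans h3)
    have h6 := hmono.lt_iff_lt.mp (h4.trans h2.2)
    omega
  · rintro ⟨h3, h4⟩
    exact ⟨h1.2.trans_le (hmono.monotone (show Qa + 1 ≤ i + 2 * m by omega)),
      (hmono.monotone h4).trans_lt h2.1⟩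

/-- The interior angle of a strip in terms of the null curve: consecutive indices alternate
between the two halves of the null curve. -/
theorem IsSingularStrip.pi_mul_index_eq
    (hN : IsNullFan C p Φ R Γ₁ Γ₂ e H) (hΦ : IsSmoothPolarChart Φ p R) {r : ℝ} (hr : r ∈ Ioc 0 R)
    {a b : ℝ → ℝ} (hab : IsSingularStrip f R a b) {Qa Qb : ℤ} (hQa : IsFanIndex H a Qa)
    (hQb : IsFanIndex H b Qb) : Real.pi * (Qb - Qa) =
      halfAngle Γ₁ (angularSector Φ a b r) + halfAngle Γ₂ (angularSector Φ a b r) := by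
  have hR := hΦ.pos
  have hIR := Ioo_mem_nhdsGT hR
  have hle : Qa ≤ Qb := hN.index_le hR hQa hQb
    (by filter_upwards [hIR] with ρ hρ using (hab.lt ρ hρ).le)
  have hle' : Qb ≤ Qa + 2 * 1 := hN.index_le hR hQb (hN.index_add_int hQa 1)
    (by filter_upwards [hIR] with ρ hρ
        rw [Int.cast_one, one_mul]
        exact hab.le ρ hρ)
  have hhalf : ∀ {i : ℤ} {Γ : ℝ → M},
      (∀ r ∈ Ioc 0 R, ∀ᶠ t in 𝓝[>] (0 : ℝ), Γ t ∈ angularGraph Φ (H i) r) →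
      ((∃ m : ℤ, Qa < i + 2 * m ∧ i + 2 * m ≤ Qb) →
        halfAngle Γ (angularSector Φ a b r) = Real.pi) ∧
      ((¬ ∃ m : ℤ, Qa < i + 2 * m ∧ i + 2 * m ≤ Qb) →
        halfAngle Γ (angularSector Φ a b r) = 0) := fun hΓ ↦ by
    have h1 := hN.eventually_mem_sector_iff hΦ.toIsPolarChart hr hQa hQb hΓ
    refine ⟨fun h ↦ halfAngle_of_mem (h1.mono fun t ht ↦ ht.mpr h),
      fun h ↦ halfAngle_of_not fun hcon ↦ ?_⟩
    obtain ⟨t, ht, ht'⟩ := (h1.and hcon).exists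
    exact h (ht.mp ht')
  have h1 := hhalf hN.half₁
  have h2 := hhalf hN.half₂
  obtain rfl | rfl | rfl : Qb = Qa ∨ Qb = Qa + 1 ∨ Qb = Qa + 2 := by omega
  · rw [h1.2 (by rintro ⟨m, h⟩; omega), h2.2 (by rintro ⟨m, h⟩; omega)]
    ring
  · rcases Int.even_or_odd' Qa with ⟨l, rfl | rfl⟩
    · rw [h1.2 (by rintro ⟨m, h⟩; omega), h2.1 ⟨l, by omega⟩]
      push_cast; ring
    · rw [h1.1 ⟨l + 1, by omega⟩, h2.2 (by rintro ⟨m, h⟩; omega)]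
      push_cast; ring
  · rcases Int.even_or_odd' Qa with ⟨l, rfl | rfl⟩
    · rw [h1.1 ⟨l + 1, by omega⟩, h2.1 ⟨l, by omega⟩]
      push_cast; ring
    · rw [h1.1 ⟨l + 1, by omega⟩, h2.1 ⟨l + 1, by omega⟩]
      push_cast; ring

/-- The interior angle of a singular sector is `π` times the number of halves of the null curve
that start in it. -/
theorem IsSingularFan.isInteriorAngle_iff (hF : IsSingularFan o C μ p Φ R f)
    (hN : IsNullFan C p Φ R Γ₁ Γ₂ e H) (hΦ : IsSmoothPolarChart Φ p R) (ho : IsOrientedAt o Φ p)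
    {r : ℝ} (hr : r ∈ Ioc 0 R) {Ω : Set M} (hΩ : IsSingularSector C p (complexDisc Φ r) Ω) {θ : ℝ} :
    IsInteriorAngle o C p (complexDisc Φ r) Ω θ ↔ θ = halfAngle Γ₁ Ω + halfAngle Γ₂ Ω := by
  have hΦ' := hΦ.toIsPolarChart
  -- all interior angles have the given value, and there is a subdivision
  suffices h : (∀ (n : ℕ) (γ : ℕ → ℝ → M) (Ψ : ℕ → V p), (SubdividesSector o C p (complexDisc Φ r) Ω n γ ∨
      (n = 3 ∧ SubdividesPunctured o C p (complexDisc Φ r) Ω γ)) →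
      (∀ j ≤ n, IsInitialVector C p (γ j) (Ψ j)) →
      ∑ j ∈ Finset.range n, Real.arccos (inner ℝ (Ψ j) (Ψ (j + 1))) =
        halfAngle Γ₁ Ω + halfAngle Γ₂ Ω) ∧
      ∃ n γ, SubdividesSector o C p (complexDisc Φ r) Ω n γ ∨
        (n = 3 ∧ SubdividesPunctured o C p (complexDisc Φ r) Ω γ) by
    constructor
    · rintro ⟨n, γ, Ψ, hγ, hΨ, rfl⟩
      exact h.1 n γ Ψ hγ hΨ
    · rintro rfl
      obtain ⟨n, γ, hγ⟩ := h.2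
      obtain ⟨Ψ, hΨ⟩ : ∃ Ψ : ℕ → V p, ∀ j ≤ n, IsInitialVector C p (γ j) (Ψ j) := by
        rcases hγ with hγ | ⟨rfl, hγ⟩
        · exact hF.exists_initialVectors hN hΦ hγ.2.2.1
        · exact hF.exists_initialVectors hN hΦ hγ.2.2.1
      exact ⟨n, γ, Ψ, hγ, hΨ, (h.1 n γ Ψ hγ hΨ).symm⟩
  rcases eq_or_ne k 0 with hk | hk
  · obtain rfl := (hF.isSingularSector_iff_of_eq_zero hΦ' hr.1 hr.2 hk).mp hΩ
    constructor
    · rintro n γ Ψ (hγ | ⟨rfl, hγ⟩) hΨ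
      · exact absurd hγ.2.1.1 (hF.not_isSingularArc hΦ' hr.1 hr.2 hk)
      · have hmem : ∀ {i : ℤ} {Γ : ℝ → M},
            (∀ r ∈ Ioc 0 R, ∀ᶠ t in 𝓝[>] (0 : ℝ), Γ t ∈ angularGraph Φ (H i) r) →
            halfAngle Γ (complexDisc Φ r \ {p}) = Real.pi := fun hΓ ↦
          halfAngle_of_mem ((hΓ r hr).mono fun t ht ↦ hΦ'.angularGraph_subset_disc hr.2 ht)
        rw [hF.sum_arccos_of_subdividesPunctured hN hΦ ho hγ hΨ, hmem hN.half₁, hmem hN.half₂]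
        ring
    · obtain ⟨γ, hγ⟩ := hF.exists_subdividesPunctured hN hΦ ho hr hk
      exact ⟨3, γ, Or.inr ⟨rfl, hγ⟩⟩
  · obtain ⟨a, b, hab, rfl, -⟩ := hF.exists_strip_of_isSingularSector hΦ' hr.1 hr.2 hk hΩ
    obtain ⟨Qa, hQa⟩ := hF.exists_index hN hΦ hab.left
    obtain ⟨Qb, hQb⟩ := hF.exists_index hN hΦ hab.right
    constructor
    · rintro n γ Ψ (hγ | ⟨rfl, hγ⟩) hΨ
      · rw [hF.sum_arccos_of_subdividesSector hN hΦ ho hr hab hQa hQb hγ hΨ,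
          hab.pi_mul_index_eq hN hΦ hr hQa hQb]
      · exact absurd hγ.1 (hF.not_isPuncturedSector hΦ' hr.1 hr.2 hk)
    · obtain ⟨n, γ, hγ⟩ := hF.exists_subdividesSector hN hΦ ho hr hab
      exact ⟨n, γ, Or.inl hγ⟩

/-- A half of the null curve starts in a singular sector. -/
theorem IsSingularFan.exists_sector_of_half (hF : IsSingularFan o C μ p Φ R f)
    (hN : IsNullFan C p Φ R Γ₁ Γ₂ e H) (hΦ : IsSmoothPolarChart Φ p R)
    {r : ℝ} (hr : r ∈ Ioc 0 R) {i : ℤ} {Γ : ℝ → M}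
    (hΓ : ∀ r ∈ Ioc 0 R, ∀ᶠ t in 𝓝[>] (0 : ℝ), Γ t ∈ angularGraph Φ (H i) r) :
    ∃ Ω, IsSingularSector C p (complexDisc Φ r) Ω ∧ ∀ᶠ t in 𝓝[>] (0 : ℝ), Γ t ∈ Ω := by
  have hΦ' := hΦ.toIsPolarChart
  rcases eq_or_ne k 0 with hk | hk
  · exact ⟨_, (hF.isSingularSector_iff_of_eq_zero hΦ' hr.1 hr.2 hk).mpr rfl,
      (hΓ r hr).mono fun t ht ↦ hΦ'.angularGraph_subset_disc hr.2 ht⟩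
  · have hindex : ∀ j, ∃ Q, IsFanIndex H (f j) Q := fun j ↦
      hF.exists_index hN hΦ ⟨j, 0, by simp⟩
    choose Q hQ using hindex
    obtain ⟨d, hd, hsub⟩ := mem_nhdsGT_iff_exists_Ioo_subset.mp
      ((eventually_all.mpr hQ).and (Ioo_mem_nhdsGT hr.1))
    -- the lifts of the singular curves lie strictly between null lifts
    have hne : ∀ ρ ∈ Ioo 0 d, ∀ j, ∀ m : ℤ, H i ρ ≠ f j ρ + m * (2 * Real.pi) := by
      intro ρ hρ j m heq
      obtain ⟨h1, hρr⟩ := hsub hρ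
      have hmono := hN.strictMono (ρ := ρ) ⟨hρ.1.le, hρr.2.le.trans hr.2⟩
      have h2 : H (i + 2 * (-m)) ρ = f j ρ := by
        rw [hN.add_two_mul, heq]
        push_cast
        ring
      have h3 := hmono.lt_iff_lt.mp ((h1 j).1.trans_eq h2.symm)
      have h4 := hmono.lt_iff_lt.mp (h2.trans_lt (h1 j).2)
      omega
    have hd' : (0 : ℝ) < d := hd
    have hm : d / 2 ∈ Ioo 0 d := ⟨by linarith, by linarith⟩
    have hdR : Ioo 0 d ⊆ Ioo 0 R := fun ρ hρ ↦ Ioo_subset_Ioo_right hr.2 (hsub hρ).2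
    obtain ⟨a, b, hab, h1, h2⟩ := hF.exists_strip hk (hdR hm) (hne _ hm)
    have hI : Ioo 0 d ⊆ Icc 0 R := hdR.trans Ioo_subset_Icc_self
    have ha := lt_on_of_ne isPreconnected_Ioo ((hab.continuousOn_left hF).mono hI)
      ((hN.continuousOn i).mono hI) (fun ρ hρ heq ↦ by
        obtain ⟨j, m, hj⟩ := hab.left
        exact hne ρ hρ j m (heq.symm.trans (by rw [hj]))) hm h1
    have hb := lt_on_of_ne isPreconnected_Ioo ((hN.continuousOn i).mono hI)
      ((hab.continuousOn_right hF).mono hI) (fun ρ hρ heq ↦ by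
        obtain ⟨j, m, hj⟩ := hab.right
        exact hne ρ hρ j m (heq.trans (by rw [hj]))) hm h2
    obtain ⟨σ₁, σ₂, -, -, hσ⟩ := hF.isSectorBetween_strip hΦ hr.1 hr.2 hab
    refine ⟨_, Or.inl ⟨σ₁, σ₂, hσ⟩, ?_⟩
    filter_upwards [hΓ (min d r) ⟨lt_min hd' hr.1, (min_le_right _ _).trans hr.2⟩] with t ht
    obtain ⟨ρ, hρ, hq⟩ := ht
    have hρd : ρ ∈ Ioo 0 d := ⟨hρ.1, hρ.2.trans_le (min_le_left _ _)⟩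
    exact ⟨ρ, ⟨hρ.1, hρ.2.trans_le (min_le_right _ _)⟩, H i ρ, ⟨ha ρ hρd, hb ρ hρd⟩, hq⟩

theorem IsPolarChart.isPreconnected_disc_diff {r : ℝ} (hΦ : IsPolarChart Φ p R) (hr : r ≤ R) :
    IsPreconnected (complexDisc Φ r \ {p}) := by
  have h1 : complexDisc Φ r \ {p} =
      (fun x : ℝ × ℝ ↦ polarPoint Φ x.1 x.2) '' (Ioo 0 r ×ˢ univ) := by
    ext q
    constructor
    · rintro ⟨hq, hqp⟩
      obtain ⟨ρ, hρ, θ, -, -, rfl⟩ := hΦ.exists_polar_of_mem_disc hq hqp (fun _ ↦ 0)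
      exact ⟨(ρ, θ), ⟨hρ, mem_univ _⟩, rfl⟩
    · rintro ⟨⟨ρ, θ⟩, ⟨hρ, -⟩, rfl⟩
      have hρR : ρ ∈ Ioc 0 R := ⟨hρ.1, hρ.2.le.trans hr⟩
      exact ⟨(hΦ.polarPoint_mem_disc_iff (Ioc_subset_Icc_self hρR)).mpr hρ.2,
        hΦ.polarPoint_ne hρR θ⟩
  rw [h1]
  exact (isPreconnected_Ioo.prod isPreconnected_univ).image _ (hΦ.continuousOn_polarPoint.mono
    (prod_mono (fun ρ hρ ↦ ⟨hρ.1.le, hρ.2.le.trans hr⟩) subset_rfl))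

theorem IsSingularFan.sector_subset_region (hF : IsSingularFan o C μ p Φ R f)
    (hΦ : IsPolarChart Φ p R) {r : ℝ} (hr : r ∈ Ioc 0 R) {Ω : Set M}
    (hΩ : IsSingularSector C p (complexDisc Φ r) Ω) :
    Ω ⊆ positiveRegion o C μ ∨ Ω ⊆ negativeRegion o C μ := by
  rcases eq_or_ne k 0 with hk | hk
  · obtain rfl := (hF.isSingularSector_iff_of_eq_zero hΦ hr.1 hr.2 hk).mp hΩ
    refine hF.region _ ?_ (sdiff_subset.trans (complexDisc_mono hr.2)) ?_
    · exact hΦ.isPreconnected_disc_diff hr.2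
    · rw [Set.disjoint_left]
      intro q hq hqS
      have h1 : q ∈ singularSet C ∩ complexDisc Φ r := ⟨hqS, hq.1⟩
      rw [hF.inter_disc_eq hΦ hr.1 hr.2 hk] at h1
      exact hq.2 h1
  · obtain ⟨a, b, hab, rfl, -⟩ := hF.exists_strip_of_isSingularSector hΦ hr.1 hr.2 hk hΩ
    exact hF.region _ (hab.isConnected hF hΦ hr.1 hr.2).isPreconnected
      (fun q hq ↦ complexDisc_mono hr.2 (hΦ.angularSector_subset_disc hr.2 hq).1)
      (hab.disjoint_singularSet hF hΦ hr.2)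

variable (o C μ p) in
/-- The conclusion on the singular sectors in the neighbourhood `U`: the halves `Γ₁`, `Γ₂` of the
null curve determine the interior angles. -/
structure HasNullAngles (Γ₁ Γ₂ : ℝ → M) (U : Set M) : Prop where
  finite : {Ω : Set M | IsSingularSector C p U Ω}.Finite
  existsUnique : ∀ Ω, IsSingularSector C p U Ω → ∃! θ : ℝ, IsInteriorAngle o C p U Ω θ
  positive : positiveAngleSum o C μ p U =
    halfAngle Γ₁ (positiveRegion o C μ) + halfAngle Γ₂ (positiveRegion o C μ)
  negative : negativeAngleSum o C μ p U =
    halfAngle Γ₁ (negativeRegion o C μ) + halfAngle Γ₂ (negativeRegion o C μ)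
  half₁ : halfAngle Γ₁ (positiveRegion o C μ) = Real.pi ∧
    halfAngle Γ₁ (negativeRegion o C μ) = 0 ∨ halfAngle Γ₁ (positiveRegion o C μ) = 0 ∧
    halfAngle Γ₁ (negativeRegion o C μ) = Real.pi
  half₂ : halfAngle Γ₂ (positiveRegion o C μ) = Real.pi ∧
    halfAngle Γ₂ (negativeRegion o C μ) = 0 ∨ halfAngle Γ₂ (positiveRegion o C μ) = 0 ∧
    halfAngle Γ₂ (negativeRegion o C μ) = Real.pi

theorem IsSingularFan.hasNullAngles (hF : IsSingularFan o C μ p Φ R f)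
    (hN : IsNullFan C p Φ R Γ₁ Γ₂ e H) (hΦ : IsSmoothPolarChart Φ p R) (ho : IsOrientedAt o Φ p)
    {r : ℝ} (hr : r ∈ Ioc 0 R) : HasNullAngles o C μ p Γ₁ Γ₂ (complexDisc Φ r) := by
  have hΦ' := hΦ.toIsPolarChart
  have hfin := hF.finite_sectors hΦ hr.1 hr.2
  have hdisj := disjoint_positiveRegion_negativeRegion (o := o) (C := C) (μ := μ)
  have hreg := fun Ω (hΩ : IsSingularSector C p (complexDisc Φ r) Ω) ↦
    hF.sector_subset_region hΦ' hr hΩ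
  have hmeet : ∀ Ω ∈ {Ω | IsSingularSector C p (complexDisc Φ r) Ω},
      ∀ Ω' ∈ {Ω | IsSingularSector C p (complexDisc Φ r) Ω}, (Ω ∩ Ω').Nonempty → Ω = Ω' :=
    fun Ω hΩ Ω' hΩ' ↦ hF.sector_eq_of_meet hΦ' hr.1 hr.2 hΩ hΩ'
  have hangle : ∀ Ω, IsSingularSector C p (complexDisc Φ r) Ω →
      interiorAngle o C p (complexDisc Φ r) Ω = halfAngle Γ₁ Ω + halfAngle Γ₂ Ω := fun Ω hΩ ↦ by
    have h : ∃ θ, IsInteriorAngle o C p (complexDisc Φ r) Ω θ :=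
      ⟨_, (hF.isInteriorAngle_iff hN hΦ ho hr hΩ).mpr rfl⟩
    rw [interiorAngle, dif_pos h]
    exact (hF.isInteriorAngle_iff hN hΦ ho hr hΩ).mp h.choose_spec
  have h₁ := hF.exists_sector_of_half hN hΦ hr hN.half₁
  have h₂ := hF.exists_sector_of_half hN hΦ hr hN.half₂
  have hsum : ∀ {A B : Set M}, Disjoint A B →
      (∀ Ω ∈ {Ω | IsSingularSector C p (complexDisc Φ r) Ω}, Ω ⊆ A ∨ Ω ⊆ B) →
      ∑ᶠ Ω ∈ {Ω | IsSingularSector C p (complexDisc Φ r) Ω ∧ Ω ⊆ A},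
        interiorAngle o C p (complexDisc Φ r) Ω = halfAngle Γ₁ A + halfAngle Γ₂ A := by
    intro A B hAB hS
    rw [finsum_mem_congr rfl fun Ω hΩ ↦ hangle Ω hΩ.1,
      finsum_mem_add_distrib (hfin.subset fun Ω hΩ ↦ hΩ.1)]
    exact congrArg₂ (· + ·) (finsum_halfAngle hAB hS hmeet h₁) (finsum_halfAngle hAB hS hmeet h₂)
  have hhalf : ∀ {Γ : ℝ → M}, (∃ Ω, IsSingularSector C p (complexDisc Φ r) Ω ∧
      ∀ᶠ t in 𝓝[>] (0 : ℝ), Γ t ∈ Ω) → halfAngle Γ (positiveRegion o C μ) = Real.pi ∧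
      halfAngle Γ (negativeRegion o C μ) = 0 ∨ halfAngle Γ (positiveRegion o C μ) = 0 ∧
      halfAngle Γ (negativeRegion o C μ) = Real.pi := by
    rintro Γ ⟨Ω, hΩ, hΓ⟩
    have hnot : ∀ {A B : Set M}, Disjoint A B → Ω ⊆ A → halfAngle Γ B = 0 := fun hAB hA ↦
      halfAngle_of_not fun h ↦ by
        obtain ⟨t, h1, h2⟩ := (h.and hΓ).exists
        exact Set.disjoint_left.mp hAB (hA h2) h1
    rcases hreg Ω hΩ with h | h
    · exact Or.inl ⟨halfAngle_of_mem (hΓ.mono fun t ht ↦ h ht), hnot hdisj h⟩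
    · exact Or.inr ⟨hnot hdisj.symm h, halfAngle_of_mem (hΓ.mono fun t ht ↦ h ht)⟩
  exact ⟨hfin, fun Ω hΩ ↦ ⟨_, (hF.isInteriorAngle_iff hN hΦ ho hr hΩ).mpr rfl,
    fun θ hθ ↦ (hF.isInteriorAngle_iff hN hΦ ho hr hΩ).mp hθ⟩, hsum hdisj hreg,
    hsum hdisj.symm fun Ω hΩ ↦ (hreg Ω hΩ).symm, hhalf h₁, hhalf h₂⟩

end Angles

section Peak

variable {M : Type*} [TopologicalSpace M] [T2Space M] [ChartedSpace Plane M]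
  [IsManifold (𝓡 2) ∞ M]
  {o : SurfaceOrientation M}
  {V : M → Type*} [TopologicalSpace (TotalSpace Plane V)]
  [∀ x, NormedAddCommGroup (V x)] [∀ x, InnerProductSpace ℝ (V x)]
  [FiberBundle Plane V] [VectorBundle ℝ Plane V] [ContMDiffVectorBundle ∞ Plane V (𝓡 2)]
  [IsContMDiffRiemannianBundle (𝓡 2) ∞ Plane V]
  {C : CoherentTangentBundle V} {μ : CoOrientation V} {p : M}

/-- At a peak, the same null curve determines the interior angles in all small discs of all
coordinate systems. -/
theorem IsPeak.exists_nullAngles (hp : IsPeak o C μ p) : ∃ Γ₁ Γ₂ : ℝ → M,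
    ∀ φ : OpenPartialHomeomorph M Plane, φ ∈ IsManifold.maximalAtlas (𝓡 2) ∞ M → p ∈ φ.source →
      ∀ᶠ r in 𝓝[>] (0 : ℝ), HasNullAngles o C μ p Γ₁ Γ₂ (coordinateDisc φ p r) := by
  have hp' := hp
  obtain ⟨hpS, -, φ₀, hφ₀, hpφ₀, -, hrank, -⟩ := hp'
  obtain ⟨W, N, Γ₁, Γ₂, e, hN⟩ := exists_isNullCurve C hpS hrank
  refine ⟨Γ₁, Γ₂, fun φ hφ hpφ ↦ ?_⟩
  obtain ⟨Φ, R₀, hΦ, ho, hdisc⟩ := exists_oriented_complexChart o hφ hpφ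
  obtain ⟨R₁, hR₁, k, f, hF⟩ := exists_isSingularFan hp hΦ
  have hΦ₁ := hΦ.shrink hR₁.1 hR₁.2
  obtain ⟨R, hR, e', H, hH⟩ := exists_isNullFan hN hΦ₁
  filter_upwards [Ioo_mem_nhdsGT hR.1] with r hr
  rw [← hdisc]
  exact (hF.mono hΦ₁.toIsPolarChart hR).hasNullAngles hH (hΦ₁.shrink hR.1 hR.2) ho
    (Ioo_subset_Ioc_self hr)

end Peak

end CoherentTangent
theorem theoremA
    {M : Type*} [TopologicalSpace M] [T2Space M] [SecondCountableTopology M]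
    [ChartedSpace CoherentTangent.Plane M] [IsManifold (𝓡 2) ∞ M]
    (o : CoherentTangent.SurfaceOrientation M)
    {V : M → Type*} [TopologicalSpace (TotalSpace CoherentTangent.Plane V)]
    [∀ x, NormedAddCommGroup (V x)] [∀ x, InnerProductSpace ℝ (V x)]
    [FiberBundle CoherentTangent.Plane V] [VectorBundle ℝ CoherentTangent.Plane V]
    [ContMDiffVectorBundle ∞ CoherentTangent.Plane V (𝓡 2)]
    [IsContMDiffRiemannianBundle (𝓡 2) ∞ CoherentTangent.Plane V]
    (C : CoherentTangent.CoherentTangentBundle V) (μ : CoherentTangent.CoOrientation V)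
    (p : M) (hp : CoherentTangent.IsPeak o C μ p) :
    ∃ αpos αneg : ℝ,
      (∀ φ : OpenPartialHomeomorph M CoherentTangent.Plane,
        φ ∈ IsManifold.maximalAtlas (𝓡 2) ∞ M → p ∈ φ.source →
        ∀ᶠ r in 𝓝[>] (0 : ℝ),
          {Ω : Set M |
            CoherentTangent.IsSingularSector C p
              (CoherentTangent.coordinateDisc φ p r) Ω}.Finite ∧
          (∀ Ω : Set M,
            CoherentTangent.IsSingularSector C p (CoherentTangent.coordinateDisc φ p r) Ω →
            ∃! θ : ℝ, CoherentTangent.IsInteriorAngle o C p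
              (CoherentTangent.coordinateDisc φ p r) Ω θ) ∧
          CoherentTangent.positiveAngleSum o C μ p
            (CoherentTangent.coordinateDisc φ p r) = αpos ∧
          CoherentTangent.negativeAngleSum o C μ p
            (CoherentTangent.coordinateDisc φ p r) = αneg) ∧
      αpos + αneg = 2 * Real.pi ∧
      αpos - αneg ∈ ({2 * Real.pi, 0, -(2 * Real.pi)} : Set ℝ) := by
  obtain ⟨Γ₁, Γ₂, h⟩ := hp.exists_nullAngles
  refine ⟨_, _, fun φ hφ hpφ ↦ (h φ hφ hpφ).mono fun r hr ↦
    ⟨hr.finite, hr.existsUnique, hr.positive, hr.negative⟩, ?_⟩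
  obtain ⟨r, hr⟩ := (h (chartAt _ p) (IsManifold.chart_mem_maximalAtlas p)
    (mem_chart_source _ p)).exists
  rcases hr.half₁ with ⟨h1, h2⟩ | ⟨h1, h2⟩ <;> rcases hr.half₂ with ⟨h3, h4⟩ | ⟨h3, h4⟩ <;>
    rw [h1, h2, h3, h4]
  · exact ⟨by ring, Or.inl (by ring)⟩
  · exact ⟨by ring, Or.inr (Or.inl (by ring))⟩
  · exact ⟨by ring, Or.inr (Or.inl (by ring))⟩
  · exact ⟨by ring, Or.inr (Or.inr (by rw [mem_singleton_iff]; ring))⟩
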